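/- Let $G$ be a connected semisimple complex group with Lie algebra $\mathfrak g$, $\mathfrak h$ a Cartan subalgebra, $\mathfrak u$ the sum of the root spaces of a system of positive roots, $\mathfrak b=\mathfrak h\oplus\mathfrak u$, $\mathfrak h^r\subset\mathfrak h$ the set of regular elements, $\langle\cdot,\cdot\rangle$ the Killing form. Let $X$ be a connected smooth complete complex curve and $\mathfrak D=\sum_j n_jx_j$ an effective divisor ($n_j\ge1$) with at least one irregular point (a point with $n_j\ge 2$), with formal coordinates $z_j$ at $x_j$; put $\dot X=X\setminus\{x_j\}$. *Local objects.* For $n\ge2$ let $\mathbf{Conn}^B_n$ be the space of connections $d+A$, $A\in\mathfrak g((z))dz$, with pole of order at most $n$, polar coefficients in $\mathfrak b$, and regular semisimple coefficient at $z^{-n}dz$. Let $G^U_n$ be the group of loops $\exp(u_0+u_1z+\dots+u_{n-1}z^{n-1}+g_nz^n+\dots)$, $u_i\in\mathfrak u$, $g_i\in\mathfrak g$, acting by gauge transformations. The quotient $\mathbf{Conn}^B_n/G^U_n$ has the Poisson structure obtained by hamiltonian reduction at $0$ from the space of all connections $d+A$ on the formal punctured disk, where $\{F_1,F_2\}(A)=\mathrm{Res}\langle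 dF_1,\nabla_A(dF_2)\rangle$, $\nabla_A\psi=d\psi+[A,\psi]$. *The moduli space.* $\mathcal Conn_U$ is the moduli space of triples $(E,\nabla,\eta)$: $E$ is a principal $G$-bundle on $X$, $\nabla$ is a connection on $E$ with polar divisor bounded by $\mathfrak D$, whose leading coefficients at the irregular points are regular semisimple, and $\eta$ is a reduction of $E|_{\mathfrak D}$ to $U=\exp\mathfrak u$ such that the polar parts of $\nabla$ are in $\mathfrak b$ with respect to $\eta$. Such a triple is given by a connection $d+\theta$, $\theta\in\mathfrak g\otimes\Omega^1(\dot X)$, on the trivial bundle over $\dot X$, and transition functions $g_j\in G((z_j))$ to formal trivializations at $x_j$ extending $\eta$; tangent vectors are deformations of such data over $\mathbb C[\epsilon]$, with $g_j$ deforming to $(1+\epsilon\psi_j)g_j$ and the connection at $x_j$ deforming by $\epsilon\nu_j$. The symplectic form is given by the residue pairing $\sum_j\mathrm{Res}\bigl(\langle\psi_j,\nu'_j+\nabla\psi'_j\rangle-\langle\psi'_j,\nu_j\rangle\bigr)$. The map $IT_U:\mathcal Conn_U\to\prod_{j:n_j\ge2}\mathbf{Conn}^B_{n_j}/G^U_{n_j}$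 restricts $\nabla$ to the formal neighbourhoods of the irregular points. **Proposition.** (a) Every element of $\mathbf{Conn}^B_n/G^U_n$, $n\ge2$, has a unique representative $d+\alpha_n\frac{dz}{z^n}+\dots+\alpha_1\frac{dz}z+\beta_0dz+\dots+\beta_{n-2}z^{n-2}dz$ with $\alpha_i,\beta_i\in\mathfrak h$, and then $\alpha_n\in\mathfrak h^r$. Tangent vectors and hamiltonian vectors on $\mathbf{Conn}^B_n/G^U_n$ are well defined in these coordinates. In the coordinates $\alpha_i,\beta_i$ one has $\{\alpha_i,\alpha_k\}=0$ for all $i,k$; the symplectic leaves are given by $\alpha_1=\mathrm{const}$ (the hamiltonian vectors at each point are exactly the tangent vectors along which $\alpha_1$ is constant); and the map $\phi$ taking a point to its irregular type $(\alpha_n,\dots,\alpha_2)$ is a lagrangian fibration of each leaf (at each point the hamiltonian vectors of the covectors that are combinations of the $d\alpha_i$ are exactly the tangent vectors along which all $\alpha_i$ are constant). (b) Let $\alpha_i^j,\beta_i^j$ be the coordinates so obtained on the target of $IT_U$, which identify it with $\prod_{j:n_j\ge2}\mathfrak h^r\times\mathfrak h^{2n_j-2}$, and let $f$ be a regular function on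 this smooth affine variety. Then $f\circ IT_U$ has a hamiltonian vector at each point of $\mathcal Conn_U$. The hamiltonian $f\circ IT_U$ is stupid, i.e. at each point its hamiltonian vector changes only the unipotent structure $\eta$ (the induced deformation of $(E,\nabla)$ is trivial) and not the irregular types (all $\alpha_i^j$ with $i\ge2$ are fixed), if and only if $f$ does not depend on the coordinates $\beta_i^j$. -/

import Mathlib

open scoped TensorProduct

noncomputable section

namespace Isostokes

/-! ### Laurent series -/

/-- The field `ℂ((z))` of Laurent series, with its usual structure of a `ℂ`-algebra. -/
def Laurent : Type := HahnSeries ℤ ℂ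

namespace Laurent

instance : Field Laurent := inferInstanceAs (Field (HahnSeries ℤ ℂ))

instance : Algebra ℂ Laurent :=
  (HahnSeries.instAlgebra : Algebra ℂ (HahnSeries ℤ ℂ))

/-- The coefficient of `z ^ k`. -/
def coeff (k : ℤ) : Laurent →ₗ[ℂ] ℂ where
  toFun s := HahnSeries.coeff s k
  map_add' _ _ := rfl
  map_smul' _ _ := rfl

@[ext]
theorem ext {s t : Laurent} (h : ∀ k, coeff k s = coeff k t) : s = t :=
  HahnSeries.ext (funext h)

/-- The monomial `z ^ k`. -/
def monomial (k : ℤ) : Laurent := HahnSeries.single k (1 : ℂ)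

/-- The operator `z d/dz`. -/
def euler : Laurent →ₗ[ℂ] Laurent where
  toFun s := HahnSeries.ofSuppBddBelow (fun k => (k : ℂ) * HahnSeries.coeff s k) <| by
    refine ⟨HahnSeries.order (Γ := ℤ) s, fun k hk => ?_⟩
    contrapose! hk
    rw [Function.notMem_support, HahnSeries.coeff_eq_zero_of_lt_order hk, mul_zero]
  map_add' s t := by
    apply HahnSeries.ext
    funext k
    exact mul_add _ _ _
  map_smul' c s := by
    apply HahnSeries.ext
    funext k
    exact mul_left_comm _ _ _

theorem coeff_euler (k : ℤ) (s : Laurent) : coeff k (euler s) = k * coeff k s := rfl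

theorem euler_mul (s t : Laurent) : euler (s * t) = s * euler t + t * euler s := by
  have hs : Function.support (HahnSeries.coeff (euler s)) ⊆ Function.support (HahnSeries.coeff s) := by
    intro k hk h
    exact hk ((congrArg (fun x => (k : ℂ) * x) h).trans (mul_zero _))
  have ht : Function.support (HahnSeries.coeff (euler t)) ⊆ Function.support (HahnSeries.coeff t) := by
    intro k hk h
    exact hk ((congrArg (fun x => (k : ℂ) * x) h).trans (mul_zero _))
  rw [mul_comm t]
  apply HahnSeries.ext
  funext k
  have h1 : HahnSeries.coeff (euler (s * t)) k = (k : ℂ) * HahnSeries.coeff (s * t) k := rfl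
  have h2 := HahnSeries.coeff_mul (Γ := ℤ) (R := ℂ) (x := s) (y := t) (a := k)
  have h3 := HahnSeries.coeff_mul_right' (Γ := ℤ) (R := ℂ) (x := s) (y := euler t) (a := k)
    (HahnSeries.isPWO_support (Γ := ℤ) (R := ℂ) t) ht
  have h4 := HahnSeries.coeff_mul_left' (Γ := ℤ) (R := ℂ) (x := euler s) (y := t) (a := k)
    (HahnSeries.isPWO_support (Γ := ℤ) (R := ℂ) s) hs
  refine h1.trans ?_
  refine (congrArg (fun x => (k : ℂ) * x) h2).trans ?_
  refine Eq.trans ?_ (congrArg₂ (· + ·) h3 h4).symm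
  rw [Finset.mul_sum, ← Finset.sum_add_distrib]
  refine Finset.sum_congr rfl fun ij hij => ?_
  have hk : (k : ℂ) = ij.1 + ij.2 := by
    have := (Finset.mem_antidiagonal.1 hij).2.2
    rw [← this, Int.cast_add]
  have e1 : HahnSeries.coeff (euler s) ij.1 = (ij.1 : ℂ) * HahnSeries.coeff s ij.1 := rfl
  have e2 : HahnSeries.coeff (euler t) ij.2 = (ij.2 : ℂ) * HahnSeries.coeff t ij.2 := rfl
  rw [e1, e2, hk]
  ring

/-- The derivation `d/dz` of `ℂ((z))`. -/
def deriv : Derivation ℂ Laurent Laurent :=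
  Derivation.mk' ((LinearMap.mulLeft ℂ (monomial (-1))) ∘ₗ euler) (by
    intro s t
    simp only [LinearMap.comp_apply, LinearMap.mulLeft_apply, euler_mul, smul_eq_mul]
    ring)

theorem coeff_deriv (k : ℤ) (s : Laurent) :
    coeff k (deriv s) = ((k + 1 : ℤ) : ℂ) * coeff (k + 1) s := by
  have h := HahnSeries.coeff_single_mul (Γ' := ℤ) (R := ℂ) (r := 1) (x := euler s) (a := k) (b := -1)
  rw [one_mul, sub_neg_eq_add] at h
  exact h

end Laurent

/-! ### Loop algebras -/

/-- The loop algebra `𝔤((z))`, as the base change of `𝔤` to `ℂ((z))`. An element `A` also stands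
for the `𝔤`-valued form `A dz` and for the connection `d + A dz` on the trivial bundle over the
formal punctured disk. -/
abbrev Loop (𝔤 : Type*) [LieRing 𝔤] [LieAlgebra ℂ 𝔤] : Type _ := Laurent ⊗[ℂ] 𝔤

section Local

variable {𝔤 : Type*} [LieRing 𝔤] [LieAlgebra ℂ 𝔤]

/-- The coefficient of `z ^ k` of an element of `𝔤((z))`. -/
def coeff (k : ℤ) : Loop 𝔤 →ₗ[ℂ] 𝔤 :=
  (TensorProduct.lid ℂ 𝔤).toLinearMap ∘ₗ (Laurent.coeff k).rTensor 𝔤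

/-- The monomial `x z ^ k`. -/
def mono (k : ℤ) (x : 𝔤) : Loop 𝔤 := Laurent.monomial k ⊗ₜ[ℂ] x

/-- Differentiation with respect to `z`. -/
def ddz : Loop 𝔤 →ₗ[ℂ] Loop 𝔤 := Laurent.deriv.toLinearMap.rTensor 𝔤

/-- The covariant derivative `∇ψ = dψ + [A, ψ]` for the connection `∇ = d + A dz`. -/
def nabla (A ψ : Loop 𝔤) : Loop 𝔤 := ddz ψ + ⁅A, ψ⁆

/-- `Res ⟨x, y⟩ dz`, where `⟨·, ·⟩` is the Cartan-Killing form. -/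
def resPair (x y : Loop 𝔤) : ℂ :=
  Laurent.coeff (-1) (killingForm Laurent (Loop 𝔤) x y)

/-- `B = Ad (exp x) A = ∑ (ad x) ^ m A / m!` (coefficientwise, the sums being finite for the `x`
that are used). -/
def IsExpAd (x A B : Loop 𝔤) : Prop :=
  ∀ k : ℤ, coeff k B =
    ∑ᶠ m : ℕ, ((m.factorial : ℂ)⁻¹) • coeff k (((LieAlgebra.ad ℂ (Loop 𝔤) x) ^ m) A)

/-- The gauge transformation by `g = exp x` takes `d + A dz` to `d + B dz`, that is
`B = Ad g A - (dg/dz) g⁻¹`, where `(dg/dz) g⁻¹ = ∑ (ad x) ^ m x' / (m + 1)!`. -/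
def IsExpGauge (x A B : Loop 𝔤) : Prop :=
  ∀ k : ℤ, coeff k B =
    (∑ᶠ m : ℕ, ((m.factorial : ℂ)⁻¹) • coeff k (((LieAlgebra.ad ℂ (Loop 𝔤) x) ^ m) A)) -
    ∑ᶠ m : ℕ, (((m + 1).factorial : ℂ)⁻¹) •
      coeff k (((LieAlgebra.ad ℂ (Loop 𝔤) x) ^ m) (ddz x))

variable [FiniteDimensional ℂ 𝔤] [LieAlgebra.IsKilling ℂ 𝔤]
  {H : LieSubalgebra ℂ 𝔤} [H.IsCartanSubalgebra]

/-- The maximal nilpotent subalgebra `𝔲`: the sum of the positive root spaces. -/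
def nilradical (b : (LieAlgebra.IsKilling.rootSystem H).Base) : Submodule ℂ 𝔤 :=
  ⨆ (α : H.root) (_ : b.IsPos α), (LieAlgebra.rootSpace H (α : LieModule.Weight ℂ H 𝔤)).toSubmodule

/-- The Borel subalgebra `𝔟 = 𝔥 ⊕ 𝔲`. -/
def borel (b : (LieAlgebra.IsKilling.rootSystem H).Base) : Submodule ℂ 𝔤 :=
  H.toSubmodule ⊔ nilradical b

variable (H) in
/-- Regular semisimple elements: `ad x` is semisimple and the centralizer of `x` has dimension
`rk 𝔤 = dim 𝔥`. -/
def IsRegularSemisimple (x : 𝔤) : Prop :=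
  (LieAlgebra.ad ℂ 𝔤 x).IsSemisimple ∧
    Module.finrank ℂ (LinearMap.ker (LieAlgebra.ad ℂ 𝔤 x)) = Module.finrank ℂ H

/-- `𝔤`-valued forms on the formal disk with a pole of order at most `n` whose polar part is
in `𝔟`. -/
def IsHiggs (b : (LieAlgebra.IsKilling.rootSystem H).Base) (n : ℕ) (ν : Loop 𝔤) : Prop :=
  (∀ k : ℤ, k < -n → coeff k ν = 0) ∧ ∀ k : ℤ, k < 0 → coeff k ν ∈ borel b

/-- The space `𝐂𝐨𝐧𝐧ₙᴮ` of non-resonant connections with a pole of order `n` and polar part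
in `𝔟`. -/
def IsConnB (b : (LieAlgebra.IsKilling.rootSystem H).Base) (n : ℕ) (A : Loop 𝔤) : Prop :=
  IsHiggs b n A ∧ IsRegularSemisimple H (coeff (-n) A)

/-- The Lie algebra of `Gₙᵁ`: loops `u₀ + u₁ z + … + uₙ₋₁ zⁿ⁻¹ + gₙ zⁿ + …` with `uᵢ ∈ 𝔲`,
`gᵢ ∈ 𝔤`. The group `Gₙᵁ` consists of the exponentials of these loops. -/
def IsLieGU (b : (LieAlgebra.IsKilling.rootSystem H).Base) (n : ℕ) (x : Loop 𝔤) : Prop :=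
  (∀ k : ℤ, k < 0 → coeff k x = 0) ∧ ∀ k : ℤ, k < n → coeff k x ∈ nilradical b

/-- The coordinates on `𝐂𝐨𝐧𝐧ₙᴮ / Gₙᵁ`: `c.1 i` is `α_{i+1}` and `c.2 i` is `β_i`. -/
abbrev Coords (H : LieSubalgebra ℂ 𝔤) (n : ℕ) : Type _ := (Fin n → H) × (Fin (n - 1) → H)

/-- The form
`αₙ dz / zⁿ + … + α₁ dz / z + β₀ dz + … + βₙ₋₂ zⁿ⁻² dz`. -/
def normalForm {n : ℕ} (c : Coords H n) : Loop 𝔤 :=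
  ∑ i : Fin n, mono (-((i : ℤ) + 1)) (c.1 i : 𝔤) + ∑ i : Fin (n - 1), mono (i : ℤ) (c.2 i : 𝔤)

/-- `d + A dz` has the coordinates `c`: some element of `Gₙᵁ` takes it to the normal form
with these coefficients. -/
def HasCoords (b : (LieAlgebra.IsKilling.rootSystem H).Base) {n : ℕ} (A : Loop 𝔤)
    (c : Coords H n) : Prop :=
  ∃ x : Loop 𝔤, IsLieGU b n x ∧ IsExpGauge x A (normalForm c)

/-- The tangent map of `𝐂𝐨𝐧𝐧ₙᴮ → 𝐂𝐨𝐧𝐧ₙᴮ / Gₙᵁ` in coordinates. The connection `A + ε ν` over the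
dual numbers `ℂ[ε]` has the coordinates `c + ε w`: the `ℂ[ε]`-point `(1 + ε χ) exp x` of `Gₙᵁ`
takes it to the normal form with these coefficients. -/
def HasTangentCoords (b : (LieAlgebra.IsKilling.rootSystem H).Base) {n : ℕ} (A ν : Loop 𝔤)
    (c w : Coords H n) : Prop :=
  ∃ x χ B : Loop 𝔤, IsLieGU b n x ∧ IsLieGU b n χ ∧ IsExpGauge x A (normalForm c) ∧
    IsExpAd x ν B ∧ B - nabla (normalForm c) χ = normalForm w

/-! ### The Poisson structure of `𝐂𝐨𝐧𝐧ₙᴮ / Gₙᵁ`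

The space of all connections on the formal punctured disk is a hyperplane in the dual of the
affine Kac-Moody algebra. Its Poisson bracket is `{F, G}(A) = Res ⟨dF, ∇(dG)⟩`, with
`dF, dG ∈ 𝔤((z))`, and its hamiltonian vector fields are `v_F = -∇(dF)`. Its hamiltonian
reduction at `0` with respect to `Gₙᵁ` is computed with covectors on the zero level of the moment
map, extended to the whole space of connections. -/

/-- `ξ ∈ 𝔤((z))` represents at `A` the pullback of the covector `l` at the point `c` of
`𝐂𝐨𝐧𝐧ₙᴮ / Gₙᵁ` (as a covector on `𝐂𝐨𝐧𝐧ₙᴮ`, extended to the space of all connections). -/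
def IsLift (b : (LieAlgebra.IsKilling.rootSystem H).Base) {n : ℕ} (A : Loop 𝔤) (c : Coords H n)
    (l : Coords H n → ℂ) (ξ : Loop 𝔤) : Prop :=
  ∀ ν w, IsHiggs b n ν → HasTangentCoords b A ν c w → resPair ξ ν = l w

/-- The Poisson bracket at `c` of two functions with differentials `l` and `m` is `r`. -/
def IsBracket (b : (LieAlgebra.IsKilling.rootSystem H).Base) {n : ℕ} (A : Loop 𝔤)
    (c : Coords H n) (l m : Coords H n → ℂ) (r : ℂ) : Prop :=
  ∃ ξ η, IsLift b A c l ξ ∧ IsLift b A c m η ∧ resPair ξ (nabla A η) = r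

/-- The hamiltonian vector at `c` of a function with differential `l` is `w`. -/
def IsHamVector (b : (LieAlgebra.IsKilling.rootSystem H).Base) {n : ℕ} (A : Loop 𝔤)
    (c : Coords H n) (l : Coords H n → ℂ) (w : Coords H n) : Prop :=
  ∃ ξ, IsLift b A c l ξ ∧ IsHiggs b n (-nabla A ξ) ∧ HasTangentCoords b A (-nabla A ξ) c w

end Local

/-! ### The structure group -/

/-- A linear algebraic group over `ℂ`: a closed subgroup scheme of `GL_N`, given by polynomial
equations in the matrix entries. -/
structure LinearAlgebraicGroup (N : ℕ) where
  /-- the equations -/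
  eqs : Set (MvPolynomial (Fin N × Fin N) ℂ)
  one_mem : ∀ p ∈ eqs, MvPolynomial.aeval (fun ij => (1 : Matrix (Fin N) (Fin N) ℂ) ij.1 ij.2) p = 0
  mul_mem : ∀ {R : Type} [CommRing R] [Algebra ℂ R] (g h : GL (Fin N) R),
    (∀ p ∈ eqs, MvPolynomial.aeval (fun ij => g.val ij.1 ij.2) p = 0) →
    (∀ p ∈ eqs, MvPolynomial.aeval (fun ij => h.val ij.1 ij.2) p = 0) →
    ∀ p ∈ eqs, MvPolynomial.aeval (fun ij => (g * h).val ij.1 ij.2) p = 0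
  inv_mem : ∀ {R : Type} [CommRing R] [Algebra ℂ R] (g : GL (Fin N) R),
    (∀ p ∈ eqs, MvPolynomial.aeval (fun ij => g.val ij.1 ij.2) p = 0) →
    ∀ p ∈ eqs, MvPolynomial.aeval (fun ij => (g⁻¹).val ij.1 ij.2) p = 0

namespace LinearAlgebraicGroup

attribute [local instance 100] LieRing.ofAssociativeRing

variable {N : ℕ} (G : LinearAlgebraicGroup N)

/-- `g ∈ G(R)`. -/
def IsPoint {R : Type} [CommRing R] [Algebra ℂ R] (g : Matrix (Fin N) (Fin N) R) : Prop :=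
  ∀ p ∈ G.eqs, MvPolynomial.aeval (fun ij => g ij.1 ij.2) p = 0

/-- `G` is connected, that is (equivalently for an algebraic group) irreducible: if a product of
two polynomial functions vanishes on `G(ℂ)`, then one of them does. -/
def IsConnected : Prop :=
  ∀ p q : MvPolynomial (Fin N × Fin N) ℂ,
    (∀ g : GL (Fin N) ℂ, G.IsPoint g.val → MvPolynomial.eval (fun ij => g.val ij.1 ij.2) (p * q) = 0) →
    (∀ g : GL (Fin N) ℂ, G.IsPoint g.val → MvPolynomial.eval (fun ij => g.val ij.1 ij.2) p = 0) ∨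
    (∀ g : GL (Fin N) ℂ, G.IsPoint g.val → MvPolynomial.eval (fun ij => g.val ij.1 ij.2) q = 0)

theorem IsPoint.map {G : LinearAlgebraicGroup N} {R S : Type} [CommRing R] [Algebra ℂ R]
    [CommRing S] [Algebra ℂ S] (f : R →ₐ[ℂ] S) {g : Matrix (Fin N) (Fin N) R}
    (hg : G.IsPoint g) : G.IsPoint (g.map f) := by
  intro p hp
  have h := MvPolynomial.comp_aeval_apply (R := ℂ) (fun ij : Fin N × Fin N => g ij.1 ij.2) f p
  rw [hg p hp, map_zero] at h
  exact h.symm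

theorem IsPoint.of_map {G : LinearAlgebraicGroup N} {R S : Type} [CommRing R] [Algebra ℂ R]
    [CommRing S] [Algebra ℂ S] (f : R →ₐ[ℂ] S) (hf : Function.Injective f)
    {g : Matrix (Fin N) (Fin N) R} (hg : G.IsPoint (g.map f)) : G.IsPoint g := by
  intro p hp
  apply hf
  rw [map_zero]
  exact (MvPolynomial.comp_aeval_apply (R := ℂ)
    (fun ij : Fin N × Fin N => g ij.1 ij.2) f p).trans (hg p hp)

/-- The matrix `1 + c X` over a `ℂ`-algebra. -/
def oneAdd {R : Type} [CommRing R] [Algebra ℂ R] (c : R) (X : Matrix (Fin N) (Fin N) ℂ) :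
    Matrix (Fin N) (Fin N) R :=
  1 + c • X.map (algebraMap ℂ R)

theorem oneAdd_mul_neg {R : Type} [CommRing R] [Algebra ℂ R] {c : R} (hc : c * c = 0)
    (X : Matrix (Fin N) (Fin N) ℂ) : oneAdd c X * oneAdd (-c) X = 1 := by
  have h : (c • X.map (algebraMap ℂ R)) * (c • X.map (algebraMap ℂ R)) = 0 := by
    rw [smul_mul_smul_comm, hc, zero_smul]
  simp only [oneAdd, neg_smul, add_mul, mul_add, mul_neg, one_mul, mul_one, h]
  abel

/-- `1 + c X` as an element of `GL_N`, when `c ^ 2 = 0`. -/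
def oneAddGL {R : Type} [CommRing R] [Algebra ℂ R] (c : R) (hc : c * c = 0)
    (X : Matrix (Fin N) (Fin N) ℂ) : GL (Fin N) R :=
  ⟨oneAdd c X, oneAdd (-c) X, oneAdd_mul_neg hc X, by
    simpa using oneAdd_mul_neg (c := -c) (by simpa using hc) X⟩

theorem oneAdd_map {R S : Type} [CommRing R] [Algebra ℂ R] [CommRing S] [Algebra ℂ S]
    (f : R →ₐ[ℂ] S) (c : R) (X : Matrix (Fin N) (Fin N) ℂ) :
    (oneAdd c X).map f = oneAdd (f c) X := by
  ext i j
  simp [oneAdd, Matrix.one_apply, apply_ite f]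

/-- The homomorphism `ℂ[ε] → R` with `ε ↦ c`, for `c ^ 2 = 0`. -/
def epsMap {R : Type} [CommRing R] [Algebra ℂ R] (c : R) (hc : c * c = 0) : DualNumber ℂ →ₐ[ℂ] R :=
  DualNumber.lift ⟨(Algebra.ofId ℂ R, c), hc, fun _ => Commute.all _ _⟩

theorem epsMap_eps {R : Type} [CommRing R] [Algebra ℂ R] (c : R) (hc : c * c = 0) :
    epsMap c hc DualNumber.eps = c :=
  DualNumber.lift_apply_eps _

theorem oneAdd_commutator {R : Type} [CommRing R] [Algebra ℂ R] {e₁ e₂ : R} (h₁ : e₁ * e₁ = 0)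
    (h₂ : e₂ * e₂ = 0) (X Y : Matrix (Fin N) (Fin N) ℂ) :
    (oneAdd e₁ X * oneAdd e₂ Y) * (oneAdd (-e₁) X * oneAdd (-e₂) Y) = oneAdd (e₁ * e₂) ⁅X, Y⁆ := by
  have hc : (e₁ * e₂) • (⁅X, Y⁆).map (algebraMap ℂ R) =
      (e₁ • X.map (algebraMap ℂ R)) * (e₂ • Y.map (algebraMap ℂ R)) -
      (e₂ • Y.map (algebraMap ℂ R)) * (e₁ • X.map (algebraMap ℂ R)) := by
    rw [smul_mul_smul_comm, smul_mul_smul_comm, mul_comm e₂ e₁, ← smul_sub, Ring.lie_def,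
      Matrix.map_sub _ (map_sub _), Matrix.map_mul, Matrix.map_mul]
  have haa : (e₁ • X.map (algebraMap ℂ R)) * (e₁ • X.map (algebraMap ℂ R)) = 0 := by
    rw [smul_mul_smul_comm, h₁, zero_smul]
  have hbb : (e₂ • Y.map (algebraMap ℂ R)) * (e₂ • Y.map (algebraMap ℂ R)) = 0 := by
    rw [smul_mul_smul_comm, h₂, zero_smul]
  have haba : (e₁ • X.map (algebraMap ℂ R)) * (e₂ • Y.map (algebraMap ℂ R)) *
      (e₁ • X.map (algebraMap ℂ R)) = 0 := by
    rw [smul_mul_smul_comm, smul_mul_smul_comm, mul_right_comm, h₁, zero_mul, zero_smul]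
  have hbab : (e₂ • Y.map (algebraMap ℂ R)) * (e₁ • X.map (algebraMap ℂ R)) *
      (e₂ • Y.map (algebraMap ℂ R)) = 0 := by
    rw [smul_mul_smul_comm, smul_mul_smul_comm, mul_right_comm, h₂, zero_mul, zero_smul]
  unfold oneAdd
  rw [hc]
  simp only [neg_smul]
  generalize e₁ • X.map (algebraMap ℂ R) = a at *
  generalize e₂ • Y.map (algebraMap ℂ R) = b at *
  have k1 : (1 + a) * (1 + b) * (1 + -a) = 1 + b + a * b - b * a - (a * a + a * b * a) := by
    noncomm_ring
  rw [← mul_assoc, k1, haa, haba]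
  have k2 : (1 + b + a * b - b * a - (0 + 0)) * (1 + -b) =
      1 + (a * b - b * a) - (b * b + a * (b * b) - b * a * b) := by
    noncomm_ring
  rw [k2, hbb, hbab]
  simp

theorem isPoint_lie {G : LinearAlgebraicGroup N} {R : Type} [CommRing R] [Algebra ℂ R] {e₁ e₂ : R}
    (h₁ : e₁ * e₁ = 0) (h₂ : e₂ * e₂ = 0)
    (h₁₂ : ∀ a b : ℂ, algebraMap ℂ R a + algebraMap ℂ R b * (e₁ * e₂) = 0 → a = 0 ∧ b = 0)
    {X Y : Matrix (Fin N) (Fin N) ℂ} (hX : G.IsPoint (oneAdd (DualNumber.eps : DualNumber ℂ) X))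
    (hY : G.IsPoint (oneAdd (DualNumber.eps : DualNumber ℂ) Y)) :
    G.IsPoint (oneAdd (DualNumber.eps : DualNumber ℂ) ⁅X, Y⁆) := by
  have h₃ : (e₁ * e₂) * (e₁ * e₂) = 0 := by rw [mul_mul_mul_comm, h₁, zero_mul]
  have hX' : G.IsPoint (oneAddGL e₁ h₁ X).val := by
    have h := IsPoint.map (epsMap e₁ h₁) hX
    rw [oneAdd_map, epsMap_eps] at h
    exact h
  have hY' : G.IsPoint (oneAddGL e₂ h₂ Y).val := by
    have h := IsPoint.map (epsMap e₂ h₂) hY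
    rw [oneAdd_map, epsMap_eps] at h
    exact h
  have h : G.IsPoint ((oneAddGL e₁ h₁ X * oneAddGL e₂ h₂ Y) *
      ((oneAddGL e₁ h₁ X)⁻¹ * (oneAddGL e₂ h₂ Y)⁻¹)).val :=
    G.mul_mem _ _ (G.mul_mem _ _ hX' hY') (G.mul_mem _ _ (G.inv_mem _ hX') (G.inv_mem _ hY'))
  have e : ((oneAddGL e₁ h₁ X * oneAddGL e₂ h₂ Y) *
      ((oneAddGL e₁ h₁ X)⁻¹ * (oneAddGL e₂ h₂ Y)⁻¹)).val = oneAdd (e₁ * e₂) ⁅X, Y⁆ :=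
    oneAdd_commutator h₁ h₂ X Y
  rw [e] at h
  refine IsPoint.of_map (epsMap (e₁ * e₂) h₃) ?_ (g := oneAdd DualNumber.eps ⁅X, Y⁆) ?_
  · rw [injective_iff_map_eq_zero]
    intro x hx
    have hx' : epsMap (e₁ * e₂) h₃ x =
        algebraMap ℂ R x.fst + algebraMap ℂ R x.snd * (e₁ * e₂) := rfl
    rw [hx'] at hx
    obtain ⟨ha, hb⟩ := h₁₂ _ _ hx
    exact TrivSqZeroExt.ext ha hb
  · rw [oneAdd_map, epsMap_eps]
    exact h

/-- The Lie algebra of `G`: the matrices `X` with `1 + ε X ∈ G(ℂ[ε])`. -/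
def lie : LieSubalgebra ℂ (Matrix (Fin N) (Fin N) ℂ) where
  carrier := {X | G.IsPoint (oneAdd (DualNumber.eps : DualNumber ℂ) X)}
  zero_mem' := by
    have h := IsPoint.map (G := G) (g := (1 : Matrix (Fin N) (Fin N) ℂ))
      (Algebra.ofId ℂ (DualNumber ℂ)) G.one_mem
    have e : (1 : Matrix (Fin N) (Fin N) ℂ).map (Algebra.ofId ℂ (DualNumber ℂ)) =
        oneAdd (DualNumber.eps : DualNumber ℂ) 0 := by
      have h1 := Matrix.map_one (n := Fin N) (Algebra.ofId ℂ (DualNumber ℂ))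
        (map_zero (Algebra.ofId ℂ (DualNumber ℂ))) (map_one (Algebra.ofId ℂ (DualNumber ℂ)))
      rw [h1]
      simp [oneAdd]
    rw [e] at h
    exact h
  add_mem' := by
    intro X Y hX hY
    have he : (DualNumber.eps : DualNumber ℂ) * DualNumber.eps = 0 := DualNumber.eps_mul_eps
    have h := G.mul_mem (oneAddGL _ he X) (oneAddGL _ he Y) hX hY
    have e : (oneAddGL _ he X * oneAddGL _ he Y).val = oneAdd DualNumber.eps (X + Y) := by
      change oneAdd DualNumber.eps X * oneAdd DualNumber.eps Y = _
      have h0 : ((DualNumber.eps : DualNumber ℂ) • X.map (algebraMap ℂ (DualNumber ℂ))) *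
          ((DualNumber.eps : DualNumber ℂ) • Y.map (algebraMap ℂ (DualNumber ℂ))) = 0 := by
        rw [smul_mul_smul_comm, he, zero_smul]
      have h1 : (X + Y).map (algebraMap ℂ (DualNumber ℂ)) =
          X.map (algebraMap ℂ (DualNumber ℂ)) + Y.map (algebraMap ℂ (DualNumber ℂ)) := by
        ext i j <;> simp
      simp only [oneAdd, add_mul, mul_add, one_mul, mul_one, h0, h1, smul_add]
      abel
    rw [e] at h
    exact h
  smul_mem' := by
    intro c X hX
    have he : (algebraMap ℂ (DualNumber ℂ) c * DualNumber.eps) *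
        (algebraMap ℂ (DualNumber ℂ) c * DualNumber.eps) = 0 := by
      rw [mul_mul_mul_comm, DualNumber.eps_mul_eps, mul_zero]
    have h := IsPoint.map (epsMap _ he) hX
    rw [oneAdd_map, epsMap_eps] at h
    have e : oneAdd (algebraMap ℂ (DualNumber ℂ) c * DualNumber.eps) X =
        oneAdd (DualNumber.eps : DualNumber ℂ) (c • X) := by
      ext i j <;> simp [oneAdd, mul_comm]
    rw [e] at h
    exact h
  lie_mem' := by
    intro X Y hX hY
    refine isPoint_lie (R := DualNumber (DualNumber ℂ)) (e₁ := TrivSqZeroExt.inl DualNumber.eps)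
      (e₂ := DualNumber.eps) ?_ DualNumber.eps_mul_eps ?_ hX hY
    · rw [← TrivSqZeroExt.inl_mul, DualNumber.eps_mul_eps, TrivSqZeroExt.inl_zero]
    · intro a b h
      have hf := congrArg (fun y => TrivSqZeroExt.fst (TrivSqZeroExt.fst y)) h
      have hs := congrArg (fun y => TrivSqZeroExt.snd (TrivSqZeroExt.snd y)) h
      constructor
      · simpa [TrivSqZeroExt.algebraMap_eq_inl'] using hf
      · simpa [TrivSqZeroExt.algebraMap_eq_inl'] using hs

end LinearAlgebraicGroup

/-! ### The curve -/

/-- Let `A` be the coordinate ring of a smooth connected affine curve `Ẋ` over `ℂ`. Its smooth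
completion is `X = Ẋ ∪ {x_i}`: the points `x_i` at infinity are exactly the discrete valuation
rings of the function field of `Ẋ` that contain `ℂ` and do not contain `A`. The structure consists
of a formal coordinate `z_i` at each of these points, given by the Laurent expansion
of rational functions at `x_i` in powers of `z_i`. -/
structure Completion (A : Type) [CommRing A] [IsDomain A] [Algebra ℂ A] (ι : Type) where
  /-- the Laurent expansion at `x_i` -/
  expand : ι → FractionRing A →ₐ[ℂ] Laurent
  /-- there is a rational function with a simple zero at `x_i` -/
  exists_uniformizer : ∀ i, ∃ f, Laurent.coeff 1 (expand i f) ≠ 0 ∧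
    ∀ k < 1, Laurent.coeff k (expand i f) = 0
  /-- `x_i` is not a point of `Ẋ` -/
  not_mem : ∀ i, ∃ a : A, ∃ k < 0, Laurent.coeff k (expand i (algebraMap A _ a)) ≠ 0
  /-- the points `x_i` are distinct -/
  separated : ∀ i j, i ≠ j → ∃ f, (∀ k < 0, Laurent.coeff k (expand i f) = 0) ∧
    ∃ k < 0, Laurent.coeff k (expand j f) ≠ 0
  /-- every point of `X` outside of `Ẋ` is one of the `x_i` -/
  exhaust : ∀ V : ValuationSubring (FractionRing A), (∀ c : ℂ, algebraMap ℂ _ c ∈ V) →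
    (∃ a : A, algebraMap A _ a ∉ V) →
    ∃ i, ∀ f, f ∈ V ↔ ∀ k < 0, Laurent.coeff k (expand i f) = 0

namespace Completion

variable {A : Type} [CommRing A] [IsDomain A] [Algebra ℂ A] {ι : Type} (X : Completion A ι)

/-- The expansion at `x_i` of a regular function on `Ẋ`. -/
def expandFun (i : ι) : A →ₐ[ℂ] Laurent :=
  (X.expand i).comp (IsScalarTower.toAlgHom ℂ A (FractionRing A))

/-- The expansion at `x_i` of a regular `1`-form on `Ẋ`: `∑ a db` is taken to
`∑ a (db/dz_i)`. -/
def expandForm (i : ι) : Ω[A⁄ℂ] →ₗ[ℂ] Laurent :=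
  letI : Algebra A Laurent := (X.expandFun i).toRingHom.toAlgebra
  haveI : IsScalarTower ℂ A Laurent := IsScalarTower.of_algebraMap_eq fun c =>
    ((X.expandFun i).commutes c).symm
  (Derivation.compAlgebraMap A Laurent.deriv).liftKaehlerDifferential.restrictScalars ℂ

variable {𝔤 : Type*} [LieRing 𝔤] [LieAlgebra ℂ 𝔤]

/-- The expansion at `x_i` of a `𝔤`-valued function on `Ẋ`. -/
def expandLieFun (i : ι) : A ⊗[ℂ] 𝔤 →ₗ[ℂ] Loop 𝔤 := (X.expandFun i).toLinearMap.rTensor 𝔤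

/-- The expansion at `x_i` of a `𝔤`-valued `1`-form on `Ẋ`. -/
def expandLieForm (i : ι) : Ω[A⁄ℂ] ⊗[ℂ] 𝔤 →ₗ[ℂ] Loop 𝔤 := (X.expandForm i).rTensor 𝔤

end Completion

/-! ### The target of `IT_U` -/

section Target

variable {𝔤 : Type*} [LieRing 𝔤] [LieAlgebra ℂ 𝔤]
  {ι : Type} (n : ι → ℕ) (H : LieSubalgebra ℂ 𝔤)

/-- The coordinates `α_i^j`, `β_i^j` on `∏_{j : n_j ≥ 2} 𝐂𝐨𝐧𝐧_{n_j}ᴮ / G_{n_j}ᵁ`. -/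
abbrev TargetCoords : Type _ := ∀ j : {j : ι // 2 ≤ n j}, Coords H (n j)

variable {n H}

/-- The leading coefficient `α_{n_j}^j`. -/
def leading (c : TargetCoords n H) (j : {j : ι // 2 ≤ n j}) : H :=
  (c j).1 ⟨n j - 1, by have := j.2; omega⟩

variable [FiniteDimensional ℂ 𝔤] [LieAlgebra.IsKilling ℂ 𝔤] [H.IsCartanSubalgebra]

/-- The points of the target of `IT_U`: the leading coefficients are regular. -/
def InTarget (c : TargetCoords n H) : Prop :=
  ∀ j, IsRegularSemisimple H (leading c j : 𝔤)

/-- The function `∏_j ∏_α α(α_{n_j}^j)` (over all roots `α`), which is invertible on the target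
of `IT_U`. -/
def discriminant [Fintype ι] (c : TargetCoords n H) : ℂ :=
  ∏ j, ∏ α ∈ H.root, (α : LieModule.Weight ℂ H 𝔤) (leading c j)

/-- `f` is a regular function on the smooth affine variety that is the target of `IT_U`. -/
def IsRegularFunction [Fintype ι] (f : TargetCoords n H → ℂ) : Prop :=
  ∃ (P : MvPolynomial (Module.Dual ℂ (TargetCoords n H)) ℂ) (m : ℕ),
    ∀ c, InTarget c → f c = MvPolynomial.eval (fun l => l c) P / discriminant c ^ m

/-- `f` does not depend on the coordinates `β_i^j`. -/
def IndependentOfBeta (f : TargetCoords n H → ℂ) : Prop :=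
  ∀ c c' : TargetCoords n H, InTarget c → InTarget c' → (∀ j, (c j).1 = (c' j).1) → f c = f c'

/-- The tangent map of `φ` annihilates `w`: no `α_i^j` with `i ≥ 2` changes in the direction
of `w`. -/
def FixesIrregularType (w : TargetCoords n H) : Prop :=
  ∀ j : {j : ι // 2 ≤ n j}, ∀ i : Fin (n j), 1 ≤ (i : ℕ) → (w j).1 i = 0

end Target

/-! ### Connections with unipotent structures

Every principal `G`-bundle over `Ẋ` (and over `Ẋ × Spec ℂ[ε]`) is trivial, since `Ẋ` is an affine
curve and `G` is connected and semisimple. A triple `(E, ∇, η)` is therefore given by a connection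
on the trivial bundle over `Ẋ`, by trivializations of `E` at the formal neighbourhoods of the
points `x_i` that extend `η`, and by the transition functions. -/

section Moduli

variable {N : ℕ} {G : LinearAlgebraicGroup N}
  {A : Type} [CommRing A] [IsDomain A] [Algebra ℂ A] {ι : Type}

/-- Elements of `𝔤((z))` as matrices over `ℂ((z))`. -/
def toMatrix : Loop G.lie →ₗ[ℂ] Matrix (Fin N) (Fin N) Laurent :=
  TensorProduct.lift <| LinearMap.mk₂ ℂ
    (fun (s : Laurent) (x : G.lie) => s • (x : Matrix (Fin N) (Fin N) ℂ).map (algebraMap ℂ Laurent))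
    (fun s t x => add_smul s t _)
    (fun c s x => smul_assoc c s _)
    (fun s x y => by
      refine Matrix.ext fun i j => ?_
      change s * algebraMap ℂ Laurent (x.1 i j + y.1 i j) =
        s * algebraMap ℂ Laurent (x.1 i j) + s * algebraMap ℂ Laurent (y.1 i j)
      rw [map_add, mul_add])
    (fun c s x => by
      refine Matrix.ext fun i j => ?_
      change s * algebraMap ℂ Laurent (c * x.1 i j) = c • (s * algebraMap ℂ Laurent (x.1 i j))
      rw [map_mul, Algebra.smul_def, mul_left_comm])

variable [LieAlgebra.IsKilling ℂ G.lie] {H : LieSubalgebra ℂ G.lie} [H.IsCartanSubalgebra]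

/-- A point `(E, ∇, η)` of `𝒞onn_U`. -/
structure ConnU (X : Completion A ι) (n : ι → ℕ) (b : (LieAlgebra.IsKilling.rootSystem H).Base) where
  /-- the connection `∇ = d + θ` in the trivialization over `Ẋ` -/
  θ : Ω[A⁄ℂ] ⊗[ℂ] G.lie
  /-- the transition function from the trivialization over `Ẋ` to the one at `x_i` -/
  g : ι → GL (Fin N) Laurent
  g_mem : ∀ i, G.IsPoint (g i).val
  /-- the connection `∇ = d + loc_i dz_i` in the trivialization at `x_i` -/
  loc : ι → Loop G.lie
  loc_eq : ∀ i, toMatrix (loc i) = (g i).val * toMatrix (X.expandLieForm i θ) * (g i)⁻¹.val -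
    (g i).val.map Laurent.deriv * (g i)⁻¹.val
  /-- the polar divisor is bounded by `∑ n_i x_i` and `η` is compatible with `∇` -/
  higgs : ∀ i, IsHiggs b (n i) (loc i)
  /-- `∇` is non-resonant -/
  nonresonant : ∀ i, 2 ≤ n i → IsRegularSemisimple H (coeff (-(n i : ℤ)) (loc i))

namespace ConnU

variable {X : Completion A ι} {n : ι → ℕ} {b : (LieAlgebra.IsKilling.rootSystem H).Base}

/-- A tangent vector to `𝒞onn_U` at `p`, i.e. a deformation of `(E, ∇, η)` over `ℂ[ε]`. The
connection over `Ẋ` deforms to `θ + ε dθ`, the transition functions deform to `(1 + ε ψ_i) g_i`, and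
the connection at `x_i` deforms to `loc_i + ε ν_i`. -/
structure Tangent (p : ConnU X n b) where
  dθ : Ω[A⁄ℂ] ⊗[ℂ] G.lie
  ψ : ι → Loop G.lie
  ν : ι → Loop G.lie
  ν_eq : ∀ i, toMatrix (ν i) = (p.g i).val * toMatrix (X.expandLieForm i dθ) * (p.g i)⁻¹.val -
    toMatrix (nabla (p.loc i) (ψ i))
  higgs : ∀ i, IsHiggs b (n i) (ν i)

/-- The symplectic form on `𝒞onn_U`, i.e. the duality pairing on the first hypercohomology,
`∑ Res (⟨ψ, Ad g dθ'⟩ - ⟨ψ', ν⟩)`, where `Ad g_i dθ' = ν'_i + ∇ψ'_i`. -/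
def symplecticForm [Fintype ι] {p : ConnU X n b} (v v' : p.Tangent) : ℂ :=
  ∑ i, (resPair (v.ψ i) (v'.ν i + nabla (p.loc i) (v'.ψ i)) - resPair (v'.ψ i) (v.ν i))

/-- `IT_U(p)` has the coordinates `c`. -/
def HasIT (p : ConnU X n b) (c : TargetCoords n H) : Prop :=
  ∀ j : {j : ι // 2 ≤ n j}, HasCoords b (p.loc j) (c j)

/-- The tangent map of `IT_U` takes `v` to the tangent vector `w` at `c`. -/
def Tangent.HasIT {p : ConnU X n b} (v : p.Tangent) (c w : TargetCoords n H) : Prop :=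
  ∀ j : {j : ι // 2 ≤ n j}, HasTangentCoords b (p.loc j) (v.ν j) (c j) (w j)

/-- `v` is the value at `p` of the hamiltonian vector field of `f ∘ IT_U`, where `IT_U(p) = c`. -/
def Tangent.IsHamiltonian [Fintype ι] {p : ConnU X n b} (v : p.Tangent)
    (f : TargetCoords n H → ℂ) (c : TargetCoords n H) : Prop :=
  ∀ (v' : p.Tangent) (w : TargetCoords n H), v'.HasIT c w →
    symplecticForm v v' = lineDeriv ℂ f c w

/-- `v` changes only the unipotent structure `η`: the corresponding deformation of `(E, ∇)` is
trivial. There are an infinitesimal change `R` of the trivialization over `Ẋ` and infinitesimal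
changes `χ_i` of the trivializations at `x_i`, not necessarily preserving `η`, that make the
deformation constant over `Ẋ` and the transition functions constant. (A form on `Ẋ` is determined
by its expansions.) -/
def Tangent.ChangesOnlyUnipotent {p : ConnU X n b} (v : p.Tangent) : Prop :=
  ∃ (R : A ⊗[ℂ] G.lie) (χ : ι → Loop G.lie), (∀ i, ∀ k < 0, coeff k (χ i) = 0) ∧
    (∀ i, X.expandLieForm i v.dθ = -nabla (X.expandLieForm i p.θ) (X.expandLieFun i R)) ∧
    ∀ i, toMatrix (v.ψ i) =
      toMatrix (χ i) - (p.g i).val * toMatrix (X.expandLieFun i R) * (p.g i)⁻¹.val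

end ConnU

/-- `f ∘ IT_U` is a stupid hamiltonian: its hamiltonian vector field changes only the unipotent
structures and not the irregular types. -/
def IsStupid [Fintype ι] (X : Completion A ι) (n : ι → ℕ)
    (b : (LieAlgebra.IsKilling.rootSystem H).Base) (f : TargetCoords n H → ℂ) : Prop :=
  ∀ (p : ConnU X n b) (c : TargetCoords n H), p.HasIT c →
    ∃ v : p.Tangent, v.IsHamiltonian f c ∧ v.ChangesOnlyUnipotent ∧
      ∀ w, v.HasIT c w → FixesIrregularType w

end Moduli

end Isostokes

set_option linter.unusedSectionVars false

/-! ### Coefficients of Laurent series and of loops; the residue pairing -/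

namespace Isostokes

namespace Laurent

/-! Local part. Grade `𝔤((z))` by giving a root vector its height and `z` a degree larger than every
height. The Lie algebra of `Gₙᵁ` then lies in positive degree, so its exponentials converge, and a
connection in `𝐂𝐨𝐧𝐧ₙᴮ` is `a z⁻ⁿ`, with `a ∈ 𝔥` regular, plus terms of higher degree. Off the Cartan
subalgebra `ad a` is invertible, and for `n ≥ 2` differentiation lowers the degree by less than
`z⁻ⁿ` does, so the off-diagonal part can be removed degree by degree. A diagonal connection still
moves by `A ↦ A - y'` with `y ∈ zⁿ 𝔥[[z]]`, and this removes exactly the terms of order at least `n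
- 1` (`exists_hasCoords`). A gauge transformation between two normal forms maps flat sections to
flat sections; this forces it to fix `𝔥`, and then to act trivially on every root space
(`gauge_rigid`).

For a connection in normal form the `𝔥`-part of `∇ψ` is the derivative of the `𝔥`-part of `ψ`. Hence
a tangent vector has its `𝔥`-part as coordinates, a covector is an `𝔥`-valued loop `η`, where
covectors in `dα_{i+1}` live in degree `i` and covectors in `dβ_i` in degree `-1 - i`, and the
hamiltonian vector of `η` is `-η'`. Derivatives are the loops without residue, which gives the
leaves. Combinations of the `dα_i` are regular loops, whose derivatives are regular and change only
the `β_i`; this gives the vanishing brackets and the lagrangian fibration (`local_poisson`).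

Global part. Lifting the differential of `f` at each irregular point to a loop `ψ_j` and setting
`ν_j = -∇ψ_j` produces a hamiltonian vector. If `f` is independent of the `β_i^j`, the `ψ_j` are
regular, so this vector is a mere change of trivializations at the `x_j`. Conversely, along a
deformation with trivial `(E, ∇)` one has `ν_j = -∇χ_j`, so residues are fixed; for a stupid
hamiltonian all `α_i^j` are therefore fixed. Pairing with a vector that moves only the `β_i^j`,
which is itself hamiltonian for a covector in the `dα_i^j`, shows that the `β`-derivatives of `f`
vanish on the image of `IT_U` (`lineDeriv_eq_zero_of_isStupid`).

It remains to see that this image is large. For every irregular type it contains all values of `β`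
and all residues in a translate of the coroot lattice (`exists_connU`), and a polynomial that
vanishes on a translate of a lattice vanishes on its complex span. The points are `𝔥`-valued
connections: a regular form with prescribed polar parts up to simple poles exists by Serre duality
(`exists_form`), and the remaining discrepancy with the normal form is the logarithmic derivative of
a product of values of coroots at Laurent series (`exists_gl_of_residue`). Serre duality rests on
the residue theorem, proved by comparing traces of compressed multiplication operators
(`sum_residue_eq_zero`), and on the finiteness of the coordinate ring over some `ℂ[t]`; that an
orthogonal rational function has no pole in the affine part is a local argument with powers of a
function with a simple pole (`exists_expandFun_eq`). -/

theorem exists_bound (s : Laurent) : ∃ N : ℤ, ∀ k < N, coeff k s = 0 :=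
  ⟨HahnSeries.order (Γ := ℤ) s, fun _ hk => HahnSeries.coeff_eq_zero_of_lt_order hk⟩

/-- The Laurent series with given coefficients. -/
def ofCoeffs (a : ℤ → ℂ) (N : ℤ) (h : ∀ k < N, a k = 0) : Laurent :=
  HahnSeries.ofSuppBddBelow a ⟨N, fun k hk => by
    contrapose! hk
    simpa using h k hk⟩

theorem coeff_ofCoeffs (a : ℤ → ℂ) (N : ℤ) (h : ∀ k < N, a k = 0) (k : ℤ) :
    coeff k (ofCoeffs a N h) = a k := rfl

theorem coeff_mul_Icc {s t : Laurent} {p q : ℤ} (hs : ∀ k < p, coeff k s = 0)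
    (ht : ∀ k < q, coeff k t = 0) (k : ℤ) :
    coeff k (s * t) = ∑ i ∈ Finset.Icc p (k - q), coeff i s * coeff (k - i) t := by
  have h := HahnSeries.coeff_mul (Γ := ℤ) (R := ℂ) (x := s) (y := t) (a := k)
  refine h.trans ?_
  have hs' : ∀ i, HahnSeries.coeff s i ≠ 0 → p ≤ i := fun i hi => by
    by_contra hc
    exact hi (hs i (not_le.1 hc))
  have ht' : ∀ i, HahnSeries.coeff t i ≠ 0 → q ≤ i := fun i hi => by
    by_contra hc
    exact hi (ht i (not_le.1 hc))
  refine Finset.sum_bij_ne_zero (fun ij _ _ => ij.1) ?_ ?_ ?_ ?_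
  · intro ij hij _
    have := Finset.mem_antidiagonal.1 hij
    have h1 := hs' _ this.1
    have h2 := ht' _ this.2.1
    have h3 := this.2.2
    rw [Finset.mem_Icc]
    omega
  · intro a ha _ b hb _ hab
    have h1 := (Finset.mem_antidiagonal.1 ha).2.2
    have h2 := (Finset.mem_antidiagonal.1 hb).2.2
    ext
    · exact hab
    · omega
  · intro i hi hne
    have h1 : coeff i s ≠ 0 := left_ne_zero_of_mul hne
    have h2 : coeff (k - i) t ≠ 0 := right_ne_zero_of_mul hne
    exact ⟨(i, k - i), Finset.mem_antidiagonal.2 ⟨h1, h2, by simp⟩, hne, rfl⟩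
  · intro ij hij _
    have := (Finset.mem_antidiagonal.1 hij).2.2
    have h4 : k - ij.1 = ij.2 := by omega
    rw [h4]
    rfl

theorem coeff_mul_finsum (s t : Laurent) (k : ℤ) :
    coeff k (s * t) = ∑ᶠ i, coeff i s * coeff (k - i) t := by
  obtain ⟨p, hp⟩ := exists_bound s
  obtain ⟨q, hq⟩ := exists_bound t
  rw [coeff_mul_Icc hp hq]
  symm
  refine finsum_eq_sum_of_support_subset _ ?_
  intro i hi
  rw [Finset.coe_Icc, Set.mem_Icc]
  by_contra hc
  rw [not_and_or] at hc
  apply hi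
  rcases hc with hc | hc
  · simp [hp i (by omega)]
  · simp [hq (k - i) (by omega)]

theorem coeff_monomial (j k : ℤ) : coeff k (monomial j) = if k = j then 1 else 0 :=
  (HahnSeries.coeff_single (Γ := ℤ)).trans (by congr)

theorem coeff_one (k : ℤ) : coeff k (1 : Laurent) = if k = 0 then 1 else 0 :=
  (HahnSeries.coeff_one (Γ := ℤ)).trans (by congr)

theorem coeff_monomial_mul (j k : ℤ) (s : Laurent) : coeff k (monomial j * s) = coeff (k - j) s := by
  have h := HahnSeries.coeff_single_mul (Γ' := ℤ) (R := ℂ) (r := 1) (x := s) (a := k) (b := j)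
  rw [one_mul] at h
  exact h

end Laurent

section LoopCoeff

variable {𝔤 : Type*} [LieRing 𝔤] [LieAlgebra ℂ 𝔤]

@[simp] theorem coeff_tmul (k : ℤ) (s : Laurent) (x : 𝔤) :
    coeff k (s ⊗ₜ[ℂ] x : Loop 𝔤) = Laurent.coeff k s • x := rfl

theorem coeff_mono (j k : ℤ) (x : 𝔤) : coeff k (mono j x) = if k = j then x else 0 := by
  rw [mono, coeff_tmul, Laurent.coeff_monomial]
  split_ifs <;> simp

theorem exists_bound (A : Loop 𝔤) : ∃ N : ℤ, ∀ k < N, coeff k A = 0 := by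
  induction A using TensorProduct.induction_on with
  | zero => exact ⟨0, fun k _ => map_zero _⟩
  | tmul s x =>
    obtain ⟨N, hN⟩ := Laurent.exists_bound s
    exact ⟨N, fun k hk => by rw [coeff_tmul, hN k hk, zero_smul]⟩
  | add A B hA hB =>
    obtain ⟨N, hN⟩ := hA
    obtain ⟨M, hM⟩ := hB
    exact ⟨min N M, fun k hk => by
      rw [map_add, hN k (lt_of_lt_of_le hk (min_le_left _ _)),
        hM k (lt_of_lt_of_le hk (min_le_right _ _)), add_zero]⟩

theorem coeff_ddz (k : ℤ) (A : Loop 𝔤) : coeff k (ddz A) = ((k + 1 : ℤ) : ℂ) • coeff (k + 1) A := by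
  induction A using TensorProduct.induction_on with
  | zero => simp
  | tmul s x =>
    change Laurent.coeff k (Laurent.deriv s) • x = _
    rw [Laurent.coeff_deriv, coeff_tmul, smul_smul]
  | add A B hA hB => rw [map_add, map_add, hA, hB, map_add, smul_add]

theorem support_finite_of_bound {M : Type*} [AddCommMonoid M] (f : ℤ → M) {p q : ℤ}
    (h1 : ∀ i < p, f i = 0) (h2 : ∀ i, q < i → f i = 0) : f.support.Finite := by
  refine (Finset.finite_toSet (Finset.Icc p q)).subset fun i hi => ?_
  rw [Finset.coe_Icc, Set.mem_Icc]
  by_contra hc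
  rw [not_and_or, not_le, not_le] at hc
  exact hi (hc.elim (h1 i) (h2 i))

theorem lie_support_finite (A B : Loop 𝔤) (k : ℤ) :
    Function.HasFiniteSupport fun i => ⁅coeff i A, coeff (k - i) B⁆ := by
  obtain ⟨p, hp⟩ := exists_bound A
  obtain ⟨q, hq⟩ := exists_bound B
  refine support_finite_of_bound _ (p := p) (q := k - q) (fun i hi => ?_) (fun i hi => ?_)
  · simp [hp i hi]
  · simp [hq (k - i) (by omega)]

theorem coeff_lie (A B : Loop 𝔤) (k : ℤ) :
    coeff k ⁅A, B⁆ = ∑ᶠ i, ⁅coeff i A, coeff (k - i) B⁆ := by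
  induction A using TensorProduct.induction_on with
  | zero => simp
  | add A A' hA hA' =>
    rw [add_lie, map_add, hA, hA', ← finsum_add_distrib (lie_support_finite _ _ _)
      (lie_support_finite _ _ _)]
    simp only [map_add, add_lie]
  | tmul s x =>
    induction B using TensorProduct.induction_on with
    | zero => simp
    | add B B' hB hB' =>
      rw [lie_add, map_add, hB, hB', ← finsum_add_distrib (lie_support_finite _ _ _)
        (lie_support_finite _ _ _)]
      simp only [map_add, lie_add]
    | tmul t y =>
      rw [LieAlgebra.ExtendScalars.bracket_tmul, coeff_tmul, Laurent.coeff_mul_finsum, finsum_smul]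
      simp only [coeff_tmul, smul_lie, lie_smul, smul_smul, mul_comm]

/-- To show that a coefficient of a bracket is in a submodule, it suffices to look at the
brackets of coefficients. -/
theorem coeff_lie_mem (S : Submodule ℂ 𝔤) (A B : Loop 𝔤) (k : ℤ)
    (h : ∀ i, ⁅coeff i A, coeff (k - i) B⁆ ∈ S) : coeff k ⁅A, B⁆ ∈ S := by
  rw [coeff_lie]
  exact finsum_induction (· ∈ S) S.zero_mem (fun _ _ => S.add_mem) h

theorem coeff_smul (s : Laurent) (A : Loop 𝔤) (k : ℤ) :
    coeff k (s • A) = ∑ᶠ i, Laurent.coeff i s • coeff (k - i) A := by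
  have hfin : ∀ A : Loop 𝔤, (Function.support fun i => Laurent.coeff i s • coeff (k - i) A).Finite := by
    intro A
    obtain ⟨p, hp⟩ := Laurent.exists_bound s
    obtain ⟨q, hq⟩ := exists_bound A
    refine support_finite_of_bound _ (p := p) (q := k - q) (fun i hi => ?_) (fun i hi => ?_)
    · simp [hp i hi]
    · simp [hq (k - i) (by omega)]
  induction A using TensorProduct.induction_on with
  | zero => simp
  | add A B hA hB =>
    rw [smul_add, map_add, hA, hB, ← finsum_add_distrib (hfin _) (hfin _)]
    simp only [map_add, smul_add]
  | tmul t y =>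
    rw [TensorProduct.smul_tmul', smul_eq_mul, coeff_tmul, Laurent.coeff_mul_finsum, finsum_smul]
    simp only [coeff_tmul, smul_smul]

variable [FiniteDimensional ℂ 𝔤]

/-- A basis of `𝔤` turns a loop into finitely many Laurent series, which are determined by their
coefficients. -/
theorem loop_ext {A B : Loop 𝔤} (h : ∀ k, coeff k A = coeff k B) : A = B := by
  let e := Module.finBasis ℂ 𝔤
  let E : Module.Basis _ Laurent (Loop 𝔤) := Algebra.TensorProduct.basis Laurent e
  have key : ∀ (A : Loop 𝔤) k j, e.repr (coeff k A) j = Laurent.coeff k (E.repr A j) := by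
    intro A k j
    induction A using TensorProduct.induction_on with
    | zero => simp
    | add A B hA hB => simp only [map_add, Finsupp.add_apply, hA, hB]
    | tmul s x =>
      have : E.repr (s ⊗ₜ[ℂ] x) j = e.repr x j • s := by
        simp [E, Algebra.TensorProduct.basis_repr_tmul, Algebra.smul_def, mul_comm]
      rw [this, coeff_tmul]
      simp [mul_comm]
  refine E.repr.injective (Finsupp.ext fun j => Laurent.ext fun k => ?_)
  rw [← key, ← key, h]

/-- Because `𝔤` is finite-dimensional, the algebraic tensor product contains every `𝔤`-valued series
with finitely many polar terms. This makes the loop algebra complete. -/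
theorem exists_ofCoeffs (a : ℤ → 𝔤) (N : ℤ) (h : ∀ k < N, a k = 0) :
    ∃ A : Loop 𝔤, ∀ k, coeff k A = a k := by
  let e := Module.finBasis ℂ 𝔤
  refine ⟨∑ j, Laurent.ofCoeffs (fun k => e.repr (a k) j) N
    (fun k hk => by simp [h k hk]) ⊗ₜ[ℂ] e j, fun k => ?_⟩
  rw [map_sum]
  simp only [coeff_tmul, Laurent.coeff_ofCoeffs]
  exact e.sum_repr (a k)

/-- The element of `𝔤((z))` with given coefficients. -/
def ofCoeffs (a : ℤ → 𝔤) (N : ℤ) (h : ∀ k < N, a k = 0) : Loop 𝔤 := (exists_ofCoeffs a N h).choose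

@[simp] theorem coeff_ofCoeffs (a : ℤ → 𝔤) (N : ℤ) (h : ∀ k < N, a k = 0) (k : ℤ) :
    coeff k (ofCoeffs a N h) = a k := (exists_ofCoeffs a N h).choose_spec k

/-- A linear endomorphism of `𝔤` applied coefficientwise. -/
abbrev mapCoeff (f : 𝔤 →ₗ[ℂ] 𝔤) : Loop 𝔤 →ₗ[ℂ] Loop 𝔤 := f.lTensor Laurent

@[simp] theorem coeff_mapCoeff (f : 𝔤 →ₗ[ℂ] 𝔤) (A : Loop 𝔤) (k : ℤ) :
    coeff k (mapCoeff f A) = f (coeff k A) := by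
  induction A using TensorProduct.induction_on with
  | zero => simp
  | add A B hA hB => rw [map_add, map_add, hA, hB, map_add, map_add]
  | tmul s x => simp [mapCoeff]

theorem ddz_lie (A B : Loop 𝔤) : ddz ⁅A, B⁆ = ⁅ddz A, B⁆ + ⁅A, ddz B⁆ := by
  induction A using TensorProduct.induction_on with
  | zero => simp
  | add A A' hA hA' => simp only [map_add, add_lie, hA, hA']; abel
  | tmul s x =>
    induction B using TensorProduct.induction_on with
    | zero => simp
    | add B B' hB hB' => simp only [map_add, lie_add, hB, hB']; abel
    | tmul t y =>
      have : ∀ (u : Laurent) (w : 𝔤), ddz (u ⊗ₜ[ℂ] w) = Laurent.deriv u ⊗ₜ[ℂ] w := fun _ _ => rfl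
      simp only [LieAlgebra.ExtendScalars.bracket_tmul, this, Derivation.leibniz, smul_eq_mul,
        TensorProduct.add_tmul]
      rw [add_comm, mul_comm t]

theorem resPair_support_finite (A B : Loop 𝔤) :
    Function.HasFiniteSupport fun i => killingForm ℂ 𝔤 (coeff i A) (coeff (-1 - i) B) := by
  obtain ⟨p, hp⟩ := exists_bound A
  obtain ⟨q, hq⟩ := exists_bound B
  refine support_finite_of_bound _ (p := p) (q := -1 - q) (fun i hi => ?_) (fun i hi => ?_)
  · simp [hp i hi]
  · simp [hq (-1 - i) (by omega)]

theorem resPair_add_left (A A' B : Loop 𝔤) : resPair (A + A') B = resPair A B + resPair A' B := by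
  simp [resPair]
theorem resPair_add_right (A B B' : Loop 𝔤) : resPair A (B + B') = resPair A B + resPair A B' := by
  simp [resPair]

/-- The Killing form commutes with base change, so on pure tensors it is the Killing form of `𝔤`
times the product of the Laurent series. -/
theorem resPair_eq (A B : Loop 𝔤) :
    resPair A B = ∑ᶠ i, killingForm ℂ 𝔤 (coeff i A) (coeff (-1 - i) B) := by
  induction A using TensorProduct.induction_on with
  | zero => simp [resPair]
  | add A A' hA hA' =>
    rw [resPair_add_left, hA, hA', ← finsum_add_distrib (resPair_support_finite _ _)
      (resPair_support_finite _ _)]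
    simp only [map_add, LinearMap.add_apply]
  | tmul s x =>
    induction B using TensorProduct.induction_on with
    | zero => simp [resPair]
    | add B B' hB hB' =>
      rw [resPair_add_right, hB, hB', ← finsum_add_distrib (resPair_support_finite _ _)
        (resPair_support_finite _ _)]
      simp only [map_add]
    | tmul t y =>
      have h1 : killingForm Laurent (Loop 𝔤) (s ⊗ₜ x) (t ⊗ₜ y) =
          (killingForm ℂ 𝔤 x y) • (s * t) := by
        have := LieModule.traceForm_baseChange ℂ 𝔤 𝔤 Laurent
        change LieModule.traceForm Laurent (Laurent ⊗[ℂ] 𝔤) (Laurent ⊗[ℂ] 𝔤) _ _ = _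
        rw [this]
        simp [Algebra.smul_def, mul_comm]
      rw [resPair, h1, map_smul, Laurent.coeff_mul_finsum, smul_finsum]
      simp only [coeff_tmul, map_smul, LinearMap.smul_apply, smul_eq_mul]
      congr 1
      ext i
      ring

theorem resPair_neg_right (A B : Loop 𝔤) : resPair A (-B) = -resPair A B := by simp [resPair]

theorem resPair_sub_left (A A' B : Loop 𝔤) : resPair (A - A') B = resPair A B - resPair A' B := by
  simp [resPair]

theorem resPair_comm (A B : Loop 𝔤) : resPair A B = resPair B A := by
  rw [resPair, resPair]
  congr 1
  exact LieModule.traceForm_comm _ _ _ _ _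

theorem resPair_lie (A B C : Loop 𝔤) : resPair A ⁅B, C⁆ = -resPair ⁅B, A⁆ C := by
  rw [resPair, resPair]
  have := LieModule.traceForm_apply_lie_apply Laurent (Loop 𝔤) (Loop 𝔤) A B C
  have h2 : ⁅B, A⁆ = -⁅A, B⁆ := (lie_skew _ _).symm
  rw [h2, map_neg, LinearMap.neg_apply, map_neg, neg_neg]
  exact congrArg _ this.symm

/-- Integration by parts, obtained by shifting the summation index by one. -/
theorem resPair_ddz (A B : Loop 𝔤) : resPair A (ddz B) = -resPair (ddz A) B := by
  rw [resPair_eq, resPair_eq, ← finsum_neg_distrib,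
    ← finsum_comp_equiv (Equiv.addRight (1 : ℤ))]
  congr 1
  ext i
  simp only [coeff_ddz, Equiv.coe_addRight, map_smul, LinearMap.smul_apply, smul_eq_mul]
  have h1 : -1 - (i + 1) + 1 = -1 - i := by ring
  rw [h1]
  push_cast
  ring

/-- Integration by parts together with the invariance of the Killing form: `∇` is skew. This cancels
the cross terms when the symplectic form is evaluated on changes of trivialization. -/
theorem resPair_nabla (A B C : Loop 𝔤) : resPair B (nabla A C) = -resPair (nabla A B) C := by
  rw [nabla, nabla, resPair_add_right, resPair_add_left, resPair_ddz, resPair_lie]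
  ring

end LoopCoeff
end Isostokes

/-! ### Weights, heights, the Killing form and regular elements -/

namespace Isostokes

open LieAlgebra LieModule

section Weights

variable {𝔤 : Type*} [LieRing 𝔤] [LieAlgebra ℂ 𝔤] [FiniteDimensional ℂ 𝔤] [LieAlgebra.IsKilling ℂ 𝔤]
  {H : LieSubalgebra ℂ 𝔤} [H.IsCartanSubalgebra]

theorem isInternal_rootSpace [DecidableEq (Weight ℂ H 𝔤)] :
    DirectSum.IsInternal fun χ : Weight ℂ H 𝔤 => (rootSpace H χ).toSubmodule :=
  DirectSum.isInternal_submodule_of_iSupIndep_of_iSup_eq_top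
    (LieSubmodule.iSupIndep_toSubmodule.mpr <| iSupIndep_genWeightSpace' ℂ H 𝔤)
    (LieSubmodule.iSup_toSubmodule_eq_top.mpr <| iSup_genWeightSpace_eq_top' ℂ H 𝔤)

open Classical in
/-- The projection of `𝔤` onto a weight space. -/
def wproj (χ : Weight ℂ H 𝔤) : 𝔤 →ₗ[ℂ] 𝔤 :=
  (rootSpace H χ).toSubmodule.subtype ∘ₗ DirectSum.component ℂ _ _ χ ∘ₗ
    (LinearEquiv.ofBijective (DirectSum.coeLinearMap _) (isInternal_rootSpace (H := H))).symm.toLinearMap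

theorem wproj_mem (χ : Weight ℂ H 𝔤) (x : 𝔤) : wproj χ x ∈ rootSpace H χ :=
  Subtype.prop _

theorem sum_wproj (x : 𝔤) : ∑ χ : Weight ℂ H 𝔤, wproj χ x = x := by
  classical
  let e := LinearEquiv.ofBijective (DirectSum.coeLinearMap _) (isInternal_rootSpace (H := H))
  obtain ⟨y, rfl⟩ := e.surjective x
  have h : ∀ χ, wproj χ (e y) = y χ := fun χ => by
    change ((e.symm (e y)) χ : 𝔤) = _
    rw [e.symm_apply_apply]
  simp only [h]
  change _ = DirectSum.coeLinearMap _ y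
  rw [DirectSum.coeLinearMap_eq_dfinsuppSum]
  symm
  exact DFinsupp.sum_eq_sum_fintype _ fun _ => rfl

theorem wproj_of_mem_weight {χ : Weight ℂ H 𝔤} {x : 𝔤} (hx : x ∈ rootSpace H χ)
    (ψ : Weight ℂ H 𝔤) [Decidable (χ = ψ)] : wproj ψ x = if χ = ψ then x else 0 := by
  classical
  let e := LinearEquiv.ofBijective (DirectSum.coeLinearMap _) (isInternal_rootSpace (H := H))
  have h : e (DirectSum.lof ℂ _ _ χ ⟨x, hx⟩) = x := DirectSum.coeLinearMap_lof _ _ _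
  have h2 : e.symm x = DirectSum.lof ℂ _ _ χ ⟨x, hx⟩ := by
    rw [LinearEquiv.symm_apply_eq]; exact h.symm
  change ((e.symm x) ψ : 𝔤) = _
  rw [h2]
  by_cases hc : χ = ψ
  · subst hc
    simp [DirectSum.lof_eq_of, DirectSum.of_eq_same]
  · rw [if_neg hc, DirectSum.lof_eq_of, DirectSum.of_eq_of_ne _ _ _ (Ne.symm hc)]
    rfl

theorem wproj_self {χ : Weight ℂ H 𝔤} {x : 𝔤} (hx : x ∈ rootSpace H χ) : wproj χ x = x := by
  classical
  rw [wproj_of_mem_weight hx, if_pos rfl]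

theorem wproj_of_ne {f : H → ℂ} {x : 𝔤} (hx : x ∈ rootSpace H f) {ψ : Weight ℂ H 𝔤}
    (h : (ψ : H → ℂ) ≠ f) : wproj ψ x = 0 := by
  classical
  by_cases h0 : genWeightSpace 𝔤 f = ⊥
  · rw [rootSpace, h0, LieSubmodule.mem_bot] at hx
    rw [hx, map_zero]
  · rw [wproj_of_mem_weight (χ := ⟨f, h0⟩) hx, if_neg]
    rintro rfl
    exact h rfl

theorem lie_eq_of_mem {χ : Weight ℂ H 𝔤} {x : 𝔤} (hx : x ∈ rootSpace H χ) {h : 𝔤} (hh : h ∈ H) :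
    ⁅h, x⁆ = χ ⟨h, hh⟩ • x :=
  IsKilling.lie_eq_smul_of_mem_rootSpace hx ⟨h, hh⟩

theorem wproj_lie {h : 𝔤} (hh : h ∈ H) (x : 𝔤) (χ : Weight ℂ H 𝔤) :
    wproj χ ⁅h, x⁆ = χ ⟨h, hh⟩ • wproj χ x := by
  classical
  conv_lhs => rw [← sum_wproj (H := H) x, lie_sum, map_sum]
  rw [Finset.sum_eq_single χ]
  · rw [lie_eq_of_mem (wproj_mem χ x) hh, map_smul, wproj_self (wproj_mem χ x)]
  · intro ψ _ hψ
    rw [lie_eq_of_mem (wproj_mem ψ x) hh, map_smul, wproj_of_mem_weight (wproj_mem ψ x), if_neg hψ,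
      smul_zero]
  · simp

theorem rootSpace_zero_eq_cartan : (rootSpace H (0 : H → ℂ)).toSubmodule = H.toSubmodule := by
  rw [LieAlgebra.rootSpace_zero_eq]
  rfl

theorem mem_cartan_iff {x : 𝔤} : x ∈ H ↔ ∀ χ : Weight ℂ H 𝔤, χ.IsNonZero → wproj χ x = 0 := by
  have h0 : ∀ y, y ∈ H ↔ y ∈ rootSpace H (0 : H → ℂ) := fun y => by
    have := rootSpace_zero_eq_cartan (H := H)
    rw [← LieSubmodule.mem_toSubmodule, this]; rfl
  constructor
  · intro hx χ hχ
    exact wproj_of_ne ((h0 x).1 hx) hχ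
  · intro h
    rw [← sum_wproj (H := H) x]
    refine sum_mem fun χ _ => ?_
    by_cases hχ : χ.IsZero
    · rw [h0]
      have := wproj_mem χ x
      rwa [hχ] at this
    · rw [h χ hχ]
      exact H.zero_mem

open Classical in
/-- The sum of the projections onto the root spaces. -/
def offDiag (H : LieSubalgebra ℂ 𝔤) [H.IsCartanSubalgebra] : 𝔤 →ₗ[ℂ] 𝔤 :=
  ∑ χ : Weight ℂ H 𝔤, if χ.IsNonZero then wproj χ else 0

/-- The projection onto the Cartan subalgebra along the root spaces. -/
def hpart (H : LieSubalgebra ℂ 𝔤) [H.IsCartanSubalgebra] : 𝔤 →ₗ[ℂ] 𝔤 := LinearMap.id - offDiag H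

theorem wproj_offDiag {χ : Weight ℂ H 𝔤} (hχ : χ.IsNonZero) (x : 𝔤) :
    wproj χ (offDiag H x) = wproj χ x := by
  classical
  rw [offDiag, LinearMap.sum_apply, map_sum, Finset.sum_eq_single χ]
  · rw [if_pos hχ, wproj_self (wproj_mem χ x)]
  · intro ψ _ hψ
    split_ifs
    · rw [wproj_of_mem_weight (wproj_mem ψ x), if_neg hψ]
    · simp
  · simp

theorem wproj_offDiag_zero {χ : Weight ℂ H 𝔤} (hχ : χ.IsZero) (x : 𝔤) :
    wproj χ (offDiag H x) = 0 := by
  classical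
  rw [offDiag, LinearMap.sum_apply, map_sum]
  refine Finset.sum_eq_zero fun ψ _ => ?_
  split_ifs with h
  · rw [wproj_of_mem_weight (wproj_mem ψ x), if_neg]
    rintro rfl
    exact h hχ
  · simp

theorem hpart_mem (x : 𝔤) : hpart H x ∈ H := by
  rw [mem_cartan_iff]
  intro χ hχ
  rw [hpart, LinearMap.sub_apply, map_sub, wproj_offDiag hχ]
  simp

theorem offDiag_of_mem {x : 𝔤} (hx : x ∈ H) : offDiag H x = 0 := by
  classical
  rw [offDiag, LinearMap.sum_apply]
  refine Finset.sum_eq_zero fun ψ _ => ?_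
  split_ifs with h
  · exact mem_cartan_iff.1 hx ψ h
  · rfl

theorem hpart_of_mem {x : 𝔤} (hx : x ∈ H) : hpart H x = x := by
  rw [hpart, LinearMap.sub_apply, offDiag_of_mem hx, sub_zero]; rfl

theorem hpart_add_offDiag (x : 𝔤) : hpart H x + offDiag H x = x := by
  simp [hpart]

theorem mem_cartan_of_offDiag {x : 𝔤} (hx : offDiag H x = 0) : x ∈ H := by
  rw [← hpart_add_offDiag (H := H) x, hx, add_zero]
  exact hpart_mem x

theorem wproj_eq_zero_ext {x y : 𝔤} (h : ∀ χ : Weight ℂ H 𝔤, wproj χ x = wproj χ y) : x = y := by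
  rw [← sum_wproj (H := H) x, ← sum_wproj (H := H) y]
  exact Finset.sum_congr rfl fun χ _ => h χ

theorem lie_cartan_cartan {x y : 𝔤} (hx : x ∈ H) (hy : y ∈ H) : ⁅x, y⁆ = 0 := by
  have := LieModule.IsTrivial.trivial (⟨x, hx⟩ : H) (⟨y, hy⟩ : H)
  exact congrArg Subtype.val this

/-! ### Heights -/

variable (b : (LieAlgebra.IsKilling.rootSystem H).Base)

open Classical in
/-- The height of a weight. -/
def ht (χ : Weight ℂ H 𝔤) : ℤ := if h : χ ∈ H.root then b.height ⟨χ, h⟩ else 0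

theorem mem_root_iff {χ : Weight ℂ H 𝔤} : χ ∈ H.root ↔ χ.IsNonZero := by
  simp

theorem ht_root (α : H.root) : ht b α = b.height α := by
  rw [ht, dif_pos α.2]

theorem ht_zero {χ : Weight ℂ H 𝔤} (hχ : χ.IsZero) : ht b χ = 0 := by
  rw [ht, dif_neg]
  rw [mem_root_iff]
  exact fun h => h hχ

theorem ht_ne_zero {χ : Weight ℂ H 𝔤} (hχ : χ.IsNonZero) : ht b χ ≠ 0 := by
  rw [ht, dif_pos (mem_root_iff.2 hχ)]
  exact b.height_ne_zero _

/-- The simple roots are a basis of the dual of `𝔥`, so some `ρ` takes the value `1` on all of them;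
every root is an integral combination of simple roots. Heights thus become values of linear forms at
one element, and additivity is immediate. -/
theorem exists_grading_element : ∃ ρ : H, ∀ χ : Weight ℂ H 𝔤, χ ρ = (ht b χ : ℂ) := by
  let B := b.toWeightBasis
  let l : Module.Dual ℂ (Module.Dual ℂ H) := B.constr ℂ fun _ => (1 : ℂ)
  let ρ : H := (Module.evalEquiv ℂ H).symm l
  have hl : ∀ f : Module.Dual ℂ H, f ρ = l f := fun f => by
    have : Module.evalEquiv ℂ H ρ = l := LinearEquiv.apply_symm_apply _ _
    rw [← this]
    rfl
  refine ⟨ρ, fun χ => ?_⟩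
  by_cases hχ : χ ∈ H.root
  · obtain ⟨f, -, -, hf⟩ := b.exists_root_eq_sum_int ⟨χ, hχ⟩
    have h1 := ht_root b ⟨χ, hχ⟩
    rw [b.height_eq_sum hf] at h1
    rw [h1]
    have h2 : χ ρ = l ((IsKilling.rootSystem H).root ⟨χ, hχ⟩) := by
      rw [← hl]
      rfl
    rw [h2, hf, map_sum]
    push_cast
    refine Finset.sum_congr rfl fun j hj => ?_
    have h3 : l ((IsKilling.rootSystem H).root j) = 1 := by
      have := b.toWeightBasis_apply ⟨j, hj⟩
      rw [← this]
      exact B.constr_basis ℂ _ _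
    rw [map_zsmul, h3]
    simp
  · have h0 : χ.IsZero := by
      by_contra h
      exact hχ (mem_root_iff.2 h)
    rw [ht_zero b h0, h0]
    simp

theorem ht_add {χ ψ ω : Weight ℂ H 𝔤} (h : (ω : H → ℂ) = χ + ψ) : ht b ω = ht b χ + ht b ψ := by
  obtain ⟨ρ, hρ⟩ := exists_grading_element b
  have h1 := congrFun h ρ
  rw [Pi.add_apply, hρ, hρ, hρ] at h1
  exact_mod_cast h1

theorem ht_neg (χ : Weight ℂ H 𝔤) : ht b (-χ) = -ht b χ := by
  obtain ⟨ρ, hρ⟩ := exists_grading_element b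
  have h1 : (-χ : Weight ℂ H 𝔤) ρ = -(χ ρ) := rfl
  rw [hρ, hρ] at h1
  exact_mod_cast h1

/-- The sum of the weight spaces of height at least `j`. -/
def fil (j : ℤ) : Submodule ℂ 𝔤 := ⨅ (χ : Weight ℂ H 𝔤) (_ : ht b χ < j), LinearMap.ker (wproj χ)

theorem mem_fil {j : ℤ} {x : 𝔤} : x ∈ fil b j ↔ ∀ χ : Weight ℂ H 𝔤, ht b χ < j → wproj χ x = 0 := by
  simp [fil, Submodule.mem_iInf]

theorem fil_antitone : Antitone (fil b) := fun _ _ hij _ hx =>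
  (mem_fil b).2 fun χ hχ => (mem_fil b).1 hx χ (lt_of_lt_of_le hχ hij)

theorem rootSpace_le_fil {χ : Weight ℂ H 𝔤} {j : ℤ} (h : j ≤ ht b χ) {x : 𝔤}
    (hx : x ∈ rootSpace H χ) : x ∈ fil b j := by
  rw [mem_fil]
  intro ψ hψ
  classical
  rw [wproj_of_mem_weight hx, if_neg]
  rintro rfl
  omega

theorem lie_mem_fil {i j : ℤ} {x y : 𝔤} (hx : x ∈ fil b i) (hy : y ∈ fil b j) :
    ⁅x, y⁆ ∈ fil b (i + j) := by
  rw [← sum_wproj (H := H) x, ← sum_wproj (H := H) y, sum_lie]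
  refine sum_mem fun χ _ => ?_
  rw [lie_sum]
  refine sum_mem fun ψ _ => ?_
  by_cases h1 : ht b χ < i
  · rw [(mem_fil b).1 hx χ h1, zero_lie]
    exact zero_mem _
  by_cases h2 : ht b ψ < j
  · rw [(mem_fil b).1 hy ψ h2, lie_zero]
    exact zero_mem _
  have h3 := LieAlgebra.lie_mem_genWeightSpace_of_mem_genWeightSpace (wproj_mem χ x) (wproj_mem ψ y)
  by_cases h0 : genWeightSpace 𝔤 (⇑χ + ⇑ψ) = ⊥
  · rw [h0, LieSubmodule.mem_bot] at h3
    rw [h3]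
    exact zero_mem _
  · have h4 : ht b ⟨_, h0⟩ = ht b χ + ht b ψ := ht_add b rfl
    exact rootSpace_le_fil b (χ := ⟨_, h0⟩) (by omega) h3

theorem exists_ht_bound : ∃ h : ℤ, 0 ≤ h ∧ ∀ χ : Weight ℂ H 𝔤, -h ≤ ht b χ ∧ ht b χ ≤ h := by
  refine ⟨∑ χ : Weight ℂ H 𝔤, |ht b χ|, Finset.sum_nonneg fun _ _ => abs_nonneg _, fun χ => ?_⟩
  have := Finset.single_le_sum (f := fun χ : Weight ℂ H 𝔤 => |ht b χ|) (fun _ _ => abs_nonneg _)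
    (Finset.mem_univ χ)
  exact abs_le.1 this

theorem mem_fil_of_le {h : ℤ} (hh : ∀ χ : Weight ℂ H 𝔤, -h ≤ ht b χ ∧ ht b χ ≤ h) {j : ℤ}
    (hj : j ≤ -h) (x : 𝔤) : x ∈ fil b j := by
  rw [mem_fil]
  intro χ hχ
  have := (hh χ).1
  omega

theorem eq_zero_of_mem_fil {h : ℤ} (hh : ∀ χ : Weight ℂ H 𝔤, -h ≤ ht b χ ∧ ht b χ ≤ h) {j : ℤ}
    (hj : h < j) {x : 𝔤} (hx : x ∈ fil b j) : x = 0 := by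
  rw [← sum_wproj (H := H) x]
  refine Finset.sum_eq_zero fun χ _ => (mem_fil b).1 hx χ ?_
  have := (hh χ).2
  omega

theorem isPos_iff_ht (α : H.root) : b.IsPos α ↔ 0 < ht b (α : Weight ℂ H 𝔤) := by
  rw [RootPairing.Base.isPos_iff, ht_root]

theorem nilradical_eq : nilradical b = fil b 1 := by
  refine le_antisymm (iSup₂_le fun α hα => ?_) fun x hx => ?_
  · rw [isPos_iff_ht] at hα
    exact fun x hx => rootSpace_le_fil b (by omega) hx
  · rw [← sum_wproj (H := H) x]
    refine sum_mem fun χ _ => ?_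
    by_cases h : ht b χ < 1
    · rw [(mem_fil b).1 hx χ h]
      exact zero_mem _
    · have hr : χ ∈ H.root := mem_root_iff.2 fun h0 => by
        rw [ht_zero b h0] at h
        omega
      have hp : b.IsPos ⟨χ, hr⟩ := by
        rw [isPos_iff_ht]
        change 0 < ht b χ
        omega
      exact Submodule.mem_iSup_of_mem ⟨χ, hr⟩ (Submodule.mem_iSup_of_mem hp (wproj_mem χ x))

theorem cartan_le_fil {x : 𝔤} (hx : x ∈ H) : x ∈ fil b 0 := by
  rw [mem_fil]
  intro χ hχ
  refine mem_cartan_iff.1 hx χ fun h => ?_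
  rw [ht_zero b h] at hχ
  omega

/-- No root has height zero, so the part of height zero is just `𝔥`. From here on `𝔲` and `𝔟` are
steps of one multiplicative filtration. -/
theorem borel_eq : borel b = fil b 0 := by
  rw [borel, nilradical_eq]
  refine le_antisymm (sup_le (fun x hx => cartan_le_fil b hx) (fil_antitone b (by norm_num))) ?_
  intro x hx
  rw [← hpart_add_offDiag (H := H) x]
  refine Submodule.add_mem_sup (hpart_mem x) ?_
  rw [mem_fil]
  intro χ hχ
  by_cases h : χ.IsZero
  · exact wproj_offDiag_zero h x
  · rw [wproj_offDiag h]
    refine (mem_fil b).1 hx χ ?_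
    have := ht_ne_zero b h
    omega

theorem offDiag_mem_fil {j : ℤ} {x : 𝔤} (hx : x ∈ fil b j) : offDiag H x ∈ fil b j := by
  rw [mem_fil]
  intro χ hχ
  by_cases h : χ.IsZero
  · exact wproj_offDiag_zero h x
  · rw [wproj_offDiag h]
    exact (mem_fil b).1 hx χ hχ

theorem offDiag_mem_fil_one {x : 𝔤} (hx : x ∈ fil b 0) : offDiag H x ∈ fil b 1 := by
  rw [mem_fil]
  intro χ hχ
  by_cases h : χ.IsZero
  · exact wproj_offDiag_zero h x
  · rw [wproj_offDiag h]
    refine (mem_fil b).1 hx χ ?_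
    have := ht_ne_zero b h
    omega

theorem hpart_of_mem_fil_one {x : 𝔤} (hx : x ∈ fil b 1) : hpart H x = 0 := by
  refine wproj_eq_zero_ext (H := H) fun χ => ?_
  rw [hpart, LinearMap.sub_apply, map_sub, map_zero]
  by_cases h : χ.IsZero
  · rw [wproj_offDiag_zero h, LinearMap.id_apply, sub_zero]
    exact (mem_fil b).1 hx χ (by rw [ht_zero b h]; omega)
  · rw [wproj_offDiag h, LinearMap.id_apply, sub_self]

/-! ### The Killing form -/

/-- The Killing form pairs the weight space of `χ` only with that of `-χ`, and without kernel. A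
component of `x` of height at most zero would be detected by the opposite weight space, which lies
in `𝔟`. -/
theorem mem_fil_one_of_perp {x : 𝔤} (h : ∀ y ∈ fil b 0, killingForm ℂ 𝔤 x y = 0) : x ∈ fil b 1 := by
  rw [mem_fil]
  intro χ hχ
  have hk : wproj χ x ∈ LinearMap.ker (killingForm ℂ 𝔤) := by
    refine mem_ker_killingForm_of_mem_rootSpace_of_forall_rootSpace_neg ℂ 𝔤 H (wproj_mem χ x) ?_
    intro y hy
    have hy' : y ∈ rootSpace H (-χ : Weight ℂ H 𝔤) := hy
    have h1 := h y (rootSpace_le_fil b (by rw [ht_neg]; omega) hy')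
    rw [← sum_wproj (H := H) x, map_sum, LinearMap.sum_apply, Finset.sum_eq_single χ] at h1
    · exact h1
    · intro ψ _ hψ
      refine killingForm_apply_eq_zero_of_mem_rootSpace_of_add_ne_zero ℂ 𝔤 H (wproj_mem ψ x) hy ?_
      intro h3
      apply hψ
      apply DFunLike.coe_injective
      exact sub_eq_zero.1 ((sub_eq_add_neg _ _).trans h3)
    · simp
  simpa using hk

theorem killing_nondegenerate {x : 𝔤} (h : ∀ y, killingForm ℂ 𝔤 x y = 0) : x = 0 := by
  have hk : x ∈ LinearMap.ker (killingForm ℂ 𝔤) := LinearMap.ext h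
  simpa using hk

theorem killing_cartan_offDiag {h : 𝔤} (hh : h ∈ H) (x : 𝔤) : killingForm ℂ 𝔤 h (offDiag H x) = 0 := by
  classical
  rw [offDiag, LinearMap.sum_apply, map_sum]
  refine Finset.sum_eq_zero fun χ _ => ?_
  split_ifs with hχ
  · have h0 : h ∈ rootSpace H (0 : H → ℂ) := by
      rw [← LieSubmodule.mem_toSubmodule, rootSpace_zero_eq_cartan]
      exact hh
    refine killingForm_apply_eq_zero_of_mem_rootSpace_of_add_ne_zero ℂ 𝔤 H h0 (wproj_mem χ x) ?_
    rw [zero_add]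
    exact hχ
  · simp

theorem killing_cartan_hpart {h : 𝔤} (hh : h ∈ H) (x : 𝔤) :
    killingForm ℂ 𝔤 h x = killingForm ℂ 𝔤 h (hpart H x) := by
  conv_lhs => rw [← hpart_add_offDiag (H := H) x, map_add, killing_cartan_offDiag hh, add_zero]

theorem exists_cartan_dual (l : H →ₗ[ℂ] ℂ) : ∃ h : H, ∀ x : H, killingForm ℂ 𝔤 (h : 𝔤) x = l x := by
  refine ⟨(IsKilling.cartanEquivDual H).symm l, fun x => ?_⟩
  have : IsKilling.cartanEquivDual H ((IsKilling.cartanEquivDual H).symm l) x = l x := by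
    rw [LinearEquiv.apply_symm_apply]
  exact this

theorem cartan_nondegenerate {h : 𝔤} (hh : h ∈ H) (h0 : ∀ x ∈ H, killingForm ℂ 𝔤 h x = 0) : h = 0 :=
  killing_nondegenerate fun y => by
    rw [killing_cartan_hpart hh]
    exact h0 _ (hpart_mem y)

/-! ### Regular elements -/

theorem ker_ad_eq {h : 𝔤} (hh : h ∈ H) (hα : ∀ χ : Weight ℂ H 𝔤, χ.IsNonZero → χ ⟨h, hh⟩ ≠ 0) :
    LinearMap.ker (ad ℂ 𝔤 h) = H.toSubmodule := by
  ext x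
  rw [LinearMap.mem_ker, LieAlgebra.ad_apply]
  constructor
  · intro h0
    refine mem_cartan_iff.2 fun χ hχ => ?_
    have h1 := wproj_lie hh x χ
    rw [h0, map_zero] at h1
    exact (smul_eq_zero.1 h1.symm).resolve_left (hα χ hχ)
  · intro hx
    exact lie_cartan_cartan hh hx

theorem isRegularSemisimple_of_cartan {h : 𝔤} (hh : h ∈ H)
    (hα : ∀ χ : Weight ℂ H 𝔤, χ.IsNonZero → χ ⟨h, hh⟩ ≠ 0) : IsRegularSemisimple H h := by
  refine ⟨IsKilling.isSemisimple_ad_of_mem_isCartanSubalgebra hh, ?_⟩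
  rw [ker_ad_eq hh hα]
  rfl

/-- In a basis of weight vectors sorted by height, `ad` of an element of `𝔟` is block triangular,
and its `𝔲`-part contributes nothing to the diagonal blocks. -/
theorem charpoly_ad_borel {a : 𝔤} (ha : a ∈ fil b 0) :
    (ad ℂ 𝔤 a).charpoly = (ad ℂ 𝔤 (hpart H a)).charpoly := by
  classical
  let B : Module.Basis (Σ χ : Weight ℂ H 𝔤, Fin (Module.finrank ℂ (rootSpace H χ).toSubmodule)) ℂ 𝔤 :=
    (isInternal_rootSpace (H := H)).collectedBasis fun χ => Module.finBasis ℂ _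
  have hB : ∀ i, B i ∈ rootSpace H i.1 := fun i =>
    (isInternal_rootSpace (H := H)).collectedBasis_mem _ i
  -- `BlockTriangular` asks for zero entries where the row index is larger; elements of `𝔟` do not
  -- lower heights, so the order has to be reversed.
  let f : (Σ χ : Weight ℂ H 𝔤, Fin (Module.finrank ℂ (rootSpace H χ).toSubmodule)) → ℤᵒᵈ :=
    fun i => OrderDual.toDual (ht b i.1)
  have hrepr : ∀ (x : 𝔤) i, wproj i.1 x = 0 → B.repr x i = 0 := by
    intro x i hx
    have h1 : B.repr x i = B.repr (wproj i.1 x) i := by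
      conv_lhs => rw [← sum_wproj (H := H) x, map_sum, Finset.sum_apply']
      refine Finset.sum_eq_single i.1 (fun χ _ hχ => ?_) (by simp)
      have := (isInternal_rootSpace (H := H)).collectedBasis_repr_of_mem_ne
        (fun χ => Module.finBasis ℂ (rootSpace H χ).toSubmodule) hχ (a := i.2) (wproj_mem χ x)
      exact this
    rw [h1, hx, map_zero, Finsupp.zero_apply]
  have hmat : ∀ (x : 𝔤) i j, LinearMap.toMatrix B B (ad ℂ 𝔤 x) i j = B.repr ⁅x, B j⁆ i := by
    intro x i j
    rw [LinearMap.toMatrix_apply, LieAlgebra.ad_apply]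
  have htri : ∀ x ∈ fil b 0, (LinearMap.toMatrix B B (ad ℂ 𝔤 x)).BlockTriangular f := by
    intro x hx i j hij
    have hij' : ht b i.1 < ht b j.1 := hij
    rw [hmat]
    apply hrepr
    have h2 := lie_mem_fil b hx (rootSpace_le_fil b le_rfl (hB j))
    exact (mem_fil b).1 h2 _ (by omega)
  have hh : hpart H a ∈ fil b 0 := cartan_le_fil b (hpart_mem a)
  rw [← LinearMap.charpoly_toMatrix _ B, ← LinearMap.charpoly_toMatrix _ B,
    (htri a ha).charpoly, (htri _ hh).charpoly]
  refine Finset.prod_congr rfl fun k _ => ?_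
  congr 1
  ext i j
  rw [Matrix.toSquareBlock_def, Matrix.of_apply, Matrix.toSquareBlock_def, Matrix.of_apply, hmat, hmat,
    ← sub_eq_zero, ← Finsupp.sub_apply, ← map_sub, ← sub_lie]
  apply hrepr
  have h1 : a - hpart H a = offDiag H a := by
    conv_lhs => rw [← hpart_add_offDiag (H := H) a, map_add]
    simp [hpart_of_mem (hpart_mem (H := H) a), hpart_of_mem_fil_one b (offDiag_mem_fil_one b ha)]
  have h2 := lie_mem_fil b (offDiag_mem_fil_one b ha) (rootSpace_le_fil b le_rfl (hB j))
  rw [h1]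
  refine (mem_fil b).1 h2 _ ?_
  have hi : ht b i.1.1 = OrderDual.ofDual k := congrArg OrderDual.ofDual i.2
  have hj : ht b j.1.1 = OrderDual.ofDual k := congrArg OrderDual.ofDual j.2
  omega

/-- The leading coefficient need not lie in `𝔥`, but it has the same characteristic polynomial of
`ad` as its `𝔥`-part, hence a generalized kernel of the same dimension. For `a` this is the
centralizer, of dimension `dim 𝔥`, by semisimplicity; a root vanishing on the `𝔥`-part would add a
root vector to the kernel, which already contains `𝔥`. -/
theorem root_hpart_ne_zero {a : 𝔤} (ha : a ∈ borel b) (hr : IsRegularSemisimple H a)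
    (χ : Weight ℂ H 𝔤) (hχ : χ.IsNonZero) : χ ⟨hpart H a, hpart_mem a⟩ ≠ 0 := by
  rw [borel_eq] at ha
  intro h0
  obtain ⟨hs, hd⟩ := hr
  have h1 := (ad ℂ 𝔤 a).finrank_maxGenEigenspace_zero_eq
  rw [charpoly_ad_borel b ha, ← LinearMap.finrank_maxGenEigenspace_zero_eq,
    hs.isFinitelySemisimple.maxGenEigenspace_eq_eigenspace, Module.End.eigenspace_zero, hd] at h1
  have h2 : LinearMap.ker (ad ℂ 𝔤 (hpart H a)) ≤ (ad ℂ 𝔤 (hpart H a)).maxGenEigenspace 0 := by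
    rw [← Module.End.eigenspace_zero]
    exact Module.End.genEigenspace_le_maximal _ _ _
  obtain ⟨x, hx, hx0⟩ := by
    have := χ.genWeightSpace_ne_bot
    rw [ne_eq, LieSubmodule.eq_bot_iff] at this
    push Not at this
    exact this
  have h3 : x ∈ LinearMap.ker (ad ℂ 𝔤 (hpart H a)) := by
    rw [LinearMap.mem_ker, LieAlgebra.ad_apply, lie_eq_of_mem hx (hpart_mem a), h0, zero_smul]
  have h4 : H.toSubmodule < LinearMap.ker (ad ℂ 𝔤 (hpart H a)) := by
    refine lt_of_le_of_ne (fun y hy => ?_) fun he => ?_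
    · rw [LinearMap.mem_ker, LieAlgebra.ad_apply]
      exact lie_cartan_cartan (hpart_mem a) hy
    · rw [← he] at h3
      have h5 := mem_cartan_iff.1 h3 χ hχ
      rw [wproj_self hx] at h5
      exact hx0 h5
  have h5 := Submodule.finrank_lt_finrank_of_lt (lt_of_lt_of_le h4 h2)
  have h6 : Module.finrank ℂ H = Module.finrank ℂ H.toSubmodule := rfl
  omega

theorem root_ne_zero_of_regular {h : 𝔤} (hh : h ∈ H) (hr : IsRegularSemisimple H h)
    (b : (LieAlgebra.IsKilling.rootSystem H).Base)
    (χ : Weight ℂ H 𝔤) (hχ : χ.IsNonZero) : χ ⟨h, hh⟩ ≠ 0 := by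
  have h1 : h ∈ borel b := by
    rw [borel_eq]
    exact cartan_le_fil b hh
  have := root_hpart_ne_zero b h1 hr χ hχ
  simpa only [hpart_of_mem hh] using this

end Weights
end Isostokes

/-! ### Exponentials in complete filtered Lie algebras -/

namespace Isostokes

/-- A complete, separated and exhaustive filtration of a Lie algebra. -/
structure LieFiltration (L : Type*) [LieRing L] [LieAlgebra ℂ L] where
  F : ℤ → Submodule ℂ L
  anti : Antitone F
  lie_mem : ∀ {i j : ℤ} {x y : L}, x ∈ F i → y ∈ F j → ⁅x, y⁆ ∈ F (i + j)
  sep : ∀ {x : L}, (∀ d, x ∈ F d) → x = 0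
  exhaust : ∀ x : L, ∃ d, x ∈ F d
  complete : ∀ (a : ℕ → L) (d : ℤ), (∀ m : ℕ, a m ∈ F (d + m)) →
    ∃ s, ∀ N : ℕ, s - ∑ m ∈ Finset.range N, a m ∈ F (d + N)

namespace LieFiltration

variable {L : Type*} [LieRing L] [LieAlgebra ℂ L] (𝓕 : LieFiltration L)

/-- `s` is the sum of the series `a`. -/
def IsSum (a : ℕ → L) (s : L) : Prop :=
  ∀ K : ℤ, ∃ N₀ : ℕ, ∀ N ≥ N₀, s - ∑ m ∈ Finset.range N, a m ∈ 𝓕.F K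

/-- A subspace closed for the topology of the filtration. -/
def IsClosed (S : Submodule ℂ L) : Prop := ∀ x, (∀ d, ∃ y ∈ S, x - y ∈ 𝓕.F d) → x ∈ S

/-- A linear map that is continuous for the filtration. -/
def IsBounded (f : L →ₗ[ℂ] L) : Prop := ∃ c : ℤ, ∀ d, ∀ x ∈ 𝓕.F d, f x ∈ 𝓕.F (d + c)

variable {𝓕}

theorem mem_of_le {i j : ℤ} (h : i ≤ j) {x : L} (hx : x ∈ 𝓕.F j) : x ∈ 𝓕.F i := 𝓕.anti h hx

theorem isClosed_F (d : ℤ) : 𝓕.IsClosed (𝓕.F d) := fun x h => by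
  obtain ⟨y, hy, hxy⟩ := h d
  simpa using add_mem hxy hy

theorem IsSum.unique {a : ℕ → L} {s t : L} (hs : 𝓕.IsSum a s) (ht : 𝓕.IsSum a t) : s = t := by
  rw [← sub_eq_zero]
  refine 𝓕.sep fun K => ?_
  obtain ⟨N, hN⟩ := hs K
  obtain ⟨M, hM⟩ := ht K
  have := sub_mem (hN (max N M) (le_max_left _ _)) (hM (max N M) (le_max_right _ _))
  simpa using this

theorem IsSum.add {a a' : ℕ → L} {s s' : L} (h : 𝓕.IsSum a s) (h' : 𝓕.IsSum a' s') :
    𝓕.IsSum (fun m => a m + a' m) (s + s') := fun K => by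
  obtain ⟨N, hN⟩ := h K
  obtain ⟨M, hM⟩ := h' K
  refine ⟨max N M, fun n hn => ?_⟩
  rw [Finset.sum_add_distrib, add_sub_add_comm]
  exact add_mem (hN n (le_of_max_le_left hn)) (hM n (le_of_max_le_right hn))

theorem IsSum.map {a : ℕ → L} {s : L} (h : 𝓕.IsSum a s) {f : L →ₗ[ℂ] L} (hf : 𝓕.IsBounded f) :
    𝓕.IsSum (fun m => f (a m)) (f s) := fun K => by
  obtain ⟨c, hc⟩ := hf
  obtain ⟨N, hN⟩ := h (K - c)
  refine ⟨N, fun n hn => ?_⟩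
  have := hc _ _ (hN n hn)
  rwa [map_sub, map_sum, sub_add_cancel] at this

theorem isBounded_smul (c : ℂ) : 𝓕.IsBounded (c • LinearMap.id) :=
  ⟨0, fun d x hx => by simpa using (𝓕.F d).smul_mem c hx⟩

theorem IsSum.smul {a : ℕ → L} {s : L} (h : 𝓕.IsSum a s) (c : ℂ) :
    𝓕.IsSum (fun m => c • a m) (c • s) := h.map (isBounded_smul c)

theorem IsSum.sub {a a' : ℕ → L} {s s' : L} (h : 𝓕.IsSum a s) (h' : 𝓕.IsSum a' s') :
    𝓕.IsSum (fun m => a m - a' m) (s - s') := by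
  have := h.add (h'.smul (-1))
  simpa [sub_eq_add_neg] using this

theorem isSum_of_finite {a : ℕ → L} (n : ℕ) (h : ∀ m ≥ n, a m = 0) :
    𝓕.IsSum a (∑ m ∈ Finset.range n, a m) := fun K => by
  refine ⟨n, fun N hN => ?_⟩
  rw [← Finset.sum_subset (Finset.range_mono hN) fun m _ hm => h m (by simpa using hm), sub_self]
  exact zero_mem _

theorem exists_isSum {a : ℕ → L} {d : ℤ} (h : ∀ m : ℕ, a m ∈ 𝓕.F (d + m)) : ∃ s, 𝓕.IsSum a s := by
  obtain ⟨s, hs⟩ := 𝓕.complete a d h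
  refine ⟨s, fun K => ⟨(K - d).toNat, fun N hN => mem_of_le ?_ (hs N)⟩⟩
  have := Int.self_le_toNat (K - d)
  omega

theorem IsSum.mem_of_isClosed {S : Submodule ℂ L} (hS : 𝓕.IsClosed S) {a : ℕ → L} {s : L}
    (h : 𝓕.IsSum a s) (ha : ∀ m, a m ∈ S) : s ∈ S := by
  refine hS s fun d => ?_
  obtain ⟨N, hN⟩ := h d
  exact ⟨_, sum_mem fun m _ => ha m, hN N le_rfl⟩

/-- Convergence by itself gives no rate. The rate comes from the degrees of the terms, by comparison
with a sufficiently long partial sum. -/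
theorem IsSum.sub_mem {a : ℕ → L} {s : L} (hs : 𝓕.IsSum a s) {d : ℤ} (h : ∀ m : ℕ, a m ∈ 𝓕.F (d + m))
    (N : ℕ) : s - ∑ m ∈ Finset.range N, a m ∈ 𝓕.F (d + N) := by
  obtain ⟨M, hM⟩ := hs (d + N)
  have h1 := hM (max M N) (le_max_left _ _)
  have h2 : s - ∑ m ∈ Finset.range N, a m =
      (s - ∑ m ∈ Finset.range (max M N), a m) + ∑ m ∈ Finset.Ico N (max M N), a m := by
    rw [Finset.sum_Ico_eq_sub _ (le_max_right M N)]
    abel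
  rw [h2]
  refine add_mem h1 (sum_mem fun m hm => mem_of_le ?_ (h m))
  have := (Finset.mem_Ico.1 hm).1
  omega

theorem sum_range_sub {M : Type*} [AddCommMonoid M] (c : ℕ → ℕ → M) (N : ℕ) :
    ∑ q ∈ Finset.range N, ∑ p ∈ Finset.range (N - q), c p q =
      ∑ m ∈ Finset.range N, ∑ pq ∈ Finset.HasAntidiagonal.antidiagonal m, c pq.1 pq.2 := by
  induction N with
  | zero => simp
  | succ N ih =>
    rw [Finset.sum_range_succ (fun m => ∑ pq ∈ Finset.HasAntidiagonal.antidiagonal m, c pq.1 pq.2) N,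
      ← ih, Finset.sum_range_succ]
    simp only [Nat.add_sub_cancel_left, Finset.sum_range_one]
    rw [← Finset.Nat.sum_antidiagonal_swap, Finset.Nat.sum_antidiagonal_eq_sum_range_succ_mk,
      Finset.sum_range_succ, ← add_assoc, ← Finset.sum_add_distrib]
    congr 1
    · refine Finset.sum_congr rfl fun q hq => ?_
      have : N + 1 - q = (N - q) + 1 := by
        have := Finset.mem_range.1 hq
        omega
      rw [this, Finset.sum_range_succ]
      rfl
    · simp

/-- Summation by antidiagonals: truncating at total index `N` leaves the tail of the outer series
and the tails of the first `N` rows, all of degree at least `d + N`. -/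
theorem IsSum.fubini {c : ℕ → ℕ → L} {t : ℕ → L} {s : L} {d : ℤ}
    (hc : ∀ p q : ℕ, c p q ∈ 𝓕.F (d + p + q)) (ht : ∀ q, 𝓕.IsSum (fun p => c p q) (t q))
    (hs : 𝓕.IsSum t s) : 𝓕.IsSum (fun m => ∑ pq ∈ Finset.HasAntidiagonal.antidiagonal m, c pq.1 pq.2) s := by
  have hc' : ∀ q p : ℕ, c p q ∈ 𝓕.F (d + q + p) := fun q p => by
    rw [add_right_comm]; exact hc p q
  have h1 : ∀ q N : ℕ, t q - ∑ p ∈ Finset.range N, c p q ∈ 𝓕.F (d + q + N) := fun q N =>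
    (ht q).sub_mem (hc' q) N
  have h2 : ∀ q : ℕ, t q ∈ 𝓕.F (d + q) := fun q => by simpa using h1 q 0
  intro K
  refine ⟨(K - d).toNat, fun N hN => ?_⟩
  have h3 : s - ∑ m ∈ Finset.range N, ∑ pq ∈ Finset.HasAntidiagonal.antidiagonal m, c pq.1 pq.2 =
      (s - ∑ q ∈ Finset.range N, t q) +
        ∑ q ∈ Finset.range N, (t q - ∑ p ∈ Finset.range (N - q), c p q) := by
    rw [Finset.sum_sub_distrib, sum_range_sub]
    abel
  have h4 := Int.self_le_toNat (K - d)
  rw [h3]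
  refine add_mem (mem_of_le (by omega) (hs.sub_mem h2 N)) (sum_mem fun q hq => ?_)
  have := Finset.mem_range.1 hq
  exact mem_of_le (by omega) (h1 q (N - q))

variable (𝓕) in
open Classical in
/-- The sum of a convergent series. -/
def fsum (a : ℕ → L) : L := if h : ∃ s, 𝓕.IsSum a s then h.choose else 0

theorem isSum_fsum {a : ℕ → L} {d : ℤ} (h : ∀ m : ℕ, a m ∈ 𝓕.F (d + m)) : 𝓕.IsSum a (𝓕.fsum a) := by
  rw [fsum, dif_pos (exists_isSum h)]
  exact (exists_isSum h).choose_spec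

theorem isBounded_ad (x : L) : 𝓕.IsBounded (LieAlgebra.ad ℂ L x) := by
  obtain ⟨c, hc⟩ := 𝓕.exhaust x
  exact ⟨c, fun d y hy => by
    rw [add_comm]
    exact 𝓕.lie_mem hc hy⟩

theorem isBounded_ad_right (x : L) : 𝓕.IsBounded (-LieAlgebra.ad ℂ L x) := by
  obtain ⟨c, hc⟩ := 𝓕.exhaust x
  exact ⟨c, fun d y hy => by
    rw [add_comm]
    exact neg_mem (𝓕.lie_mem hc hy)⟩

theorem IsSum.lie {a a' : ℕ → L} {s s' : L} {d d' : ℤ} (h : 𝓕.IsSum a s) (h' : 𝓕.IsSum a' s')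
    (ha : ∀ m : ℕ, a m ∈ 𝓕.F (d + m)) (ha' : ∀ m : ℕ, a' m ∈ 𝓕.F (d' + m)) :
    𝓕.IsSum (fun m => ∑ pq ∈ Finset.HasAntidiagonal.antidiagonal m, ⁅a pq.1, a' pq.2⁆) ⁅s, s'⁆ := by
  refine IsSum.fubini (c := fun p q => ⁅a p, a' q⁆) (t := fun q => ⁅s, a' q⁆) (d := d + d')
    (fun p q => ?_) (fun q => ?_) ?_
  · have := 𝓕.lie_mem (ha p) (ha' q)
    rwa [add_add_add_comm, ← add_assoc] at this
  · have := h.map (isBounded_ad_right (a' q))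
    simpa [lie_skew] using this
  · exact h'.map (isBounded_ad s)

/-! ### Exponentials -/

/-- The divided power `(ad x) ^ m A / m!`. -/
def dp (x : L) (m : ℕ) (A : L) : L := ((m.factorial : ℂ)⁻¹) • ((LieAlgebra.ad ℂ L x) ^ m) A

/-- `(ad x) ^ m u / (m + 1)!`. -/
def dq (x : L) (m : ℕ) (u : L) : L := (((m + 1).factorial : ℂ)⁻¹) • ((LieAlgebra.ad ℂ L x) ^ m) u

@[simp] theorem dp_zero (x A : L) : dp x 0 A = A := by simp [dp]
@[simp] theorem dq_zero (x A : L) : dq x 0 A = A := by simp [dq]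

theorem lie_dp (x : L) (m : ℕ) (A : L) : ⁅x, dp x m A⁆ = ((m + 1 : ℕ) : ℂ) • dp x (m + 1) A := by
  rw [dp, dp, pow_succ', Module.End.mul_apply, LieAlgebra.ad_apply, lie_smul, smul_smul,
    Nat.factorial_succ]
  congr 1
  have : ((m + 1 : ℕ) : ℂ) ≠ 0 := Nat.cast_ne_zero.2 (Nat.succ_ne_zero m)
  push_cast at this ⊢
  field_simp

theorem dp_lie_self (x : L) (m : ℕ) (A : L) : dp x m ⁅x, A⁆ = ((m + 1 : ℕ) : ℂ) • dp x (m + 1) A := by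
  rw [← lie_dp, dp, dp, lie_smul, ← LieAlgebra.ad_apply ℂ, ← LieAlgebra.ad_apply ℂ,
    ← Module.End.mul_apply, ← Module.End.mul_apply, ← pow_succ, ← pow_succ']

theorem lie_dq (x : L) (m : ℕ) (A : L) : ⁅x, dq x m A⁆ = ((m + 2 : ℕ) : ℂ) • dq x (m + 1) A := by
  rw [dq, dq, pow_succ', Module.End.mul_apply, LieAlgebra.ad_apply, lie_smul, smul_smul,
    Nat.factorial_succ (m + 1)]
  congr 1
  have : ((m + 1 + 1 : ℕ) : ℂ) ≠ 0 := Nat.cast_ne_zero.2 (Nat.succ_ne_zero _)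
  push_cast at this ⊢
  field_simp
  ring

/-- A pair `(p, q)` with `p + q = m + 1` is reached once by raising the first index, with weight
`p`, and once by raising the second, with weight `q`. This bookkeeping replaces binomial
coefficients in all identities for divided powers. -/
theorem sum_antidiagonal_weighted (f : ℕ → ℕ → L) (m : ℕ) :
    ∑ pq ∈ Finset.HasAntidiagonal.antidiagonal m, (((pq.1 + 1 : ℕ) : ℂ) • f (pq.1 + 1) pq.2 +
      ((pq.2 + 1 : ℕ) : ℂ) • f pq.1 (pq.2 + 1)) =
    ((m + 1 : ℕ) : ℂ) • ∑ pq ∈ Finset.HasAntidiagonal.antidiagonal (m + 1), f pq.1 pq.2 := by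
  have h1 := Finset.Nat.sum_antidiagonal_succ (n := m) (f := fun pq => ((pq.1 : ℕ) : ℂ) • f pq.1 pq.2)
  have h2 := Finset.Nat.sum_antidiagonal_succ' (n := m) (f := fun pq => ((pq.2 : ℕ) : ℂ) • f pq.1 pq.2)
  simp only [Nat.cast_zero, zero_smul, zero_add] at h1 h2
  rw [Finset.sum_add_distrib, ← h1, ← h2, ← Finset.sum_add_distrib, Finset.smul_sum]
  refine Finset.sum_congr rfl fun pq hpq => ?_
  rw [← add_smul, ← Nat.cast_add, Finset.HasAntidiagonal.mem_antidiagonal.1 hpq]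

theorem dp_succ_eq {x : L} {m : ℕ} {A B : L} (h : ((m + 1 : ℕ) : ℂ) • B = ⁅x, dp x m A⁆) :
    dp x (m + 1) A = B := by
  rw [lie_dp] at h
  exact (smul_right_injective L (Nat.cast_ne_zero.2 (Nat.succ_ne_zero m)) h).symm

theorem dp_lie (x : L) (m : ℕ) (A B : L) :
    dp x m ⁅A, B⁆ = ∑ pq ∈ Finset.HasAntidiagonal.antidiagonal m, ⁅dp x pq.1 A, dp x pq.2 B⁆ := by
  induction m with
  | zero => simp
  | succ m ih =>
    refine dp_succ_eq ?_
    rw [ih, lie_sum, ← sum_antidiagonal_weighted fun p q => ⁅dp x p A, dp x q B⁆]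
    refine Finset.sum_congr rfl fun pq _ => ?_
    rw [leibniz_lie, lie_dp, lie_dp, smul_lie, lie_smul]

/-- The homogeneous part of `D (e^{ad x} A) = e^{ad x} (D A) + [(D g) g⁻¹, e^{ad x} A]`, where `g =
exp x`. Since `x` need not commute with `D x`, the factor `(D g) g⁻¹` is the series `∑ (ad x)ᵐ (D x)
/ (m + 1)!`. -/
theorem derivation_dp (D : L →ₗ[ℂ] L) (hD : ∀ A B, D ⁅A, B⁆ = ⁅D A, B⁆ + ⁅A, D B⁆)
    (x : L) (m : ℕ) (A : L) :
    D (dp x (m + 1) A) = dp x (m + 1) (D A) +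
      ∑ pq ∈ Finset.HasAntidiagonal.antidiagonal m, ⁅dq x pq.1 (D x), dp x pq.2 A⁆ := by
  have hs : ∀ (m : ℕ) {u v : L}, ((m + 1 : ℕ) : ℂ) • u = ((m + 1 : ℕ) : ℂ) • v → u = v :=
    fun m u v h => smul_right_injective L (Nat.cast_ne_zero.2 (Nat.succ_ne_zero m)) h
  induction m with
  | zero =>
    have h1 : ∀ A, dp x (0 + 1) A = ⁅x, A⁆ := fun A => by simp [dp]
    rw [h1, h1, hD]
    simp [add_comm]
  | succ m ih =>
    apply hs (m + 1)
    rw [← map_smul, ← lie_dp, hD, ih, smul_add, ← lie_dp, lie_add, add_left_comm]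
    congr 1
    have h1 := sum_antidiagonal_weighted (fun p q => ⁅dq x p (D x), dp x q A⁆) m
    have h2 := Finset.Nat.sum_antidiagonal_succ (n := m)
      (f := fun pq => ⁅dq x pq.1 (D x), dp x pq.2 A⁆)
    have h3 : ⁅x, ∑ pq ∈ Finset.HasAntidiagonal.antidiagonal m, ⁅dq x pq.1 (D x), dp x pq.2 A⁆⁆ =
        ∑ pq ∈ Finset.HasAntidiagonal.antidiagonal m, (((pq.1 + 1 : ℕ) : ℂ) • ⁅dq x (pq.1 + 1) (D x), dp x pq.2 A⁆ +
          ((pq.2 + 1 : ℕ) : ℂ) • ⁅dq x pq.1 (D x), dp x (pq.2 + 1) A⁆) +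
        ∑ pq ∈ Finset.HasAntidiagonal.antidiagonal m, ⁅dq x (pq.1 + 1) (D x), dp x pq.2 A⁆ := by
      rw [lie_sum, ← Finset.sum_add_distrib]
      refine Finset.sum_congr rfl fun pq _ => ?_
      rw [leibniz_lie, lie_dp, lie_dq, smul_lie, lie_smul]
      push_cast
      module
    rw [h3, h1]
    have h4 : ((m + 1 + 1 : ℕ) : ℂ) = ((m + 1 : ℕ) : ℂ) + 1 := by push_cast; ring
    rw [h4, add_smul, one_smul]
    nth_rewrite 3 [h2]
    simp only [dq_zero]
    abel

theorem pow_ad_mem {x : L} (hx : x ∈ 𝓕.F 1) {d : ℤ} {A : L} (hA : A ∈ 𝓕.F d) (m : ℕ) :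
    ((LieAlgebra.ad ℂ L x) ^ m) A ∈ 𝓕.F (d + m) := by
  induction m with
  | zero => simpa using hA
  | succ m ih =>
    rw [pow_succ', Module.End.mul_apply, LieAlgebra.ad_apply]
    have := 𝓕.lie_mem hx ih
    refine mem_of_le ?_ this
    push_cast
    omega

theorem dp_mem {x : L} (hx : x ∈ 𝓕.F 1) {d : ℤ} {A : L} (hA : A ∈ 𝓕.F d) (m : ℕ) :
    dp x m A ∈ 𝓕.F (d + m) := Submodule.smul_mem _ _ (pow_ad_mem hx hA m)

theorem dq_mem {x : L} (hx : x ∈ 𝓕.F 1) {d : ℤ} {A : L} (hA : A ∈ 𝓕.F d) (m : ℕ) :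
    dq x m A ∈ 𝓕.F (d + m) := Submodule.smul_mem _ _ (pow_ad_mem hx hA m)

variable (𝓕) in
/-- `exp (ad x) A`. -/
def expAd (x A : L) : L := 𝓕.fsum fun m => dp x m A

variable (𝓕) in
/-- `∑ (ad x) ^ m u / (m + 1)!`, which is `(Dg) g⁻¹` for `g = exp x` and `u = D x`. -/
def dexp (x u : L) : L := 𝓕.fsum fun m => dq x m u

theorem isSum_expAd {x : L} (hx : x ∈ 𝓕.F 1) (A : L) : 𝓕.IsSum (fun m => dp x m A) (𝓕.expAd x A) := by
  obtain ⟨d, hd⟩ := 𝓕.exhaust A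
  exact isSum_fsum (dp_mem hx hd)

theorem isSum_dexp {x : L} (hx : x ∈ 𝓕.F 1) (A : L) : 𝓕.IsSum (fun m => dq x m A) (𝓕.dexp x A) := by
  obtain ⟨d, hd⟩ := 𝓕.exhaust A
  exact isSum_fsum (dq_mem hx hd)

theorem expAd_add {x : L} (hx : x ∈ 𝓕.F 1) (A B : L) :
    𝓕.expAd x (A + B) = 𝓕.expAd x A + 𝓕.expAd x B := by
  refine (isSum_expAd hx (A + B)).unique ?_
  have := (isSum_expAd hx A).add (isSum_expAd hx B)
  simpa [dp] using this

theorem expAd_smul {x : L} (hx : x ∈ 𝓕.F 1) (c : ℂ) (A : L) :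
    𝓕.expAd x (c • A) = c • 𝓕.expAd x A := by
  refine (isSum_expAd hx (c • A)).unique ?_
  have := (isSum_expAd hx A).smul c
  simpa [dp, smul_comm c] using this

/-- `exp (ad x)` as a linear map. -/
def expAdₗ {x : L} (hx : x ∈ 𝓕.F 1) : L →ₗ[ℂ] L where
  toFun := 𝓕.expAd x
  map_add' := expAd_add hx
  map_smul' := expAd_smul hx

theorem expAd_zero {x : L} (hx : x ∈ 𝓕.F 1) : 𝓕.expAd x 0 = 0 := map_zero (expAdₗ hx)

theorem expAd_mem {x : L} (hx : x ∈ 𝓕.F 1) {d : ℤ} {A : L} (hA : A ∈ 𝓕.F d) : 𝓕.expAd x A ∈ 𝓕.F d := by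
  have := (isSum_expAd hx A).sub_mem (dp_mem hx hA) 0
  simpa using this

theorem dexp_mem {x : L} (hx : x ∈ 𝓕.F 1) {d : ℤ} {A : L} (hA : A ∈ 𝓕.F d) : 𝓕.dexp x A ∈ 𝓕.F d := by
  have := (isSum_dexp hx A).sub_mem (dq_mem hx hA) 0
  simpa using this

theorem expAd_sub_mem {x : L} (hx : x ∈ 𝓕.F 1) {d : ℤ} {A : L} (hA : A ∈ 𝓕.F d) :
    𝓕.expAd x A - A ∈ 𝓕.F (d + 1) := by
  have := (isSum_expAd hx A).sub_mem (dp_mem hx hA) 1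
  simpa using this

theorem dexp_sub_mem {x : L} (hx : x ∈ 𝓕.F 1) {d : ℤ} {A : L} (hA : A ∈ 𝓕.F d) :
    𝓕.dexp x A - A ∈ 𝓕.F (d + 1) := by
  have := (isSum_dexp hx A).sub_mem (dq_mem hx hA) 1
  simpa using this

theorem isBounded_expAd {x : L} (hx : x ∈ 𝓕.F 1) : 𝓕.IsBounded (expAdₗ hx) :=
  ⟨0, fun d A hA => by rw [add_zero]; exact expAd_mem hx hA⟩

theorem expAd_lie {x : L} (hx : x ∈ 𝓕.F 1) (A B : L) :
    𝓕.expAd x ⁅A, B⁆ = ⁅𝓕.expAd x A, 𝓕.expAd x B⁆ := by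
  obtain ⟨d, hd⟩ := 𝓕.exhaust A
  obtain ⟨d', hd'⟩ := 𝓕.exhaust B
  refine (isSum_expAd hx ⁅A, B⁆).unique ?_
  have := (isSum_expAd hx A).lie (isSum_expAd hx B) (dp_mem hx hd) (dp_mem hx hd')
  simpa only [dp_lie] using this

theorem dp_smul (x : L) (m : ℕ) (c : ℂ) (A : L) : dp x m (c • A) = c • dp x m A := by
  simp [dp, smul_comm c]

/-- In total degree `m + 1` the double series, multiplied by `m + 1`, becomes a sum of terms in
which `ad (-x)` and `ad x` occur next to each other and cancel; only degree zero survives. -/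
theorem expAd_neg_expAd {x : L} (hx : x ∈ 𝓕.F 1) (A : L) : 𝓕.expAd (-x) (𝓕.expAd x A) = A := by
  have hx' : -x ∈ 𝓕.F 1 := neg_mem hx
  obtain ⟨d, hd⟩ := 𝓕.exhaust A
  have h1 : 𝓕.IsSum (fun m => ∑ pq ∈ Finset.HasAntidiagonal.antidiagonal m, dp (-x) pq.1 (dp x pq.2 A))
      (𝓕.expAd (-x) (𝓕.expAd x A)) := by
    refine IsSum.fubini (c := fun p q => dp (-x) p (dp x q A))
      (t := fun q => 𝓕.expAd (-x) (dp x q A)) (d := d) (fun p q => ?_) (fun q => ?_) ?_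
    · rw [add_right_comm]
      exact dp_mem hx' (dp_mem hx hd q) p
    · exact isSum_expAd hx' _
    · exact (isSum_expAd hx A).map (isBounded_expAd hx')
  refine h1.unique ?_
  have h2 : ∀ m ≥ 1, ∑ pq ∈ Finset.HasAntidiagonal.antidiagonal m, dp (-x) pq.1 (dp x pq.2 A) = 0 := by
    intro m hm
    obtain ⟨m, rfl⟩ := Nat.exists_eq_add_of_le' hm
    have h3 := sum_antidiagonal_weighted (fun p q => dp (-x) p (dp x q A)) m
    have h4 : ∀ pq ∈ Finset.HasAntidiagonal.antidiagonal m, (((pq.1 + 1 : ℕ) : ℂ) • dp (-x) (pq.1 + 1) (dp x pq.2 A) +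
        ((pq.2 + 1 : ℕ) : ℂ) • dp (-x) pq.1 (dp x (pq.2 + 1) A)) = 0 := by
      intro pq _
      have h5 : ∀ B C : L, dp (-x) pq.1 (B + C) = dp (-x) pq.1 B + dp (-x) pq.1 C := fun B C => by
        simp [dp]
      rw [← dp_lie_self, ← dp_smul, ← lie_dp, ← h5, neg_lie, neg_add_cancel]
      simp [dp]
    rw [Finset.sum_eq_zero h4] at h3
    exact (smul_eq_zero.1 h3.symm).resolve_left (Nat.cast_ne_zero.2 (Nat.succ_ne_zero m))
  have := isSum_of_finite (𝓕 := 𝓕) 1 h2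
  simpa using this

theorem expAd_expAd_neg {x : L} (hx : x ∈ 𝓕.F 1) (A : L) : 𝓕.expAd x (𝓕.expAd (-x) A) = A := by
  have := expAd_neg_expAd (neg_mem hx) A
  rwa [neg_neg] at this

theorem expAd_injective {x : L} (hx : x ∈ 𝓕.F 1) {A B : L} (h : 𝓕.expAd x A = 𝓕.expAd x B) : A = B := by
  rw [← expAd_neg_expAd hx A, h, expAd_neg_expAd hx]

/-- The sum of the identities `derivation_dp`. It is used for `d/dz`, where it gives the gauge
action, and for the grading derivation, where it gives the group law. -/
theorem derivation_expAd {D : L →ₗ[ℂ] L} (hD : ∀ A B, D ⁅A, B⁆ = ⁅D A, B⁆ + ⁅A, D B⁆)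
    (hb : 𝓕.IsBounded D) {x : L} (hx : x ∈ 𝓕.F 1) (A : L) :
    D (𝓕.expAd x A) = 𝓕.expAd x (D A) + ⁅𝓕.dexp x (D x), 𝓕.expAd x A⁆ := by
  obtain ⟨d, hd⟩ := 𝓕.exhaust A
  obtain ⟨d', hd'⟩ := 𝓕.exhaust (D x)
  have h1 := (isSum_expAd hx A).map hb
  have h2 := (isSum_dexp hx (D x)).lie (isSum_expAd hx A) (dq_mem hx hd') (dp_mem hx hd)
  refine h1.unique fun K => ?_
  -- The bracket series begins one degree later than the other two, hence partial sums of lengths `n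
  -- + 1` and `n` are compared.
  obtain ⟨N, hN⟩ := h2 K
  obtain ⟨M, hM⟩ := isSum_expAd hx (D A) K
  refine ⟨max N M + 1, fun n hn => ?_⟩
  obtain ⟨n, rfl⟩ := Nat.exists_eq_add_of_le' (le_of_add_le_right hn)
  have e1 : ∑ m ∈ Finset.range (n + 1), D (dp x m A) = ∑ m ∈ Finset.range (n + 1), dp x m (D A) +
      ∑ m ∈ Finset.range n, ∑ pq ∈ Finset.HasAntidiagonal.antidiagonal m, ⁅dq x pq.1 (D x), dp x pq.2 A⁆ := by
    rw [Finset.sum_range_succ', Finset.sum_range_succ']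
    simp only [derivation_dp D hD, Finset.sum_add_distrib, dp_zero]
    abel
  rw [e1, add_sub_add_comm]
  have hn' : max N M ≤ n := by omega
  exact add_mem (hM _ (by omega)) (hN _ (by omega))

theorem pow_ad_add_sub_mem {x δ : L} (hx : x ∈ 𝓕.F 1) {e : ℤ} (he : 1 ≤ e) (hδ : δ ∈ 𝓕.F e) {d : ℤ}
    {A : L} (hA : A ∈ 𝓕.F d) (m : ℕ) :
    ((LieAlgebra.ad ℂ L (x + δ)) ^ (m + 1)) A - ((LieAlgebra.ad ℂ L x) ^ (m + 1)) A ∈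
      𝓕.F (d + e + m) := by
  induction m with
  | zero =>
    have := 𝓕.lie_mem hδ hA
    simpa [add_comm d e] using this
  | succ m ih =>
    rw [pow_succ', Module.End.mul_apply, pow_succ' _ (m + 1), Module.End.mul_apply,
      LieAlgebra.ad_apply, LieAlgebra.ad_apply]
    have h1 := 𝓕.lie_mem (add_mem hx (mem_of_le he hδ)) ih
    have h2 := 𝓕.lie_mem hδ (pow_ad_mem hx hA (m + 1))
    have h3 : ∀ P Q : L, ⁅x + δ, P⁆ - ⁅x, Q⁆ = ⁅x + δ, P - Q⁆ + ⁅δ, Q⁆ := fun P Q => by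
      simp only [add_lie, lie_sub]
      abel
    rw [h3]
    refine add_mem (mem_of_le ?_ h1) (mem_of_le ?_ h2) <;> push_cast <;> omega

/-- The linearization used in successive approximation: a correction `δ` of degree `e` acts to
lowest order as `ad δ`, and every mixed term with `x` or a further `δ` has higher degree. -/
theorem expAd_add_sub_mem {x δ : L} (hx : x ∈ 𝓕.F 1) {e : ℤ} (he : 1 ≤ e) (hδ : δ ∈ 𝓕.F e) {d : ℤ}
    {A : L} (hA : A ∈ 𝓕.F d) :
    𝓕.expAd (x + δ) A - 𝓕.expAd x A - ⁅δ, A⁆ ∈ 𝓕.F (d + e + 1) := by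
  have hxδ : x + δ ∈ 𝓕.F 1 := add_mem hx (mem_of_le he hδ)
  have h1 := (isSum_expAd hxδ A).sub (isSum_expAd hx A)
  have h2 := isSum_of_finite (𝓕 := 𝓕) (a := fun m => if m = 1 then ⁅δ, A⁆ else 0) 2
    (fun m hm => if_neg (by omega))
  have h3 : ∑ m ∈ Finset.range 2, (if m = 1 then ⁅δ, A⁆ else 0) = ⁅δ, A⁆ := by
    simp
  rw [h3] at h2
  refine (h1.sub h2).mem_of_isClosed (isClosed_F _) fun m => ?_
  rcases m with _ | _ | m
  · simp
  · simp [dp]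
  · rw [if_neg (by omega), sub_zero, dp, dp, ← smul_sub]
    refine Submodule.smul_mem _ _ (mem_of_le ?_ (pow_ad_add_sub_mem hx he hδ hA (m + 1)))
    push_cast
    omega

theorem dexp_add_sub_mem {x δ : L} (hx : x ∈ 𝓕.F 1) {e : ℤ} (he : 1 ≤ e) (hδ : δ ∈ 𝓕.F e) {d : ℤ}
    {A : L} (hA : A ∈ 𝓕.F d) :
    𝓕.dexp (x + δ) A - 𝓕.dexp x A ∈ 𝓕.F (d + e) := by
  have hxδ : x + δ ∈ 𝓕.F 1 := add_mem hx (mem_of_le he hδ)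
  refine ((isSum_dexp hxδ A).sub (isSum_dexp hx A)).mem_of_isClosed (isClosed_F _) fun m => ?_
  rcases m with _ | m
  · simp
  · rw [dq, dq, ← smul_sub]
    exact Submodule.smul_mem _ _ (mem_of_le (by omega) (pow_ad_add_sub_mem hx he hδ hA m))

theorem dexp_map_add {x : L} (hx : x ∈ 𝓕.F 1) (A B : L) :
    𝓕.dexp x (A + B) = 𝓕.dexp x A + 𝓕.dexp x B := by
  refine (isSum_dexp hx (A + B)).unique ?_
  have := (isSum_dexp hx A).add (isSum_dexp hx B)
  simpa [dq] using this

theorem pow_ad_mem_of_stable {S : Submodule ℂ L} {x : L} (h : ∀ A ∈ S, ⁅x, A⁆ ∈ S) {A : L}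
    (hA : A ∈ S) (m : ℕ) : ((LieAlgebra.ad ℂ L x) ^ m) A ∈ S := by
  induction m with
  | zero => simpa using hA
  | succ m ih =>
    rw [pow_succ', Module.End.mul_apply]
    exact h _ ih

theorem expAd_mem_of_stable {S : Submodule ℂ L} (hS : 𝓕.IsClosed S) {x : L} (hx : x ∈ 𝓕.F 1)
    (h : ∀ A ∈ S, ⁅x, A⁆ ∈ S) {A : L} (hA : A ∈ S) : 𝓕.expAd x A ∈ S :=
  (isSum_expAd hx A).mem_of_isClosed hS fun m =>
    Submodule.smul_mem _ _ (pow_ad_mem_of_stable h hA m)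

theorem dexp_mem_of_stable {S : Submodule ℂ L} (hS : 𝓕.IsClosed S) {x : L} (hx : x ∈ 𝓕.F 1)
    (h : ∀ A ∈ S, ⁅x, A⁆ ∈ S) {A : L} (hA : A ∈ S) : 𝓕.dexp x A ∈ S :=
  (isSum_dexp hx A).mem_of_isClosed hS fun m =>
    Submodule.smul_mem _ _ (pow_ad_mem_of_stable h hA m)

end LieFiltration
end Isostokes

/-! ### Successive approximation and products of exponentials -/

namespace Isostokes

namespace LieFiltration

variable {L : Type*} [LieRing L] [LieAlgebra ℂ L] {𝓕 : LieFiltration L}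

/-- The limit of a sequence of successive approximations. -/
theorem exists_limit (Q : ℕ → L → Prop) (w₀ : L) (h0 : Q 0 w₀)
    (hs : ∀ k w, Q k w → ∃ δ ∈ 𝓕.F (k + 1), Q (k + 1) (w + δ)) :
    ∃ (w : L) (s : ℕ → L), (∀ k, Q k (s k)) ∧ ∀ k : ℕ, w - s k ∈ 𝓕.F (k + 1) := by
  choose! δ hδ hQ using hs
  let s : ℕ → L := fun n => Nat.rec w₀ (fun k w => w + δ k w) n
  have hsucc : ∀ k, s (k + 1) = s k + δ k (s k) := fun _ => rfl
  have hQs : ∀ k, Q k (s k) := by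
    intro k
    induction k with
    | zero => exact h0
    | succ k ih => exact hQ k _ ih
  obtain ⟨v, hv⟩ := 𝓕.complete (fun m => s (m + 1) - s m) 1 fun m => by
    rw [hsucc, add_sub_cancel_left, add_comm]
    exact hδ m _ (hQs m)
  refine ⟨v + s 0, s, hQs, fun k => ?_⟩
  have h1 := hv k
  rw [Finset.sum_range_sub, add_comm] at h1
  have h2 : v + s 0 - s k = v - (s k - s 0) := by abel
  rw [h2]
  exact h1

/-- The map `w ↦ (T g) g⁻¹`, `g = exp w`, has `T` as its lowest order term, so it can be inverted by
successive approximation where `T` can. It serves as a logarithm: an element of the group is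
recovered from its logarithmic derivative. -/
theorem exists_dexp_eq {T : L →ₗ[ℂ] L} (hT : ∀ d, ∀ x ∈ 𝓕.F d, T x ∈ 𝓕.F d) {S : Submodule ℂ L}
    (hS : 𝓕.IsClosed S) (hSlie : ∀ x ∈ S, ∀ y ∈ S, ⁅x, y⁆ ∈ S) (hST : ∀ x ∈ S, T x ∈ S)
    (hsolve : ∀ d ≥ 1, ∀ u ∈ 𝓕.F d, u ∈ S → ∃ δ ∈ 𝓕.F d, δ ∈ S ∧ T δ = u)
    {σ : L} (hσ : σ ∈ 𝓕.F 1) (hσS : σ ∈ S) : ∃ w ∈ 𝓕.F 1, w ∈ S ∧ 𝓕.dexp w (T w) = σ := by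
  have hvar : ∀ w ∈ 𝓕.F 1, ∀ e ≥ (1 : ℤ), ∀ δ ∈ 𝓕.F e,
      𝓕.dexp (w + δ) (T (w + δ)) - 𝓕.dexp w (T w) - T δ ∈ 𝓕.F (e + 1) := by
    intro w hw e he δ hδ
    have hwδ : w + δ ∈ 𝓕.F 1 := add_mem hw (mem_of_le he hδ)
    rw [map_add, dexp_map_add hwδ]
    have h1 := dexp_add_sub_mem hw he hδ (hT _ _ hw)
    have h2 := dexp_sub_mem hwδ (hT _ _ hδ)
    rw [add_comm] at h1
    have := add_mem h1 h2
    convert this using 1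
    abel
  obtain ⟨w, s, hs, hlim⟩ := exists_limit (𝓕 := 𝓕)
    (fun k w => w ∈ 𝓕.F 1 ∧ w ∈ S ∧ σ - 𝓕.dexp w (T w) ∈ 𝓕.F (k + 1)) 0
    ⟨zero_mem _, zero_mem _, by
      have h1 : 𝓕.dexp 0 (T 0) ∈ 𝓕.F 1 := dexp_mem (zero_mem _) (by rw [map_zero]; exact zero_mem _)
      simpa using sub_mem hσ h1⟩ (by
      rintro k w ⟨hw, hwS, hr⟩
      have hk : (1 : ℤ) ≤ k + 1 := by omega
      have hrS : σ - 𝓕.dexp w (T w) ∈ S :=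
        sub_mem hσS (dexp_mem_of_stable hS hw (fun A hA => hSlie _ hwS _ hA) (hST _ hwS))
      obtain ⟨δ, hδ, hδS, hTδ⟩ := hsolve _ hk _ hr hrS
      refine ⟨δ, hδ, add_mem hw (mem_of_le hk hδ), add_mem hwS hδS, ?_⟩
      have := neg_mem (hvar w hw _ hk δ hδ)
      rw [hTδ] at this
      convert this using 1
      · push_cast; rfl
      · abel)
  have hw1 : w ∈ 𝓕.F 1 := by
    have := add_mem (hlim 0) (mem_of_le (by simp) (hs 0).1)
    simpa using this
  refine ⟨w, hw1, hS w fun d => ⟨s d.toNat, (hs _).2.1, mem_of_le ?_ (hlim _)⟩, ?_⟩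
  · have := Int.self_le_toNat d
    omega
  · rw [← sub_eq_zero]
    refine 𝓕.sep fun d => ?_
    have hk : (1 : ℤ) ≤ (d.toNat : ℤ) + 1 := by omega
    have h1 := hvar _ (hs d.toNat).1 _ hk _ (hlim d.toNat)
    rw [add_sub_cancel] at h1
    have h2 := sub_mem (add_mem (mem_of_le (by omega) h1) (hT _ _ (hlim d.toNat))) (hs d.toNat).2.2
    refine mem_of_le (j := (d.toNat : ℤ) + 1) (by have := Int.self_le_toNat d; omega) ?_
    convert h2 using 1
    abel

/-- Products of exponentials are exponentials. -/
theorem exists_expAd_comp {T : L →ₗ[ℂ] L} (hTlie : ∀ A B, T ⁅A, B⁆ = ⁅T A, B⁆ + ⁅A, T B⁆)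
    (hT : ∀ d, ∀ x ∈ 𝓕.F d, T x ∈ 𝓕.F d)
    (hrig : ∀ (d : ℤ), ∀ u ∈ 𝓕.F (d + 1), T u = (d : ℂ) • u → u = 0)
    (hdense : ∀ A K, ∃ A' ∈ Submodule.span ℂ {v | ∃ d : ℤ, v ∈ 𝓕.F d ∧ T v = (d : ℂ) • v},
      A - A' ∈ 𝓕.F K)
    {S : Submodule ℂ L} (hS : 𝓕.IsClosed S) (hSlie : ∀ x ∈ S, ∀ y ∈ S, ⁅x, y⁆ ∈ S)
    (hST : ∀ x ∈ S, T x ∈ S)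
    (hsolve : ∀ d ≥ 1, ∀ u ∈ 𝓕.F d, u ∈ S → ∃ δ ∈ 𝓕.F d, δ ∈ S ∧ T δ = u)
    {x y : L} (hx : x ∈ 𝓕.F 1) (hxS : x ∈ S) (hy : y ∈ 𝓕.F 1) (hyS : y ∈ S) :
    ∃ w ∈ 𝓕.F 1, w ∈ S ∧ ∀ A, 𝓕.expAd w A = 𝓕.expAd y (𝓕.expAd x A) := by
  have hTb : 𝓕.IsBounded T := ⟨0, fun d A hA => by rw [add_zero]; exact hT d A hA⟩
  -- Instead of a Baker–Campbell–Hausdorff series, `w` is chosen so that `exp w` has the same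
  -- logarithmic derivative along `T` as `exp y exp x`.
  obtain ⟨w, hw, hwS, hσ⟩ := exists_dexp_eq hT hS hSlie hST hsolve
    (σ := 𝓕.expAd y (𝓕.dexp x (T x)) + 𝓕.dexp y (T y))
    (add_mem (expAd_mem hy (dexp_mem hx (hT _ _ hx))) (dexp_mem hy (hT _ _ hy)))
    (add_mem (expAd_mem_of_stable hS hy (hSlie _ hyS)
      (dexp_mem_of_stable hS hx (hSlie _ hxS) (hST _ hxS)))
      (dexp_mem_of_stable hS hy (hSlie _ hyS) (hST _ hyS)))
  refine ⟨w, hw, hwS, ?_⟩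
  have hnw : -w ∈ 𝓕.F 1 := neg_mem hw
  -- `Θ = exp (-w) exp y exp x`, which has to be the identity. Equal logarithmic derivatives mean
  -- that `Θ` commutes with `T`.
  let Θ : L →ₗ[ℂ] L := expAdₗ hnw ∘ₗ expAdₗ hy ∘ₗ expAdₗ hx
  have hΘ : ∀ A, 𝓕.expAd w (Θ A) = 𝓕.expAd y (𝓕.expAd x A) := fun A => expAd_expAd_neg hw _
  have hΘT : ∀ A, T (Θ A) = Θ (T A) := by
    intro A
    have h1 := derivation_expAd hTlie hTb hw (Θ A)
    rw [hΘ, hσ, derivation_expAd hTlie hTb hy, derivation_expAd hTlie hTb hx, expAd_add hy,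
      expAd_lie hy, add_lie, add_assoc] at h1
    have h2 := add_right_cancel h1
    apply expAd_injective hw
    rw [hΘ]
    exact h2.symm
  have hΘ1 : ∀ d, ∀ A ∈ 𝓕.F d, Θ A - A ∈ 𝓕.F (d + 1) := by
    intro d A hA
    have h1 := expAd_sub_mem hx hA
    have h2 := expAd_sub_mem hy (expAd_mem hx hA)
    have h3 := expAd_sub_mem hnw (expAd_mem hy (expAd_mem hx hA))
    have := add_mem (add_mem h1 h2) h3
    convert this using 1
    change 𝓕.expAd (-w) (𝓕.expAd y (𝓕.expAd x A)) - A = _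
    abel
  have hΘe : ∀ A, Θ A = A := by
    intro A
    rw [← sub_eq_zero]
    refine 𝓕.sep fun K => ?_
    obtain ⟨A', hA', hAA'⟩ := hdense A K
    -- For an eigenvector `v` of degree `d`, the difference `Θ v - v` has the same eigenvalue but
    -- lies one step higher, where that eigenvalue does not occur. Sums of eigenvectors are dense.
    have h1 : Θ A' = A' := by
      refine Submodule.span_induction (p := fun v _ => Θ v = v) ?_ (map_zero _) ?_ ?_ hA'
      · rintro v ⟨d, hv, hTv⟩
        rw [← sub_eq_zero]
        refine hrig d _ (hΘ1 d v hv) ?_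
        rw [map_sub, hΘT, hTv, map_smul, smul_sub]
      · intro u v _ _ hu hv
        rw [map_add, hu, hv]
      · intro c v _ hv
        rw [map_smul, hv]
    have h2 := 𝓕.mem_of_le (i := K) (j := K + 1) (by omega) (hΘ1 K _ hAA')
    rw [map_sub, h1] at h2
    convert h2 using 1
    abel
  intro A
  rw [← hΘ, hΘe]

end LieFiltration

/-! ### The principal filtration of the loop algebra -/

open LieAlgebra LieModule LieFiltration

section LoopFiltration

variable {𝔤 : Type*} [LieRing 𝔤] [LieAlgebra ℂ 𝔤] [FiniteDimensional ℂ 𝔤] [LieAlgebra.IsKilling ℂ 𝔤]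
  {H : LieSubalgebra ℂ 𝔤} [H.IsCartanSubalgebra] (b : (LieAlgebra.IsKilling.rootSystem H).Base)

/-- A bound for the heights of all roots. -/
def hmax : ℤ := (exists_ht_bound b).choose

theorem hmax_nonneg : 0 ≤ hmax b := (exists_ht_bound b).choose_spec.1

theorem ht_bounds (χ : Weight ℂ H 𝔤) : -hmax b ≤ ht b χ ∧ ht b χ ≤ hmax b :=
  (exists_ht_bound b).choose_spec.2 χ

/-- The degree of `z` for the principal grading of the loop algebra. -/
def zdeg : ℤ := hmax b + 1

theorem zdeg_pos : 0 < zdeg b := by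
  have := hmax_nonneg b
  rw [zdeg]
  omega

theorem coeff_eq_zero_of_fil {d : ℤ} {x : 𝔤} (hx : x ∈ fil b d) (hd : hmax b < d) : x = 0 :=
  eq_zero_of_mem_fil b (ht_bounds b) hd hx

/-- The filtration of the loop algebra by the principal degree. -/
def loopF (d : ℤ) : Submodule ℂ (Loop 𝔤) :=
  ⨅ k : ℤ, (fil b (d - k * zdeg b)).comap (coeff k)

theorem mem_loopF {d : ℤ} {A : Loop 𝔤} : A ∈ loopF b d ↔ ∀ k, coeff k A ∈ fil b (d - k * zdeg b) := by
  simp [loopF, Submodule.mem_iInf]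

theorem coeff_eq_zero_of_mem_loopF {d k : ℤ} {A : Loop 𝔤} (hA : A ∈ loopF b d)
    (h : hmax b < d - k * zdeg b) : coeff k A = 0 :=
  coeff_eq_zero_of_fil b ((mem_loopF b).1 hA k) h

/-- Heights are bounded, so for fixed `k` the coefficient of `z ^ k` vanishes in all but finitely
many terms, and the sum is formed coefficientwise. -/
theorem loop_complete (a : ℕ → Loop 𝔤) (d : ℤ) (h : ∀ m : ℕ, a m ∈ loopF b (d + m)) :
    ∃ s, ∀ N : ℕ, s - ∑ m ∈ Finset.range N, a m ∈ loopF b (d + N) := by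
  have h0 : ∀ (k : ℤ) (m : ℕ), (hmax b + k * zdeg b - d + 1).toNat ≤ m → coeff k (a m) = 0 := by
    intro k m hm
    refine coeff_eq_zero_of_mem_loopF b (h m) ?_
    have := Int.toNat_le.1 hm
    linarith
  let N₀ : ℤ → ℕ := fun k => (hmax b + k * zdeg b - d + 1).toNat
  refine ⟨ofCoeffs (fun k => ∑ m ∈ Finset.range (N₀ k), coeff k (a m)) (-|hmax b - d| - 1)
    fun k hk => ?_, fun N => ?_⟩
  · refine Finset.sum_eq_zero fun m _ => ?_
    refine coeff_eq_zero_of_mem_loopF b (h m) ?_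
    have h1 := zdeg_pos b
    have h2 := le_abs_self (hmax b - d)
    have h3 := abs_nonneg (hmax b - d)
    nlinarith
  · rw [mem_loopF]
    intro k
    rw [map_sub, coeff_ofCoeffs, map_sum]
    rcases le_total (N₀ k) N with hN | hN
    · rw [← Finset.sum_subset (Finset.range_mono hN) fun m _ hm => h0 k m (not_lt.1 fun h => hm (Finset.mem_range.2 h)), sub_self]
      exact zero_mem _
    · rw [← Finset.sum_Ico_eq_sub _ hN]
      refine sum_mem fun m hm => fil_antitone b ?_ ((mem_loopF b).1 (h m) k)
      have := (Finset.mem_Ico.1 hm).1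
      omega

/-- The principal filtration of the loop algebra. -/
def loopFiltration : LieFiltration (Loop 𝔤) where
  F := loopF b
  anti := fun i j hij A hA => (mem_loopF b).2 fun k =>
    fil_antitone b (by omega) ((mem_loopF b).1 hA k)
  lie_mem := fun {i j x y} hx hy => (mem_loopF b).2 fun k => coeff_lie_mem _ _ _ _ fun l => by
    have := lie_mem_fil b ((mem_loopF b).1 hx l) ((mem_loopF b).1 hy (k - l))
    convert this using 2
    ring
  sep := fun {x} h => loop_ext fun k => by
    rw [map_zero]
    exact coeff_eq_zero_of_mem_loopF b (h (hmax b + 1 + k * zdeg b)) (by omega)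
  exhaust := fun x => by
    obtain ⟨N, hN⟩ := exists_bound x
    refine ⟨N * zdeg b - hmax b, (mem_loopF b).2 fun k => ?_⟩
    rcases lt_or_ge k N with hk | hk
    · rw [hN k hk]
      exact zero_mem _
    · refine mem_fil_of_le b (ht_bounds b) ?_ _
      have := mul_le_mul_of_nonneg_right hk (zdeg_pos b).le
      linarith
  complete := loop_complete b

/-- The bridge to `IsExpAd` and `IsExpGauge`: a `finsum` with infinite support would be zero by
convention, so finiteness in each degree has to be established. -/
theorem coeff_isSum {a : ℕ → Loop 𝔤} {s : Loop 𝔤} (hs : (loopFiltration b).IsSum a s) {d : ℤ}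
    (h : ∀ m : ℕ, a m ∈ loopF b (d + m)) (k : ℤ) : coeff k s = ∑ᶠ m, coeff k (a m) := by
  let N := (hmax b + k * zdeg b - d + 1).toNat
  have hN := Int.self_le_toNat (hmax b + k * zdeg b - d + 1)
  have h1 := coeff_eq_zero_of_mem_loopF b (k := k) (hs.sub_mem h N) (by omega)
  rw [map_sub, map_sum, sub_eq_zero] at h1
  rw [h1]
  symm
  refine finsum_eq_sum_of_support_subset _ fun m hm => ?_
  rw [Finset.coe_range, Set.mem_Iio]
  by_contra hc
  exact hm (coeff_eq_zero_of_mem_loopF b (h m) (by omega))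

theorem isClosed_of_coeff (S : ℤ → Submodule ℂ 𝔤) :
    (loopFiltration b).IsClosed (⨅ k : ℤ, (S k).comap (coeff k)) := by
  intro x h
  simp only [Submodule.mem_iInf, Submodule.mem_comap] at h ⊢
  intro k
  obtain ⟨y, hy, hxy⟩ := h (hmax b + 1 + k * zdeg b)
  have := coeff_eq_zero_of_mem_loopF b (k := k) hxy (by omega)
  rw [map_sub, sub_eq_zero] at this
  rw [this]
  exact hy k

theorem isExpAd_iff {x : Loop 𝔤} (hx : x ∈ loopF b 1) (A B : Loop 𝔤) :
    IsExpAd x A B ↔ B = (loopFiltration b).expAd x A := by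
  obtain ⟨d, hd⟩ := (loopFiltration b).exhaust A
  have h1 := coeff_isSum b (isSum_expAd (𝓕 := loopFiltration b) hx A) (dp_mem (𝓕 := loopFiltration b) hx hd)
  simp only [dp, map_smul] at h1
  constructor
  · intro h
    exact loop_ext fun k => (h k).trans (h1 k).symm
  · rintro rfl
    exact h1

/-- The gauge transformation by `exp x`. -/
def gauge (x A : Loop 𝔤) : Loop 𝔤 :=
  (loopFiltration b).expAd x A - (loopFiltration b).dexp x (ddz x)

theorem isExpGauge_iff {x : Loop 𝔤} (hx : x ∈ loopF b 1) (A B : Loop 𝔤) :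
    IsExpGauge x A B ↔ B = gauge b x A := by
  obtain ⟨d, hd⟩ := (loopFiltration b).exhaust A
  obtain ⟨d', hd'⟩ := (loopFiltration b).exhaust (ddz x)
  have h1 := coeff_isSum b (isSum_expAd (𝓕 := loopFiltration b) hx A) (dp_mem (𝓕 := loopFiltration b) hx hd)
  have h2 := coeff_isSum b (isSum_dexp (𝓕 := loopFiltration b) hx (ddz x))
    (dq_mem (𝓕 := loopFiltration b) hx hd')
  simp only [dp, dq, map_smul] at h1 h2
  constructor
  · intro h
    refine loop_ext fun k => (h k).trans ?_
    rw [gauge, map_sub, h1, h2]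
  · rintro rfl k
    rw [gauge, map_sub, h1, h2]

theorem ddz_mem {d : ℤ} {A : Loop 𝔤} (hA : A ∈ loopF b d) : ddz A ∈ loopF b (d - zdeg b) := by
  rw [mem_loopF]
  intro k
  rw [coeff_ddz]
  refine Submodule.smul_mem _ _ ?_
  have := (mem_loopF b).1 hA (k + 1)
  convert this using 2
  ring

theorem isBounded_ddz : (loopFiltration b).IsBounded ddz :=
  ⟨-zdeg b, fun d A hA => by
    rw [← sub_eq_add_neg]
    exact ddz_mem b hA⟩

/-- The term `(dg/dz) g⁻¹` produced by differentiating `Ad g` is exactly the inhomogeneous term of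
the gauge action. -/
theorem expAd_nabla {x : Loop 𝔤} (hx : x ∈ loopF b 1) (A ψ : Loop 𝔤) :
    (loopFiltration b).expAd x (nabla A ψ) = nabla (gauge b x A) ((loopFiltration b).expAd x ψ) := by
  have hx' : x ∈ (loopFiltration b).F 1 := hx
  rw [nabla, nabla, gauge, expAd_add hx', expAd_lie hx',
    derivation_expAd ddz_lie (isBounded_ddz b) hx', sub_lie]
  abel

theorem eq_zero_of_lie_eq_zero {A : Loop 𝔤} (h : ∀ ψ : Loop 𝔤, ⁅A, ψ⁆ = 0) : A = 0 := by
  refine loop_ext fun k => ?_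
  rw [map_zero]
  refine killing_nondegenerate fun y => ?_
  have h1 : ∀ y : 𝔤, ⁅coeff k A, y⁆ = 0 := by
    intro y
    have h2 := congrArg (coeff k) (h (mono 0 y))
    rw [coeff_lie, map_zero, finsum_eq_single _ k] at h2
    · rwa [sub_self, coeff_mono, if_pos rfl] at h2
    · intro i hi
      rw [coeff_mono, if_neg (by omega), lie_zero]
  have h3 : LieAlgebra.ad ℂ 𝔤 (coeff k A) = 0 := LinearMap.ext h1
  rw [LieModule.traceForm_apply_apply]
  change LinearMap.trace ℂ 𝔤 (LieAlgebra.ad ℂ 𝔤 (coeff k A) ∘ₗ _) = 0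
  rw [h3, LinearMap.zero_comp, map_zero]

/-- The centre of `𝔤` is zero, so a connection is determined by its operator on `𝔤((z))`. Laws for
gauge transformations thereby reduce to laws for `exp (ad x)`. -/
theorem nabla_injective {A B : Loop 𝔤} (h : ∀ ψ, nabla A ψ = nabla B ψ) : A = B := by
  rw [← sub_eq_zero]
  refine eq_zero_of_lie_eq_zero fun ψ => ?_
  have := h ψ
  rw [nabla, nabla, add_right_inj] at this
  rw [sub_lie, this, sub_self]

/-- Multiplication by a Laurent series is continuous and commutes with `ad x`. Hence `exp (ad x)` is
an automorphism over `ℂ((z))`, and so preserves the Killing form over `ℂ((z))`. -/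
theorem expAd_smul_laurent {x : Loop 𝔤} (hx : x ∈ loopF b 1) (s : Laurent) (A : Loop 𝔤) :
    (loopFiltration b).expAd x (s • A) = s • (loopFiltration b).expAd x A := by
  have hx' : x ∈ (loopFiltration b).F 1 := hx
  let f : Loop 𝔤 →ₗ[ℂ] Loop 𝔤 := (LinearMap.lsmul Laurent (Loop 𝔤) s).restrictScalars ℂ
  have hf : (loopFiltration b).IsBounded f := by
    obtain ⟨c, hc⟩ := Laurent.exists_bound s
    refine ⟨c * zdeg b, fun d A hA => (mem_loopF b).2 fun k => ?_⟩
    change coeff k (s • A) ∈ _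
    rw [coeff_smul]
    refine finsum_induction (· ∈ fil b (d + c * zdeg b - k * zdeg b)) (zero_mem _)
      (fun _ _ => add_mem) fun i => ?_
    rcases lt_or_ge i c with hi | hi
    · rw [hc i hi, zero_smul]
      exact zero_mem _
    · refine Submodule.smul_mem _ _ (fil_antitone b ?_ ((mem_loopF b).1 hA (k - i)))
      have := mul_le_mul_of_nonneg_right hi (zdeg_pos b).le
      linarith
  refine (isSum_expAd hx' (s • A)).unique ?_
  have h2 : ∀ m, f (dp x m A) = dp x m (s • A) := by
    intro m
    have h3 : ∀ B : Loop 𝔤, ⁅x, s • B⁆ = s • ⁅x, B⁆ := fun B => lie_smul s x B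
    change s • dp x m A = _
    rw [dp, dp, smul_comm]
    congr 1
    induction m with
    | zero => simp
    | succ m ih =>
      rw [pow_succ', Module.End.mul_apply, Module.End.mul_apply, ← ih, LieAlgebra.ad_apply,
        LieAlgebra.ad_apply, h3]
  have h1 : (loopFiltration b).IsSum (fun m => f (dp x m A))
      (s • (loopFiltration b).expAd x A) := (isSum_expAd hx' A).map hf
  simp only [h2] at h1
  exact h1

/-- `exp (ad x)` as an automorphism of the loop algebra over `ℂ((z))`. -/
def expEquiv {x : Loop 𝔤} (hx : x ∈ loopF b 1) : Loop 𝔤 ≃ₗ⁅Laurent⁆ Loop 𝔤 where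
  toFun := (loopFiltration b).expAd x
  map_add' := expAd_add (𝓕 := loopFiltration b) hx
  map_smul' := expAd_smul_laurent b hx
  map_lie' := expAd_lie (𝓕 := loopFiltration b) hx _ _
  invFun := (loopFiltration b).expAd (-x)
  left_inv := expAd_neg_expAd (𝓕 := loopFiltration b) hx
  right_inv := expAd_expAd_neg (𝓕 := loopFiltration b) hx

theorem resPair_expAd {x : Loop 𝔤} (hx : x ∈ loopF b 1) (A B : Loop 𝔤) :
    resPair ((loopFiltration b).expAd x A) ((loopFiltration b).expAd x B) = resPair A B := by
  rw [resPair, resPair]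
  exact congrArg _ (LieAlgebra.killingForm_of_equiv_apply (expEquiv b hx) A B)

end LoopFiltration
end Isostokes

/-! ### The group `Gₙᵁ` -/

namespace Isostokes

open LieAlgebra LieModule LieFiltration

section UnipotentGroup

variable {𝔤 : Type*} [LieRing 𝔤] [LieAlgebra ℂ 𝔤] [FiniteDimensional ℂ 𝔤] [LieAlgebra.IsKilling ℂ 𝔤]
  {H : LieSubalgebra ℂ 𝔤} [H.IsCartanSubalgebra] (b : (LieAlgebra.IsKilling.rootSystem H).Base)

theorem mem_fil_top {j : ℤ} (hj : j ≤ -hmax b) (x : 𝔤) : x ∈ fil b j :=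
  mem_fil_of_le b (ht_bounds b) hj x

/-- Loops whose coefficient of `z ^ k` is in the step `j k` of the height filtration. -/
def coeffFil (j : ℤ → ℤ) : Submodule ℂ (Loop 𝔤) := ⨅ k : ℤ, (fil b (j k)).comap (coeff k)

theorem mem_coeffFil {j : ℤ → ℤ} {A : Loop 𝔤} : A ∈ coeffFil b j ↔ ∀ k, coeff k A ∈ fil b (j k) := by
  simp [coeffFil, Submodule.mem_iInf]

theorem isClosed_coeffFil (j : ℤ → ℤ) : (loopFiltration b).IsClosed (coeffFil b j) :=
  isClosed_of_coeff b _

/-- Brackets of loops with coefficientwise height conditions are controlled by inequalities between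
the steps. The last three alternatives say that one factor vanishes or that nothing is required. -/
theorem lie_mem_coeffFil {j₁ j₂ j₃ : ℤ → ℤ}
    (h : ∀ i l, j₃ (i + l) ≤ j₁ i + j₂ l ∨ hmax b < j₁ i ∨ hmax b < j₂ l ∨ j₃ (i + l) ≤ -hmax b)
    {x y : Loop 𝔤} (hx : x ∈ coeffFil b j₁) (hy : y ∈ coeffFil b j₂) : ⁅x, y⁆ ∈ coeffFil b j₃ := by
  rw [mem_coeffFil] at hx hy ⊢
  refine fun k => coeff_lie_mem _ _ _ _ fun i => ?_
  have hk := h i (k - i)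
  rw [add_sub_cancel] at hk
  rcases hk with h | h | h | h
  · exact fil_antitone b h (lie_mem_fil b (hx i) (hy (k - i)))
  · rw [coeff_eq_zero_of_fil b (hx i) h, zero_lie]
    exact zero_mem _
  · rw [coeff_eq_zero_of_fil b (hy _) h, lie_zero]
    exact zero_mem _
  · exact mem_fil_top b h _

/-- The step of the height filtration that contains the coefficient of `z ^ k` of the elements
of the Lie algebra of `Gₙᵁ`. -/
def guIdx (n : ℕ) (k : ℤ) : ℤ := if k < 0 then hmax b + 1 else if k < n then 1 else -hmax b

/-- The step of the height filtration that contains the coefficient of `z ^ k` of the forms with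
polar part in `𝔟` and a pole of order at most `n`. -/
def higgsIdx (n : ℕ) (k : ℤ) : ℤ := if k < -n then hmax b + 1 else if k < 0 then 0 else -hmax b

/-- The Lie algebra of `Gₙᵁ`. -/
def lieGU (n : ℕ) : Submodule ℂ (Loop 𝔤) := coeffFil b (guIdx b n)

/-- The forms with polar part in `𝔟` and a pole of order at most `n`. -/
def higgs (n : ℕ) : Submodule ℂ (Loop 𝔤) := coeffFil b (higgsIdx b n)

variable {n : ℕ}

/-- Step `hmax + 1` of the height filtration is zero and step `-hmax` is everything, so all
conditions on the coefficients have the same form. -/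
theorem isLieGU_iff {x : Loop 𝔤} : IsLieGU b n x ↔ x ∈ lieGU b n := by
  rw [lieGU, mem_coeffFil, IsLieGU, nilradical_eq]
  constructor
  · rintro ⟨h1, h2⟩ k
    rw [guIdx]
    split_ifs with h h'
    · rw [h1 k h]
      exact zero_mem _
    · exact h2 k h'
    · exact mem_fil_top b le_rfl _
  · intro h
    refine ⟨fun k hk => ?_, fun k hk => ?_⟩
    · have := h k
      rw [guIdx, if_pos hk] at this
      exact coeff_eq_zero_of_fil b this (by omega)
    · have := h k
      rw [guIdx] at this
      split_ifs at this
      · rw [coeff_eq_zero_of_fil b this (by omega)]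
        exact zero_mem _
      · exact this

theorem isHiggs_iff {x : Loop 𝔤} : IsHiggs b n x ↔ x ∈ higgs b n := by
  rw [higgs, mem_coeffFil, IsHiggs, borel_eq]
  constructor
  · rintro ⟨h1, h2⟩ k
    rw [higgsIdx]
    split_ifs with h h'
    · rw [h1 k h]
      exact zero_mem _
    · exact h2 k h'
    · exact mem_fil_top b le_rfl _
  · intro h
    refine ⟨fun k hk => ?_, fun k hk => ?_⟩
    · have := h k
      rw [higgsIdx, if_pos hk] at this
      exact coeff_eq_zero_of_fil b this (by omega)
    · have := h k
      rw [higgsIdx] at this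
      split_ifs at this
      · rw [coeff_eq_zero_of_fil b this (by omega)]
        exact zero_mem _
      · exact this

/-- Heights are at least `-hmax` and `z` has degree `hmax + 1`, so every coefficient at a positive
power of `z` has positive degree. For `n ≥ 1` the constant term is in `𝔲`, of height at least one.
-/
theorem lieGU_le_loopF (hn : 1 ≤ n) {x : Loop 𝔤} (hx : x ∈ lieGU b n) : x ∈ loopF b 1 := by
  rw [mem_loopF]
  rw [lieGU, mem_coeffFil] at hx
  intro k
  have h0 := hmax_nonneg b
  have hz := zdeg_pos b
  rcases lt_or_ge k 0 with hk | hk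
  · have := hx k
    rw [guIdx, if_pos hk] at this
    rw [coeff_eq_zero_of_fil b this (by omega)]
    exact zero_mem _
  · rcases lt_or_ge k n with hk' | hk'
    · have := hx k
      rw [guIdx, if_neg (by omega), if_pos hk'] at this
      refine fil_antitone b ?_ this
      nlinarith
    · refine mem_fil_top b ?_ _
      have : (1 : ℤ) ≤ k := by omega
      have : 1 * zdeg b ≤ k * zdeg b := mul_le_mul_of_nonneg_right this hz.le
      have h3 : zdeg b = hmax b + 1 := rfl
      omega

theorem higgs_le_loopF (hn : 1 ≤ n) {A : Loop 𝔤} (hA : A ∈ higgs b n) :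
    A ∈ loopF b (-n * zdeg b) := by
  rw [mem_loopF]
  rw [higgs, mem_coeffFil] at hA
  intro k
  have h0 := hmax_nonneg b
  have hz := zdeg_pos b
  have h3 : zdeg b = hmax b + 1 := rfl
  have := hA k
  rw [higgsIdx] at this
  split_ifs at this with h1 h2
  · rw [coeff_eq_zero_of_fil b this (by omega)]
    exact zero_mem _
  · refine fil_antitone b ?_ this
    nlinarith
  · refine mem_fil_top b ?_ _
    nlinarith

theorem lie_mem_lieGU {x y : Loop 𝔤} (hx : x ∈ lieGU b n) (hy : y ∈ lieGU b n) :
    ⁅x, y⁆ ∈ lieGU b n := by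
  refine lie_mem_coeffFil b (fun i l => ?_) hx hy
  have h0 := hmax_nonneg b
  unfold guIdx
  split_ifs <;> omega

theorem lie_mem_higgs {x y : Loop 𝔤} (hx : x ∈ lieGU b n) (hy : y ∈ higgs b n) :
    ⁅x, y⁆ ∈ higgs b n := by
  refine lie_mem_coeffFil b (fun i l => ?_) hx hy
  have h0 := hmax_nonneg b
  unfold guIdx higgsIdx
  split_ifs <;> omega

theorem coeff_eq_zero_of_mem_lieGU {x : Loop 𝔤} (hx : x ∈ lieGU b n) {k : ℤ} (hk : k < 0) :
    coeff k x = 0 := ((isLieGU_iff b).2 hx).1 k hk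

theorem coeff_mem_fil_one {x : Loop 𝔤} (hx : x ∈ lieGU b n) {k : ℤ} (hk : k < n) :
    coeff k x ∈ fil b 1 := by
  rw [← nilradical_eq]
  exact ((isLieGU_iff b).2 hx).2 k hk

theorem coeff_eq_zero_of_mem_higgs {x : Loop 𝔤} (hx : x ∈ higgs b n) {k : ℤ} (hk : k < -n) :
    coeff k x = 0 := ((isHiggs_iff b).2 hx).1 k hk

theorem coeff_mem_fil_zero {x : Loop 𝔤} (hx : x ∈ higgs b n) {k : ℤ} (hk : k < 0) :
    coeff k x ∈ fil b 0 := by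
  rw [← borel_eq]
  exact ((isHiggs_iff b).2 hx).2 k hk

theorem mem_lieGU {x : Loop 𝔤} (h1 : ∀ k < 0, coeff k x = 0)
    (h2 : ∀ k < (n : ℤ), coeff k x ∈ fil b 1) : x ∈ lieGU b n := by
  refine (isLieGU_iff b).1 ⟨h1, ?_⟩
  rwa [nilradical_eq]

theorem mem_higgs {x : Loop 𝔤} (h1 : ∀ k < -(n : ℤ), coeff k x = 0)
    (h2 : ∀ k < 0, coeff k x ∈ fil b 0) : x ∈ higgs b n := by
  refine (isHiggs_iff b).1 ⟨h1, ?_⟩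
  rwa [borel_eq]

theorem ddz_mem_higgs {x : Loop 𝔤} (hx : x ∈ lieGU b n) : ddz x ∈ higgs b n := by
  have h : ∀ k < 0, coeff k (ddz x) = 0 := by
    intro k hk
    rw [coeff_ddz]
    rcases (Int.add_one_le_of_lt hk).eq_or_lt with h | h
    · rw [h, Int.cast_zero, zero_smul]
    · rw [coeff_eq_zero_of_mem_lieGU b hx h, smul_zero]
  refine mem_higgs b (fun k hk => h k (by omega)) fun k hk => ?_
  rw [h k hk]
  exact zero_mem _

theorem nabla_mem_higgs {A x : Loop 𝔤} (hA : A ∈ higgs b n) (hx : x ∈ lieGU b n) :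
    nabla A x ∈ higgs b n := by
  rw [nabla, ← lie_skew]
  exact add_mem (ddz_mem_higgs b hx) (neg_mem (lie_mem_higgs b hx hA))

theorem expAd_mem_higgs (hn : 1 ≤ n) {x A : Loop 𝔤} (hx : x ∈ lieGU b n) (hA : A ∈ higgs b n) :
    (loopFiltration b).expAd x A ∈ higgs b n :=
  expAd_mem_of_stable (isClosed_coeffFil b _) (lieGU_le_loopF b hn hx)
    (fun _ h => lie_mem_higgs b hx h) hA

theorem gauge_mem_higgs (hn : 1 ≤ n) {x A : Loop 𝔤} (hx : x ∈ lieGU b n) (hA : A ∈ higgs b n) :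
    gauge b x A ∈ higgs b n :=
  sub_mem (expAd_mem_higgs b hn hx hA) (dexp_mem_of_stable (isClosed_coeffFil b _)
    (lieGU_le_loopF b hn hx) (fun _ h => lie_mem_higgs b hx h) (ddz_mem_higgs b hx))

theorem coeff_monomial_smul (j k : ℤ) (A : Loop 𝔤) :
    coeff k (Laurent.monomial j • A) = coeff (k - j) A := by
  rw [coeff_smul, finsum_eq_single _ j]
  · rw [Laurent.coeff_monomial, if_pos rfl, one_smul]
  · intro i hi
    rw [Laurent.coeff_monomial, if_neg hi, zero_smul]

theorem coeff_mono_lie (j k : ℤ) (x : 𝔤) (A : Loop 𝔤) :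
    coeff k ⁅mono j x, A⁆ = ⁅x, coeff (k - j) A⁆ := by
  rw [coeff_lie, finsum_eq_single _ j]
  · rw [coeff_mono, if_pos rfl]
  · intro i hi
    rw [coeff_mono, if_neg hi, zero_lie]

/-- The derivation of the loop algebra that defines the principal grading. -/
def degreeOp : Loop 𝔤 →ₗ[ℂ] Loop 𝔤 :=
  LieAlgebra.ad ℂ (Loop 𝔤) (mono 0 ((exists_grading_element b).choose : 𝔤)) +
    (zdeg b : ℂ) • ((LinearMap.lsmul Laurent (Loop 𝔤) (Laurent.monomial 1)).restrictScalars ℂ ∘ₗ ddz)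

theorem degreeOp_apply (A : Loop 𝔤) : degreeOp b A =
    ⁅mono 0 ((exists_grading_element b).choose : 𝔤), A⁆ +
      (zdeg b : ℂ) • (Laurent.monomial 1 • ddz A) := rfl

theorem coeff_degreeOp (k : ℤ) (A : Loop 𝔤) : coeff k (degreeOp b A) =
    ⁅((exists_grading_element b).choose : 𝔤), coeff k A⁆ + ((k * zdeg b : ℤ) : ℂ) • coeff k A := by
  rw [degreeOp_apply, map_add, map_smul, coeff_mono_lie, coeff_monomial_smul, coeff_ddz, sub_zero, sub_add_cancel,
    smul_smul]
  push_cast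
  rw [mul_comm (k : ℂ)]

theorem wproj_degreeOp (χ : Weight ℂ H 𝔤) (k : ℤ) (A : Loop 𝔤) :
    wproj χ (coeff k (degreeOp b A)) = ((ht b χ + k * zdeg b : ℤ) : ℂ) • wproj χ (coeff k A) := by
  rw [coeff_degreeOp, map_add, map_smul, wproj_lie (SetLike.coe_mem _)]
  have := (exists_grading_element b).choose_spec χ
  rw [Subtype.coe_eta, this, ← add_smul]
  push_cast
  rfl

theorem degreeOp_lie (A B : Loop 𝔤) :
    degreeOp b ⁅A, B⁆ = ⁅degreeOp b A, B⁆ + ⁅A, degreeOp b B⁆ := by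
  have h1 : ∀ C : Loop 𝔤, ⁅Laurent.monomial 1 • ddz A, C⁆ = Laurent.monomial 1 • ⁅ddz A, C⁆ :=
    fun C => smul_lie _ _ _
  have h2 : ⁅A, Laurent.monomial 1 • ddz B⁆ = Laurent.monomial 1 • ⁅A, ddz B⁆ := lie_smul _ _ _
  simp only [degreeOp_apply, ddz_lie, add_lie, lie_add, smul_lie, lie_smul, h1, h2, smul_add]
  rw [leibniz_lie]
  abel

theorem degreeOp_mem_coeffFil {j : ℤ → ℤ} {A : Loop 𝔤} (hA : A ∈ coeffFil b j) :
    degreeOp b A ∈ coeffFil b j := by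
  rw [mem_coeffFil] at hA ⊢
  intro k
  rw [mem_fil]
  intro χ hχ
  rw [wproj_degreeOp, (mem_fil b).1 (hA k) χ hχ, smul_zero]

/-- The eigenvalue of the grading derivation is the degree, and all degrees occurring in step `d +
1` exceed `d`. -/
theorem eq_zero_of_degreeOp {d : ℤ} {u : Loop 𝔤} (hu : u ∈ loopF b (d + 1))
    (h : degreeOp b u = (d : ℂ) • u) : u = 0 := by
  refine loop_ext fun k => wproj_eq_zero_ext (H := H) fun χ => ?_
  have h1 := congrArg (fun v => wproj χ (coeff k v)) h
  simp only [wproj_degreeOp, map_smul] at h1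
  rw [map_zero, map_zero]
  by_cases hd : ht b χ < d + 1 - k * zdeg b
  · exact (mem_fil b).1 ((mem_loopF b).1 hu k) χ hd
  · rw [← sub_eq_zero, ← sub_smul, smul_eq_zero] at h1
    refine h1.resolve_left ?_
    rw [← Int.cast_sub, Int.cast_eq_zero]
    omega

theorem exists_approx_eigen (A : Loop 𝔤) (K : ℤ) :
    ∃ A' ∈ Submodule.span ℂ {v | ∃ d : ℤ, v ∈ loopF b d ∧ degreeOp b v = (d : ℂ) • v},
      A - A' ∈ loopF b K := by
  obtain ⟨N, hN⟩ := exists_bound A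
  let M : ℤ := |K + hmax b|
  refine ⟨∑ k ∈ Finset.Icc N M, ∑ χ : Weight ℂ H 𝔤, mono k (wproj χ (coeff k A)),
    sum_mem fun k _ => sum_mem fun χ _ => Submodule.subset_span ⟨ht b χ + k * zdeg b, ?_, ?_⟩, ?_⟩
  · rw [mem_loopF]
    intro l
    rw [coeff_mono]
    split_ifs with h
    · subst h
      rw [add_sub_cancel_right]
      exact rootSpace_le_fil b le_rfl (wproj_mem _ _)
    · exact zero_mem _
  · refine loop_ext fun l => wproj_eq_zero_ext (H := H) fun ψ => ?_
    rw [wproj_degreeOp, map_smul, map_smul, coeff_mono]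
    split_ifs with h
    · subst h
      by_cases hψ : χ = ψ
      · subst hψ
        rfl
      · classical
        rw [wproj_of_mem_weight (wproj_mem χ _) ψ, if_neg hψ, smul_zero, smul_zero]
    · rw [map_zero, smul_zero, smul_zero]
  · rw [mem_loopF]
    intro l
    rw [map_sub, map_sum]
    have h1 : ∀ k, coeff l (∑ χ : Weight ℂ H 𝔤, mono k (wproj χ (coeff k A))) =
        if l = k then coeff k A else 0 := by
      intro k
      rw [map_sum]
      simp only [coeff_mono]
      split_ifs
      · exact sum_wproj _
      · exact Finset.sum_const_zero
    simp only [h1, Finset.sum_ite_eq, Finset.mem_Icc]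
    split_ifs with h
    · rw [sub_self]
      exact zero_mem _
    · rw [sub_zero]
      rcases lt_or_ge l N with hl | hl
      · rw [hN l hl]
        exact zero_mem _
      · refine mem_fil_top b ?_ _
        have h2 : M < l := by omega
        have h3 : K + hmax b ≤ M := le_abs_self _
        have h4 : 0 ≤ M := abs_nonneg _
        have := zdeg_pos b
        nlinarith

/-- The grading derivation is diagonal, so its inverse is division by the degree, which is positive
where `u` has components. Being diagonal, it also respects every coefficientwise height condition.
-/
theorem exists_degreeOp_eq {j : ℤ → ℤ} {d : ℤ} (hd : 1 ≤ d) {u : Loop 𝔤} (hu : u ∈ loopF b d)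
    (huj : u ∈ coeffFil b j) : ∃ δ ∈ loopF b d, δ ∈ coeffFil b j ∧ degreeOp b δ = u := by
  obtain ⟨N, hN⟩ := exists_bound u
  let δ : Loop 𝔤 := ofCoeffs (fun k => ∑ χ : Weight ℂ H 𝔤,
    ((ht b χ + k * zdeg b : ℤ) : ℂ)⁻¹ • wproj χ (coeff k u)) N
    fun k hk => by simp [hN k hk]
  have hδ : ∀ k (ψ : Weight ℂ H 𝔤), wproj ψ (coeff k δ) =
      ((ht b ψ + k * zdeg b : ℤ) : ℂ)⁻¹ • wproj ψ (coeff k u) := by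
    intro k ψ
    classical
    rw [coeff_ofCoeffs, map_sum, Finset.sum_eq_single ψ]
    · rw [map_smul, wproj_self (wproj_mem _ _)]
    · intro χ _ h
      rw [map_smul, wproj_of_mem_weight (wproj_mem χ _) ψ, if_neg h, smul_zero]
    · simp
  have hmem : ∀ j, u ∈ coeffFil b j → δ ∈ coeffFil b j := by
    intro j h
    rw [mem_coeffFil] at h ⊢
    refine fun k => (mem_fil b).2 fun χ hχ => ?_
    rw [hδ, (mem_fil b).1 (h k) χ hχ, smul_zero]
  refine ⟨δ, hmem _ hu, hmem _ huj, loop_ext fun k => wproj_eq_zero_ext (H := H) fun χ => ?_⟩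
  rw [wproj_degreeOp, hδ, smul_smul]
  by_cases h : ht b χ < d - k * zdeg b
  · rw [(mem_fil b).1 ((mem_loopF b).1 hu k) χ h, smul_zero]
  · rw [mul_inv_cancel₀, one_smul]
    rw [Int.cast_ne_zero]
    omega

/-- Both sides define the same covariant derivative, the conjugate of `∇` by `exp w`. -/
theorem gauge_comp {x y w : Loop 𝔤} (hx : x ∈ loopF b 1) (hy : y ∈ loopF b 1) (hw : w ∈ loopF b 1)
    (h : ∀ A, (loopFiltration b).expAd w A =
      (loopFiltration b).expAd y ((loopFiltration b).expAd x A)) (A : Loop 𝔤) :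
    gauge b w A = gauge b y (gauge b x A) := by
  refine nabla_injective fun ψ => ?_
  have h1 := expAd_nabla b hw A ((loopFiltration b).expAd (-w) ψ)
  rw [expAd_expAd_neg (𝓕 := loopFiltration b) hw] at h1
  rw [← h1, h, expAd_nabla b hx, expAd_nabla b hy, ← h, expAd_expAd_neg (𝓕 := loopFiltration b) hw]

/-- The exponentials of the Lie algebra of `Gₙᵁ` form a group. -/
theorem exists_lieGU_comp (hn : 1 ≤ n) {x y : Loop 𝔤} (hx : x ∈ lieGU b n) (hy : y ∈ lieGU b n) :
    ∃ w ∈ lieGU b n, (∀ A, (loopFiltration b).expAd w A =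
        (loopFiltration b).expAd y ((loopFiltration b).expAd x A)) ∧
      ∀ A, gauge b w A = gauge b y (gauge b x A) := by
  obtain ⟨w, hw, hwS, h⟩ := exists_expAd_comp (𝓕 := loopFiltration b) (degreeOp_lie b)
    (fun d x hx => degreeOp_mem_coeffFil b hx) (fun d u hu h => eq_zero_of_degreeOp b hu h)
    (exists_approx_eigen b) (isClosed_coeffFil b (guIdx b n)) (fun _ hx _ hy => lie_mem_lieGU b hx hy)
    (fun _ hx => degreeOp_mem_coeffFil b hx)
    (fun d hd u hu huS => exists_degreeOp_eq b hd hu huS)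
    (lieGU_le_loopF b hn hx) hx (lieGU_le_loopF b hn hy) hy
  exact ⟨w, hwS, h, gauge_comp b (lieGU_le_loopF b hn hx) (lieGU_le_loopF b hn hy) hw h⟩

theorem gauge_neg_gauge {x : Loop 𝔤} (hx : x ∈ loopF b 1) (A : Loop 𝔤) :
    gauge b (-x) (gauge b x A) = A := by
  refine nabla_injective fun ψ => ?_
  have hx' : x ∈ (loopFiltration b).F 1 := hx
  have h1 := expAd_nabla b hx A ψ
  have h2 := expAd_nabla b (neg_mem hx) (gauge b x A) ((loopFiltration b).expAd x ψ)
  rw [← h1, expAd_neg_expAd hx', expAd_neg_expAd hx'] at h2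
  exact h2.symm

end UnipotentGroup
end Isostokes

/-! ### Existence of the normal form -/

namespace Isostokes

open LieAlgebra LieModule LieFiltration

section NormalForm

variable {𝔤 : Type*} [LieRing 𝔤] [LieAlgebra ℂ 𝔤] [FiniteDimensional ℂ 𝔤] [LieAlgebra.IsKilling ℂ 𝔤]
  {H : LieSubalgebra ℂ 𝔤} [H.IsCartanSubalgebra]

theorem coeff_normalForm {n : ℕ} (c : Coords H n) (k : ℤ) : coeff k (normalForm c) =
    (∑ i : Fin n, if k = -((i : ℤ) + 1) then (c.1 i : 𝔤) else 0) +
      ∑ i : Fin (n - 1), if k = (i : ℤ) then (c.2 i : 𝔤) else 0 := by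
  simp only [normalForm, map_add, map_sum, coeff_mono]

theorem coeff_normalForm_neg {n : ℕ} (c : Coords H n) (i : Fin n) :
    coeff (-((i : ℤ) + 1)) (normalForm c) = c.1 i := by
  rw [coeff_normalForm, Finset.sum_eq_single i, if_pos rfl, Finset.sum_eq_zero, add_zero]
  · intro j _
    rw [if_neg (by omega)]
  · intro j _ hj
    rw [if_neg]
    intro h
    exact hj (Fin.ext (by omega))
  · simp

theorem coeff_normalForm_nonneg {n : ℕ} (c : Coords H n) (i : Fin (n - 1)) :
    coeff (i : ℤ) (normalForm c) = c.2 i := by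
  rw [coeff_normalForm, Finset.sum_eq_zero, zero_add, Finset.sum_eq_single i, if_pos rfl]
  · intro j _ hj
    rw [if_neg]
    intro h
    exact hj (Fin.ext (by omega))
  · simp
  · intro j _
    rw [if_neg (by omega)]

theorem coeff_normalForm_lt {n : ℕ} (c : Coords H n) {k : ℤ} (hk : k < -n) :
    coeff k (normalForm c) = 0 := by
  rw [coeff_normalForm, Finset.sum_eq_zero, Finset.sum_eq_zero, add_zero]
  · intro j _
    rw [if_neg (by omega)]
  · intro j _
    rw [if_neg (by omega)]

theorem coeff_normalForm_ge {n : ℕ} (c : Coords H n) {k : ℤ} (hk : (n : ℤ) - 1 ≤ k) (h0 : 0 ≤ k) :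
    coeff k (normalForm c) = 0 := by
  rw [coeff_normalForm, Finset.sum_eq_zero, Finset.sum_eq_zero, add_zero]
  · intro j _
    rw [if_neg (by omega)]
  · intro j _
    rw [if_neg (by omega)]

theorem coeff_normalForm_mem {n : ℕ} (c : Coords H n) (k : ℤ) : coeff k (normalForm c) ∈ H := by
  rw [coeff_normalForm]
  refine add_mem (sum_mem fun i _ => ?_) (sum_mem fun i _ => ?_)
  · split_ifs
    · exact SetLike.coe_mem _
    · exact zero_mem _
  · split_ifs
    · exact SetLike.coe_mem _
    · exact zero_mem _

/-- The coordinates of the `𝔥`-part of a loop. -/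
def coordsOf (H : LieSubalgebra ℂ 𝔤) [H.IsCartanSubalgebra] (n : ℕ) : Loop 𝔤 →ₗ[ℂ] Coords H n where
  toFun A := (fun i => ⟨hpart H (coeff (-((i : ℤ) + 1)) A), hpart_mem _⟩,
    fun i => ⟨hpart H (coeff (i : ℤ) A), hpart_mem _⟩)
  map_add' A B := by
    refine Prod.ext (funext fun i => Subtype.ext ?_) (funext fun i => Subtype.ext ?_)
    · exact (congrArg _ (map_add _ _ _)).trans (map_add _ _ _)
    · exact (congrArg _ (map_add _ _ _)).trans (map_add _ _ _)
  map_smul' c A := by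
    refine Prod.ext (funext fun i => Subtype.ext ?_) (funext fun i => Subtype.ext ?_)
    · exact (congrArg _ (map_smul _ _ _)).trans (map_smul _ _ _)
    · exact (congrArg _ (map_smul _ _ _)).trans (map_smul _ _ _)

theorem coordsOf_normalForm {n : ℕ} (c : Coords H n) : coordsOf H n (normalForm c) = c := by
  refine Prod.ext (funext fun i => Subtype.ext ?_) (funext fun i => Subtype.ext ?_)
  · change hpart H (coeff (-((i : ℤ) + 1)) (normalForm c)) = _
    rw [coeff_normalForm_neg, hpart_of_mem (SetLike.coe_mem _)]
  · change hpart H (coeff (i : ℤ) (normalForm c)) = _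
    rw [coeff_normalForm_nonneg, hpart_of_mem (SetLike.coe_mem _)]

theorem coeff_normalForm_coordsOf {n : ℕ} (A : Loop 𝔤) {k : ℤ} (hk : -n ≤ k) (hk' : k < n - 1) :
    coeff k (normalForm (coordsOf H n A)) = hpart H (coeff k A) := by
  rcases lt_or_ge k 0 with h | h
  · have := coeff_normalForm_neg (coordsOf H n A) ⟨(-k - 1).toNat, by omega⟩
    have h2 : -((((-k - 1).toNat : ℕ) : ℤ) + 1) = k := by omega
    simp only [h2] at this
    rw [this]
    change hpart H (coeff (-((((-k - 1).toNat : ℕ) : ℤ) + 1)) A) = _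
    rw [h2]
  · have := coeff_normalForm_nonneg (coordsOf H n A) ⟨k.toNat, by omega⟩
    have h2 : ((k.toNat : ℕ) : ℤ) = k := by omega
    simp only [h2] at this
    rw [this]
    change hpart H (coeff ((k.toNat : ℕ) : ℤ) A) = _
    rw [h2]

theorem normalForm_coordsOf {n : ℕ} (_hn : 1 ≤ n) {A : Loop 𝔤} (hA : ∀ k, coeff k A ∈ H)
    (h1 : ∀ k < -(n : ℤ), coeff k A = 0) (h2 : ∀ k : ℤ, (n : ℤ) - 1 ≤ k → coeff k A = 0) :
    normalForm (coordsOf H n A) = A := by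
  refine loop_ext fun k => ?_
  by_cases hk : k < -n
  · rw [coeff_normalForm_lt _ hk, h1 k hk]
  by_cases hk' : k < n - 1
  · rw [coeff_normalForm_coordsOf _ (not_lt.1 hk) hk', hpart_of_mem (hA k)]
  · rw [coeff_normalForm_ge _ (not_lt.1 hk') (by omega), h2 k (not_lt.1 hk')]

theorem coordsOf_eq_zero {n : ℕ} {A : Loop 𝔤}
    (h : ∀ k : ℤ, -n ≤ k → k < n - 1 → hpart H (coeff k A) = 0) : coordsOf H n A = 0 := by
  refine Prod.ext (funext fun i => Subtype.ext ?_) (funext fun i => Subtype.ext ?_)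
  · exact h _ (by omega) (by omega)
  · exact h _ (by omega) (by omega)

theorem hpart_eq_zero_iff {x : 𝔤} :
    hpart H x = 0 ↔ ∀ χ : Weight ℂ H 𝔤, χ.IsZero → wproj χ x = 0 := by
  constructor
  · intro h χ hχ
    have h1 := hpart_add_offDiag (H := H) x
    rw [h, zero_add] at h1
    rw [← h1, wproj_offDiag_zero hχ]
  · intro h
    have h1 : offDiag H x = x := by
      refine wproj_eq_zero_ext (H := H) fun χ => ?_
      by_cases hχ : χ.IsZero
      · rw [wproj_offDiag_zero hχ, h χ hχ]
      · exact wproj_offDiag hχ x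
    have h2 := hpart_add_offDiag (H := H) x
    rwa [h1, add_eq_right] at h2

theorem hpart_lie_cartan {h : 𝔤} (hh : h ∈ H) (x : 𝔤) : hpart H ⁅h, x⁆ = 0 := by
  rw [hpart_eq_zero_iff]
  intro χ hχ
  have h0 : χ ⟨h, hh⟩ = 0 := congrFun hχ _
  rw [wproj_lie hh, h0, zero_smul]

theorem hpart_coeff_lie {C : Loop 𝔤} (hC : ∀ k, coeff k C ∈ H) (ψ : Loop 𝔤) (k : ℤ) :
    hpart H (coeff k ⁅C, ψ⁆) = 0 :=
  coeff_lie_mem (LinearMap.ker (hpart H)) C ψ k fun i => hpart_lie_cartan (hC i) _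

/-- The bracket with an `𝔥`-valued loop has no `𝔥`-part, so on `𝔥`-parts `∇` is `d/dz`. All
computations with the coordinates rest on this. -/
theorem hpart_coeff_nabla {C : Loop 𝔤} (hC : ∀ k, coeff k C ∈ H) (ψ : Loop 𝔤) (k : ℤ) :
    hpart H (coeff k (nabla C ψ)) = ((k + 1 : ℤ) : ℂ) • hpart H (coeff (k + 1) ψ) := by
  rw [nabla, map_add, map_add, hpart_coeff_lie hC, add_zero, coeff_ddz, map_smul]

theorem lie_cartan_loops {B C : Loop 𝔤} (hB : ∀ k, coeff k B ∈ H) (hC : ∀ k, coeff k C ∈ H) :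
    ⁅B, C⁆ = 0 := by
  refine loop_ext fun k => ?_
  rw [map_zero]
  have := coeff_lie_mem ⊥ B C k fun i => by
    rw [lie_cartan_cartan (hB i) (hC _)]
    exact zero_mem _
  simpa using this

theorem hpart_offDiag (x : 𝔤) : hpart H (offDiag H x) = 0 :=
  hpart_eq_zero_iff.2 fun _ hχ => wproj_offDiag_zero hχ x

variable (b : (LieAlgebra.IsKilling.rootSystem H).Base) {n : ℕ}

/-- The `𝔥`-part of the coefficient of `z ^ (-n)` is regular. -/
def LeadingRegular (H : LieSubalgebra ℂ 𝔤) [H.IsCartanSubalgebra] (n : ℕ) (A : Loop 𝔤) : Prop :=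
  ∀ χ : Weight ℂ H 𝔤, χ.IsNonZero → χ ⟨hpart H (coeff (-n) A), hpart_mem _⟩ ≠ 0

theorem mem_higgs_of_cartan {C : Loop 𝔤} (mem : ∀ k, coeff k C ∈ H)
    (bound : ∀ k < -(n : ℤ), coeff k C = 0) : C ∈ higgs b n :=
  mem_higgs b bound fun _ _ => cartan_le_fil b (mem _)

/-- At `z⁻ⁿ` what remains is in `𝔲`, of height at least one; at higher powers of `z` the degree of
`z` outweighs any negative height. -/
theorem sub_leading_mem (hn : 1 ≤ n) {A : Loop 𝔤} (hA : A ∈ higgs b n) :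
    A - mono (-n) (hpart H (coeff (-n) A)) ∈ loopF b (-n * zdeg b + 1) := by
  rw [mem_loopF]
  intro k
  have h0 := hmax_nonneg b
  have h3 : zdeg b = hmax b + 1 := rfl
  rw [map_sub, coeff_mono]
  rcases lt_trichotomy k (-n) with hk | hk | hk
  · rw [if_neg hk.ne, coeff_eq_zero_of_mem_higgs b hA hk, sub_zero]
    exact zero_mem _
  · subst hk
    rw [if_pos rfl]
    have h4 := hpart_add_offDiag (H := H) (coeff (-n : ℤ) A)
    have h5 : coeff (-n : ℤ) A - hpart H (coeff (-n : ℤ) A) = offDiag H (coeff (-n : ℤ) A) := by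
      rw [sub_eq_iff_eq_add', h4]
    rw [h5]
    refine fil_antitone b (by linarith) (offDiag_mem_fil_one b (coeff_mem_fil_zero b hA (by omega)))
  · rw [if_neg hk.ne', sub_zero]
    have h5 : (-n + 1 : ℤ) * zdeg b ≤ k * zdeg b :=
      mul_le_mul_of_nonneg_right (by omega) (by omega)
    refine mem_fil_top b (by linarith) _

/-- Bracketing with `a z⁻ⁿ` shifts the order by `n` and multiplies the `χ`-component by `χ(a) ≠ 0`;
the inverse divides. -/
theorem exists_lie_leading_eq {a : 𝔤} (ha : a ∈ H)
    (hreg : ∀ χ : Weight ℂ H 𝔤, χ.IsNonZero → χ ⟨a, ha⟩ ≠ 0) {r : Loop 𝔤}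
    (hr : ∀ k, hpart H (coeff k r) = 0) (hrn : r ∈ higgs b n) {e : ℤ}
    (hre : r ∈ loopF b (-n * zdeg b + e)) :
    ∃ δ ∈ loopF b e, δ ∈ lieGU b n ∧ (∀ k, hpart H (coeff k δ) = 0) ∧ ⁅mono (-n) a, δ⁆ = r := by
  obtain ⟨N, hN⟩ := exists_bound r
  let δ : Loop 𝔤 := ofCoeffs (fun k => ∑ χ : Weight ℂ H 𝔤,
    (χ ⟨a, ha⟩)⁻¹ • wproj χ (coeff (k - n) r)) (N + n)
    fun k hk => by simp [hN (k - n) (by omega)]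
  have hδ : ∀ k (ψ : Weight ℂ H 𝔤), wproj ψ (coeff k δ) =
      (ψ ⟨a, ha⟩)⁻¹ • wproj ψ (coeff (k - n) r) := by
    intro k ψ
    classical
    rw [coeff_ofCoeffs, map_sum, Finset.sum_eq_single ψ]
    · rw [map_smul, wproj_self (wproj_mem _ _)]
    · intro χ _ h
      rw [map_smul, wproj_of_mem_weight (wproj_mem χ _) ψ, if_neg h, smul_zero]
    · simp
  have hδ0 : ∀ k (ψ : Weight ℂ H 𝔤), ψ.IsZero → wproj ψ (coeff k δ) = 0 := by
    intro k ψ hψ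
    rw [hδ, hpart_eq_zero_iff.1 (hr _) ψ hψ, smul_zero]
  refine ⟨δ, ?_, mem_lieGU b (fun k hk => ?_) fun k hk => ?_, fun k => hpart_eq_zero_iff.2 (hδ0 k), ?_⟩
  · rw [mem_loopF]
    refine fun k => (mem_fil b).2 fun χ hχ => ?_
    rw [hδ, (mem_fil b).1 ((mem_loopF b).1 hre (k - n)) χ (by linarith), smul_zero]
  · refine wproj_eq_zero_ext (H := H) fun χ => ?_
    rw [hδ, coeff_eq_zero_of_mem_higgs b hrn (by omega), map_zero, smul_zero]
  -- Orders below `n` of `δ` come from the polar part of `r`, which is in `𝔟`; without an `𝔥`-part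
  -- it is in `𝔲`.
  · refine (mem_fil b).2 fun χ hχ => ?_
    rcases (show ht b χ ≤ 0 by omega).lt_or_eq with h | h
    · rw [hδ, (mem_fil b).1 (coeff_mem_fil_zero b hrn (by omega)) χ h, smul_zero]
    · by_cases hz : χ.IsZero
      · exact hδ0 k χ hz
      · exact absurd h (ht_ne_zero b hz)
  · refine loop_ext fun k => wproj_eq_zero_ext (H := H) fun χ => ?_
    rw [coeff_mono_lie, wproj_lie ha, hδ, sub_neg_eq_add, add_sub_cancel_right]
    by_cases hz : χ.IsZero
    · rw [hpart_eq_zero_iff.1 (hr _) χ hz, smul_zero, smul_zero]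
    · rw [smul_inv_smul₀ (hreg χ hz)]

theorem mem_of_lie_leading_mem {a : 𝔤} (ha : a ∈ H)
    (hreg : ∀ χ : Weight ℂ H 𝔤, χ.IsNonZero → χ ⟨a, ha⟩ ≠ 0) {s : Loop 𝔤}
    (hs : ∀ k, hpart H (coeff k s) = 0) {e : ℤ} (h : ⁅mono (-n) a, s⁆ ∈ loopF b (-n * zdeg b + e)) :
    s ∈ loopF b e := by
  rw [mem_loopF] at h ⊢
  refine fun k => (mem_fil b).2 fun χ hχ => ?_
  by_cases hz : χ.IsZero
  · exact hpart_eq_zero_iff.1 (hs _) χ hz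
  · have h1 := (mem_fil b).1 (h (k - n)) χ (by linarith)
    rw [coeff_mono_lie, wproj_lie ha, sub_neg_eq_add, sub_add_cancel] at h1
    exact (smul_eq_zero.1 h1).resolve_left (hreg χ hz)

/-- The linearization of the gauge action is `[δ, A]`, of degree `-n deg z + e`. The derivative of
`δ` has degree only `e - deg z`, and this is strictly higher precisely because `n ≥ 2`. -/
theorem gauge_add_sub_mem (hn : 2 ≤ n) {A x δ : Loop 𝔤} (hA : A ∈ loopF b (-n * zdeg b))
    (hx : x ∈ loopF b 1) {e : ℤ} (he : 1 ≤ e) (hδ : δ ∈ loopF b e) :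
    gauge b (x + δ) A - gauge b x A - ⁅δ, A⁆ ∈ loopF b (-n * zdeg b + e + 1) := by
  have hz := zdeg_pos b
  have hx' : x ∈ (loopFiltration b).F 1 := hx
  have hxδ : x + δ ∈ (loopFiltration b).F 1 := add_mem hx (mem_of_le (𝓕 := loopFiltration b) he hδ)
  have h1 := expAd_add_sub_mem (𝓕 := loopFiltration b) hx he hδ hA
  have h2 := dexp_add_sub_mem (𝓕 := loopFiltration b) hx he hδ (ddz_mem b hx)
  have h3 := dexp_mem (𝓕 := loopFiltration b) hxδ (ddz_mem b hδ)
  have hnz : 2 * zdeg b ≤ n * zdeg b := mul_le_mul_of_nonneg_right (by omega) hz.le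
  have h2' := mem_of_le (𝓕 := loopFiltration b) (i := -n * zdeg b + e + 1) (by linarith) h2
  have h3' := mem_of_le (𝓕 := loopFiltration b) (i := -n * zdeg b + e + 1) (by linarith) h3
  have h4 := sub_mem (sub_mem h1 h2') h3'
  rw [gauge, gauge, map_add, dexp_map_add hxδ]
  refine (congrArg (· ∈ loopF b (-n * zdeg b + e + 1)) ?_).mp h4
  generalize (loopFiltration b).expAd (x + δ) A = u₁
  generalize (loopFiltration b).expAd x A = u₂
  generalize (loopFiltration b).dexp (x + δ) (ddz x) = u₃
  generalize (loopFiltration b).dexp (x + δ) (ddz δ) = u₄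
  generalize (loopFiltration b).dexp x (ddz x) = u₅
  generalize (⁅δ, A⁆ : Loop 𝔤) = u₆
  abel

theorem lie_leading_sub_mem (hn : 1 ≤ n) {A δ : Loop 𝔤} (hA : A ∈ higgs b n) {e : ℤ}
    (hδ : δ ∈ loopF b e) :
    ⁅A, δ⁆ - ⁅mono (-n) (hpart H (coeff (-n) A)), δ⁆ ∈ loopF b (-n * zdeg b + e + 1) := by
  rw [← sub_lie]
  have := (loopFiltration b).lie_mem (sub_leading_mem b hn hA) hδ
  have h1 : -n * zdeg b + e + 1 = -n * zdeg b + 1 + e := by ring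
  rw [h1]
  exact this

theorem mapCoeff_offDiag_mem {d : ℤ} {A : Loop 𝔤} (hA : A ∈ loopF b d) :
    mapCoeff (offDiag H) A ∈ loopF b d := by
  rw [mem_loopF] at hA ⊢
  intro k
  rw [coeff_mapCoeff]
  exact offDiag_mem_fil b (hA k)

theorem mapCoeff_offDiag_mem_higgs {A : Loop 𝔤} (hA : A ∈ higgs b n) :
    mapCoeff (offDiag H) A ∈ higgs b n := by
  rw [higgs, mem_coeffFil] at hA ⊢
  intro k
  rw [coeff_mapCoeff]
  exact offDiag_mem_fil b (hA k)

theorem expAd_of_lie_eq_zero {x A : Loop 𝔤} (hx : x ∈ loopF b 1) (h : ⁅x, A⁆ = 0) :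
    (loopFiltration b).expAd x A = A := by
  have h0 : ∀ m ≥ 1, dp x m A = 0 := by
    intro m hm
    obtain ⟨m, rfl⟩ := Nat.exists_eq_add_of_le' hm
    rw [dp, pow_succ, Module.End.mul_apply, LieAlgebra.ad_apply, h, map_zero, smul_zero]
  refine (isSum_expAd (𝓕 := loopFiltration b) hx A).unique ?_
  have h1 := isSum_of_finite (𝓕 := loopFiltration b) 1 h0
  simpa [dp] using h1

theorem dexp_of_lie_eq_zero {x A : Loop 𝔤} (hx : x ∈ loopF b 1) (h : ⁅x, A⁆ = 0) :
    (loopFiltration b).dexp x A = A := by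
  have h0 : ∀ m ≥ 1, dq x m A = 0 := by
    intro m hm
    obtain ⟨m, rfl⟩ := Nat.exists_eq_add_of_le' hm
    rw [dq, pow_succ, Module.End.mul_apply, LieAlgebra.ad_apply, h, map_zero, smul_zero]
  refine (isSum_dexp (𝓕 := loopFiltration b) hx A).unique ?_
  have h1 := isSum_of_finite (𝓕 := loopFiltration b) 1 h0
  simpa [dq] using h1

theorem gauge_of_lie_eq_zero {x A : Loop 𝔤} (hx : x ∈ loopF b 1) (h : ⁅x, A⁆ = 0)
    (h' : ⁅x, ddz x⁆ = 0) : gauge b x A = A - ddz x := by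
  rw [gauge, expAd_of_lie_eq_zero b hx h, dexp_of_lie_eq_zero b hx h']

theorem gauge_zero (A : Loop 𝔤) : gauge b 0 A = A := by
  rw [gauge_of_lie_eq_zero b (zero_mem _) (zero_lie _) (zero_lie _), map_zero, sub_zero]

/-- Every element of `𝐂𝐨𝐧𝐧ₙᴮ` can be made diagonal. -/
theorem exists_gauge_cartan (hn : 2 ≤ n) {A : Loop 𝔤} (hA : A ∈ higgs b n)
    (hreg : LeadingRegular H n A) :
    ∃ x ∈ lieGU b n, ∀ k, coeff k (gauge b x A) ∈ H := by
  have hn1 : 1 ≤ n := by omega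
  have hAF := higgs_le_loopF b hn1 hA
  -- After step `k` the off-diagonal part of the transformed connection exceeds the leading degree
  -- by at least `k + 1`.
  obtain ⟨w, s, hs, hlim⟩ := exists_limit (𝓕 := loopFiltration b)
    (fun k x => x ∈ lieGU b n ∧ mapCoeff (offDiag H) (gauge b x A) ∈ loopF b (-n * zdeg b + k + 1)) 0
    ⟨zero_mem _, by
      rw [gauge_zero]
      have h1 := mapCoeff_offDiag_mem b (sub_leading_mem b hn1 hA)
      rw [map_sub] at h1
      have h2 : mapCoeff (offDiag H) (mono (-n) (hpart H (coeff (-n : ℤ) A))) = 0 :=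
        loop_ext fun k => by
          rw [coeff_mapCoeff, coeff_mono, map_zero]
          split_ifs
          · exact offDiag_of_mem (hpart_mem _)
          · exact map_zero _
      rw [h2, sub_zero] at h1
      simpa using h1⟩ (by
      rintro k x ⟨hx, hr⟩
      set r := mapCoeff (offDiag H) (gauge b x A) with hrdef
      have hB := gauge_mem_higgs b hn1 hx hA
      -- To lowest order the correction changes the connection by `-[A, δ]`, that is by `-[a z⁻ⁿ, δ]
      -- = -r`. The leading coefficient `a` may be taken from `A` itself.
      obtain ⟨δ, hδ, hδS, -, hδe⟩ := exists_lie_leading_eq b (hpart_mem _) hreg (r := r)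
        (fun k => by rw [hrdef, coeff_mapCoeff, hpart_offDiag])
        (mapCoeff_offDiag_mem_higgs b hB) (e := k + 1) (by rwa [← add_assoc])
      refine ⟨δ, hδ, add_mem hx hδS, ?_⟩
      have h1 := gauge_add_sub_mem b hn hAF (lieGU_le_loopF b hn1 hx) (by omega) hδ
      have h2 := lie_leading_sub_mem b hn1 hA hδ
      rw [hδe] at h2
      have h3 := mapCoeff_offDiag_mem b (sub_mem h1 h2)
      have h4 : mapCoeff (offDiag H) r = r := by
        rw [hrdef]
        refine loop_ext fun k => ?_
        rw [coeff_mapCoeff, coeff_mapCoeff]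
        have := hpart_add_offDiag (H := H) (offDiag H (coeff k (gauge b x A)))
        rwa [hpart_offDiag, zero_add] at this
      have h5 : gauge b (x + δ) A - gauge b x A - ⁅δ, A⁆ - (⁅A, δ⁆ - r) =
          gauge b (x + δ) A - gauge b x A + r := by
        rw [← lie_skew A δ]
        abel
      rw [h5, map_add, map_sub, h4, ← hrdef, sub_add_cancel] at h3
      have h6 : -n * zdeg b + ((k + 1 : ℕ) : ℤ) + 1 = -n * zdeg b + (k + 1) + 1 := by push_cast; ring
      rw [h6]
      exact h3)
  have hw : w ∈ lieGU b n := isClosed_coeffFil b _ w fun d => ⟨s d.toNat, (hs _).1,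
    mem_of_le (𝓕 := loopFiltration b) (by have := Int.self_le_toNat d; omega) (hlim _)⟩
  refine ⟨w, hw, ?_⟩
  -- The limit differs from the `k`-th approximation by terms of degree tending to infinity, and so
  -- does its off-diagonal part from zero.
  have h0 : mapCoeff (offDiag H) (gauge b w A) = 0 := by
    refine (loopFiltration b).sep fun d => ?_
    let k := (d + n * zdeg b).toNat
    have hk := Int.self_le_toNat (d + n * zdeg b)
    have h1 := gauge_add_sub_mem b hn hAF (lieGU_le_loopF b hn1 (hs k).1) (by omega) (hlim k)
    have h2 := (loopFiltration b).lie_mem (hlim k) hAF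
    rw [add_sub_cancel] at h1
    have h3 := mem_of_le (𝓕 := loopFiltration b) (i := d) (by linarith) h1
    have h4 := mem_of_le (𝓕 := loopFiltration b) (i := d) (by linarith) h2
    have h5 := mem_of_le (𝓕 := loopFiltration b) (i := d) (by linarith) (hs k).2
    have h6 := mapCoeff_offDiag_mem b (add_mem h3 h4)
    rw [sub_add_cancel, map_sub] at h6
    have h7 := add_mem h6 h5
    rwa [sub_add_cancel] at h7
  intro k
  refine mem_cartan_of_offDiag ?_
  rw [← coeff_mapCoeff, h0, map_zero]

/-- A loop without residue is a derivative. -/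
theorem exists_ddz_eq {B : Loop 𝔤} (h0 : coeff (-1) B = 0) :
    ∃ y : Loop 𝔤, ddz y = B ∧ ∀ k, coeff k y = (k : ℂ)⁻¹ • coeff (k - 1) B := by
  obtain ⟨N, hN⟩ := exists_bound B
  refine ⟨ofCoeffs (fun k => (k : ℂ)⁻¹ • coeff (k - 1) B) (N + 1)
    fun k hk => by rw [hN _ (by omega), smul_zero], loop_ext fun k => ?_, fun k => coeff_ofCoeffs _ _ _ _⟩
  rw [coeff_ddz, coeff_ofCoeffs, add_sub_cancel_right]
  by_cases hk : k + 1 = 0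
  · rw [hk, Int.cast_zero, zero_smul, show k = -1 by omega, h0]
  · rw [smul_inv_smul₀ (Int.cast_ne_zero.2 hk)]

/-- The truncation of a loop to the degrees in `s`. -/
def truncate (s : Set ℤ) [DecidablePred (· ∈ s)] (A : Loop 𝔤) : Loop 𝔤 :=
  ofCoeffs (fun k => if k ∈ s then coeff k A else 0) (exists_bound A).choose fun k hk => by
    rw [(exists_bound A).choose_spec k hk, ite_self]

theorem coeff_truncate (s : Set ℤ) [DecidablePred (· ∈ s)] (A : Loop 𝔤) (k : ℤ) :
    coeff k (truncate s A) = if k ∈ s then coeff k A else 0 := coeff_ofCoeffs _ _ _ _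

/-- Once the connection is diagonal, `exp y` with `y` in `𝔥((z))` acts by subtracting `y'`, and the
two gauge transformations are composed by the group law. -/
theorem exists_hasCoords (hn : 2 ≤ n) {A : Loop 𝔤} (hA : A ∈ higgs b n)
    (hreg : LeadingRegular H n A) :
    ∃ x ∈ lieGU b n, ∃ c : Coords H n, gauge b x A = normalForm c := by
  have hn1 : 1 ≤ n := by omega
  obtain ⟨x, hx, hB⟩ := exists_gauge_cartan b hn hA hreg
  set B := gauge b x A with hBdef
  have hBn := gauge_mem_higgs b hn1 hx hA
  -- The part of order at least `n - 1` has a primitive of order at least `n`, which is where the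
  -- Lie algebra of `Gₙᵁ` begins to contain `𝔥`.
  obtain ⟨y, hy, hyc⟩ := exists_ddz_eq (B := truncate (Set.Ici ((n : ℤ) - 1)) B)
    (by rw [coeff_truncate, if_neg (by simp; omega)])
  have hyH : ∀ k, coeff k y ∈ H := by
    intro k
    rw [hyc, coeff_truncate]
    refine H.smul_mem _ ?_
    split_ifs
    · exact hB _
    · exact zero_mem _
  have hy0 : ∀ k < (n : ℤ), coeff k y = 0 := by
    intro k hk
    rw [hyc, coeff_truncate, if_neg (by simp; omega), smul_zero]
  have hyS : y ∈ lieGU b n := mem_lieGU b (fun k hk => hy0 k (by omega)) fun k hk => by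
    rw [hy0 k hk]
    exact zero_mem _
  obtain ⟨w, hw, -, hwg⟩ := exists_lieGU_comp b hn1 hx hyS
  refine ⟨w, hw, coordsOf H n (B - ddz y), ?_⟩
  have hyH' : ∀ k, coeff k (ddz y) ∈ H := fun k => by
    rw [coeff_ddz]
    exact H.smul_mem _ (hyH _)
  rw [hwg, ← hBdef, gauge_of_lie_eq_zero b (lieGU_le_loopF b hn1 hyS) (lie_cartan_loops hyH hB)
    (lie_cartan_loops hyH hyH')]
  refine (normalForm_coordsOf hn1 (fun k => ?_) (fun k hk => ?_) fun k hk => ?_).symm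
  · rw [map_sub]
    exact sub_mem (hB k) (hyH' k)
  · rw [map_sub, hy, coeff_truncate, if_neg (by simp; omega), sub_zero,
      coeff_eq_zero_of_mem_higgs b hBn hk]
  · rw [map_sub, hy, coeff_truncate, if_pos (Set.mem_Ici.2 hk), sub_self]

end NormalForm
end Isostokes

/-! ### Uniqueness of the normal form -/

namespace Isostokes

open LieAlgebra LieModule LieFiltration

section Uniqueness

variable {𝔤 : Type*} [LieRing 𝔤] [LieAlgebra ℂ 𝔤] [FiniteDimensional ℂ 𝔤] [LieAlgebra.IsKilling ℂ 𝔤]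
  {H : LieSubalgebra ℂ 𝔤} [H.IsCartanSubalgebra] (b : (LieAlgebra.IsKilling.rootSystem H).Base)
  {n : ℕ}

/-- A diagonal connection with a regular leading coefficient has no off-diagonal flat sections. -/
theorem eq_zero_of_nabla_eq_zero (b : (LieAlgebra.IsKilling.rootSystem H).Base) (hn : 2 ≤ n) {C : Loop 𝔤} (hC : ∀ k, coeff k C ∈ H)
    (hCn : ∀ k < -(n : ℤ), coeff k C = 0) (hreg : LeadingRegular H n C) {s : Loop 𝔤}
    (hs : ∀ k, hpart H (coeff k s) = 0) (h : nabla C s = 0) : s = 0 := by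
  have hz := zdeg_pos b
  have hnz : 2 * zdeg b ≤ n * zdeg b := mul_le_mul_of_nonneg_right (by omega) hz.le
  -- For a flat `s` the bracket `[C, s] = -s'` loses only `deg z` in degree, whereas bracketing with
  -- the leading term loses `n deg z` and nothing more. So `s` lies one step higher than assumed.
  have step : ∀ e, s ∈ loopF b e → s ∈ loopF b (e + 1) := by
    intro e he
    refine mem_of_lie_leading_mem b (n := n) (hpart_mem _) hreg hs ?_
    have h1 := lie_leading_sub_mem b (by omega) (mem_higgs_of_cartan b hC hCn) he
    have h2 : ⁅C, s⁆ ∈ loopF b (-n * zdeg b + e + 1) := by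
      rw [eq_neg_of_add_eq_zero_right h]
      exact neg_mem (mem_of_le (𝓕 := loopFiltration b) (by linarith) (ddz_mem b he))
    have h3 := sub_mem h2 h1
    rwa [sub_sub_cancel, add_assoc] at h3
  obtain ⟨d₀, h0⟩ := (loopFiltration b).exhaust s
  have hm : ∀ m : ℕ, s ∈ loopF b (d₀ + m) := by
    intro m
    induction m with
    | zero => rwa [Nat.cast_zero, add_zero]
    | succ m ih =>
      have := step _ ih
      push_cast
      rwa [← add_assoc]
  refine (loopFiltration b).sep fun d => ?_
  refine mem_of_le (𝓕 := loopFiltration b) ?_ (hm (d - d₀).toNat)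
  have := Int.self_le_toNat (d - d₀)
  omega

theorem LieFiltration.expAd_sub_mem_of_stable {L : Type*} [LieRing L] [LieAlgebra ℂ L]
    {𝓕 : LieFiltration L} {S : Submodule ℂ L} (hS : 𝓕.IsClosed S) {x : L} (hx : x ∈ 𝓕.F 1)
    (h : ∀ A ∈ S, ⁅x, A⁆ ∈ S) {A : L} (hA : ⁅x, A⁆ ∈ S) : 𝓕.expAd x A - A ∈ S := by
  have h1 := isSum_of_finite (𝓕 := 𝓕) (a := fun m => if m = 0 then A else 0) 1
    (fun m hm => if_neg (by omega))
  rw [Finset.sum_range_one, if_pos rfl] at h1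
  refine ((isSum_expAd hx A).sub h1).mem_of_isClosed hS fun m => ?_
  rcases m with _ | m
  · simp [dp]
  · rw [if_neg (Nat.succ_ne_zero m), sub_zero, dp, pow_succ, Module.End.mul_apply]
    exact S.smul_mem _ (pow_ad_mem_of_stable h hA m)

/-- Loops without polar part, with the coefficients of degree less than `n` in the step `j` of the
height filtration. -/
def jetIdx (n : ℕ) (j k : ℤ) : ℤ := if k < 0 then hmax b + 1 else if k < n then j else -hmax b

theorem lie_mem_jet {x A : Loop 𝔤} (hx : x ∈ lieGU b n) {j : ℤ} (hA : A ∈ coeffFil b (jetIdx b n j)) :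
    ⁅x, A⁆ ∈ coeffFil b (jetIdx b n (j + 1)) := by
  refine lie_mem_coeffFil b (fun i l => ?_) hx hA
  have h0 := hmax_nonneg b
  unfold guIdx jetIdx
  split_ifs <;> omega

/-- Modulo `zⁿ` the loops in the Lie algebra of `Gₙᵁ` take values in `𝔲`, so each bracket raises the
height. This triangularity distinguishes `Gₙᵁ` from a group containing torus elements. -/
theorem expAd_mono_sub_mem (hn : 1 ≤ n) {x : Loop 𝔤} (hx : x ∈ lieGU b n) {j : ℤ} {e : 𝔤}
    (he : e ∈ fil b j) :
    (loopFiltration b).expAd x (mono 0 e) - mono 0 e ∈ coeffFil b (jetIdx b n (j + 1)) := by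
  refine expAd_sub_mem_of_stable (isClosed_coeffFil b _) (lieGU_le_loopF b hn hx) (fun A hA => ?_)
    (lie_mem_jet b hx ?_)
  · have := lie_mem_jet b hx hA
    rw [mem_coeffFil] at this ⊢
    refine fun k => fil_antitone b ?_ (this k)
    unfold jetIdx
    split_ifs <;> omega
  · rw [mem_coeffFil]
    intro k
    rw [coeff_mono, jetIdx]
    split_ifs
    any_goals omega
    all_goals exact zero_mem _

theorem coeff_eq_zero_of_jet {A : Loop 𝔤} {j : ℤ} (hA : A ∈ coeffFil b (jetIdx b n j)) {k : ℤ}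
    (hk : k < 0) : coeff k A = 0 := by
  have := (mem_coeffFil b).1 hA k
  rw [jetIdx, if_pos hk] at this
  exact coeff_eq_zero_of_fil b this (by omega)

theorem coeff_mem_of_jet {A : Loop 𝔤} {j : ℤ} (hA : A ∈ coeffFil b (jetIdx b n j)) {k : ℤ}
    (hk : k < n) : coeff k A ∈ fil b j := by
  rcases lt_or_ge k 0 with h | h
  · rw [coeff_eq_zero_of_jet b hA h]
    exact zero_mem _
  · have := (mem_coeffFil b).1 hA k
    rwa [jetIdx, if_neg (by omega), if_pos hk] at this

theorem nabla_mono_cartan {C : Loop 𝔤} (hC : ∀ k, coeff k C ∈ H) {h : 𝔤} (hh : h ∈ H) :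
    nabla C (mono 0 h) = 0 := by
  have h1 : ddz (mono 0 h) = 0 := by
    refine loop_ext fun k => ?_
    rw [coeff_ddz, coeff_mono, map_zero]
    split_ifs with hk
    · rw [hk, Int.cast_zero, zero_smul]
    · rw [smul_zero]
  rw [nabla, h1, zero_add]
  refine lie_cartan_loops hC fun k => ?_
  rw [coeff_mono]
  split_ifs
  · exact hh
  · exact zero_mem _

/-- The Laurent series `χ(C)`. -/
theorem exists_rootSeries (χ : Weight ℂ H 𝔤) {C : Loop 𝔤} (hC : ∀ k, coeff k C ∈ H) :
    ∃ γ : Laurent, (∀ k, Laurent.coeff k γ = χ ⟨coeff k C, hC k⟩) ∧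
      ∀ f : Loop 𝔤, (∀ k, coeff k f ∈ rootSpace H χ) → ⁅C, f⁆ = γ • f := by
  obtain ⟨N, hN⟩ := exists_bound C
  have h0 : ∀ k < N, χ ⟨coeff k C, hC k⟩ = 0 := by
    intro k hk
    have : (⟨coeff k C, hC k⟩ : H) = 0 := Subtype.ext (hN k hk)
    rw [this]
    exact map_zero (Weight.toLinear ℂ H 𝔤 χ)
  refine ⟨Laurent.ofCoeffs (fun k => χ ⟨coeff k C, hC k⟩) N h0, fun k => rfl, fun f hf => ?_⟩
  refine loop_ext fun k => ?_
  rw [coeff_lie, coeff_smul]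
  refine finsum_congr fun i => ?_
  rw [lie_eq_of_mem (hf _) (hC i), Laurent.coeff_ofCoeffs]

theorem mem_rootSpace_of_lie {χ : Weight ℂ H 𝔤} {x : 𝔤} (h : ∀ y : H, ⁅(y : 𝔤), x⁆ = χ y • x) :
    x ∈ rootSpace H χ := by
  have h1 : x = wproj χ x := by
    refine wproj_eq_zero_ext (H := H) fun ψ => ?_
    by_cases hψ : ψ = χ
    · rw [hψ, wproj_self (wproj_mem χ x)]
    · classical
      rw [wproj_of_mem_weight (wproj_mem χ x), if_neg (Ne.symm hψ)]
      obtain ⟨y, hy⟩ : ∃ y, ψ y ≠ χ y := by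
        by_contra! hc
        exact hψ (Weight.ext hc)
      have h2 := congrArg (wproj ψ) (h y)
      rw [wproj_lie (SetLike.coe_mem y), map_smul, ← sub_eq_zero, ← sub_smul, smul_eq_zero] at h2
      exact h2.resolve_left (sub_ne_zero.2 hy)
  rw [h1]
  exact wproj_mem _ _

theorem eq_zero_of_roots {x : 𝔤} (hx : x ∈ H) (h : ∀ χ : Weight ℂ H 𝔤, χ ⟨x, hx⟩ = 0) : x = 0 := by
  have h1 : LieAlgebra.ad ℂ 𝔤 x = 0 := by
    refine LinearMap.ext fun y => wproj_eq_zero_ext (H := H) fun χ => ?_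
    rw [LieAlgebra.ad_apply, wproj_lie hx, h, zero_smul, LinearMap.zero_apply, map_zero]
  refine killing_nondegenerate fun y => ?_
  rw [killingForm_apply_apply, h1, LinearMap.zero_comp, map_zero]

theorem ddz_mono_zero (x : 𝔤) : ddz (mono 0 x) = 0 := by
  refine loop_ext fun k => ?_
  rw [coeff_ddz, coeff_mono, map_zero]
  split_ifs with hk
  · rw [hk, Int.cast_zero, zero_smul]
  · rw [smul_zero]

/-- Normal forms are rigid: only the identity of `Gₙᵁ` takes one to another. -/
theorem gauge_rigid (hn : 2 ≤ n) {B C w : Loop 𝔤} (hB : ∀ k, coeff k B ∈ H)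
    (hC : ∀ k, coeff k C ∈ H) (hBn : ∀ k < -(n : ℤ), coeff k B = 0)
    (hCn : ∀ k < -(n : ℤ), coeff k C = 0) (hB' : ∀ k : ℤ, (n : ℤ) - 1 ≤ k → coeff k B = 0)
    (hC' : ∀ k : ℤ, (n : ℤ) - 1 ≤ k → coeff k C = 0) (hreg : LeadingRegular H n C)
    (hw : w ∈ lieGU b n) (hg : gauge b w B = C) :
    B = C ∧ ∀ ψ, (loopFiltration b).expAd w ψ = ψ := by
  have hn1 : 1 ≤ n := by omega
  have hw1 := lieGU_le_loopF b hn1 hw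
  have hw1' : w ∈ (loopFiltration b).F 1 := hw1
  -- Constants in `𝔥` are flat for both diagonal connections, and `exp w` carries flat sections for
  -- `B` to flat sections for `C`.
  have hH : ∀ h ∈ H, (loopFiltration b).expAd w (mono 0 h) = mono 0 h := by
    intro h hh
    have h1 := expAd_nabla b hw1 B (mono 0 h)
    rw [hg, nabla_mono_cartan hB hh, expAd_zero hw1'] at h1
    rw [← sub_eq_zero]
    have hjet := expAd_mono_sub_mem b hn1 hw (cartan_le_fil b hh)
    set t := (loopFiltration b).expAd w (mono 0 h) - mono 0 h with ht
    have hnt : nabla C t = 0 := by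
      have h2 : nabla C t = nabla C ((loopFiltration b).expAd w (mono 0 h)) - nabla C (mono 0 h) := by
        rw [ht, nabla, nabla, nabla, map_sub, lie_sub]
        abel
      rw [h2, ← h1, nabla_mono_cartan hC hh, sub_zero]
    -- The `𝔥`-part of the flat difference `t` is constant, and its constant term is in `𝔲`; so `t`
    -- is off-diagonal and flat.
    refine eq_zero_of_nabla_eq_zero b hn hC hCn hreg (fun k => ?_) hnt
    by_cases hk : k = 0
    · subst hk
      exact hpart_of_mem_fil_one b (coeff_mem_of_jet b hjet (by omega))
    · have h3 := hpart_coeff_nabla hC t (k - 1)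
      rw [hnt, map_zero, map_zero, sub_add_cancel] at h3
      exact (smul_eq_zero.1 h3.symm).resolve_left (Int.cast_ne_zero.2 hk)
  -- As `exp w` fixes `𝔥`, it maps a root vector `e` to a loop `f` in the same root space, and `f ≡
  -- e` modulo `zⁿ` by triangularity. Transporting `∇e` gives `(χ(B) - χ(C)) f = f'`.
  have hroot : ∀ (χ : Weight ℂ H 𝔤), ∀ e ∈ rootSpace H χ, e ≠ 0 →
      (∀ k, χ ⟨coeff k B, hB k⟩ = χ ⟨coeff k C, hC k⟩) ∧
        (loopFiltration b).expAd w (mono 0 e) = mono 0 e := by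
    intro χ e he he0
    have hjet := expAd_mono_sub_mem b hn1 hw (rootSpace_le_fil b le_rfl he)
    set f := (loopFiltration b).expAd w (mono 0 e) with hf
    have hfχ : ∀ k, coeff k f ∈ rootSpace H χ := by
      intro k
      refine mem_rootSpace_of_lie fun y => ?_
      have h1 : ⁅mono 0 (y : 𝔤), mono 0 e⁆ = χ y • mono 0 e := by
        refine loop_ext fun k => ?_
        rw [coeff_mono_lie, map_smul, sub_zero, coeff_mono]
        split_ifs
        · exact lie_eq_of_mem he (SetLike.coe_mem y)
        · rw [lie_zero, smul_zero]
      have h2 := congrArg ((loopFiltration b).expAd w) h1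
      rw [expAd_lie hw1', expAd_smul hw1', hH _ (SetLike.coe_mem y), ← hf] at h2
      have h3 := congrArg (coeff k) h2
      rwa [coeff_mono_lie, sub_zero, map_smul] at h3
    set t := f - mono 0 e with ht
    have hmem : ∀ k, coeff k (mono 0 e) ∈ rootSpace H χ := by
      intro k
      rw [coeff_mono]
      split_ifs
      · exact he
      · exact zero_mem _
    have ht0 : ∀ k < (n : ℤ), coeff k t = 0 := by
      intro k hk
      have h1 : coeff k t ∈ rootSpace H χ := by
        rw [ht, map_sub]
        exact sub_mem (hfχ k) (hmem k)
      rw [← wproj_self h1]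
      exact (mem_fil b).1 (coeff_mem_of_jet b hjet hk) χ (by omega)
    obtain ⟨β, hβ, hβf⟩ := exists_rootSeries χ hB
    obtain ⟨γ, hγ, hγf⟩ := exists_rootSeries χ hC
    have h1 := expAd_nabla b hw1 B (mono 0 e)
    rw [hg, nabla, ddz_mono_zero, zero_add, hβf _ hmem, expAd_smul_laurent b hw1, ← hf, nabla,
      hγf f hfχ, ← sub_eq_iff_eq_add, ← sub_smul] at h1
    -- The difference has orders between `-n` and `n - 2`, while `f'` has order at least `n - 1`.
    -- Comparing coefficients from the lowest order upwards kills every term, since the constant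
    -- term of `f` is `e ≠ 0`.
    have hD : β - γ = 0 := by
      have hlow : ∀ m : ℕ, ∀ i < -(n : ℤ) + m, Laurent.coeff i (β - γ) = 0 := by
        intro m
        induction m with
        | zero =>
          intro i hi
          have e1 : (⟨coeff i B, hB i⟩ : H) = 0 := Subtype.ext (hBn i (by omega))
          have e2 : (⟨coeff i C, hC i⟩ : H) = 0 := Subtype.ext (hCn i (by omega))
          rw [map_sub, hβ, hγ, e1, e2, sub_self]
        | succ m ih =>
          intro p hp
          rcases (show p ≤ -(n : ℤ) + m by push_cast at hp; omega).lt_or_eq with h | h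
          · exact ih p h
          by_cases hpn : (n : ℤ) - 1 ≤ p
          · have e1 : (⟨coeff p B, hB p⟩ : H) = 0 := Subtype.ext (hB' p hpn)
            have e2 : (⟨coeff p C, hC p⟩ : H) = 0 := Subtype.ext (hC' p hpn)
            rw [map_sub, hβ, hγ, e1, e2, sub_self]
          have h2 := congrArg (coeff p) h1
          have hfp : ∀ k < (n : ℤ), coeff k f = if k = 0 then e else 0 := by
            intro k hk
            have := ht0 k hk
            rwa [ht, map_sub, sub_eq_zero, coeff_mono] at this
          rw [coeff_smul, finsum_eq_single _ p, coeff_ddz, sub_self, hfp 0 (by omega), if_pos rfl,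
            hfp (p + 1) (by omega)] at h2
          · have h3 : ((p + 1 : ℤ) : ℂ) • (if p + 1 = 0 then e else 0) = 0 := by
              split_ifs with h
              · rw [h, Int.cast_zero, zero_smul]
              · rw [smul_zero]
            rw [h3] at h2
            exact (smul_eq_zero.1 h2).resolve_right he0
          · intro i hi
            rcases lt_or_gt_of_ne hi with hi | hi
            · rw [ih i (by omega), zero_smul]
            · rw [hfp _ (by omega), if_neg (by omega), smul_zero]
      refine Laurent.ext fun k => ?_
      rw [map_zero]
      refine hlow (k + n + 1).toNat k ?_
      have := Int.self_le_toNat (k + n + 1)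
      omega
    refine ⟨fun k => ?_, ?_⟩
    · rw [← hβ, ← hγ, sub_eq_zero.1 hD]
    -- Now `f' = 0`, hence `f = e` also beyond order `n`.
    · rw [hD, zero_smul] at h1
      rw [← sub_eq_zero]
      change t = 0
      refine loop_ext fun k => ?_
      rw [map_zero]
      by_cases hk : k < n
      · exact ht0 k hk
      · have h2 := congrArg (coeff (k - 1)) h1
        rw [map_zero, coeff_ddz, sub_add_cancel] at h2
        have h3 := (smul_eq_zero.1 h2.symm).resolve_left (Int.cast_ne_zero.2 (by omega))
        rw [ht, map_sub, h3, coeff_mono, if_neg (by omega), sub_zero]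
  -- An element of `𝔥` killed by all roots is zero; and constants span the loop algebra over
  -- `ℂ((z))`, on which `exp w` acts linearly.
  constructor
  · rw [← sub_eq_zero]
    refine loop_ext fun k => ?_
    rw [map_sub, map_zero]
    refine eq_zero_of_roots (sub_mem (hB k) (hC k)) fun χ => ?_
    obtain ⟨e, he, he0⟩ := χ.exists_ne_zero
    have h1 := (hroot χ e he he0).1 k
    have h2 : (⟨coeff k B - coeff k C, sub_mem (hB k) (hC k)⟩ : H) =
      ⟨coeff k B, hB k⟩ - ⟨coeff k C, hC k⟩ := rfl
    rw [h2]
    have h3 : χ (⟨coeff k B, hB k⟩ - ⟨coeff k C, hC k⟩) = χ ⟨coeff k B, hB k⟩ - χ ⟨coeff k C, hC k⟩ :=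
      map_sub (Weight.toLinear ℂ H 𝔤 χ) _ _
    rw [h3, h1, sub_self]
  · have hx : ∀ x : 𝔤, (loopFiltration b).expAd w (mono 0 x) = mono 0 x := by
      intro x
      have h1 : mono 0 x = ∑ χ : Weight ℂ H 𝔤, mono 0 (wproj χ x) := by
        rw [mono]
        nth_rw 1 [← sum_wproj (H := H) x]
        rw [TensorProduct.tmul_sum]
        rfl
      rw [h1]
      change expAdₗ hw1' _ = _
      rw [map_sum]
      refine Finset.sum_congr rfl fun χ _ => ?_
      by_cases h0 : wproj χ x = 0
      · rw [h0, mono, TensorProduct.tmul_zero, map_zero]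
      · exact (hroot χ _ (wproj_mem χ x) h0).2
    intro ψ
    induction ψ using TensorProduct.induction_on with
    | zero => exact expAd_zero hw1'
    | add u v hu hv => rw [expAd_add hw1', hu, hv]
    | tmul s x =>
      have h1 : s ⊗ₜ[ℂ] x = s • mono 0 x := by
        have h2 : Laurent.monomial 0 = 1 := rfl
        rw [mono, TensorProduct.smul_tmul', h2, smul_eq_mul, mul_one]
      rw [h1, expAd_smul_laurent b hw1, hx]

end Uniqueness
end Isostokes

/-! ### The Poisson structure in normal form coordinates -/

namespace Isostokes

open LieAlgebra LieModule LieFiltration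

section LocalPoisson

variable {𝔤 : Type*} [LieRing 𝔤] [LieAlgebra ℂ 𝔤] [FiniteDimensional ℂ 𝔤] [LieAlgebra.IsKilling ℂ 𝔤]
  {H : LieSubalgebra ℂ 𝔤} [H.IsCartanSubalgebra] {b : (LieAlgebra.IsKilling.rootSystem H).Base}
  {n : ℕ}

theorem IsConnB.mem_higgs {A : Loop 𝔤} (hA : IsConnB b n A) : A ∈ higgs b n :=
  (isHiggs_iff b).1 hA.1

theorem IsConnB.leadingRegular (hn : 1 ≤ n) {A : Loop 𝔤} (hA : IsConnB b n A) : LeadingRegular H n A :=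
  root_hpart_ne_zero b (hA.1.2 _ (by omega)) hA.2

variable (b) in
theorem hpart_leading_gauge (hn : 2 ≤ n) {x A : Loop 𝔤} (hx : x ∈ lieGU b n) (hA : A ∈ higgs b n) :
    hpart H (coeff (-n) (gauge b x A)) = hpart H (coeff (-n) A) := by
  have hn1 : 1 ≤ n := by omega
  have hAF := higgs_le_loopF b hn1 hA
  have hx1 := lieGU_le_loopF b hn1 hx
  have h1 := gauge_add_sub_mem b hn hAF (zero_mem _) le_rfl hx1
  rw [zero_add, gauge_zero] at h1
  have h2 := (loopFiltration b).lie_mem hx1 hAF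
  have h3 := mem_of_le (𝓕 := loopFiltration b) (i := -n * zdeg b + 1) (by linarith) h1
  have h4 := mem_of_le (𝓕 := loopFiltration b) (i := -n * zdeg b + 1) (by linarith) h2
  have h5 := (mem_loopF b).1 (add_mem h3 h4) (-n)
  rw [sub_add_cancel, map_sub] at h5
  have h6 := hpart_of_mem_fil_one b (fil_antitone b (by linarith) h5)
  rwa [map_sub, sub_eq_zero] at h6

/-- The properties of a gauge transformation of `A` to its normal form. -/
theorem gauge_unique (hn : 2 ≤ n) {A : Loop 𝔤} (hA : IsConnB b n A) {x y : Loop 𝔤}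
    (hx : x ∈ lieGU b n) (hy : y ∈ lieGU b n) {c d : Coords H n} (hc : gauge b x A = normalForm c)
    (hd : gauge b y A = normalForm d) :
    c = d ∧ ∀ ψ, (loopFiltration b).expAd x ψ = (loopFiltration b).expAd y ψ := by
  have hn1 : 1 ≤ n := by omega
  have hx1 := lieGU_le_loopF b hn1 hx
  obtain ⟨w, hw, hwE, hwg⟩ := exists_lieGU_comp b hn1 (neg_mem hx) hy
  have h1 : gauge b w (normalForm c) = normalForm d := by
    rw [hwg, ← hc, gauge_neg_gauge b hx1, hd]
  have hreg : LeadingRegular H n (normalForm d) := by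
    intro χ hχ
    have h2 := hA.leadingRegular hn1 χ hχ
    have h3 : (⟨hpart H (coeff (-n) (normalForm d)), hpart_mem _⟩ : H) =
      ⟨hpart H (coeff (-n) A), hpart_mem _⟩ := by
      rw [Subtype.mk.injEq, ← hd]
      exact hpart_leading_gauge b hn hy hA.mem_higgs
    rwa [h3]
  obtain ⟨h2, h3⟩ := gauge_rigid b hn (coeff_normalForm_mem c) (coeff_normalForm_mem d)
    (fun k hk => coeff_normalForm_lt c hk) (fun k hk => coeff_normalForm_lt d hk)
    (fun k hk => coeff_normalForm_ge c hk (by omega))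
    (fun k hk => coeff_normalForm_ge d hk (by omega)) hreg hw h1
  refine ⟨?_, fun ψ => ?_⟩
  · rw [← coordsOf_normalForm c, h2, coordsOf_normalForm]
  · have h4 := hwE ((loopFiltration b).expAd x ψ)
    rwa [h3, expAd_neg_expAd (𝓕 := loopFiltration b) hx1] at h4

theorem hasCoords_iff (hn : 1 ≤ n) {A : Loop 𝔤} {c : Coords H n} :
    HasCoords b A c ↔ ∃ x ∈ lieGU b n, gauge b x A = normalForm c := by
  constructor
  · rintro ⟨x, hx, hg⟩
    rw [isLieGU_iff] at hx
    rw [isExpGauge_iff b (lieGU_le_loopF b hn hx)] at hg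
    exact ⟨x, hx, hg.symm⟩
  · rintro ⟨x, hx, hg⟩
    exact ⟨x, (isLieGU_iff b).2 hx, (isExpGauge_iff b (lieGU_le_loopF b hn hx) _ _).2 hg.symm⟩

theorem existsUnique_coords (hn : 2 ≤ n) {A : Loop 𝔤} (hA : IsConnB b n A) :
    ∃! c : Coords H n, HasCoords b A c := by
  have hn1 : 1 ≤ n := by omega
  obtain ⟨x, hx, c, hc⟩ := exists_hasCoords b hn hA.mem_higgs (hA.leadingRegular hn1)
  refine ⟨c, (hasCoords_iff hn1).2 ⟨x, hx, hc⟩, fun d hd => ?_⟩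
  obtain ⟨y, hy, hd⟩ := (hasCoords_iff hn1).1 hd
  exact (gauge_unique hn hA hy hx hd hc).1

/-- The coordinates involve orders `k < n - 1`, where the `𝔥`-part of `∇χ` comes from the
coefficient of order `k + 1 < n` of `χ`, which is in `𝔲`. Gauge directions are therefore invisible
in the coordinates. -/
theorem coordsOf_nabla {C χ : Loop 𝔤} (hC : ∀ k, coeff k C ∈ H) (hχ : χ ∈ lieGU b n) :
    coordsOf H n (nabla C χ) = 0 := by
  refine coordsOf_eq_zero fun k _ hk => ?_
  rw [hpart_coeff_nabla hC, hpart_of_mem_fil_one b (coeff_mem_fil_one b hχ (by omega)), smul_zero]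

/-- The off-diagonal part of the equation `∇χ = r`. -/
theorem exists_nabla_eq (b : (LieAlgebra.IsKilling.rootSystem H).Base) (hn : 2 ≤ n) {C : Loop 𝔤}
    (hC : ∀ k, coeff k C ∈ H) (hCn : ∀ k < -(n : ℤ), coeff k C = 0)
    (hreg : LeadingRegular H n C) {r : Loop 𝔤} (hr : ∀ k, hpart H (coeff k r) = 0)
    (hrn : r ∈ higgs b n) : ∃ χ ∈ lieGU b n, nabla C χ = r := by
  have hn1 : 1 ≤ n := by omega
  have hz := zdeg_pos b
  have hnz : 2 * zdeg b ≤ n * zdeg b := mul_le_mul_of_nonneg_right (by omega) hz.le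
  have hCh := mem_higgs_of_cartan b hC hCn
  have hCF := higgs_le_loopF b hn1 hCh
  have hnadd : ∀ u v, nabla C (u + v) = nabla C u + nabla C v := fun u v => by
    rw [nabla, nabla, nabla, map_add, lie_add]
    abel
  have hnF : ∀ e, ∀ u ∈ loopF b e, nabla C u ∈ loopF b (-n * zdeg b + e) := fun e u hu =>
    add_mem (mem_of_le (𝓕 := loopFiltration b) (by linarith) (ddz_mem b hu))
      ((loopFiltration b).lie_mem hCF hu)
  have hr1 : r ∈ loopF b (-n * zdeg b + 1) := by
    have h1 := mapCoeff_offDiag_mem b (sub_leading_mem b hn1 hrn)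
    rw [hr, show mono (-n) (0 : 𝔤) = 0 from TensorProduct.tmul_zero _ _, sub_zero] at h1
    convert h1 using 1
    refine loop_ext fun k => ?_
    rw [coeff_mapCoeff]
    have := hpart_add_offDiag (H := H) (coeff k r)
    rwa [hr, zero_add, eq_comm] at this
  obtain ⟨w, s, hs, hlim⟩ := exists_limit (𝓕 := loopFiltration b)
    (fun k x => x ∈ lieGU b n ∧ (∀ k, hpart H (coeff k x) = 0) ∧
      r - nabla C x ∈ loopF b (-n * zdeg b + (k + 1))) 0
    ⟨zero_mem _, fun k => by rw [map_zero, map_zero], by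
      rw [nabla, map_zero, lie_zero, add_zero, sub_zero]
      simpa using hr1⟩ (by
      rintro k x ⟨hx, hx0, hxr⟩
      obtain ⟨δ, hδ, hδS, hδ0, hδe⟩ := exists_lie_leading_eq b (n := n) (hpart_mem _) hreg
        (r := r - nabla C x) (fun k => by
          rw [map_sub, map_sub, hr, hpart_coeff_nabla hC, hx0, smul_zero, sub_zero])
        (sub_mem hrn (nabla_mem_higgs b hCh hx)) hxr
      refine ⟨δ, hδ, add_mem hx hδS, fun k => by rw [map_add, map_add, hx0, hδ0, add_zero], ?_⟩
      have h1 := lie_leading_sub_mem b hn1 hCh hδ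
      have h2 := mem_of_le (𝓕 := loopFiltration b) (i := -n * zdeg b + (k + 1) + 1) (by linarith)
        (ddz_mem b hδ)
      have h3 := neg_mem (add_mem h1 h2)
      rw [hδe] at h3
      have h4 : -(⁅C, δ⁆ - (r - nabla C x) + ddz δ) = r - nabla C (x + δ) := by
        rw [hnadd, nabla.eq_1 C δ]
        abel
      rw [h4] at h3
      push_cast
      rwa [add_assoc] at h3)
  have hw : w ∈ lieGU b n := isClosed_coeffFil b _ w fun d => ⟨s d.toNat, (hs _).1,
    mem_of_le (𝓕 := loopFiltration b) (by have := Int.self_le_toNat d; omega) (hlim _)⟩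
  refine ⟨w, hw, ?_⟩
  rw [← sub_eq_zero]
  refine (loopFiltration b).sep fun d => ?_
  let k := (d + n * zdeg b).toNat
  have hk := Int.self_le_toNat (d + n * zdeg b)
  have h1 := hnF _ _ (hlim k)
  have h2 := hnadd (s k) (w - s k)
  rw [add_sub_cancel] at h2
  have h3 := sub_mem h1 (hs k).2.2
  refine mem_of_le (𝓕 := loopFiltration b) (j := -n * zdeg b + (k + 1)) (by linarith) ?_
  have h4 : nabla C w - r = nabla C (w - s k) - (r - nabla C (s k)) := by
    rw [h2]
    generalize nabla C (w - s k) = u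
    generalize nabla C (s k) = v
    abel
  rw [h4]
  exact h3

/-- A gauge transformation to the normal form computes the tangent map. -/
theorem hasTangentCoords_iff (hn : 2 ≤ n) {A ν x : Loop 𝔤} (hA : IsConnB b n A)
    (hν : ν ∈ higgs b n) (hx : x ∈ lieGU b n) {c w : Coords H n} (hc : gauge b x A = normalForm c) :
    HasTangentCoords b A ν c w ↔ w = coordsOf H n ((loopFiltration b).expAd x ν) := by
  have hn1 : 1 ≤ n := by omega
  have hx1 := lieGU_le_loopF b hn1 hx
  constructor
  · rintro ⟨y, χ, B, hy, hχ, hg, hB, hw⟩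
    rw [isLieGU_iff] at hy hχ
    have hy1 := lieGU_le_loopF b hn1 hy
    rw [isExpGauge_iff b hy1] at hg
    rw [isExpAd_iff b hy1] at hB
    have h1 := (gauge_unique hn hA hy hx hg.symm hc).2 ν
    rw [← h1, ← hB, ← coordsOf_normalForm w, ← hw, map_sub,
      coordsOf_nabla (coeff_normalForm_mem c) hχ, sub_zero]
  · rintro rfl
    set μ := (loopFiltration b).expAd x ν with hμ
    have hμh : μ ∈ higgs b n := expAd_mem_higgs b hn1 hx hν
    have hreg : LeadingRegular H n (normalForm c) := by
      intro χ hχ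
      have h2 := hA.leadingRegular hn1 χ hχ
      have h3 : (⟨hpart H (coeff (-n) (normalForm c)), hpart_mem _⟩ : H) =
        ⟨hpart H (coeff (-n) A), hpart_mem _⟩ := by
        rw [Subtype.mk.injEq, ← hc]
        exact hpart_leading_gauge b hn hx hA.mem_higgs
      rwa [h3]
    -- The off-diagonal part of `μ` is a gauge direction `∇χ₁`; its `𝔥`-part of order at least `n -
    -- 1` is one as well, as the derivative of `y`. What is left is the normal form.
    obtain ⟨χ₁, hχ₁, h1⟩ := exists_nabla_eq b hn (coeff_normalForm_mem c)
      (fun k hk => coeff_normalForm_lt c hk) hreg (r := mapCoeff (offDiag H) μ)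
      (fun k => by rw [coeff_mapCoeff, hpart_offDiag]) (mapCoeff_offDiag_mem_higgs b hμh)
    obtain ⟨y, hy, hyc⟩ := exists_ddz_eq (B := truncate (Set.Ici ((n : ℤ) - 1)) (mapCoeff (hpart H) μ))
      (by rw [coeff_truncate, if_neg (by simp; omega)])
    have hyH : ∀ k, coeff k y ∈ H := by
      intro k
      rw [hyc, coeff_truncate]
      refine H.smul_mem _ ?_
      split_ifs
      · rw [coeff_mapCoeff]
        exact hpart_mem _
      · exact zero_mem _
    have hy0 : ∀ k < (n : ℤ), coeff k y = 0 := by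
      intro k hk
      rw [hyc, coeff_truncate, if_neg (by simp; omega), smul_zero]
    have hyS : y ∈ lieGU b n := mem_lieGU b (fun k hk => hy0 k (by omega)) fun k hk => by
      rw [hy0 k hk]
      exact zero_mem _
    refine ⟨x, χ₁ + y, μ, (isLieGU_iff b).2 hx, (isLieGU_iff b).2 (add_mem hχ₁ hyS),
      (isExpGauge_iff b hx1 _ _).2 hc.symm, (isExpAd_iff b hx1 _ _).2 hμ, ?_⟩
    have h2 : nabla (normalForm c) (χ₁ + y) = mapCoeff (offDiag H) μ +
        truncate (Set.Ici ((n : ℤ) - 1)) (mapCoeff (hpart H) μ) := by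
      rw [← h1, ← hy, nabla, nabla, map_add, lie_add,
        lie_cartan_loops (coeff_normalForm_mem c) hyH]
      abel
    rw [h2]
    refine loop_ext fun k => ?_
    have h3 := hpart_add_offDiag (H := H) (coeff k μ)
    rw [map_sub, map_add, coeff_mapCoeff, coeff_truncate, coeff_mapCoeff]
    by_cases hk : (n : ℤ) - 1 ≤ k
    · rw [if_pos (Set.mem_Ici.2 hk), coeff_normalForm_ge _ hk (by omega), add_comm, h3, sub_self]
    · rw [if_neg (fun h => hk (Set.mem_Ici.1 h)), add_zero, sub_eq_iff_eq_add]
      by_cases hk' : k < -n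
      · rw [coeff_normalForm_lt _ hk', zero_add, coeff_eq_zero_of_mem_higgs b hμh hk', map_zero]
      · rw [coeff_normalForm_coordsOf _ (by omega) (by omega), h3]

theorem resPair_mono (A : Loop 𝔤) (k : ℤ) (y : 𝔤) :
    resPair A (mono k y) = killingForm ℂ 𝔤 (coeff (-1 - k) A) y := by
  rw [resPair_eq, finsum_eq_single _ (-1 - k)]
  · rw [coeff_mono, if_pos (by ring)]
  · intro i hi
    rw [coeff_mono, if_neg (by omega), map_zero]

theorem mono_mem_higgs {k : ℤ} {y : 𝔤} (hk : -(n : ℤ) ≤ k) (hy : k < 0 → y ∈ fil b 0) :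
    mono k y ∈ higgs b n := by
  refine mem_higgs b (fun l hl => ?_) fun l hl => ?_
  · rw [coeff_mono, if_neg (by omega)]
  · rw [coeff_mono]
    split_ifs with h
    · exact hy (by omega)
    · exact zero_mem _

/-- The polar coefficients are annihilated since all regular forms are allowed, and orders below `n`
lie in `𝔲`, the orthogonal of `𝔟`. Consequently two lifts of the same covector differ, after
normalization, by an element of the Lie algebra of `Gₙᵁ`. -/
theorem mem_lieGU_of_perp {x : Loop 𝔤} (h : ∀ μ ∈ higgs b n, resPair x μ = 0) : x ∈ lieGU b n := by
  refine mem_lieGU b (fun k hk => ?_) fun k hk => ?_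
  · refine killing_nondegenerate fun y => ?_
    have := h _ (mono_mem_higgs (b := b) (n := n) (k := -1 - k) (y := y) (by omega) (by omega))
    rwa [resPair_mono, sub_sub_cancel] at this
  · refine mem_fil_one_of_perp b fun y hy => ?_
    have := h _ (mono_mem_higgs (b := b) (n := n) (k := -1 - k) (y := y) (by omega) fun _ => hy)
    rwa [resPair_mono, sub_sub_cancel] at this

theorem resPair_sum_left {ι : Type*} (s : Finset ι) (f : ι → Loop 𝔤) (B : Loop 𝔤) :
    resPair (∑ i ∈ s, f i) B = ∑ i ∈ s, resPair (f i) B := by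
  simp only [resPair, map_sum, LinearMap.sum_apply]

/-- A linear form in the coordinates is the residue pairing with an `𝔥`-valued loop. -/
theorem exists_dual_loop (l : Coords H n →ₗ[ℂ] ℂ) : ∃ η : Loop 𝔤, (∀ k, coeff k η ∈ H) ∧
    (∀ k ≤ -(n : ℤ), coeff k η = 0) ∧ ∀ μ, resPair η μ = l (coordsOf H n μ) := by
  choose h hh using fun i : Fin n => exists_cartan_dual
    (l ∘ₗ LinearMap.inl ℂ _ _ ∘ₗ LinearMap.single ℂ (fun _ : Fin n => H) i)
  choose h' hh' using fun i : Fin (n - 1) => exists_cartan_dual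
    (l ∘ₗ LinearMap.inr ℂ _ _ ∘ₗ LinearMap.single ℂ (fun _ : Fin (n - 1) => H) i)
  have hc : ∀ k, coeff k (∑ i : Fin n, mono (i : ℤ) (h i : 𝔤) +
      ∑ i : Fin (n - 1), mono (-1 - (i : ℤ)) (h' i : 𝔤)) =
      (∑ i : Fin n, if k = (i : ℤ) then (h i : 𝔤) else 0) +
      ∑ i : Fin (n - 1), if k = -1 - (i : ℤ) then (h' i : 𝔤) else 0 := by
    intro k
    simp only [map_add, map_sum, coeff_mono]
  -- `α_{i+1}` sits at order `-(i + 1)` and `β_i` at order `i`; their residue duals sit at `i` and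
  -- `-1 - i`, so altogether between `-(n - 1)` and `n - 1`.
  refine ⟨∑ i : Fin n, mono (i : ℤ) (h i : 𝔤) + ∑ i : Fin (n - 1), mono (-1 - (i : ℤ)) (h' i : 𝔤),
    fun k => ?_, fun k hk => ?_, fun μ => ?_⟩
  · rw [hc]
    refine add_mem (sum_mem fun i _ => ?_) (sum_mem fun i _ => ?_)
    · split_ifs
      · exact SetLike.coe_mem _
      · exact zero_mem _
    · split_ifs
      · exact SetLike.coe_mem _
      · exact zero_mem _
  · rw [hc, Finset.sum_eq_zero, Finset.sum_eq_zero, add_zero]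
    · intro i _
      rw [if_neg (by omega)]
    · intro i _
      rw [if_neg (by omega)]
  · rw [resPair_add_left, resPair_sum_left, resPair_sum_left]
    have h1 : ∀ (k : ℤ) (x : H), resPair (mono k (x : 𝔤)) μ =
        killingForm ℂ 𝔤 (x : 𝔤) (hpart H (coeff (-1 - k) μ)) := by
      intro k x
      rw [resPair_comm, resPair_mono, LieModule.traceForm_comm,
        killing_cartan_hpart (SetLike.coe_mem x)]
    simp only [h1]
    have h2 : coordsOf H n μ = ∑ i : Fin n, LinearMap.inl ℂ (Fin n → H) (Fin (n - 1) → H)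
          (Pi.single i ((coordsOf H n μ).1 i)) +
        ∑ i : Fin (n - 1), LinearMap.inr ℂ (Fin n → H) (Fin (n - 1) → H)
          (Pi.single i ((coordsOf H n μ).2 i)) := by
      rw [← map_sum, ← map_sum, Finset.univ_sum_single, Finset.univ_sum_single]
      simp
    rw [h2, map_add, map_sum, map_sum]
    congr 1
    · refine Finset.sum_congr rfl fun i _ => ?_
      have h3 := hh i ((coordsOf H n μ).1 i)
      refine Eq.trans ?_ h3
      have h4 : (((coordsOf H n μ).1 i : H) : 𝔤) = hpart H (coeff (-((i : ℤ) + 1)) μ) := rfl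
      rw [h4, show -((i : ℤ) + 1) = -1 - i by ring]
    · refine Finset.sum_congr rfl fun i _ => ?_
      have h3 := hh' i ((coordsOf H n μ).2 i)
      refine Eq.trans ?_ h3
      have h4 : (((coordsOf H n μ).2 i : H) : 𝔤) = hpart H (coeff (i : ℤ) μ) := rfl
      rw [h4, sub_sub_cancel]

theorem normalForm_add (u v : Coords H n) : normalForm (u + v) = normalForm u + normalForm v := by
  have h : ∀ x y : H, ((x + y : H) : 𝔤) = (x : 𝔤) + (y : 𝔤) := fun _ _ => rfl
  simp only [normalForm, mono, Prod.fst_add, Prod.snd_add, Pi.add_apply, h, TensorProduct.tmul_add,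
    Finset.sum_add_distrib]
  exact add_add_add_comm _ _ _ _

theorem normalForm_smul (r : ℂ) (v : Coords H n) : normalForm (r • v) = r • normalForm v := by
  have h : ∀ x : H, ((r • x : H) : 𝔤) = r • (x : 𝔤) := fun _ => rfl
  simp only [normalForm, mono, Prod.smul_fst, Prod.smul_snd, Pi.smul_apply, h,
    TensorProduct.tmul_smul, Finset.smul_sum, smul_add]

/-- `d + A dz` and a gauge transformation to its normal form. -/
structure IsNormalization (b : (LieAlgebra.IsKilling.rootSystem H).Base) (n : ℕ) (A x : Loop 𝔤)
    (c : Coords H n) : Prop where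
  two_le : 2 ≤ n
  conn : IsConnB b n A
  mem : x ∈ lieGU b n
  gauge_eq : gauge b x A = normalForm c

namespace IsNormalization

variable {A x : Loop 𝔤} {c : Coords H n} (S : IsNormalization b n A x c)
local notation "E" => LieFiltration.expAd (loopFiltration b)

theorem one_le (S : IsNormalization b n A x c) : 1 ≤ n := by
  have := S.two_le
  omega

theorem memF (S : IsNormalization b n A x c) : x ∈ (loopFiltration b).F 1 :=
  lieGU_le_loopF b S.one_le S.mem

theorem normalForm_mem_higgs (c : Coords H n) : normalForm c ∈ higgs b n :=
  mem_higgs_of_cartan b (coeff_normalForm_mem c) fun _ hk => coeff_normalForm_lt c hk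

theorem tangent_iff (S : IsNormalization b n A x c) {ν : Loop 𝔤} (hν : ν ∈ higgs b n)
    {w : Coords H n} : HasTangentCoords b A ν c w ↔ w = coordsOf H n (E x ν) :=
  hasTangentCoords_iff S.two_le S.conn hν S.mem S.gauge_eq

theorem expAd_neg_mem_higgs (S : IsNormalization b n A x c) {μ : Loop 𝔤} (hμ : μ ∈ higgs b n) :
    E (-x) μ ∈ higgs b n := expAd_mem_higgs b S.one_le (neg_mem S.mem) hμ

theorem resPair_expAd_left (S : IsNormalization b n A x c) (ξ μ : Loop 𝔤) :
    resPair ξ (E (-x) μ) = resPair (E x ξ) μ := by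
  rw [← resPair_expAd b S.memF, expAd_expAd_neg S.memF]

/-- Transporting by `exp x`, which preserves the residue pairing, reduces lifts at any point to
lifts at the normal form, where the tangent map is linear and explicit. -/
theorem isLift_iff (S : IsNormalization b n A x c) {l : Coords H n → ℂ} {ξ : Loop 𝔤} :
    IsLift b A c l ξ ↔ ∀ μ ∈ higgs b n, resPair (E x ξ) μ = l (coordsOf H n μ) := by
  constructor
  · intro h μ hμ
    have h1 := h (E (-x) μ) _ ((isHiggs_iff b).2 (S.expAd_neg_mem_higgs hμ))
      ((S.tangent_iff (S.expAd_neg_mem_higgs hμ)).2 rfl)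
    rwa [S.resPair_expAd_left, expAd_expAd_neg S.memF] at h1
  · intro h ν w hν hw
    rw [isHiggs_iff] at hν
    rw [(S.tangent_iff hν).1 hw, ← h _ (expAd_mem_higgs b S.one_le S.mem hν),
      resPair_expAd b S.memF]

theorem expAd_nabla_eq (S : IsNormalization b n A x c) (ξ : Loop 𝔤) :
    E x (nabla A ξ) = nabla (normalForm c) (E x ξ) := by
  rw [expAd_nabla b S.memF, S.gauge_eq]

/-- The `𝔥`-parts of the coefficients of a lift. -/
theorem killing_lift (S : IsNormalization b n A x c) {l : Coords H n → ℂ} {ξ : Loop 𝔤}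
    (h : IsLift b A c l ξ) {k : ℤ} (hk : k < n) {y : 𝔤} (hy : y ∈ H) :
    killingForm ℂ 𝔤 (coeff k (E x ξ)) y = l (coordsOf H n (mono (-1 - k) y)) := by
  rw [← S.isLift_iff.1 h _ (mono_mem_higgs (by omega) fun _ => cartan_le_fil b hy), resPair_mono,
    sub_sub_cancel]

/-- Up to the Lie algebra of `Gₙᵁ` a lift is the `𝔥`-valued dual loop, with a pole of order at most
`n - 1`; its `∇` is its derivative, with a pole of order at most `n`. So the hamiltonian vector is
again tangent to `𝐂𝐨𝐧𝐧ₙᴮ`. -/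
theorem nabla_lift_mem (S : IsNormalization b n A x c) {l : Coords H n →ₗ[ℂ] ℂ} {ξ : Loop 𝔤}
    (h : IsLift b A c l ξ) : nabla (normalForm c) (E x ξ) ∈ higgs b n := by
  obtain ⟨η, hη, hηn, hηl⟩ := exists_dual_loop l
  have h1 : E x ξ - η ∈ lieGU b n := mem_lieGU_of_perp fun μ hμ => by
    rw [resPair_sub_left, S.isLift_iff.1 h μ hμ, hηl, sub_self]
  have h2 : nabla (normalForm c) (E x ξ) = nabla (normalForm c) (E x ξ - η) + ddz η := by
    rw [nabla, nabla, map_sub, lie_sub, lie_cartan_loops (coeff_normalForm_mem c) hη]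
    abel
  rw [h2]
  refine add_mem (nabla_mem_higgs b (normalForm_mem_higgs c) h1) (mem_higgs_of_cartan b (fun k => ?_)
    fun k hk => ?_)
  · rw [coeff_ddz]
    exact H.smul_mem _ (hη _)
  · rw [coeff_ddz, hηn _ (by omega), smul_zero]

theorem neg_nabla_mem (S : IsNormalization b n A x c) {l : Coords H n →ₗ[ℂ] ℂ} {ξ : Loop 𝔤}
    (h : IsLift b A c l ξ) : -nabla A ξ ∈ higgs b n := by
  have h1 := S.expAd_neg_mem_higgs (S.nabla_lift_mem h)
  rw [← S.expAd_nabla_eq, expAd_neg_expAd S.memF] at h1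
  exact neg_mem h1

theorem exists_lift (S : IsNormalization b n A x c) (l : Coords H n →ₗ[ℂ] ℂ) :
    ∃ ξ, IsLift b A c l ξ := by
  obtain ⟨η, hη, hηn, hηl⟩ := exists_dual_loop l
  refine ⟨E (-x) η, S.isLift_iff.2 fun μ _ => ?_⟩
  rw [expAd_expAd_neg S.memF, hηl]

/-- The hamiltonian vector computed from a lift. -/
theorem ham_of_lift (S : IsNormalization b n A x c) {l : Coords H n →ₗ[ℂ] ℂ} {ξ : Loop 𝔤}
    (h : IsLift b A c l ξ) {w : Coords H n} : HasTangentCoords b A (-nabla A ξ) c w ↔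
      w = -coordsOf H n (nabla (normalForm c) (E x ξ)) := by
  have h0 : E x (-nabla A ξ) = -E x (nabla A ξ) := map_neg (expAdₗ S.memF) _
  rw [S.tangent_iff (S.neg_nabla_mem h), h0, S.expAd_nabla_eq, map_neg]

theorem coords_nabla_lift_congr (S : IsNormalization b n A x c) {l : Coords H n →ₗ[ℂ] ℂ}
    {ξ ξ' : Loop 𝔤} (h : IsLift b A c l ξ) (h' : IsLift b A c l ξ') :
    coordsOf H n (nabla (normalForm c) (E x ξ)) = coordsOf H n (nabla (normalForm c) (E x ξ')) := by
  have h1 : E x ξ - E x ξ' ∈ lieGU b n := mem_lieGU_of_perp fun μ hμ => by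
    rw [resPair_sub_left, S.isLift_iff.1 h μ hμ, S.isLift_iff.1 h' μ hμ, sub_self]
  have h2 := coordsOf_nabla (coeff_normalForm_mem c) h1
  have h3 : nabla (normalForm c) (E x ξ - E x ξ') =
      nabla (normalForm c) (E x ξ) - nabla (normalForm c) (E x ξ') := by
    rw [nabla, nabla, nabla, map_sub, lie_sub]
    abel
  rwa [h3, map_sub, sub_eq_zero] at h2

theorem existsUnique_ham (S : IsNormalization b n A x c) (l : Coords H n →ₗ[ℂ] ℂ) :
    ∃! w, IsHamVector b A c l w := by
  obtain ⟨ξ, hξ⟩ := S.exists_lift l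
  refine ⟨_, ⟨ξ, hξ, (isHiggs_iff b).2 (S.neg_nabla_mem hξ), (S.ham_of_lift hξ).2 rfl⟩, ?_⟩
  rintro w ⟨ξ', hξ', -, hw⟩
  rw [(S.ham_of_lift hξ').1 hw, S.coords_nabla_lift_congr hξ' hξ]

/-- The residue of the connection does not change along hamiltonian vectors. -/
theorem ham_residue (S : IsNormalization b n A x c) {l : Coords H n →ₗ[ℂ] ℂ} {w : Coords H n}
    (h : IsHamVector b A c l w) (i : Fin n) (hi : (i : ℕ) = 0) : w.1 i = 0 := by
  obtain ⟨ξ, hξ, -, hw⟩ := h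
  rw [(S.ham_of_lift hξ).1 hw]
  refine Subtype.ext ?_
  change -hpart H (coeff (-((i : ℤ) + 1)) (nabla (normalForm c) (E x ξ))) = 0
  rw [hpart_coeff_nabla (coeff_normalForm_mem c), hi]
  simp

/-- The component along `α_{i+1}` is, up to the factor `i`, the coefficient of order `-i` of the
lift. For `i ≥ 1` that coefficient pairs with `β_{i-1}`, on which `l` vanishes; for `i = 0` the
factor is zero. -/
theorem ham_fst_eq_zero (S : IsNormalization b n A x c) {l : Coords H n →ₗ[ℂ] ℂ}
    (hl : ∀ w, w.1 = 0 → l w = 0) {w : Coords H n} (h : IsHamVector b A c l w) : w.1 = 0 := by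
  obtain ⟨ξ, hξ, -, hw⟩ := h
  rw [(S.ham_of_lift hξ).1 hw]
  refine funext fun i => Subtype.ext ?_
  change -hpart H (coeff (-((i : ℤ) + 1)) (nabla (normalForm c) (E x ξ))) = 0
  rw [hpart_coeff_nabla (coeff_normalForm_mem c), neg_eq_zero, smul_eq_zero]
  by_cases hi : (i : ℕ) = 0
  · left
    rw [hi]
    simp
  · right
    refine cartan_nondegenerate (hpart_mem _) fun y hy => ?_
    rw [LieModule.traceForm_comm, ← killing_cartan_hpart hy, LieModule.traceForm_comm,
      S.killing_lift hξ (by omega) hy]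
    refine hl _ (funext fun j => Subtype.ext ?_)
    change hpart H (coeff (-((j : ℤ) + 1)) (mono _ y)) = 0
    rw [coeff_mono, if_neg (by omega), map_zero]

/-- The equation to solve is `-y' = w` for an `𝔥`-valued loop `y`; the vanishing of the component
along `α₁` is exactly the absence of a residue. The covector is then the pairing with `y`. -/
theorem exists_ham (S : IsNormalization b n A x c) {w : Coords H n}
    (hw : ∀ i : Fin n, (i : ℕ) = 0 → w.1 i = 0) :
    ∃ l : Coords H n →ₗ[ℂ] ℂ, (w.1 = 0 → ∀ w', w'.1 = 0 → l w' = 0) ∧ IsHamVector b A c l w := by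
  have hn := S.two_le
  obtain ⟨y, hy, hyc⟩ := exists_ddz_eq (B := -normalForm w) (by
    have h1 := coeff_normalForm_neg w ⟨0, by omega⟩
    rw [hw _ rfl] at h1
    rw [map_neg, neg_eq_zero]
    simpa using h1)
  have hyH : ∀ k, coeff k y ∈ H := by
    intro k
    rw [hyc, map_neg]
    exact H.smul_mem _ (neg_mem (coeff_normalForm_mem w _))
  have hy1 : ∀ k ≤ -(n : ℤ), coeff k y = 0 := by
    intro k hk
    rw [hyc, map_neg, coeff_normalForm_lt w (by omega), neg_zero, smul_zero]
  have hy2 : ∀ k ≥ (n : ℤ), coeff k y = 0 := by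
    intro k hk
    rw [hyc, map_neg, coeff_normalForm_ge w (by omega) (by omega), neg_zero, smul_zero]
  let l : Coords H n →ₗ[ℂ] ℂ :=
    { toFun := fun v => resPair y (normalForm v)
      map_add' := fun u v => by rw [normalForm_add, resPair_add_right]
      map_smul' := fun r v => by
        rw [normalForm_smul, resPair_eq, resPair_eq, RingHom.id_apply, smul_finsum]
        simp only [map_smul] }
  -- The loop `y` has orders strictly between `-n` and `n`, so it pairs only with orders `-n` to `n
  -- - 2`, which are those recorded by the coordinates.
  have hlift : IsLift b A c l (E (-x) y) := by
    refine S.isLift_iff.2 fun μ hμ => ?_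
    rw [expAd_expAd_neg S.memF]
    change _ = resPair y (normalForm (coordsOf H n μ))
    rw [resPair_eq, resPair_eq]
    refine finsum_congr fun k => ?_
    by_cases hk : k ≤ -n
    · rw [hy1 k hk]
      simp
    by_cases hk' : (n : ℤ) ≤ k
    · rw [hy2 k hk']
      simp
    · rw [killing_cartan_hpart (hyH k), coeff_normalForm_coordsOf _ (by omega) (by omega)]
  refine ⟨l, fun hw0 w' hw' => ?_, E (-x) y, hlift, (isHiggs_iff b).2 (S.neg_nabla_mem hlift),
    (S.ham_of_lift hlift).2 ?_⟩
  -- If `w` moves only the `β_i`, then `y` is regular, and it has no residue pairing with a regular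
  -- form.
  · change resPair y (normalForm w') = 0
    rw [resPair_eq]
    refine finsum_eq_zero_of_forall_eq_zero fun k => ?_
    have hz : ∀ v : Coords H n, v.1 = 0 → ∀ k < 0, coeff k (normalForm v) = 0 := by
      intro v hv k hk
      by_cases hk' : k < -n
      · exact coeff_normalForm_lt v hk'
      · have h1 : coeff (-((((-k - 1).toNat : ℕ) : ℤ) + 1)) (normalForm v) = _ :=
          coeff_normalForm_neg v ⟨(-k - 1).toNat, by omega⟩
        have h2 : -((((-k - 1).toNat : ℕ) : ℤ) + 1) = k := by omega
        rw [h2, hv] at h1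
        exact h1
    rcases lt_or_ge (-1 - k) 0 with h | h
    · rw [hz w' hw' _ h, map_zero]
    · rw [hyc, map_neg, hz w hw0 _ (by omega)]
      simp
  · rw [expAd_expAd_neg S.memF, nabla, lie_cartan_loops (coeff_normalForm_mem c) hyH, add_zero, hy,
      map_neg, neg_neg, coordsOf_normalForm]

/-- The bracket is `l` applied, up to sign, to the hamiltonian vector of `l'`, and the latter has
only `β`-components. Existence of lifts is needed for the implication from `r = 0`. -/
theorem bracket_iff (S : IsNormalization b n A x c) {l l' : Coords H n →ₗ[ℂ] ℂ}
    (hl : ∀ w, w.1 = 0 → l w = 0) (hl' : ∀ w, w.1 = 0 → l' w = 0) (r : ℂ) :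
    IsBracket b A c l l' r ↔ r = 0 := by
  have key : ∀ ξ η, IsLift b A c l ξ → IsLift b A c l' η → resPair ξ (nabla A η) = 0 := by
    intro ξ η hξ hη
    rw [← resPair_expAd b S.memF, S.expAd_nabla_eq, S.isLift_iff.1 hξ _ (S.nabla_lift_mem hη)]
    refine hl _ ?_
    have h1 := S.ham_fst_eq_zero hl'
      ⟨η, hη, (isHiggs_iff b).2 (S.neg_nabla_mem hη), (S.ham_of_lift hη).2 rfl⟩
    simpa using h1
  constructor
  · rintro ⟨ξ, η, hξ, hη, h⟩
    rw [← h, key ξ η hξ hη]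
  · rintro rfl
    obtain ⟨ξ, hξ⟩ := S.exists_lift l
    obtain ⟨η, hη⟩ := S.exists_lift l'
    exact ⟨ξ, η, hξ, hη, key ξ η hξ hη⟩

end IsNormalization

theorem exists_normalization (hn : 2 ≤ n) {A : Loop 𝔤} (hA : IsConnB b n A) {c : Coords H n}
    (hc : HasCoords b A c) : ∃ x, IsNormalization b n A x c := by
  obtain ⟨x, hx, hg⟩ := (hasCoords_iff (by omega)).1 hc
  exact ⟨x, hn, hA, hx, hg⟩

/-- The Poisson structure of `𝐂𝐨𝐧𝐧ₙᴮ / Gₙᵁ`. -/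
theorem local_poisson (b : (LieAlgebra.IsKilling.rootSystem H).Base) (m : ℕ) (hm : 2 ≤ m)
    (L : Loop 𝔤) (hL : IsConnB b m L) :
    (∃! c : Coords H m, HasCoords b L c) ∧
      ∀ c : Coords H m, HasCoords b L c →
        (∀ ν, IsHiggs b m ν → ∃! w, HasTangentCoords b L ν c w) ∧
        (∀ l : Coords H m →ₗ[ℂ] ℂ, ∃! w, IsHamVector b L c l w) ∧
        (∀ l l' : Coords H m →ₗ[ℂ] ℂ,
          (∀ w, w.1 = 0 → l w = 0) → (∀ w, w.1 = 0 → l' w = 0) →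
          ∀ r, IsBracket b L c l l' r ↔ r = 0) ∧
        (∀ w, (∃ l : Coords H m →ₗ[ℂ] ℂ, IsHamVector b L c l w) ↔
          ∀ i : Fin m, (i : ℕ) = 0 → w.1 i = 0) ∧
        (∀ w, (∃ l : Coords H m →ₗ[ℂ] ℂ, (∀ w', w'.1 = 0 → l w' = 0) ∧
          IsHamVector b L c l w) ↔ w.1 = 0) := by
  refine ⟨existsUnique_coords hm hL, fun c hc => ?_⟩
  obtain ⟨x, S⟩ := exists_normalization hm hL hc
  refine ⟨fun ν hν => ?_, S.existsUnique_ham, fun l l' hl hl' r => S.bracket_iff hl hl' r,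
    fun w => ⟨?_, fun h => ?_⟩, fun w => ⟨?_, fun h => ?_⟩⟩
  · rw [isHiggs_iff] at hν
    exact ⟨_, (S.tangent_iff hν).2 rfl, fun w hw => (S.tangent_iff hν).1 hw⟩
  · rintro ⟨l, hl⟩
    exact S.ham_residue hl
  · obtain ⟨l, -, hl⟩ := S.exists_ham h
    exact ⟨l, hl⟩
  · rintro ⟨l, hl, hw⟩
    exact S.ham_fst_eq_zero hl hw
  · obtain ⟨l, hl, hl'⟩ := S.exists_ham (fun i _ => congrFun h i)
    exact ⟨l, hl h, hl'⟩

/-- The leading coefficient of the normal form. -/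
theorem regular_leading_coords (hn : 2 ≤ n) {A : Loop 𝔤} (hA : IsConnB b n A) {c : Coords H n}
    (hc : HasCoords b A c) (hi : n - 1 < n) :
    IsRegularSemisimple H ((c.1 ⟨n - 1, hi⟩ : H) : 𝔤) := by
  obtain ⟨x, S⟩ := exists_normalization hn hA hc
  have h1 : ((c.1 ⟨n - 1, hi⟩ : H) : 𝔤) = hpart H (coeff (-n) A) := by
    rw [← coeff_normalForm_neg c ⟨n - 1, hi⟩, ← hpart_leading_gauge b hn S.mem hA.mem_higgs, S.gauge_eq]
    have h2 : -(((n - 1 : ℕ) : ℤ) + 1) = -n := by omega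
    simp only [h2]
    rw [hpart_of_mem (coeff_normalForm_mem c _)]
  rw [h1]
  exact isRegularSemisimple_of_cartan (hpart_mem _) (hA.leadingRegular S.one_le)

end LocalPoisson
end Isostokes

/-! ### Orders of Laurent series and weak approximation at infinity -/

namespace Isostokes

namespace Laurent

/-- The Laurent series of order at least `k`. -/
def ge (k : ℤ) : Submodule ℂ Laurent where
  carrier := {s | ∀ j < k, coeff j s = 0}
  zero_mem' := fun _ _ => map_zero _
  add_mem' := fun hs ht j hj => by rw [map_add, hs j hj, ht j hj, add_zero]
  smul_mem' := fun c s hs j hj => by rw [map_smul, hs j hj, smul_zero]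

theorem ge_anti {k l : ℤ} (h : k ≤ l) : ge l ≤ ge k := fun _ hs j hj => hs j (by omega)

theorem exists_mem_ge (s : Laurent) : ∃ k, s ∈ ge k := exists_bound s

theorem coeff_mul_of_mem_ge {s t : Laurent} {p q : ℤ} (hs : s ∈ ge p) (ht : t ∈ ge q) :
    coeff (p + q) (s * t) = coeff p s * coeff q t := by
  rw [coeff_mul_Icc hs ht, add_sub_cancel_right, Finset.Icc_self, Finset.sum_singleton,
    add_sub_cancel_left]

theorem mul_mem_ge {s t : Laurent} {p q : ℤ} (hs : s ∈ ge p) (ht : t ∈ ge q) :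
    s * t ∈ ge (p + q) := fun k hk => by
  rw [coeff_mul_Icc hs ht, Finset.Icc_eq_empty (by omega), Finset.sum_empty]

theorem algebraMap_mem_ge (c : ℂ) : algebraMap ℂ Laurent c ∈ ge 0 := fun k hk => by
  rw [Algebra.algebraMap_eq_smul_one, map_smul, coeff_one, if_neg hk.ne, smul_zero]

theorem one_mem_ge : (1 : Laurent) ∈ ge 0 := by
  have := algebraMap_mem_ge 1
  rwa [map_one] at this

theorem monomial_mem_ge (k : ℤ) : monomial k ∈ ge k := fun j hj => by
  rw [coeff_monomial, if_neg hj.ne]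

theorem deriv_mem_ge {s : Laurent} {k : ℤ} (hs : s ∈ ge k) : deriv s ∈ ge (k - 1) := fun j hj => by
  rw [coeff_deriv, hs (j + 1) (by omega), mul_zero]

/-- The Laurent series `s` has order `k`. -/
def HasOrd (s : Laurent) (k : ℤ) : Prop := s ∈ ge k ∧ coeff k s ≠ 0

theorem exists_hasOrd {s : Laurent} (hs : s ≠ 0) : ∃ k, HasOrd s k :=
  ⟨HahnSeries.order (Γ := ℤ) s, fun _ hk => HahnSeries.coeff_eq_zero_of_lt_order hk,
    fun h => hs (HahnSeries.coeff_order_eq_zero (Γ := ℤ) (x := s).1 h)⟩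

namespace HasOrd

variable {s t : Laurent} {k l : ℤ}

theorem ne_zero (h : HasOrd s k) : s ≠ 0 := fun h0 => h.2 (by rw [h0, map_zero])

theorem mem_ge_iff (h : HasOrd s k) : s ∈ ge l ↔ l ≤ k :=
  ⟨fun hl => not_lt.1 fun hk => h.2 (hl k hk), fun hl => ge_anti hl h.1⟩

theorem unique (h : HasOrd s k) (h' : HasOrd s l) : k = l :=
  le_antisymm (h'.mem_ge_iff.1 h.1) (h.mem_ge_iff.1 h'.1)

theorem mul (h : HasOrd s k) (h' : HasOrd t l) : HasOrd (s * t) (k + l) :=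
  ⟨mul_mem_ge h.1 h'.1, by rw [coeff_mul_of_mem_ge h.1 h'.1]; exact mul_ne_zero h.2 h'.2⟩

theorem one : HasOrd 1 0 := ⟨one_mem_ge, by simp [coeff_one]⟩

theorem inv (h : HasOrd s k) : HasOrd s⁻¹ (-k) := by
  obtain ⟨l, hl⟩ := exists_hasOrd (inv_ne_zero h.ne_zero)
  have h1 := h.mul hl
  rw [mul_inv_cancel₀ h.ne_zero] at h1
  have := h1.unique one
  rwa [show -k = l by omega]

theorem pow (h : HasOrd s k) (n : ℕ) : HasOrd (s ^ n) (n * k) := by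
  induction n with
  | zero => simpa using one
  | succ n ih => rw [pow_succ, Nat.cast_succ, add_mul, one_mul]; exact ih.mul h

theorem zpow (h : HasOrd s k) (n : ℤ) : HasOrd (s ^ n) (n * k) := by
  obtain ⟨m, rfl | rfl⟩ := n.eq_nat_or_neg
  · rw [zpow_natCast]; exact h.pow m
  · rw [zpow_neg, zpow_natCast, neg_mul]; exact (h.pow m).inv

theorem add (h : HasOrd s k) (ht : t ∈ ge l) (hl : k < l) : HasOrd (s + t) k :=
  ⟨add_mem h.1 (ge_anti hl.le ht), by rw [map_add, ht k hl, add_zero]; exact h.2⟩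

end HasOrd

theorem monomial_hasOrd (k : ℤ) : HasOrd (monomial k) k :=
  ⟨monomial_mem_ge k, by simp [coeff_monomial]⟩

theorem hasOrd_zero_of_notMem {s : Laurent} (h : s ∉ ge 0) : ∃ k < 0, HasOrd s k := by
  obtain ⟨k, hk⟩ := exists_hasOrd (s := s) (fun h0 => h (h0 ▸ zero_mem _))
  exact ⟨k, not_le.1 fun h0 => h (ge_anti h0 hk.1), hk⟩

theorem mul_mem_ge_of_mem_left {s t : Laurent} (hs : s ∈ ge 0) {q : ℤ} (ht : t ∈ ge q) :
    s * t ∈ ge q := by simpa using mul_mem_ge hs ht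

/-- If `s` has a pole, then `s / (1 + s)` is a unit. -/
theorem HasOrd.div_one_add {s : Laurent} {k : ℤ} (h : HasOrd s k) (hk : k < 0) :
    HasOrd (s * (1 + s)⁻¹) 0 := by
  have := h.mul (add_comm s 1 ▸ (h.add one_mem_ge hk)).inv
  simpa using this

/-- If `s` has a zero, then `s / (1 + s)` has the same order. -/
theorem HasOrd.div_one_add_of_pos {s : Laurent} {k : ℤ} (h : HasOrd s k) (hk : 0 < k) :
    HasOrd (s * (1 + s)⁻¹) k := by
  have := h.mul (HasOrd.one.add h.1 hk).inv
  simpa using this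

end Laurent

namespace Completion

open Laurent

variable {A : Type} [CommRing A] [IsDomain A] [Algebra ℂ A] {ι : Type} (X : Completion A ι)

theorem exists_hasOrd {f : FractionRing A} (hf : f ≠ 0) (i : ι) : ∃ k, HasOrd (X.expand i f) k :=
  Laurent.exists_hasOrd ((map_ne_zero _).2 hf)

/-- Separation in both directions gives `f` with a pole at `x_i`, integral at `x_j`, and `g` with
the roles exchanged; the quotient `f / g` has both properties. -/
theorem exists_pole_zero {i j : ι} (h : i ≠ j) :
    ∃ f, (∃ k < 0, HasOrd (X.expand i f) k) ∧ ∃ k > 0, HasOrd (X.expand j f) k := by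
  obtain ⟨f, hf, k, hk, hfk⟩ := X.separated j i h.symm
  obtain ⟨g, hg, l, hl, hgl⟩ := X.separated i j h
  obtain ⟨k', hk', hf'⟩ := hasOrd_zero_of_notMem (s := X.expand i f) fun h0 => hfk (h0 k hk)
  obtain ⟨l', hl', hg'⟩ := hasOrd_zero_of_notMem (s := X.expand j g) fun h0 => hgl (h0 l hl)
  have hf0 : f ≠ 0 := fun h0 => hf'.ne_zero (by rw [h0, map_zero])
  have hg0 : g ≠ 0 := fun h0 => hg'.ne_zero (by rw [h0, map_zero])
  obtain ⟨p, hp⟩ := X.exists_hasOrd hf0 j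
  obtain ⟨q, hq⟩ := X.exists_hasOrd hg0 i
  have hp0 : 0 ≤ p := hp.mem_ge_iff.1 hf
  have hq0 : 0 ≤ q := hq.mem_ge_iff.1 hg
  refine ⟨f * g⁻¹, ⟨k' + -q, by omega, ?_⟩, ⟨p + -l', by omega, ?_⟩⟩
  · rw [map_mul, map_inv₀]; exact hf'.mul hq.inv
  · rw [map_mul, map_inv₀]; exact hp.mul hg'.inv

/-- Independence of valuations, by adding one point `x_j` at a time. If the function `w` so far
obtained has no pole at `x_j`, then `w ^ M h` works, with `h` separating `x_i` from `x_j`. Otherwise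
`w ^ M` is replaced by `w ^ M / (1 + w ^ M)`, a unit at every pole of `w`. A large `M` outweighs the
poles of `h` at the old points. -/
theorem exists_pole_zeros [DecidableEq ι] (i : ι) (S : Finset ι) (hi : i ∉ S) :
    ∃ f, (∃ k < 0, HasOrd (X.expand i f) k) ∧ ∀ j ∈ S, ∃ k > 0, HasOrd (X.expand j f) k := by
  induction S using Finset.induction_on with
  | empty =>
    obtain ⟨f, hf, hf'⟩ := X.exists_uniformizer i
    refine ⟨f⁻¹, ⟨-1, by omega, ?_⟩, by simp⟩
    rw [map_inv₀]
    exact HasOrd.inv ⟨hf', hf⟩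
  | insert j S hj ih =>
    obtain ⟨w, ⟨k, hk, hw⟩, hS⟩ := ih fun h => hi (Finset.mem_insert_of_mem h)
    obtain ⟨h, ⟨k', hk', hh⟩, l', hl', hh'⟩ :=
      X.exists_pole_zero (i := i) (j := j) fun h => hi (h ▸ Finset.mem_insert_self _ _)
    have hw0 : w ≠ 0 := fun h0 => hw.ne_zero (by rw [h0, map_zero])
    have hh0 : h ≠ 0 := fun h0 => hh.ne_zero (by rw [h0, map_zero])
    have hM : ∃ M : ℕ, 1 ≤ M ∧ ∀ a ∈ S, ∀ q, HasOrd (X.expand a h) q → 0 < (M : ℤ) + q := by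
      choose q hq using X.exists_hasOrd hh0
      refine ⟨1 + ∑ a ∈ S, (q a).natAbs, by omega, fun a ha p hp => ?_⟩
      have h1 := Finset.single_le_sum (f := fun a => (q a).natAbs) (fun _ _ => Nat.zero_le _) ha
      have h2 := hp.unique (hq a)
      omega
    obtain ⟨M, hM1, hM⟩ := hM
    obtain ⟨l, hl⟩ := X.exists_hasOrd hw0 j
    have hMk : (M : ℤ) * k < 0 := mul_neg_of_pos_of_neg (by omega) hk
    rcases lt_or_ge l 0 with hl0 | hl0
    · refine ⟨w ^ M * (1 + w ^ M)⁻¹ * h, ⟨k', hk', ?_⟩, fun a ha => ?_⟩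
      · simp only [map_mul, map_inv₀, map_add, map_one, map_pow]
        simpa using ((hw.pow M).div_one_add hMk).mul hh
      · simp only [map_mul, map_inv₀, map_add, map_one, map_pow]
        rcases Finset.mem_insert.1 ha with rfl | ha
        · refine ⟨l', hl', ?_⟩
          simpa using ((hl.pow M).div_one_add (mul_neg_of_pos_of_neg (by omega) hl0)).mul hh'
        · obtain ⟨p, hp, hwp⟩ := hS a ha
          obtain ⟨q, hq⟩ := X.exists_hasOrd hh0 a
          refine ⟨_, ?_, ((hwp.pow M).div_one_add_of_pos (mul_pos (by omega) hp)).mul hq⟩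
          have := hM a ha q hq
          nlinarith
    · refine ⟨w ^ M * h, ⟨_, ?_, by rw [map_mul, map_pow]; exact (hw.pow M).mul hh⟩, fun a ha => ?_⟩
      · omega
      · rw [map_mul, map_pow]
        rcases Finset.mem_insert.1 ha with rfl | ha
        · refine ⟨_, ?_, (hl.pow M).mul hh'⟩
          have := mul_nonneg (Int.natCast_nonneg M) hl0
          omega
        · obtain ⟨p, hp, hwp⟩ := hS a ha
          obtain ⟨q, hq⟩ := X.exists_hasOrd hh0 a
          refine ⟨_, ?_, (hwp.pow M).mul hq⟩
          have := hM a ha q hq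
          nlinarith

variable [Fintype ι]

/-- For `w` with a pole at `x_i` and zeros elsewhere, `w / (1 + w)` is a unit at `x_i` and still
vanishes elsewhere. A high power of it times `π ^ k`, with `π` a uniformizer at `x_i`, has the
required orders. -/
theorem exists_hasOrd_and_mem_ge (i : ι) (k L : ℤ) :
    ∃ f, HasOrd (X.expand i f) k ∧ ∀ j ≠ i, X.expand j f ∈ ge L := by
  classical
  obtain ⟨w, ⟨p, hp, hw⟩, hS⟩ := X.exists_pole_zeros i (Finset.univ.erase i) (by simp)
  obtain ⟨π, hπ, hπ'⟩ := X.exists_uniformizer i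
  have hπ1 : HasOrd (X.expand i π) 1 := ⟨hπ', hπ⟩
  have hπ0 : π ≠ 0 := fun h0 => hπ1.ne_zero (by rw [h0, map_zero])
  choose q hq using X.exists_hasOrd (zpow_ne_zero k hπ0)
  let M : ℕ := L.natAbs + ∑ a, (q a).natAbs
  refine ⟨(w * (1 + w)⁻¹) ^ M * π ^ k, ?_, fun j hj => ?_⟩
  · simp only [map_mul, map_inv₀, map_add, map_one, map_pow, map_zpow₀]
    simpa using ((hw.div_one_add hp).pow M).mul (hπ1.zpow k)
  · obtain ⟨l, hl, hwl⟩ := hS j (by simp [hj])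
    have h1 := ((hwl.div_one_add_of_pos hl).pow M).mul (hq j)
    rw [map_mul, map_pow, map_mul, map_inv₀, map_add, map_one, h1.mem_ge_iff]
    have h2 := Finset.single_le_sum (f := fun a => (q a).natAbs) (fun _ _ => Nat.zero_le _)
      (Finset.mem_univ j)
    have h3 : (M : ℤ) ≤ M * l := le_mul_of_one_le_right (by omega) (by omega)
    have h4 : (M : ℤ) = L.natAbs + (∑ a, (q a).natAbs : ℕ) := by simp [M]
    omega

theorem exists_approx_one (i : ι) (s : Laurent) (L : ℤ) :
    ∃ f, X.expand i f - s ∈ ge L ∧ ∀ j ≠ i, X.expand j f ∈ ge L := by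
  obtain ⟨p, hp⟩ := exists_mem_ge s
  obtain ⟨m, hm⟩ : ∃ m : ℕ, L ≤ p + m := ⟨(L - p).toNat, by omega⟩
  induction m generalizing s p with
  | zero =>
    refine ⟨0, ?_, fun j _ => by rw [map_zero]; exact zero_mem _⟩
    rw [map_zero, zero_sub]
    exact neg_mem (ge_anti (by simpa using hm) hp)
  | succ m ih =>
    obtain ⟨f, hf, hf'⟩ := X.exists_hasOrd_and_mem_ge i p L
    set c := Laurent.coeff p s / Laurent.coeff p (X.expand i f) with hc
    obtain ⟨g, hg, hg'⟩ := ih (s - c • X.expand i f) (p + 1) (fun k hk => by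
      rcases lt_or_eq_of_le (Int.lt_add_one_iff.1 hk) with h | rfl
      · rw [map_sub, map_smul, hp k h, hf.1 k h, smul_zero, sub_zero]
      · rw [map_sub, map_smul, hc, smul_eq_mul, div_mul_cancel₀ _ hf.2, sub_self])
      (by push_cast at hm; omega)
    refine ⟨g + c • f, ?_, fun j hj => ?_⟩
    · rw [map_add, map_smul]
      convert hg using 1
      ring
    · rw [map_add, map_smul]
      exact add_mem (hg' j hj) (Submodule.smul_mem _ _ (hf' j hj))

/-- Weak approximation at the points at infinity. -/
theorem exists_approx (y : ι → Laurent) (L : ℤ) : ∃ f, ∀ i, X.expand i f - y i ∈ ge L := by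
  classical
  choose f hf hf' using fun i => X.exists_approx_one i (y i) L
  refine ⟨∑ i, f i, fun i => ?_⟩
  rw [map_sum, ← Finset.add_sum_erase _ _ (Finset.mem_univ i), add_sub_right_comm]
  exact add_mem (hf i) (sum_mem fun j hj => hf' j i (Finset.ne_of_mem_erase hj).symm)

end Completion
end Isostokes

/-! ### Regular functions with poles at infinity -/

namespace Isostokes

namespace Completion

open Laurent

variable {A : Type} [CommRing A] [IsDomain A] [Algebra ℂ A] {ι : Type} (X : Completion A ι)

theorem expandFun_apply (i : ι) (a : A) :
    X.expandFun i a = X.expand i (algebraMap A (FractionRing A) a) := rfl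

theorem expandFun_injective (i : ι) : Function.Injective (X.expandFun i) :=
  (X.expand i).toRingHom.injective.comp (IsFractionRing.injective A (FractionRing A))

/-- A rational function that is integral at all points at infinity at which the given function `t`
is integral is integral over `ℂ[t]` if it is regular elsewhere. -/
theorem isIntegral_of_forall (R : Subalgebra ℂ A) (a : A)
    (h : ∀ i, (∀ r ∈ R, X.expandFun i r ∈ ge 0) → X.expandFun i a ∈ ge 0) : IsIntegral R a := by
  let K := FractionRing A
  let S : Set K := algebraMap A K '' (R : Set A)
  have h1 : algebraMap A K a ∈ (integralClosure (Subring.closure S) K).toSubring := by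
    -- The integral closure is the intersection of the valuation rings containing `R`. Such a ring
    -- contains `A`, or else it is the ring of a point at infinity, by `exhaust`.
    rw [← iInf_valuationSubring_superset, Subring.mem_iInf]
    rintro ⟨V, hV⟩
    by_cases hA : ∃ a : A, algebraMap A K a ∉ V
    · obtain ⟨i, hi⟩ := X.exhaust V (fun c => hV ⟨algebraMap ℂ A c, R.algebraMap_mem c, rfl⟩) hA
      exact (hi _).2 (h i fun r hr => (hi _).1 (hV ⟨r, hr, rfl⟩))
    · push Not at hA
      exact hA a
  have hS : Subring.closure S = R.toSubring.map (algebraMap A K) := by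
    have : S = (R.toSubring.map (algebraMap A K) : Set K) := by ext; simp [S]
    rw [this, Subring.closure_eq]
  rw [hS] at h1
  obtain ⟨p, hp, hpa⟩ := h1
  have hmem : ∀ x : R.toSubring.map (algebraMap A K), ∃ r : R, algebraMap A K r = x.1 := by
    rintro ⟨_, r, hr, rfl⟩; exact ⟨⟨r, hr⟩, rfl⟩
  -- The integral equation obtained has coefficients in the image of `R` in the function field; it
  -- is lifted to a monic polynomial over `R`.
  let φ : R →+* R.toSubring.map (algebraMap A K) :=
    ((algebraMap A K).comp R.toSubring.subtype).codRestrict _ fun r => ⟨r.1, r.2, rfl⟩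
  have hφ : Function.Surjective φ := fun x => by
    obtain ⟨r, hr⟩ := hmem x
    exact ⟨r, Subtype.ext hr⟩
  obtain ⟨q, hq, -, hqm⟩ := Polynomial.lifts_and_natDegree_eq_and_monic
    ((Polynomial.mem_lifts p).2 (Polynomial.map_surjective φ hφ p)) hp
  refine ⟨q, hqm, IsFractionRing.injective A K ?_⟩
  rw [map_zero, ← hpa, ← hq, Polynomial.eval₂_map, Polynomial.hom_eval₂]
  rfl

/-- Regular functions without poles are constant. -/
theorem exists_eq_algebraMap {a : A} (h : ∀ i, X.expandFun i a ∈ ge 0) :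
    ∃ c, a = algebraMap ℂ A c := by
  have h1 : IsIntegral (⊥ : Subalgebra ℂ A) a := X.isIntegral_of_forall ⊥ a fun i _ => h i
  have h2 : IsIntegral ℂ a := by
    have : Algebra.IsIntegral ℂ (⊥ : Subalgebra ℂ A) :=
      ⟨fun x => by
        obtain ⟨c, hc⟩ := Algebra.mem_bot.1 x.2
        have : x = algebraMap ℂ _ c := Subtype.ext hc.symm
        rw [this]
        exact isIntegral_algebraMap⟩
    exact isIntegral_trans a h1
  have : Algebra.IsIntegral ℂ (Algebra.adjoin ℂ {a}) := Algebra.IsIntegral.adjoin (by simpa using h2)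
  obtain ⟨c, hc⟩ := (IsAlgClosed.algebraMap_bijective_of_isIntegral (k := ℂ)
    (K := Algebra.adjoin ℂ {a})).2 ⟨a, Algebra.self_mem_adjoin_singleton ℂ a⟩
  exact ⟨c, (congrArg Subtype.val hc).symm⟩

variable [Fintype ι]

/-- There is a regular function with a pole at every point at infinity. -/
theorem exists_pole : ∃ t : A, ∀ i, X.expandFun i t ∉ ge 0 := by
  by_contra! h
  -- For each `i` the functions without a pole at `x_i` form a proper subspace, and a vector space
  -- over an infinite field is not a finite union of proper subspaces.
  obtain ⟨i, hi⟩ := Subspace.exists_eq_top_of_iUnion_eq_univ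
    (p := fun i => (ge 0).comap (X.expandFun i).toLinearMap) (by
      ext a
      simp only [Set.mem_iUnion, Set.mem_univ, iff_true]
      exact h a)
  obtain ⟨a, k, hk, ha⟩ := X.not_mem i
  have : a ∈ (ge 0).comap (X.expandFun i).toLinearMap := by rw [hi]; trivial
  exact ha (this k hk)

theorem isIntegral_adjoin {t : A} (ht : ∀ i, X.expandFun i t ∉ ge 0) :
    Algebra.IsIntegral (Algebra.adjoin ℂ {t}) A :=
  ⟨fun a => X.isIntegral_of_forall _ a fun i h =>
    absurd (h t (Algebra.self_mem_adjoin_singleton ℂ t)) (ht i)⟩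

theorem finite_adjoin [Algebra.FiniteType ℂ A] {t : A} (ht : ∀ i, X.expandFun i t ∉ ge 0) :
    Module.Finite (Algebra.adjoin ℂ {t}) A := by
  have := X.isIntegral_adjoin ht
  have : Algebra.FiniteType (Algebra.adjoin ℂ {t}) A :=
    Algebra.FiniteType.of_restrictScalars_finiteType ℂ _ _
  exact Algebra.IsIntegral.finite

theorem HasOrd.aeval {s : Laurent} {k : ℤ} (hs : HasOrd s k) (hk : k < 0) {p : Polynomial ℂ}
    (hp : p ≠ 0) : HasOrd (Polynomial.aeval s p) (p.natDegree * k) := by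
  induction h : p.natDegree using Nat.strong_induction_on generalizing p with
  | _ d ih =>
    rw [← p.eraseLead_add_C_mul_X_pow, map_add, add_comm]
    have hlead : HasOrd (Polynomial.aeval s (Polynomial.C p.leadingCoeff * Polynomial.X ^ p.natDegree))
        (d * k) := by
      rw [map_mul, Polynomial.aeval_C, map_pow, Polynomial.aeval_X, h, ← Algebra.smul_def]
      exact ⟨Submodule.smul_mem _ _ (hs.pow d).1, by
        rw [map_smul]; exact mul_ne_zero (Polynomial.leadingCoeff_ne_zero.2 hp) (hs.pow d).2⟩
    by_cases h0 : p.eraseLead = 0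
    · rw [h0, map_zero, add_zero]; exact hlead
    · have hd : p.eraseLead.natDegree < d := by
        rcases p.eraseLead_natDegree_lt_or_eraseLead_eq_zero with h' | h'
        · exact h ▸ h'
        · exact absurd h' h0
      refine hlead.add (ih _ hd h0 rfl).1 ?_
      have : (p.eraseLead.natDegree : ℤ) < d := by exact_mod_cast hd
      nlinarith

theorem aeval_div_mem_ge {s : Laurent} {k : ℤ} (hs : HasOrd s k) (hk : k < 0) {p q : Polynomial ℂ}
    (hp : p ≠ 0) (hq : q.degree < p.degree) :
    Polynomial.aeval s q * (Polynomial.aeval s p)⁻¹ ∈ ge 0 := by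
  by_cases hq0 : q = 0
  · rw [hq0, map_zero, zero_mul]; exact zero_mem _
  · rw [((HasOrd.aeval hs hk hq0).mul (HasOrd.aeval hs hk hp).inv).mem_ge_iff]
    have : (q.natDegree : ℤ) ≤ p.natDegree := by
      exact_mod_cast (Polynomial.natDegree_lt_natDegree hq0 hq).le
    nlinarith

/-- Every family of Laurent series is the sum of a regular function and a family with poles of
bounded order. -/
theorem exists_approx_regular [Algebra.FiniteType ℂ A] :
    ∃ m : ℤ, ∀ y : ι → Laurent, ∃ a : A, ∀ i, X.expandFun i a - y i ∈ ge (-m) := by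
  obtain ⟨t, ht⟩ := X.exists_pole
  have hint := X.isIntegral_adjoin ht
  have hfin := X.finite_adjoin ht
  obtain ⟨S, hS⟩ := hfin.fg_top
  obtain ⟨m, hm0, hm⟩ : ∃ m : ℤ, 0 ≤ m ∧ ∀ w ∈ S, ∀ i, X.expandFun i w ∈ ge (-m) := by
    choose k hk using fun (w : A) (i : ι) => exists_mem_ge (X.expandFun i w)
    refine ⟨∑ w ∈ S, ∑ i, ((k w i).natAbs : ℤ),
      Finset.sum_nonneg fun _ _ => Finset.sum_nonneg fun _ _ => by positivity,
      fun w hw i => ge_anti ?_ (hk w i)⟩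
    have h1 := Finset.single_le_sum (f := fun w => ∑ i, ((k w i).natAbs : ℤ))
      (fun w _ => Finset.sum_nonneg fun _ _ => by positivity) hw
    have h2 := Finset.single_le_sum (f := fun i => ((k w i).natAbs : ℤ)) (fun i _ => by positivity)
      (Finset.mem_univ i)
    have h3 := h2.trans h1
    omega
  refine ⟨m, fun y => ?_⟩
  obtain ⟨f, hf⟩ := X.exists_approx y 0
  obtain ⟨a₀, s, hs, rfl⟩ := IsFractionRing.div_surjective (A := A) f
  -- The denominator divides a nonzero polynomial `p(t)`, since `A` is integral over `ℂ[t]`. Thus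
  -- the approximating rational function is `a₀ a₁ / p(t)`.
  obtain ⟨r, hr0, a₁, ha₁⟩ := (hint.1 s).isAlgebraic.exists_nonzero_dvd hs
  have hadj : ∀ r : Algebra.adjoin ℂ {t}, ∃ p : Polynomial ℂ, Polynomial.aeval t p = (r : A) :=
    fun r => by
      have h := r.2
      exact (AlgHom.mem_range _).1 (Algebra.adjoin_singleton_eq_range_aeval ℂ t ▸ h)
  obtain ⟨p, hp⟩ := hadj r
  have hp0 : p ≠ 0 := fun h0 => hr0 (Subtype.ext (by rw [← hp, h0, map_zero]; rfl))
  -- For a module generator `w`, division with remainder splits `q(t) w / p(t)` into a regular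
  -- function and `w` times a proper fraction in `t`. The fraction has no pole at infinity, so the
  -- error is bounded by the poles of the finitely many generators.
  have key : ∀ x : A, ∀ q : Polynomial ℂ, ∃ a : A, ∀ i, X.expandFun i a -
      X.expandFun i (Polynomial.aeval t q * x) * (Polynomial.aeval (X.expandFun i t) p)⁻¹ ∈
        ge (-m) := by
    intro x
    have hx : x ∈ Submodule.span (Algebra.adjoin ℂ {t}) (S : Set A) := by rw [hS]; trivial
    induction hx using Submodule.span_induction with
    | zero => exact fun q => ⟨0, fun i => by simp⟩
    | add x y _ _ hx hy =>
      intro q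
      obtain ⟨a, ha⟩ := hx q
      obtain ⟨b, hb⟩ := hy q
      refine ⟨a + b, fun i => ?_⟩
      convert add_mem (ha i) (hb i) using 1
      rw [mul_add, map_add, map_add]
      ring
    | smul r x _ hx =>
      intro q
      obtain ⟨q', hq'⟩ := hadj r
      obtain ⟨a, ha⟩ := hx (q * q')
      refine ⟨a, fun i => ?_⟩
      have h : Polynomial.aeval t q * r • x = Polynomial.aeval t (q * q') * x := by
        rw [map_mul, hq', mul_assoc]; rfl
      rw [h]
      exact ha i
    | mem w hw =>
      intro q
      refine ⟨Polynomial.aeval t (q / p) * w, fun i => ?_⟩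
      obtain ⟨k, hk, htk⟩ := hasOrd_zero_of_notMem (ht i)
      have h1 := mul_mem_ge_of_mem_left (neg_mem (aeval_div_mem_ge htk hk hp0
        (EuclideanDomain.mod_lt q hp0))) (hm w hw i)
      convert h1 using 1
      have h2 := congrArg (Polynomial.aeval (X.expandFun i t)) (EuclideanDomain.div_add_mod q p)
      rw [map_add, map_mul] at h2
      have h3 := (HasOrd.aeval htk hk hp0).ne_zero
      simp only [map_mul, ← Polynomial.aeval_algHom_apply]
      rw [← h2]
      field_simp
      ring
  obtain ⟨a, ha⟩ := key (a₀ * a₁) 1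
  refine ⟨a, fun i => ?_⟩
  convert add_mem (ha i) (ge_anti (by omega) (hf i)) using 1
  have hs0 : X.expandFun i s ≠ 0 :=
    (map_ne_zero_iff _ (X.expandFun_injective i)).2 (nonZeroDivisors.ne_zero hs)
  have h1 : Polynomial.aeval (X.expandFun i t) p = X.expandFun i s * X.expandFun i a₁ := by
    rw [Polynomial.aeval_algHom_apply, hp, ← map_mul, ← ha₁]; rfl
  have h2 : X.expandFun i a₁ ≠ 0 := fun h0 => by
    obtain ⟨k, hk, htk⟩ := hasOrd_zero_of_notMem (ht i)
    exact (HasOrd.aeval htk hk hp0).ne_zero (by rw [h1, h0, mul_zero])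
  rw [h1, map_div₀, ← expandFun_apply, ← expandFun_apply, map_one, one_mul, map_mul]
  field_simp
  ring

end Completion
end Isostokes

/-! ### The residue theorem -/

namespace Isostokes

namespace Laurent

/-- The part of a Laurent series of order less than `k`. -/
def below (k : ℤ) : Laurent →ₗ[ℂ] Laurent where
  toFun s := ofCoeffs (fun j => if j < k then coeff j s else 0) (exists_bound s).choose
    fun j hj => by rw [(exists_bound s).choose_spec j hj, ite_self]
  map_add' s t := by
    ext j
    simp only [coeff_ofCoeffs, map_add]
    split_ifs <;> simp
  map_smul' c s := by
    ext j
    simp only [coeff_ofCoeffs, map_smul, RingHom.id_apply]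
    split_ifs <;> simp

theorem coeff_below (k j : ℤ) (s : Laurent) :
    coeff j (below k s) = if j < k then coeff j s else 0 := rfl

theorem sub_below_mem_ge (k : ℤ) (s : Laurent) : s - below k s ∈ ge k := fun j hj => by
  rw [map_sub, coeff_below, if_pos hj, sub_self]

theorem below_eq_zero {k : ℤ} {s : Laurent} (hs : s ∈ ge k) : below k s = 0 := by
  ext j
  rw [coeff_below, map_zero]
  split_ifs with h
  · exact hs j h
  · rfl

/-- A diagonal entry in the trace computation: `z ^ (-m-1-e)` is multiplied by `s`, the part below
order `-m` is dropped, and `t` leads back to the same monomial. Only the products of the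
coefficients of `s` at `d` and of `t` at `-d` with `d > e` pass. -/
theorem coeff_mul_truncation {s t : Laurent} {N : ℕ} (ht : t ∈ ge (-N)) (m : ℤ) (e : ℕ) :
    coeff (-m - 1 - e) (t * (s * monomial (-m - 1 - e) - below (-m) (s * monomial (-m - 1 - e)))) =
      ∑ d ∈ Finset.Icc (e + 1) N, coeff d s * coeff (-d) t := by
  rw [mul_comm t, coeff_mul_Icc (sub_below_mem_ge _ _) ht]
  refine Finset.sum_nbij' (fun k => (k + m + 1 + e).toNat) (fun d => (d : ℤ) - m - 1 - e) ?_ ?_ ?_ ?_ ?_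
  · intro k hk
    simp only [Finset.mem_Icc] at hk ⊢
    omega
  · intro d hd
    simp only [Finset.mem_Icc] at hd ⊢
    omega
  · intro k hk
    simp only [Finset.mem_Icc] at hk
    omega
  · intro d hd
    omega
  · intro k hk
    simp only [Finset.mem_Icc] at hk
    have h1 : ((k + m + 1 + e).toNat : ℤ) = k + m + 1 + e := by omega
    rw [map_sub, coeff_below, if_neg (by omega), sub_zero, mul_comm s, coeff_monomial_mul, h1]
    congr 3 <;> ring

theorem sum_range_sum_Icc (x : ℕ → ℂ) (N : ℕ) :
    ∑ e ∈ Finset.range N, ∑ d ∈ Finset.Icc (e + 1) N, x d = ∑ d ∈ Finset.Icc 1 N, d * x d := by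
  rw [Finset.sum_comm' (s' := fun d => Finset.range d) (t' := Finset.Icc 1 N)]
  · simp
  · intro e d
    simp only [Finset.mem_range, Finset.mem_Icc]
    omega

theorem coeff_mul_deriv {s t : Laurent} {N : ℕ} (hs : s ∈ ge (-N)) (ht : t ∈ ge (-N)) :
    coeff (-1) (s * deriv t) = ∑ d ∈ Finset.Icc 1 N, (d : ℂ) * (coeff d t * coeff (-d) s) -
      ∑ d ∈ Finset.Icc 1 N, (d : ℂ) * (coeff d s * coeff (-d) t) := by
  rw [coeff_mul_Icc hs (deriv_mem_ge ht)]
  have h0 : ∀ i : ℤ, coeff i s * coeff (-1 - i) (deriv t) = -(i * (coeff i s * coeff (-i) t)) := by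
    intro i
    rw [coeff_deriv, show -1 - i + 1 = -i by ring]
    push_cast
    ring
  have h1 : Finset.Icc (-(N : ℤ)) (-1 - (-N - 1)) =
      ((Finset.Icc 1 N).image fun d : ℕ => -(d : ℤ)) ∪ ({0} ∪ (Finset.Icc 1 N).image fun d : ℕ => (d : ℤ)) := by
    ext k
    simp only [Finset.mem_Icc, Finset.mem_union, Finset.mem_image, Finset.mem_singleton]
    constructor
    · intro h
      rcases lt_trichotomy k 0 with h' | h' | h'
      · exact Or.inl ⟨k.natAbs, by omega, by omega⟩
      · exact Or.inr (Or.inl h')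
      · exact Or.inr (Or.inr ⟨k.natAbs, by omega, by omega⟩)
    · rintro (⟨d, h, rfl⟩ | rfl | ⟨d, h, rfl⟩) <;> omega
  have h2 : Disjoint ((Finset.Icc 1 N).image fun d : ℕ => -(d : ℤ))
      ({0} ∪ (Finset.Icc 1 N).image fun d : ℕ => (d : ℤ)) := by
    rw [Finset.disjoint_left]
    intro k
    simp only [Finset.mem_Icc, Finset.mem_union, Finset.mem_image, Finset.mem_singleton]
    rintro ⟨d, h, rfl⟩ (h' | ⟨d', h', h''⟩) <;> omega
  have h3 : Disjoint ({0} : Finset ℤ) ((Finset.Icc 1 N).image fun d : ℕ => (d : ℤ)) := by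
    rw [Finset.disjoint_left]
    intro k
    simp only [Finset.mem_Icc, Finset.mem_image, Finset.mem_singleton]
    rintro rfl ⟨d', h', h''⟩
    omega
  rw [Finset.sum_congr rfl fun i _ => h0 i, h1, Finset.sum_union h2, Finset.sum_union h3,
    Finset.sum_image (fun a _ b _ h => by simpa using h),
    Finset.sum_image (fun a _ b _ h => by simpa using h), Finset.sum_neg_distrib,
    Finset.sum_neg_distrib, Finset.sum_singleton]
  push_cast
  simp only [neg_neg, neg_mul, zero_mul, neg_zero, zero_add, Finset.sum_neg_distrib]
  rw [sub_eq_add_neg]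
  congr 2
  funext d
  ring

end Laurent

namespace Completion

open Laurent

variable {A : Type} [CommRing A] [IsDomain A] [Algebra ℂ A] {ι : Type} (X : Completion A ι)
  [Fintype ι]

/-- The approximations can be chosen linearly, as a section of a surjection of vector spaces.
Linearity is what allows traces to be taken. -/
theorem exists_section [Algebra.FiniteType ℂ A] : ∃ m : ℤ, ∃ σ : (ι → Laurent) →ₗ[ℂ] A,
    ∀ y i, X.expandFun i (σ y) - y i ∈ ge (-m) := by
  obtain ⟨m, hm⟩ := X.exists_approx_regular
  let P : Submodule ℂ (ι → Laurent) := Submodule.pi Set.univ fun _ => ge (-m)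
  let D : A →ₗ[ℂ] (ι → Laurent) := LinearMap.pi fun i => (X.expandFun i).toLinearMap
  obtain ⟨g, hg⟩ := (P.mkQ ∘ₗ D).exists_rightInverse_of_surjective (by
    rw [LinearMap.range_eq_top]
    intro y
    obtain ⟨y, rfl⟩ := P.mkQ_surjective y
    obtain ⟨a, ha⟩ := hm y
    refine ⟨a, ?_⟩
    rw [LinearMap.comp_apply, Submodule.mkQ_apply, Submodule.mkQ_apply, Submodule.Quotient.eq]
    exact fun i _ => ha i)
  refine ⟨m, g ∘ₗ P.mkQ, fun y i => ?_⟩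
  have h := LinearMap.congr_fun hg (P.mkQ y)
  rw [LinearMap.comp_apply, LinearMap.comp_apply, LinearMap.id_apply, Submodule.mkQ_apply,
    Submodule.mkQ_apply, Submodule.Quotient.eq] at h
  exact h i trivial

/-- The regular functions with poles of order at most `m`. -/
def sections (m : ℤ) : Submodule ℂ A := ⨅ i, (ge (-m)).comap (X.expandFun i).toLinearMap

theorem mem_sections {m : ℤ} {a : A} : a ∈ X.sections m ↔ ∀ i, X.expandFun i a ∈ ge (-m) := by
  simp [sections, Submodule.mem_iInf]

/-- The coefficients of orders `-m` to `0` are a finite set of data; if they vanish, the function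
has no poles, hence is constant, and it vanishes at a point. -/
theorem finite_sections [Nonempty ι] (m : ℤ) : Module.Finite ℂ (X.sections m) := by
  let f : X.sections m →ₗ[ℂ] (ι × Finset.Icc (-m) 0 → ℂ) :=
    LinearMap.pi fun r => (Laurent.coeff r.2) ∘ₗ (X.expandFun r.1).toLinearMap ∘ₗ (X.sections m).subtype
  refine Module.Finite.of_injective f ((injective_iff_map_eq_zero f).2 fun a ha => ?_)
  have h : ∀ i, ∀ k < 1, Laurent.coeff k (X.expandFun i a) = 0 := by
    intro i k hk
    by_cases hm : k < -m
    · exact X.mem_sections.1 a.2 i k hm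
    · exact congrFun ha (i, ⟨k, by simp only [Finset.mem_Icc]; omega⟩)
  obtain ⟨c, hc⟩ := X.exists_eq_algebraMap (a := a) fun i k hk => h i k (by omega)
  have i := Classical.arbitrary ι
  have h0 := h i 0 (by omega)
  rw [hc, AlgHom.commutes, Algebra.algebraMap_eq_smul_one, map_smul, coeff_one, if_pos rfl,
    smul_eq_mul, mul_one] at h0
  rw [h0, map_zero] at hc
  exact Subtype.ext hc

/-- The sum of the residues of `a db` is zero. -/
theorem sum_residue_eq_zero [Algebra.FiniteType ℂ A] [Nonempty ι] (a b : A) :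
    ∑ i, Laurent.coeff (-1) (X.expandFun i a * Laurent.deriv (X.expandFun i b)) = 0 := by
  classical
  obtain ⟨m₀, σ, hσ⟩ := X.exists_section
  obtain ⟨N, haN, hbN⟩ : ∃ N : ℕ, (∀ i, X.expandFun i a ∈ ge (-N)) ∧ ∀ i, X.expandFun i b ∈ ge (-N) := by
    choose p hp using fun i => exists_mem_ge (X.expandFun i a)
    choose q hq using fun i => exists_mem_ge (X.expandFun i b)
    refine ⟨∑ i, ((p i).natAbs + (q i).natAbs), fun i => ge_anti ?_ (hp i), fun i => ge_anti ?_ (hq i)⟩ <;>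
    · have h := Finset.single_le_sum (f := fun i => (p i).natAbs + (q i).natAbs)
        (fun _ _ => Nat.zero_le _) (Finset.mem_univ i)
      omega
  -- The section is exact up to order `-m₀`; multiplying the error by `a` and by `b` costs `N` each,
  -- and the result must not reach below order `-m`.
  let m : ℤ := m₀ + 2 * N
  let V := X.sections m
  have hfin : Module.Finite ℂ V := X.finite_sections m
  let D : A →ₗ[ℂ] (ι → Laurent) := LinearMap.pi fun i => (X.expandFun i).toLinearMap
  let pol : (ι → Laurent) →ₗ[ℂ] (ι → Laurent) := LinearMap.pi fun i => below (-m) ∘ₗ LinearMap.proj i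
  -- A projection of all regular functions onto those with poles of order at most `m`.
  let p : A →ₗ[ℂ] A := LinearMap.id - σ ∘ₗ pol ∘ₗ D
  have hp : ∀ x, p x ∈ V := fun x => X.mem_sections.2 fun i => by
    have h1 := sub_below_mem_ge (-m) (X.expandFun i x)
    have h2 := ge_anti (show -m ≤ -m₀ by omega) (hσ (pol (D x)) i)
    convert sub_mem h1 h2 using 1
    change X.expandFun i (x - σ (pol (D x))) = _
    rw [map_sub]
    change _ = _ - (X.expandFun i (σ (pol (D x))) - below (-m) (X.expandFun i x))
    ring
  -- Multiplication by `a` or `b` takes the functions in `V` out of `V` only through the `N` orders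
  -- just below `-m`; `κ` reads off these coefficients and `j` restores them.
  let j : (ι × Fin N → ℂ) →ₗ[ℂ] (ι → Laurent) := LinearMap.pi fun i =>
    ∑ e : Fin N, (LinearMap.toSpanSingleton ℂ Laurent (monomial (-m - 1 - e))) ∘ₗ LinearMap.proj (i, e)
  let κ : (ι → Laurent) →ₗ[ℂ] (ι × Fin N → ℂ) := LinearMap.pi fun r =>
    Laurent.coeff (-m - 1 - r.2) ∘ₗ LinearMap.proj r.1
  have hj' : ∀ x i, j x i = ∑ e : Fin N, x (i, e) • monomial (-m - 1 - e) := by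
    intro x i
    simp [j]
  have hj : ∀ y : ι → Laurent, (∀ i, y i ∈ ge (-m - N)) → j (κ y) = pol y := by
    intro y hy
    funext i
    rw [hj']
    change _ = below (-m) (y i)
    ext k
    rw [map_sum, coeff_below]
    change ∑ e : Fin N, Laurent.coeff k (Laurent.coeff (-m - 1 - e) (y i) • monomial (-m - 1 - e)) = _
    simp only [map_smul, coeff_monomial, smul_eq_mul, mul_ite, mul_one, mul_zero]
    split_ifs with hk
    · by_cases hk' : k < -m - N
      · rw [hy i k hk']
        exact Finset.sum_eq_zero fun e _ => by rw [if_neg (by omega)]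
      · rw [Finset.sum_eq_single ⟨(-m - 1 - k).toNat, by omega⟩]
        · have : -m - 1 - ((-m - 1 - k).toNat : ℤ) = k := by omega
          simp only [this, if_true]
        · intro e _ he
          rw [if_neg]
          intro h
          apply he
          ext
          simp only
          omega
        · simp
    · exact Finset.sum_eq_zero fun e _ => by rw [if_neg (by omega)]
  -- The compression of multiplication by `x` to `V`. It is multiplicative up to an operator that
  -- factors through the finite-dimensional space of excess polar coefficients.
  let L : A → V →ₗ[ℂ] V := fun x =>
    LinearMap.codRestrict V (p ∘ₗ LinearMap.mulLeft ℂ x ∘ₗ V.subtype) fun _ => hp _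
  let F : A → (ι × Fin N → ℂ) →ₗ[ℂ] V := fun x =>
    LinearMap.codRestrict V (p ∘ₗ LinearMap.mulLeft ℂ x ∘ₗ σ ∘ₗ j) fun _ => hp _
  let K : A → V →ₗ[ℂ] (ι × Fin N → ℂ) := fun x => κ ∘ₗ D ∘ₗ LinearMap.mulLeft ℂ x ∘ₗ V.subtype
  have hLF : ∀ x y : A, (∀ i, X.expandFun i y ∈ ge (-N)) → L x * L y = L (x * y) - F x ∘ₗ K y := by
    intro x y hy
    ext v
    change p (x * (y * v - σ (pol (D (y * v))))) = p (x * y * v) - p (x * σ (j (κ (D (y * v)))))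
    rw [hj, ← map_sub]
    · congr 1
      ring
    · intro i
      change X.expandFun i (y * v) ∈ _
      rw [map_mul]
      exact ge_anti (by omega) (mul_mem_ge (hy i) (X.mem_sections.1 v.2 i))
  -- The commutator of `L a` and `L b` has trace zero because `V` is finite-dimensional, and `A` is
  -- commutative; so the two corrections have equal traces.
  have htr : LinearMap.trace ℂ _ (K b ∘ₗ F a) = LinearMap.trace ℂ _ (K a ∘ₗ F b) := by
    have h1 := LinearMap.trace_mul_comm ℂ (L a) (L b)
    have h2 : ∀ f g : V →ₗ[ℂ] V,
        LinearMap.trace ℂ V (f - g) = LinearMap.trace ℂ V f - LinearMap.trace ℂ V g :=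
      fun f g => LinearMap.map_sub (LinearMap.trace ℂ V) f g
    rw [hLF a b hbN, hLF b a haN, mul_comm b a, h2, h2, sub_right_inj] at h1
    rw [LinearMap.trace_comp_comm', h1, LinearMap.trace_comp_comm']
  -- Each such trace is one half of the residue sum in `coeff_mul_deriv`; the equality of the two
  -- traces is the residue theorem.
  have hdiag : ∀ x y : A, (∀ i, X.expandFun i x ∈ ge (-N)) → (∀ i, X.expandFun i y ∈ ge (-N)) →
      LinearMap.trace ℂ _ (K y ∘ₗ F x) = ∑ i, ∑ d ∈ Finset.Icc 1 N,
        (d : ℂ) * (Laurent.coeff d (X.expandFun i x) * Laurent.coeff (-d) (X.expandFun i y)) := by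
    intro x y hx hy
    rw [LinearMap.trace_eq_matrix_trace ℂ (Pi.basisFun ℂ (ι × Fin N)), Matrix.trace,
      Fintype.sum_prod_type]
    refine Finset.sum_congr rfl fun i _ => ?_
    rw [← sum_range_sum_Icc, Finset.sum_range]
    refine Finset.sum_congr rfl fun e _ => ?_
    rw [Matrix.diag_apply, LinearMap.toMatrix_apply, Pi.basisFun_apply, Pi.basisFun_repr,
      ← coeff_mul_truncation (hy i) m]
    set z : ι → Laurent := j (Pi.single (i, e) 1) with hz
    have hzi : z i = monomial (-m - 1 - e) := by
      rw [hz, hj', Finset.sum_eq_single e]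
      · rw [Pi.single_eq_same, one_smul]
      · intro e' _ he
        rw [Pi.single_eq_of_ne (by simpa using he), zero_smul]
      · simp
    change Laurent.coeff (-m - 1 - e) (X.expandFun i (y * (x * σ z - σ (pol (D (x * σ z)))))) = _
    rw [← sub_eq_zero, ← map_sub]
    have h1 : X.expandFun i (x * σ z) - X.expandFun i x * monomial (-m - 1 - e) ∈ ge (-m₀ - N) := by
      rw [map_mul, ← mul_sub, ← hzi]
      exact ge_anti (by omega) (mul_mem_ge (hx i) (hσ z i))
    have h2 : below (-m) (X.expandFun i (x * σ z)) =
        below (-m) (X.expandFun i x * monomial (-m - 1 - e)) := by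
      rw [← sub_eq_zero, ← map_sub]
      exact below_eq_zero (ge_anti (by omega) h1)
    have h3 := hσ (pol (D (x * σ z))) i
    change _ - below (-m) (X.expandFun i (x * σ z)) ∈ _ at h3
    rw [h2] at h3
    have h4 := mul_mem_ge (hy i) (sub_mem h1 (ge_anti (show -m₀ - N ≤ -m₀ by omega) h3))
    have h5 := h4 (-m - 1 - e) (by omega)
    rw [← h5]
    congr 1
    rw [map_mul, map_sub]
    ring
  have hterm := fun i => coeff_mul_deriv (haN i) (hbN i)
  rw [Finset.sum_congr rfl fun i _ => hterm i, Finset.sum_sub_distrib, ← hdiag b a hbN haN,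
    ← hdiag a b haN hbN, htr, sub_self]

end Completion
end Isostokes

/-! ### The orthogonal of the regular forms -/

namespace Isostokes

namespace Laurent

theorem coeff_neg_one_deriv (s : Laurent) : coeff (-1) (deriv s) = 0 := by
  rw [coeff_deriv]
  simp

theorem HasOrd.deriv {s : Laurent} {k : ℤ} (hs : HasOrd s k) (hk : k ≠ 0) :
    HasOrd (deriv s) (k - 1) :=
  ⟨deriv_mem_ge hs.1, by
    rw [coeff_deriv, sub_add_cancel]
    exact mul_ne_zero (by exact_mod_cast hk) hs.2⟩

end Laurent

namespace Completion

open Laurent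

variable {A : Type} [CommRing A] [IsDomain A] [Algebra ℂ A] {ι : Type} (X : Completion A ι)
  [Fintype ι]

/-- The sum of the residues of `f dg` at the points at infinity, for rational functions
`f` and `g`. -/
def residueForm : FractionRing A →ₗ[ℂ] FractionRing A →ₗ[ℂ] ℂ :=
  LinearMap.mk₂ ℂ (fun f g => ∑ i, Laurent.coeff (-1) (X.expand i f * Laurent.deriv (X.expand i g)))
    (fun f f' g => by simp only [map_add, add_mul, Finset.sum_add_distrib])
    (fun c f g => by simp only [map_smul, smul_mul_assoc, Finset.smul_sum])
    (fun f g g' => by simp only [map_add, mul_add, Finset.sum_add_distrib])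
    (fun c f g => by simp only [map_smul, Derivation.map_smul, mul_smul_comm, Finset.smul_sum])

theorem residueForm_apply (f g : FractionRing A) : X.residueForm f g =
    ∑ i, Laurent.coeff (-1) (X.expand i f * Laurent.deriv (X.expand i g)) := rfl

theorem residueForm_mul (f g h : FractionRing A) :
    X.residueForm f (g * h) = X.residueForm (f * g) h + X.residueForm (f * h) g := by
  simp only [residueForm_apply, ← Finset.sum_add_distrib, ← map_add, map_mul, Derivation.leibniz,
    smul_eq_mul]
  refine Finset.sum_congr rfl fun i _ => congrArg _ ?_
  ring

theorem residueForm_one (f : FractionRing A) : X.residueForm 1 f = 0 := by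
  simp only [residueForm_apply, map_one, one_mul, coeff_neg_one_deriv, Finset.sum_const_zero]

theorem residueForm_swap (f g : FractionRing A) : X.residueForm f g = -X.residueForm g f := by
  have h := X.residueForm_mul 1 f g
  rw [residueForm_one, one_mul, one_mul] at h
  linear_combination -h

theorem residueForm_pow (f g : FractionRing A) (k : ℕ) :
    X.residueForm f (g ^ (k + 1)) = (k + 1) * X.residueForm (f * g ^ k) g := by
  induction k generalizing f with
  | zero => simp
  | succ k ih =>
    rw [pow_succ, residueForm_mul, ih, mul_assoc, ← pow_succ']
    push_cast
    ring

/-- If `h` has a simple pole, `s` is a local coordinate there and all residues of `h da` vanish,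
for regular functions `a`, then the same holds for all powers of `h`. -/
theorem residueForm_pow_eq_zero {h : FractionRing A} {p : Ideal A} {s ε : A}
    (hres : ∀ a b : A, X.residueForm (algebraMap A _ a) (algebraMap A _ b) = 0)
    (hh : ∀ a b : A, X.residueForm (algebraMap A _ a * h) (algebraMap A _ b) = 0)
    (hp : ∀ a ∈ p, ∃ b : A, algebraMap A _ a * h = algebraMap A _ b)
    (hc : ∀ a : A, ∃ c : ℂ, a - algebraMap ℂ A c ∈ p)
    (hε : ε ∈ p) (hs : algebraMap A _ s * h = 1 + algebraMap A _ ε) (k : ℕ) (a b : A) :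
    X.residueForm (algebraMap A _ a * h ^ k) (algebraMap A _ b) = 0 := by
  let e : A →+* FractionRing A := algebraMap A (FractionRing A)
  have heC : ∀ c : ℂ, e (algebraMap ℂ A c) = algebraMap ℂ _ c := fun c =>
    (IsScalarTower.algebraMap_apply ℂ A _ c).symm
  have hconst : ∀ f (c : ℂ), X.residueForm f (e (algebraMap ℂ A c)) = 0 := by
    intro f c
    rw [residueForm_swap, heC, Algebra.algebraMap_eq_smul_one, map_smul, LinearMap.smul_apply,
      residueForm_one, smul_zero, neg_zero]
  suffices H : ∀ k, (∀ a b : A, X.residueForm (e a * h ^ k) (e b) = 0) ∧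
      ∀ a b : A, X.residueForm (e a * h ^ (k + 1)) (e b) = 0 from (H k).1 a b
  intro k
  induction k with
  | zero => simpa using ⟨hres, hh⟩
  | succ k ih =>
    obtain ⟨-, ih⟩ := ih
    refine ⟨ih, ?_⟩
    -- A factor in `p` cancels one pole and so lowers the power of `h`.
    have hp1 : ∀ x ∈ p, ∀ b : A, X.residueForm (e x * h ^ (k + 2)) (e b) = 0 := by
      intro x hx b
      obtain ⟨y, hy⟩ := hp x hx
      rw [pow_succ', ← mul_assoc]
      erw [hy]
      exact ih y b
    -- Modulo `p` every function is constant, so the coefficient `a` may be taken to be `1`.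
    have hred : ∀ b : A, X.residueForm (h ^ (k + 2)) (e b) = 0 →
        ∀ a : A, X.residueForm (e a * h ^ (k + 2)) (e b) = 0 := by
      intro b hb a
      obtain ⟨c, hc⟩ := hc a
      have h1 := hp1 _ hc b
      rw [map_sub, sub_mul, map_sub, LinearMap.sub_apply, heC, ← Algebra.smul_def c, map_smul,
        LinearMap.smul_apply, hb, smul_zero, sub_zero] at h1
      exact h1
    obtain ⟨ε', hε'⟩ := hp ε hε
    -- Expand `h ^ (k+1) d(s h)`, where `s h = 1 + ε` is regular. Besides `h ^ (k+2) ds` this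
    -- contains `(1 + ε) h ^ k dh`; the term `h ^ k dh` is exact, and `ε h ^ k dh` is equivalent to
    -- a multiple of `h ^ (k+1) dε`, which is covered by the induction.
    have hds : X.residueForm (h ^ (k + 2)) (e s) = 0 := by
      have h1 : X.residueForm (h ^ (k + 1)) (e s * h) = 0 := by
        have e1 : e s * h = e (1 + ε) := by rw [map_add, map_one]; exact hs
        rw [e1]
        simpa using ih 1 (1 + ε)
      have h2 : h ^ (k + 1) * e s = h ^ k + e ε * h ^ k := by
        have : e s * h = 1 + e ε := hs
        linear_combination h ^ k * this
      have h3 : X.residueForm (h ^ k) h = 0 := by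
        have := X.residueForm_pow 1 h k
        rw [residueForm_one, one_mul] at this
        exact (mul_eq_zero.1 this.symm).resolve_left (by exact_mod_cast k.succ_ne_zero)
      have h4 : X.residueForm (e ε * h ^ k) h = 0 := by
        have := X.residueForm_pow (e ε) h k
        rw [residueForm_swap] at this
        have h5 := ih 1 ε
        rw [map_one, one_mul] at h5
        rw [h5, neg_zero] at this
        exact (mul_eq_zero.1 this.symm).resolve_left (by exact_mod_cast k.succ_ne_zero)
      rw [residueForm_mul, h2, map_add, LinearMap.add_apply, h3, h4, add_zero, zero_add,
        ← pow_succ] at h1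
      exact h1
    -- With `y = (b - c) h` one has `b - c = s y - (b - c) ε`. The last product lies in `p²`, so it
    -- contributes nothing, and `s y` reduces to the case of `s`.
    have hdb : ∀ b : A, X.residueForm (h ^ (k + 2)) (e b) = 0 := by
      intro b
      obtain ⟨c, hc⟩ := hc b
      obtain ⟨y, hy⟩ := hp _ hc
      have e1 : b = algebraMap ℂ A c + (s * y - (b - algebraMap ℂ A c) * ε) := by
        apply IsFractionRing.injective A (FractionRing A)
        simp only [map_add, map_sub, map_mul] at hy ⊢
        linear_combination e s * hy - (e b - e (algebraMap ℂ A c)) * hs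
      have e2 : X.residueForm (h ^ (k + 2)) (e (s * y)) = 0 := by
        rw [map_mul, residueForm_mul, mul_comm _ (e y), hred s hds y, add_zero]
        have h6 : h ^ (k + 2) * e s = e (1 + ε) * h ^ (k + 1) := by
          rw [map_add, map_one]
          have : e s * h = 1 + e ε := hs
          linear_combination h ^ (k + 1) * this
        rw [h6]
        exact ih _ _
      have e3 : X.residueForm (h ^ (k + 2)) (e ((b - algebraMap ℂ A c) * ε)) = 0 := by
        rw [map_mul, residueForm_mul, mul_comm _ (e ε), hp1 ε hε, add_zero, mul_comm, hp1 _ hc]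
      rw [e1, map_add, map_sub, map_add, map_sub, hconst, e2, e3, sub_zero, zero_add]
    exact fun a b => hred b (hdb b) a

/-- The families of Laurent series that are orthogonal to all regular forms. -/
def orthogonal : Submodule ℂ (ι → Laurent) where
  carrier := {y | ∀ a b : A, ∑ i, Laurent.coeff (-1)
    (y i * (X.expandFun i a * Laurent.deriv (X.expandFun i b))) = 0}
  zero_mem' := by simp
  add_mem' := by
    intro y z hy hz a b
    simp only [Pi.add_apply, add_mul, map_add, Finset.sum_add_distrib, hy a b, hz a b, add_zero]
  smul_mem' := by
    intro c y hy a b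
    simp only [Pi.smul_apply, smul_mul_assoc, map_smul, ← Finset.smul_sum, hy a b, smul_zero]

theorem expand_mem_orthogonal {f : FractionRing A} : (fun i => X.expand i f) ∈ X.orthogonal ↔
    ∀ a b : A, X.residueForm (algebraMap A _ a * f) (algebraMap A _ b) = 0 := by
  refine forall₂_congr fun a b => ?_
  rw [residueForm_apply]
  refine Eq.congr (Finset.sum_congr rfl fun i _ => congrArg _ ?_) rfl
  rw [map_mul, ← mul_assoc, mul_comm (X.expand i f)]
  rfl

variable [Algebra.FiniteType ℂ A] [Nonempty ι]

/-- The orthogonal of the regular forms is, modulo the regular functions, of finite dimension. -/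
theorem exists_finite_map : ∃ (L m : ℤ) (T : (ι → Laurent) →ₗ[ℂ] (ι × Finset.Ico m L → ℂ)),
    ∀ y ∈ X.orthogonal, T y = 0 → ∃ a, ∀ i, X.expandFun i a = y i := by
  classical
  obtain ⟨m, σ, hσ⟩ := X.exists_section
  obtain ⟨t, ht⟩ := X.exists_pole
  choose e he hte using fun i => hasOrd_zero_of_notMem (ht i)
  -- So large that an element of order at least `L`, times an approximation error, times `dt`, has
  -- no residue.
  obtain ⟨L, hL⟩ : ∃ L : ℤ, ∀ i, 0 ≤ L - m + (e i - 1) := by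
    refine ⟨m + 1 + ∑ i, ((e i).natAbs : ℤ), fun i => ?_⟩
    have h := Finset.single_le_sum (f := fun i => ((e i).natAbs : ℤ)) (fun _ _ => by positivity)
      (Finset.mem_univ i)
    omega
  let D : A →ₗ[ℂ] (ι → Laurent) := LinearMap.pi fun i => (X.expandFun i).toLinearMap
  let T : (ι → Laurent) →ₗ[ℂ] (ι × Finset.Ico (-m) L → ℂ) := LinearMap.pi fun r =>
    Laurent.coeff r.2 ∘ₗ LinearMap.proj r.1 ∘ₗ (LinearMap.id - D ∘ₗ σ)
  -- If `y_i ≠ 0`, a regular function approximating `z⁻¹ / (y_i dt/dz)` at `x_i` and zero elsewhere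
  -- gives a form whose pairing with `y` is `1`.
  have hsmall : ∀ y ∈ X.orthogonal, (∀ i, y i ∈ ge L) → y = 0 := by
    intro y hy hyL
    by_contra hy0
    obtain ⟨i, hi⟩ : ∃ i, y i ≠ 0 := by
      by_contra! h
      exact hy0 (funext h)
    let u : Laurent := y i * Laurent.deriv (X.expandFun i t)
    have hu : u ≠ 0 := mul_ne_zero hi ((hte i).deriv (he i).ne).ne_zero
    let z : ι → Laurent := Pi.single i (u⁻¹ * monomial (-1))
    have h1 := hy (σ z) t
    have h2 : ∀ j, Laurent.coeff (-1)
        (y j * (X.expandFun j (σ z) * Laurent.deriv (X.expandFun j t))) = if j = i then 1 else 0 := by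
      intro j
      have h3 : Laurent.coeff (-1) (y j * ((X.expandFun j (σ z) - z j) *
          Laurent.deriv (X.expandFun j t))) = 0 := by
        have h4 := mul_mem_ge (hyL j) (mul_mem_ge (hσ z j) (deriv_mem_ge (hte j).1))
        exact h4 _ (by have := hL j; omega)
      have h5 : y j * (X.expandFun j (σ z) * Laurent.deriv (X.expandFun j t)) =
          y j * ((X.expandFun j (σ z) - z j) * Laurent.deriv (X.expandFun j t)) +
            y j * Laurent.deriv (X.expandFun j t) * z j := by ring
      rw [h5, map_add, h3, zero_add]
      split_ifs with hij
      · subst hij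
        rw [show z j = u⁻¹ * monomial (-1) from Pi.single_eq_same _ _, ← mul_assoc]
        change Laurent.coeff (-1) (u * u⁻¹ * monomial (-1)) = 1
        rw [mul_inv_cancel₀ hu, one_mul, coeff_monomial, if_pos rfl]
      · rw [show z j = 0 from Pi.single_eq_of_ne hij _, mul_zero, map_zero]
    rw [Finset.sum_congr rfl fun j _ => h2 j, Finset.sum_ite_eq' Finset.univ i,
      if_pos (Finset.mem_univ i)] at h1
    exact one_ne_zero h1
  refine ⟨L, -m, T, fun y hy hT => ⟨σ y, ?_⟩⟩
  -- Regular functions are orthogonal to regular forms by the residue theorem. If `T y = 0`, the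
  -- difference `y - σ y` is therefore orthogonal and of order at least `L`, hence zero.
  have hD : D (σ y) ∈ X.orthogonal := by
    have : D (σ y) = fun i => X.expand i (algebraMap A _ (σ y)) := rfl
    rw [this, expand_mem_orthogonal]
    intro a b
    rw [← map_mul, residueForm_apply]
    exact X.sum_residue_eq_zero _ _
  have h0 := hsmall (y - D (σ y)) (sub_mem hy hD) fun i k hk => by
    by_cases hkm : k < -m
    · have := neg_mem (hσ y i) k hkm
      rwa [neg_sub] at this
    · exact congrFun hT (i, ⟨k, Finset.mem_Ico.2 ⟨by omega, hk⟩⟩)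
  exact fun i => (sub_eq_zero.1 (congrFun h0 i)).symm

/-- In an infinite family of orthogonal elements some combination is regular. -/
theorem exists_ne_zero_regular (φ : Polynomial ℂ →ₗ[ℂ] (ι → Laurent))
    (hφ : ∀ p, φ p ∈ X.orthogonal) : ∃ p ≠ 0, ∃ a, ∀ i, X.expandFun i a = φ p i := by
  obtain ⟨L, m, T, hT⟩ := X.exists_finite_map
  by_contra! h
  refine Polynomial.not_finite (R := ℂ) (Module.Finite.of_injective (T ∘ₗ φ)
    ((injective_iff_map_eq_zero _).2 fun p hp => ?_))
  by_contra hp0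
  obtain ⟨a, ha⟩ := hT _ (hφ p) hp
  obtain ⟨i, hi⟩ := h p hp0 a
  exact hi (ha i)

theorem mul_mem_orthogonal {y : ι → Laurent} (hy : y ∈ X.orthogonal) (a : A) :
    (fun i => X.expandFun i a * y i) ∈ X.orthogonal := by
  intro b c
  rw [← hy (a * b) c]
  refine Finset.sum_congr rfl fun i _ => congrArg _ ?_
  rw [map_mul]
  ring

/-- The multiples `p(t) y` are an infinite-dimensional family of orthogonal elements, so one of
them, with `p ≠ 0`, is a regular function `a`, and `y = a / p(t)` is rational. -/
theorem exists_expand_eq {y : ι → Laurent} (hy : y ∈ X.orthogonal) :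
    ∃ f, ∀ i, X.expand i f = y i := by
  obtain ⟨t, ht⟩ := X.exists_pole
  let φ : Polynomial ℂ →ₗ[ℂ] (ι → Laurent) := LinearMap.pi fun i =>
    (LinearMap.mulRight ℂ (y i)) ∘ₗ (X.expandFun i).toLinearMap ∘ₗ (Polynomial.aeval t).toLinearMap
  obtain ⟨p, hp, a, ha⟩ := X.exists_ne_zero_regular φ fun p =>
    X.mul_mem_orthogonal hy (Polynomial.aeval t p)
  refine ⟨algebraMap A _ a / algebraMap A _ (Polynomial.aeval t p), fun i => ?_⟩
  obtain ⟨k, hk, htk⟩ := hasOrd_zero_of_notMem (ht i)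
  have h0 : X.expandFun i (Polynomial.aeval t p) ≠ 0 := by
    rw [← Polynomial.aeval_algHom_apply]
    exact (HasOrd.aeval htk hk hp).ne_zero
  rw [map_div₀, ← expandFun_apply, ← expandFun_apply, ha, div_eq_iff h0, mul_comm]
  rfl

end Completion
end Isostokes

/-! ### Serre duality -/

namespace Isostokes

namespace Completion

open Laurent

/-- The residue fields of an algebra of finite type over `ℂ` are `ℂ`. -/
theorem exists_sub_algebraMap_mem {A : Type} [CommRing A] [Algebra ℂ A] [Algebra.FiniteType ℂ A]
    (p : Ideal A) [hp : p.IsMaximal] (a : A) : ∃ c : ℂ, a - algebraMap ℂ A c ∈ p := by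
  let _ := Ideal.Quotient.field p
  have : Module.Finite ℂ (A ⧸ p) := finite_of_finite_type_of_isJacobsonRing ℂ (A ⧸ p)
  obtain ⟨c, hc⟩ := (IsAlgClosed.algebraMap_bijective_of_isIntegral (k := ℂ) (K := A ⧸ p)).2
    (Ideal.Quotient.mk p a)
  exact ⟨c, Ideal.Quotient.eq.1 hc.symm⟩

theorem isIntegral_of_aeval_eq {A K : Type} [CommRing A] [IsDomain A] [Algebra ℂ A] [CommRing K] [Algebra A K]
    [Algebra ℂ K] [IsScalarTower ℂ A K] {h : K} {q : Polynomial ℂ} (hq : 0 < q.degree) {a : A}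
    (ha : algebraMap A K a = Polynomial.aeval h q) : IsIntegral A h := by
  have hq0 : q ≠ 0 := by rintro rfl; simp at hq
  set c := q.leadingCoeff⁻¹ with hc
  have hmon : (q * Polynomial.C c).Monic := Polynomial.monic_mul_leadingCoeff_inv hq0
  refine ⟨(q * Polynomial.C c).map (algebraMap ℂ A) - Polynomial.C (algebraMap ℂ A c * a),
    (hmon.map _).sub_of_left ?_, ?_⟩
  · rw [Polynomial.degree_map, Polynomial.degree_mul_leadingCoeff_inv _ hq0]
    exact Polynomial.degree_C_le.trans_lt hq
  · rw [Polynomial.eval₂_sub, Polynomial.eval₂_map, ← IsScalarTower.algebraMap_eq,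
      Polynomial.eval₂_C, ← Polynomial.aeval_def, map_mul, Polynomial.aeval_C, map_mul, ha,
      ← IsScalarTower.algebraMap_apply, mul_comm, sub_self]

variable {A : Type} [CommRing A] [IsDedekindDomain A] [Algebra ℂ A] {ι : Type} (X : Completion A ι)
  [Fintype ι] [Algebra.FiniteType ℂ A] [Nonempty ι]

/-- All polynomials in `h` are orthogonal, so a nonzero one without constant term is a regular
function; this is an integral equation for `h`. The factor `X` keeps the polynomial from being
constant. -/
theorem isIntegral_of_residueForm {h : FractionRing A} (hpow : ∀ (k : ℕ) (a b : A),
      X.residueForm (algebraMap A _ a * h ^ k) (algebraMap A _ b) = 0) : IsIntegral A h := by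
  let ψ : Polynomial ℂ →ₗ[ℂ] FractionRing A :=
    (Polynomial.aeval h).toLinearMap ∘ₗ LinearMap.mulLeft ℂ Polynomial.X
  let φ : Polynomial ℂ →ₗ[ℂ] (ι → Laurent) := LinearMap.pi fun i => (X.expand i).toLinearMap ∘ₗ ψ
  have hψ : ∀ q, ψ q = Polynomial.aeval h (Polynomial.X * q) := fun q => rfl
  have hφ : ∀ q i, φ q i = X.expand i (ψ q) := fun q i => rfl
  have haeval : ∀ (q : Polynomial ℂ) (a b : A), X.residueForm (algebraMap A _ a *
      Polynomial.aeval h q) (algebraMap A _ b) = 0 := by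
    intro q a b
    induction q using Polynomial.induction_on' with
    | add q r hq hr => rw [map_add, mul_add, map_add, LinearMap.add_apply, hq, hr, add_zero]
    | monomial k z =>
      rw [Polynomial.aeval_monomial, mul_left_comm, ← Algebra.smul_def z, map_smul,
        LinearMap.smul_apply, hpow, smul_zero]
  have hmem : ∀ q, φ q ∈ X.orthogonal := by
    intro q
    rw [show φ q = fun i => X.expand i (ψ q) from funext (hφ q), expand_mem_orthogonal, hψ]
    exact haeval _
  obtain ⟨q, hq, a, ha⟩ := X.exists_ne_zero_regular φ hmem
  have ha' : algebraMap A (FractionRing A) a = Polynomial.aeval h (Polynomial.X * q) :=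
    (X.expand (Classical.arbitrary ι)).toRingHom.injective ((ha _).trans (hφ _ _))
  have hq0 : 0 < (Polynomial.X * q).degree := by
    rw [Polynomial.degree_mul, Polynomial.degree_X]
    exact add_pos_of_pos_of_nonneg one_pos (Polynomial.zero_le_degree_iff.2 hq)
  exact isIntegral_of_aeval_eq hq0 ha'

/-- Serre duality: a family of Laurent series that is orthogonal to all regular forms is
a regular function. -/
theorem exists_expandFun_eq {y : ι → Laurent} (hy : y ∈ X.orthogonal) :
    ∃ a, ∀ i, X.expandFun i a = y i := by
  let K := FractionRing A
  -- The module of orthogonal rational functions. It contains `A`, and the claim is that it equals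
  -- `A`.
  let M : Submodule A K :=
    { carrier := {f | (fun i => X.expand i f) ∈ X.orthogonal}
      zero_mem' := by
        change (fun i => X.expand i 0) ∈ X.orthogonal
        rw [show (fun i => X.expand i 0) = 0 from funext fun i => map_zero _]
        exact zero_mem _
      add_mem' := by
        intro f g hf hg
        change (fun i => X.expand i (f + g)) ∈ X.orthogonal
        rw [show (fun i => X.expand i (f + g)) = (fun i => X.expand i f) + fun i => X.expand i g from
          funext fun i => map_add _ _ _]
        exact add_mem hf hg
      smul_mem' := by
        intro a f hf
        change (fun i => X.expand i (a • f)) ∈ X.orthogonal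
        rw [show (fun i => X.expand i (a • f)) = fun i => X.expandFun i a * X.expand i f from
          funext fun i => by rw [Algebra.smul_def, map_mul]; rfl]
        exact X.mul_mem_orthogonal hf a }
  have hres : ∀ a b : A, X.residueForm (algebraMap A _ a) (algebraMap A _ b) = 0 := fun a b =>
    X.sum_residue_eq_zero a b
  let N : Submodule A M := (1 : Submodule A K).comap M.subtype
  have hN : ∀ f : M, f ∈ N ↔ ∃ a : A, algebraMap A K a = f := fun f => by
    change (f : K) ∈ (1 : Submodule A K) ↔ _
    rw [Submodule.mem_one]
  suffices hT : N = ⊤ by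
    obtain ⟨f, hf⟩ := X.exists_expand_eq hy
    have hfM : f ∈ M := by
      change (fun i => X.expand i f) ∈ X.orthogonal
      rwa [funext hf]
    obtain ⟨a, ha⟩ := (hN ⟨f, hfM⟩).1 (by rw [hT]; trivial)
    exact ⟨a, fun i => by rw [expandFun_apply, ha, hf]⟩
  by_contra hne
  obtain ⟨f₀, hf₀⟩ : ∃ f : M, f ∉ N := by
    by_contra! h
    exact hne (eq_top_iff.2 fun f _ => h f)
  -- If `M / A` were nonzero, it would have an associated prime: some `h ∈ M` outside `A` whose
  -- multiples by elements of `p`, and only those, are regular.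
  obtain ⟨p, hp, -⟩ := exists_le_isAssociatedPrime_of_isNoetherianRing A (N.mkQ f₀)
    (by rwa [Ne, Submodule.mkQ_apply, Submodule.Quotient.mk_eq_zero])
  obtain ⟨hprime, x, hx⟩ := (isAssociatedPrime_iff).1 hp
  obtain ⟨⟨h, hhM⟩, rfl⟩ := N.mkQ_surjective x
  have hmem : ∀ a : A, a ∈ p ↔ ∃ b : A, algebraMap A K a * h = algebraMap A K b := by
    intro a
    rw [hx, Submodule.mem_colon_singleton, Submodule.mem_bot, ← map_smul, Submodule.mkQ_apply,
      Submodule.Quotient.mk_eq_zero, hN]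
    change (∃ b, algebraMap A K b = a • h) ↔ _
    rw [Algebra.smul_def]
    exact exists_congr fun b => eq_comm
  have hhA : ∀ a : A, algebraMap A K a ≠ h := fun a ha => hprime.ne_top ((Ideal.eq_top_iff_one p).2
    ((hmem 1).2 ⟨a, by rw [map_one, one_mul, ha]⟩))
  have hp0 : p ≠ ⊥ := by
    obtain ⟨a, s, hs, ha⟩ := IsFractionRing.div_surjective (A := A) h
    intro h0
    have hs0 : algebraMap A K s ≠ 0 := by
      simpa using nonZeroDivisors.ne_zero hs
    have : s ∈ p := (hmem s).2 ⟨a, by rw [← ha]; exact mul_div_cancel₀ _ hs0⟩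
    rw [h0, Submodule.mem_bot] at this
    exact nonZeroDivisors.ne_zero hs this
  have hmax : p.IsMaximal := hprime.isMaximal hp0
  -- some multiple of `h` by an element of `p` is a unit at `p`
  have hunit : ∃ s ∈ p, ∃ b ∉ p, algebraMap A K s * h = algebraMap A K b := by
    by_contra! hcon
    -- Otherwise `h p ⊆ p` with `p` finitely generated and nonzero, so `h` is integral over `A` and
    -- lies in `A`, which is integrally closed.
    have hint : IsIntegral A h := by
      refine isIntegral_of_smul_mem_submodule (M := K) (Submodule.map (Algebra.linearMap A K) p) ?_ ?_ h ?_
      · intro h0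
        obtain ⟨a, ha, ha0⟩ := (Submodule.ne_bot_iff p).1 hp0
        have : algebraMap A K a ∈ (Submodule.map (Algebra.linearMap A K) p) := ⟨a, ha, rfl⟩
        rw [h0, Submodule.mem_bot] at this
        exact ha0 (by simpa using this)
      · exact (IsNoetherian.noetherian p).map _
      · rintro _ ⟨a, ha, rfl⟩
        obtain ⟨b, hb⟩ := (hmem a).1 ha
        refine ⟨b, ?_, ?_⟩
        · by_contra hbp
          exact hcon a ha b hbp hb
        · rw [Algebra.linearMap_apply, ← hb, smul_eq_mul, mul_comm]; rfl
    obtain ⟨a, ha⟩ := IsIntegrallyClosed.algebraMap_eq_of_integral hint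
    exact hhA a ha
  obtain ⟨s, hs, b, hb, hsb⟩ := hunit
  obtain ⟨c, hc⟩ := exists_sub_algebraMap_mem p b
  have hc0 : c ≠ 0 := by
    rintro rfl
    rw [map_zero, sub_zero] at hc
    exact hb hc
  -- Rescaled so that `s h' = 1 + ε` with `ε ∈ p`: the function `h'` has a simple pole with local
  -- coordinate `s`. All its powers are then orthogonal, which makes it integral, hence regular, a
  -- contradiction.
  set h' : K := c⁻¹ • h with hh'
  have hmul : ∀ a : A, algebraMap A K a * h' = algebraMap A K (algebraMap ℂ A c⁻¹ * a) * h := by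
    intro a
    rw [hh', Algebra.smul_def, map_mul, ← IsScalarTower.algebraMap_apply ℂ A K]
    ring
  have hpow : ∀ (k : ℕ) (a b : A),
      X.residueForm (algebraMap A _ a * h' ^ k) (algebraMap A _ b) = 0 := by
    refine X.residueForm_pow_eq_zero (p := p) (s := s)
      (ε := algebraMap ℂ A c⁻¹ * (b - algebraMap ℂ A c)) hres ?_ ?_ ?_ ?_ ?_
    · intro a b
      rw [hmul]
      exact X.expand_mem_orthogonal.1 hhM _ _
    · intro a ha
      obtain ⟨b, hb⟩ := (hmem _).1 (p.mul_mem_left (algebraMap ℂ A c⁻¹) ha)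
      exact ⟨b, by rw [hmul, hb]⟩
    · exact exists_sub_algebraMap_mem p
    · exact p.mul_mem_left _ hc
    · rw [hmul, map_mul, mul_assoc, hsb, ← map_mul, ← map_one (algebraMap A K), ← map_add, mul_sub,
        ← map_mul, inv_mul_cancel₀ hc0, map_one]
      congr 1
      ring
  have hint : IsIntegral A h' := X.isIntegral_of_residueForm hpow
  obtain ⟨a', ha'⟩ := IsIntegrallyClosed.algebraMap_eq_of_integral hint
  refine hhA (algebraMap ℂ A c * a') ?_
  rw [map_mul, ha', hh', Algebra.smul_def, ← IsScalarTower.algebraMap_apply ℂ A K, ← mul_assoc,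
    ← map_mul, mul_inv_cancel₀ hc0, map_one, one_mul]

end Completion
end Isostokes

/-! ### Regular forms with prescribed polar parts -/

namespace Isostokes

namespace Laurent

/-- A linear functional on Laurent series that vanishes on `z⁻¹ ℂ[[z]]` is the residue pairing with
a series without constant term. -/
theorem exists_residue_eq (f : Laurent →ₗ[ℂ] ℂ) (hf : ∀ s ∈ ge (-1), f s = 0) :
    ∃ y ∈ ge 1, ∀ s, f s = coeff (-1) (y * s) := by
  let y := ofCoeffs (fun k => if k < 1 then 0 else f (monomial (-1 - k))) 1 fun k hk => if_pos hk
  have hy : y ∈ ge 1 := fun k hk => if_pos hk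
  refine ⟨y, hy, fun s => ?_⟩
  obtain ⟨p, hp⟩ := exists_mem_ge s
  have h1 : s - ∑ j ∈ Finset.Icc p (-1 - 1), coeff j s • monomial j ∈ ge (-1) := by
    intro k hk
    simp only [map_sub, map_sum, map_smul, coeff_monomial, smul_eq_mul, mul_ite, mul_one, mul_zero,
      Finset.sum_ite_eq, Finset.mem_Icc]
    split_ifs with h
    · exact sub_self _
    · rw [sub_zero]
      exact hp k (by omega)
  have h2 := hf _ h1
  rw [map_sub, sub_eq_zero] at h2
  rw [h2, map_sum, mul_comm, coeff_mul_Icc hp hy]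
  refine Finset.sum_congr rfl fun j hj => ?_
  rw [Finset.mem_Icc] at hj
  have h3 : coeff (-1 - j) y = f (monomial (-1 - (-1 - j))) := if_neg (by omega)
  rw [map_smul, h3, smul_eq_mul]
  congr 3
  ring

end Laurent

namespace Completion

open Laurent

section

variable {A : Type} [CommRing A] [IsDomain A] [Algebra ℂ A] {ι : Type} (X : Completion A ι)

theorem expandForm_smul_D (i : ι) (a b : A) : X.expandForm i (a • KaehlerDifferential.D ℂ A b) =
    X.expandFun i a * Laurent.deriv (X.expandFun i b) := by
  let _ : Algebra A Laurent := (X.expandFun i).toRingHom.toAlgebra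
  have _ : IsScalarTower ℂ A Laurent := IsScalarTower.of_algebraMap_eq fun c =>
    ((X.expandFun i).commutes c).symm
  change (Derivation.compAlgebraMap A Laurent.deriv).liftKaehlerDifferential (a • _) = _
  rw [map_smul, Derivation.liftKaehlerDifferential_comp_D, Algebra.smul_def]
  rfl

end

variable {A : Type} [CommRing A] [IsDedekindDomain A] [Algebra ℂ A] {ι : Type} (X : Completion A ι)
  [Fintype ι] [Algebra.FiniteType ℂ A] [Nonempty ι]

/-- There is a regular form with given polar parts, up to simple poles. -/
theorem exists_form (P : ι → Laurent) : ∃ ω : Ω[A⁄ℂ], ∀ i, X.expandForm i ω - P i ∈ ge (-1) := by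
  classical
  let F : Ω[A⁄ℂ] →ₗ[ℂ] (ι → Laurent) := LinearMap.pi X.expandForm
  let Q : Submodule ℂ (ι → Laurent) := Submodule.pi Set.univ fun _ => ge (-1)
  suffices h : P ∈ LinearMap.range F ⊔ Q by
    obtain ⟨_, ⟨ω, rfl⟩, q, hq, hP⟩ := Submodule.mem_sup.1 h
    refine ⟨ω, fun i => ?_⟩
    have : X.expandForm i ω - P i = -q i := by
      rw [← hP]
      change X.expandForm i ω - (X.expandForm i ω + q i) = _
      ring
    rw [this]
    exact neg_mem (hq i trivial)
  by_contra hP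
  -- A functional that kills regular forms and simple poles is a residue pairing with series without
  -- constant term. By duality these are the expansions of a regular function without poles, a
  -- constant, which must be zero.
  obtain ⟨f, hfP, hf⟩ := Submodule.exists_le_ker_of_notMem hP
  choose y hy1 hy using fun i => exists_residue_eq (f ∘ₗ LinearMap.single ℂ (fun _ => Laurent) i)
    fun s hs => hf (Submodule.mem_sup_right fun j _ => by
      by_cases hij : j = i
      · subst hij; simpa using hs
      · simp [hij])
  have hfy : ∀ w, f w = ∑ i, Laurent.coeff (-1) (y i * w i) := by
    intro w
    rw [← Finset.univ_sum_single w, map_sum]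
    refine Finset.sum_congr rfl fun i _ => ?_
    rw [Finset.univ_sum_single w]
    exact hy i (w i)
  have hyM : y ∈ X.orthogonal := by
    intro a b
    have h := hf (Submodule.mem_sup_left (LinearMap.mem_range_self F (a • KaehlerDifferential.D ℂ A b)))
    rw [LinearMap.mem_ker, hfy] at h
    rw [← h]
    exact Finset.sum_congr rfl fun i _ => by rw [← expandForm_smul_D]; rfl
  obtain ⟨a, ha⟩ := X.exists_expandFun_eq hyM
  obtain ⟨c, hc⟩ := X.exists_eq_algebraMap (a := a) fun i => by
    rw [ha]
    exact ge_anti (by omega) (hy1 i)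
  have hc0 : c = 0 := by
    have h := hy1 (Classical.arbitrary ι) 0 (by omega)
    rw [← ha, hc, AlgHom.commutes, Algebra.algebraMap_eq_smul_one, map_smul, coeff_one, if_pos rfl,
      smul_eq_mul, mul_one] at h
    exact h
  apply hfP
  rw [hfy]
  refine Finset.sum_eq_zero fun i _ => ?_
  rw [← ha, hc, hc0, map_zero, map_zero, zero_mul, map_zero]

end Completion
end Isostokes

/-! ### One-parameter groups of nilpotent matrices -/

namespace Isostokes

namespace LinearAlgebraicGroup

attribute [local instance 100] LieRing.ofAssociativeRing

open Polynomial (derivative aeval eval)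

variable {N : ℕ}

theorem map_derivation_mul {R : Type*} [CommRing R] [Algebra ℂ R] (D : Derivation ℂ R R)
    (A B : Matrix (Fin N) (Fin N) R) : (A * B).map D = A.map D * B + A * B.map D := by
  ext i j
  simp only [Matrix.map_apply, Matrix.mul_apply, Matrix.add_apply, map_sum, Derivation.leibniz,
    smul_eq_mul, Finset.sum_add_distrib]
  rw [add_comm]
  congr 1
  exact Finset.sum_congr rfl fun k _ => mul_comm _ _

theorem map_derivation_const {R : Type*} [CommRing R] [Algebra ℂ R] (D : Derivation ℂ R R)
    (A : Matrix (Fin N) (Fin N) ℂ) : (A.map (algebraMap ℂ R)).map D = 0 := by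
  ext i j
  simp

/-- A polynomial matrix is determined by its derivative and its value at `0`. -/
theorem eq_of_derivative_eq_zero {Z : Matrix (Fin N) (Fin N) (Polynomial ℂ)}
    {Y : Matrix (Fin N) (Fin N) ℂ} (h : Z.map derivative = 0) (h0 : Z.map (eval 0) = Y) :
    Z = Y.map (algebraMap ℂ (Polynomial ℂ)) := by
  ext1 i j
  have h1 : derivative (Z i j) = 0 := congrFun (congrFun h i) j
  have h2 : eval 0 (Z i j) = Y i j := congrFun (congrFun h0 i) j
  rw [Polynomial.eq_C_of_natDegree_eq_zero (Polynomial.derivative_eq_zero.1 h1),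
    Polynomial.coeff_zero_eq_eval_zero, h2]
  rfl

/-- The matrix `exp (τ M)` over `ℂ[τ]`, for a nilpotent matrix `M`. -/
def expMat (M : Matrix (Fin N) (Fin N) ℂ) : Matrix (Fin N) (Fin N) (Polynomial ℂ) :=
  ∑ k ∈ Finset.range (nilpotencyClass M), (Polynomial.C ((k.factorial : ℂ)⁻¹) * Polynomial.X ^ k) •
    (M.map (algebraMap ℂ (Polynomial ℂ))) ^ k

variable {M : Matrix (Fin N) (Fin N) ℂ}

theorem expMat_comm : M.map (algebraMap ℂ (Polynomial ℂ)) * expMat M =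
    expMat M * M.map (algebraMap ℂ (Polynomial ℂ)) := by
  rw [expMat, Finset.mul_sum, Finset.sum_mul]
  refine Finset.sum_congr rfl fun k _ => ?_
  rw [mul_smul_comm, smul_mul_assoc, ← pow_succ', ← pow_succ]

theorem map_pow_algebraMap {R : Type*} [CommRing R] [Algebra ℂ R] (k : ℕ) :
    (M.map (algebraMap ℂ R)) ^ k = (M ^ k).map (algebraMap ℂ R) :=
  (map_pow (RingHom.mapMatrix (algebraMap ℂ R)) M k).symm

theorem expMat_derivative (hM : IsNilpotent M) : (expMat M).map derivative =
    M.map (algebraMap ℂ (Polynomial ℂ)) * expMat M := by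
  obtain ⟨d, hd⟩ : ∃ d, nilpotencyClass M = d + 1 ∨ nilpotencyClass M = 0 := by
    rcases nilpotencyClass M with _ | d
    · exact ⟨0, Or.inr rfl⟩
    · exact ⟨d, Or.inl rfl⟩
  -- Nilpotency class zero means `1 = 0`, which happens only for matrices of size zero.
  rcases hd with hd | hd
  · have hpow : (M.map (algebraMap ℂ (Polynomial ℂ))) ^ (d + 1) = 0 := by
      rw [map_pow_algebraMap, ← hd, pow_nilpotencyClass hM]
      ext i j
      simp
    have hder : ∀ k : ℕ, ((Polynomial.C ((k.factorial : ℂ)⁻¹) * Polynomial.X ^ k) •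
        (M.map (algebraMap ℂ (Polynomial ℂ))) ^ k).map derivative =
        (Polynomial.C (k * (k.factorial : ℂ)⁻¹) * Polynomial.X ^ (k - 1)) •
        (M.map (algebraMap ℂ (Polynomial ℂ))) ^ k := by
      intro k
      rw [map_pow_algebraMap]
      ext1 i j
      simp only [Matrix.map_apply, Matrix.smul_apply, smul_eq_mul, Polynomial.algebraMap_eq]
      rw [mul_right_comm, ← Polynomial.C_mul, Polynomial.derivative_C_mul, Polynomial.derivative_X_pow]
      simp only [Polynomial.C_mul]
      ring
    have hsum : (expMat M).map derivative = ∑ k ∈ Finset.range (d + 1),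
        ((Polynomial.C ((k.factorial : ℂ)⁻¹) * Polynomial.X ^ k) •
        (M.map (algebraMap ℂ (Polynomial ℂ))) ^ k).map derivative := by
      rw [expMat, hd]
      exact map_sum (derivative.toAddMonoidHom.mapMatrix (m := Fin N) (n := Fin N)) _ _
    rw [hsum, Finset.sum_congr rfl fun k _ => hder k, Finset.sum_range_succ', expMat, hd,
      Finset.sum_range_succ, mul_add, Finset.mul_sum, mul_smul_comm, ← pow_succ', hpow, smul_zero,
      add_zero, Nat.cast_zero, zero_mul, Polynomial.C_0, zero_mul, zero_smul, add_zero]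
    refine Finset.sum_congr rfl fun k _ => ?_
    rw [mul_smul_comm, ← pow_succ', Nat.add_sub_cancel, Nat.factorial_succ]
    have h1 : ((k + 1 : ℕ) : ℂ) ≠ 0 := by exact_mod_cast k.succ_ne_zero
    have h2 : ((k + 1 : ℕ) : ℂ) * (((k + 1) * k.factorial : ℕ) : ℂ)⁻¹ = ((k.factorial : ℕ) : ℂ)⁻¹ := by
      rw [Nat.cast_mul, mul_inv, ← mul_assoc, mul_inv_cancel₀ h1, one_mul]
    rw [h2]
  · rw [expMat, hd]
    ext i j
    simp

theorem expMat_eval_zero (hM : IsNilpotent M) : (expMat M).map (eval 0) = 1 := by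
  rcases h : nilpotencyClass M with _ | d
  · have h1 := pow_nilpotencyClass hM
    rw [h, pow_zero] at h1
    have h2 : ∀ A : Matrix (Fin N) (Fin N) ℂ, A = 1 := fun A => by
      rw [← one_mul A, h1, zero_mul]
    exact h2 _
  · have hsum : (expMat M).map (eval 0) = ∑ k ∈ Finset.range (d + 1),
        ((Polynomial.C ((k.factorial : ℂ)⁻¹) * Polynomial.X ^ k) •
        (M.map (algebraMap ℂ (Polynomial ℂ))) ^ k).map (eval 0) := by
      rw [expMat, h]
      exact map_sum ((Polynomial.evalRingHom (0 : ℂ)).toAddMonoidHom.mapMatrix (m := Fin N)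
        (n := Fin N)) _ _
    rw [hsum, Finset.sum_range_succ', Finset.sum_eq_zero, zero_add]
    · ext i j
      simp [Matrix.one_apply, apply_ite]
    · intro k _
      ext i j
      simp

/-- The matrix `exp (s M)`. -/
def expAt (M : Matrix (Fin N) (Fin N) ℂ) {R : Type} [CommRing R] [Algebra ℂ R] (s : R) :
    Matrix (Fin N) (Fin N) R := (expMat M).map (aeval s)

theorem map_algHom_algebraMap {R S : Type*} [CommRing R] [Algebra ℂ R] [CommRing S] [Algebra ℂ S]
    (f : R →ₐ[ℂ] S) (Y : Matrix (Fin N) (Fin N) ℂ) :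
    (Y.map (algebraMap ℂ R)).map f = Y.map (algebraMap ℂ S) := by
  ext i j
  simp

theorem map_neg_algebraMap {R : Type*} [CommRing R] [Algebra ℂ R] :
    (-M).map (algebraMap ℂ R) = -M.map (algebraMap ℂ R) := by
  ext i j
  simp

theorem map_derivative_mul (A B : Matrix (Fin N) (Fin N) (Polynomial ℂ)) :
    (A * B).map derivative = A.map derivative * B + A * B.map derivative :=
  map_derivation_mul Polynomial.derivative' A B

theorem expMat_comm_of_comm {Y : Matrix (Fin N) (Fin N) (Polynomial ℂ)}
    (h : Commute Y (M.map (algebraMap ℂ (Polynomial ℂ)))) : Commute Y (expMat M) :=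
  Commute.sum_right _ _ _ fun _ _ => (h.pow_right _).smul_right _

theorem expMat_neg_mul (hM : IsNilpotent M) : expMat (-M) * expMat M = 1 := by
  have h0 : Commute (M.map (algebraMap ℂ (Polynomial ℂ))) (expMat (-M)) :=
    expMat_comm_of_comm (by rw [map_neg_algebraMap]; exact (Commute.refl _).neg_right)
  rw [eq_of_derivative_eq_zero (Z := expMat (-M) * expMat M) (Y := 1)]
  · ext i j
    simp [Matrix.one_apply, apply_ite]
  · rw [map_derivative_mul, expMat_derivative hM, expMat_derivative hM.neg, map_neg_algebraMap,
      ← mul_assoc, ← h0.eq, neg_mul, neg_mul, neg_add_cancel]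
  · have h1 : (expMat (-M) * expMat M).map (eval 0) =
        (expMat (-M)).map (eval 0) * (expMat M).map (eval 0) :=
      Matrix.map_mul (f := Polynomial.evalRingHom (0 : ℂ))
    rw [h1, expMat_eval_zero hM, expMat_eval_zero hM.neg, one_mul]

theorem expMat_mul_neg (hM : IsNilpotent M) : expMat M * expMat (-M) = 1 := by
  simpa using expMat_neg_mul hM.neg

/-- `exp (s M) Y exp (-s M) = Y + s [M, Y] + s ^ 2 [M, [M, Y]] / 2` if the other terms
vanish. -/
theorem expMat_conj (hM : IsNilpotent M) {Y Y₁ Y₂ : Matrix (Fin N) (Fin N) ℂ}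
    (h₁ : M * Y - Y * M = Y₁) (h₂ : M * Y₁ - Y₁ * M = (2 : ℂ) • Y₂) (h₃ : M * Y₂ - Y₂ * M = 0) :
    expMat M * Y.map (algebraMap ℂ (Polynomial ℂ)) = (Y.map (algebraMap ℂ (Polynomial ℂ)) +
      (Polynomial.X : Polynomial ℂ) • Y₁.map (algebraMap ℂ (Polynomial ℂ)) +
      (Polynomial.X ^ 2 : Polynomial ℂ) • Y₂.map (algebraMap ℂ (Polynomial ℂ))) * expMat M := by
  let φ := RingHom.mapMatrix (m := Fin N) (algebraMap ℂ (Polynomial ℂ))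
  have hφ : ∀ Y, Y.map (algebraMap ℂ (Polynomial ℂ)) = φ Y := fun Y => rfl
  set Z := Y.map (algebraMap ℂ (Polynomial ℂ)) +
      (Polynomial.X : Polynomial ℂ) • Y₁.map (algebraMap ℂ (Polynomial ℂ)) +
      (Polynomial.X ^ 2 : Polynomial ℂ) • Y₂.map (algebraMap ℂ (Polynomial ℂ)) with hZ
  have hZ' : Z.map derivative = φ M * Z - Z * φ M := by
    have e1 : φ M * φ Y - φ Y * φ M = φ Y₁ := by rw [← map_mul, ← map_mul, ← map_sub, h₁]
    have e2 : φ M * φ Y₁ - φ Y₁ * φ M = (2 : Polynomial ℂ) • φ Y₂ := by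
      rw [← map_mul, ← map_mul, ← map_sub, h₂]
      ext1 i j
      simp only [φ, RingHom.mapMatrix_apply, Matrix.map_apply, Matrix.smul_apply, smul_eq_mul, map_mul]
      rfl
    have e3 : φ M * φ Y₂ - φ Y₂ * φ M = 0 := by rw [← map_mul, ← map_mul, ← map_sub, h₃, map_zero]
    have e4 : Z.map derivative = φ Y₁ + (2 * Polynomial.X : Polynomial ℂ) • φ Y₂ := by
      ext1 i j
      simp [hZ, φ, Polynomial.derivative_mul]
      ring
    have e5 : φ M * Z - Z * φ M = (φ M * φ Y - φ Y * φ M) + (Polynomial.X : Polynomial ℂ) •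
        (φ M * φ Y₁ - φ Y₁ * φ M) + (Polynomial.X ^ 2 : Polynomial ℂ) •
        (φ M * φ Y₂ - φ Y₂ * φ M) := by
      simp only [hZ, hφ, mul_add, add_mul, mul_smul_comm, smul_mul_assoc, smul_sub]
      abel
    rw [e4, e5, e1, e2, e3, smul_zero, add_zero, smul_smul, mul_comm Polynomial.X]
  have h0 : φ M * expMat (-M) = expMat (-M) * φ M :=
    expMat_comm_of_comm (by rw [map_neg_algebraMap]; exact (Commute.refl _).neg_right)
  have hc : (φ Y).map derivative = 0 := map_derivation_const Polynomial.derivative' Y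
  -- The polynomial `Z` solves `Z' = [M, Z]`, so conjugating it back gives a constant matrix, equal
  -- to its value `Y` at zero.
  have hW : expMat (-M) * (Z * expMat M) = φ Y := by
    refine eq_of_derivative_eq_zero ?_ ?_
    · rw [map_derivative_mul, map_derivative_mul, expMat_derivative hM, expMat_derivative hM.neg,
        hZ', map_neg_algebraMap, hφ, neg_mul, h0]
      noncomm_ring
    · have h1 : (expMat (-M) * (Z * expMat M)).map (eval 0) =
          (expMat (-M)).map (eval 0) * (Z.map (eval 0) * (expMat M).map (eval 0)) := by
        exact (Matrix.map_mul (f := Polynomial.evalRingHom (0 : ℂ))).trans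
          (congrArg _ (Matrix.map_mul (f := Polynomial.evalRingHom (0 : ℂ))))
      rw [h1, expMat_eval_zero hM, expMat_eval_zero hM.neg, one_mul, mul_one]
      ext1 i j
      simp [hZ]
  rw [hφ, ← hW, ← mul_assoc, expMat_mul_neg hM, one_mul]

section

variable {R : Type} [CommRing R] [Algebra ℂ R]

theorem map_aeval_mul (A B : Matrix (Fin N) (Fin N) (Polynomial ℂ)) (s : R) :
    (A * B).map (aeval s) = A.map (aeval s) * B.map (aeval s) :=
  Matrix.map_mul (f := aeval (R := ℂ) s)

theorem expAt_mul_neg (hM : IsNilpotent M) (s : R) : expAt M s * expAt (-M) s = 1 := by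
  rw [expAt, expAt, ← map_aeval_mul, expMat_mul_neg hM]
  exact Matrix.map_one _ (map_zero _) (map_one _)

/-- `exp (s M)` as an invertible matrix. -/
def expGL (hM : IsNilpotent M) (s : R) : GL (Fin N) R :=
  ⟨expAt M s, expAt (-M) s, expAt_mul_neg hM s, by simpa using expAt_mul_neg hM.neg s⟩

theorem expAt_conj (hM : IsNilpotent M) (s : R) {Y Y₁ Y₂ : Matrix (Fin N) (Fin N) ℂ}
    (h₁ : M * Y - Y * M = Y₁) (h₂ : M * Y₁ - Y₁ * M = (2 : ℂ) • Y₂) (h₃ : M * Y₂ - Y₂ * M = 0) :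
    expAt M s * Y.map (algebraMap ℂ R) = (Y.map (algebraMap ℂ R) + s • Y₁.map (algebraMap ℂ R) +
      (s ^ 2) • Y₂.map (algebraMap ℂ R)) * expAt M s := by
  have h := congrArg (fun A : Matrix (Fin N) (Fin N) (Polynomial ℂ) => A.map (aeval s))
    (expMat_conj hM h₁ h₂ h₃)
  simp only [map_aeval_mul] at h
  rw [map_algHom_algebraMap] at h
  refine h.trans (congrArg (· * _) ?_)
  ext i j
  simp [mul_comm s, mul_comm (s ^ 2)]

theorem expAt_comm (s : R) : expAt M s * M.map (algebraMap ℂ R) =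
    M.map (algebraMap ℂ R) * expAt M s := by
  have h := congrArg (fun A : Matrix (Fin N) (Fin N) (Polynomial ℂ) => A.map (aeval s))
    (expMat_comm (M := M))
  simp only [map_aeval_mul] at h
  rw [map_algHom_algebraMap] at h
  exact h.symm

theorem expAt_derivation (hM : IsNilpotent M) (D : Derivation ℂ R R) (s : R) :
    (expAt M s).map D = D s • (M.map (algebraMap ℂ R) * expAt M s) := by
  have h := congrArg (fun A : Matrix (Fin N) (Fin N) (Polynomial ℂ) => A.map (aeval s))
    (expMat_derivative hM)
  simp only [map_aeval_mul] at h
  rw [map_algHom_algebraMap] at h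
  rw [expAt, ← h]
  ext i j
  simp [mul_comm]

theorem expAt_mul_oneAdd (hM : IsNilpotent M) (x : R) {e : R} (he : e * e = 0) :
    expAt M x * oneAdd e M = expAt M (x + e) := by
  have h5 : expAt M (x + e) = expAt M x + e • ((expMat M).map derivative).map (aeval x) := by
    ext i j
    simp only [expAt, Matrix.map_apply, Matrix.add_apply, Matrix.smul_apply, smul_eq_mul]
    rw [Polynomial.aeval_add_of_sq_eq_zero _ _ _ (by rw [pow_two, he]), mul_comm e]
  rw [h5, expMat_derivative hM, expMat_comm, map_aeval_mul, map_algHom_algebraMap, oneAdd, mul_add,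
    mul_one, mul_smul_comm]
  rfl

theorem aeval_map_aeval (p : MvPolynomial (Fin N × Fin N) ℂ) (x : R) :
    MvPolynomial.aeval (fun ij => expAt M x ij.1 ij.2) p =
      aeval x (MvPolynomial.aeval (fun ij => expMat M ij.1 ij.2) p) :=
  (MvPolynomial.comp_aeval_apply (R := ℂ)
    (fun ij : Fin N × Fin N => expMat M ij.1 ij.2) (aeval (R := ℂ) x) p).symm

theorem isPoint_expAt_add {G : LinearAlgebraicGroup N} (hG : M ∈ G.lie) (hM : IsNilpotent M) {x e : R}
    (hx : G.IsPoint (expAt M x)) (he : e * e = 0) : G.IsPoint (expAt M (x + e)) := by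
  have h2 : G.IsPoint (oneAdd e M) := by
    have h := IsPoint.map (epsMap _ he) (show G.IsPoint (oneAdd (DualNumber.eps : DualNumber ℂ) M) from hG)
    rwa [oneAdd_map, epsMap_eps] at h
  have h3 := G.mul_mem (expGL hM x) (oneAddGL _ he M) hx h2
  rwa [show (expGL hM x * oneAddGL _ he M).val = expAt M (x + e) from expAt_mul_oneAdd hM x he] at h3

end

/-- All derivatives of an element vanish at zero, so the polynomial does. -/
theorem eq_bot_of_derivative_mem {J : Ideal (Polynomial ℂ)} (h0 : ∀ q ∈ J, q.eval 0 = 0)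
    (h : ∀ q ∈ J, derivative q ∈ J) : J = ⊥ := by
  rw [eq_bot_iff]
  intro q hq
  rw [Ideal.mem_bot]
  induction hd : q.natDegree using Nat.strong_induction_on generalizing q with
  | _ d ih =>
    have hdeg : q.natDegree = 0 := by
      by_contra hne
      have h1 := ih _ (hd ▸ Polynomial.natDegree_derivative_lt hne) (h q hq) rfl
      exact hne (Polynomial.derivative_eq_zero.1 h1)
    have h1 := h0 q hq
    rw [Polynomial.eq_C_of_natDegree_eq_zero hdeg] at h1 ⊢
    rw [Polynomial.eval_C] at h1
    rw [h1, Polynomial.C_0]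

/-- The one-parameter group of a nilpotent element of the Lie algebra is contained in the
group. -/
theorem isPoint_expMat {G : LinearAlgebraicGroup N} (hG : M ∈ G.lie) (hM : IsNilpotent M) :
    G.IsPoint (expMat M) := by
  let ev : MvPolynomial (Fin N × Fin N) ℂ → Polynomial ℂ :=
    fun p => MvPolynomial.aeval (fun ij => expMat M ij.1 ij.2) p
  let J : Ideal (Polynomial ℂ) := Ideal.span (ev '' G.eqs)
  suffices hJ : J = ⊥ by
    intro p hp
    have : ev p ∈ J := Ideal.subset_span ⟨p, hp, rfl⟩
    rwa [hJ, Ideal.mem_bot] at this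
  -- Modulo `J` the matrix `exp (τ M)` is a point of the group, and over the dual numbers `1 + ε M`
  -- is another. Their product is `exp ((τ + ε) M)`; the coefficient of `ε` in its equations is the
  -- derivative of the original ones.
  have hder : ∀ p ∈ G.eqs, derivative (ev p) ∈ J := by
    intro p hp
    let mk := Ideal.Quotient.mk J
    let x : DualNumber (Polynomial ℂ ⧸ J) := TrivSqZeroExt.inl (mk Polynomial.X)
    let φ : Polynomial ℂ →ₐ[ℂ] DualNumber (Polynomial ℂ ⧸ J) :=
      (TrivSqZeroExt.inlAlgHom ℂ _ _).comp (Ideal.Quotient.mkₐ ℂ J)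
    have hφ : ∀ q, aeval x q = TrivSqZeroExt.inl (mk q) := fun q => by
      have h : aeval (φ Polynomial.X) q = φ q := by
        rw [Polynomial.aeval_algHom_apply, Polynomial.aeval_X_left_apply]
      exact h
    have hx : G.IsPoint (expAt M x) := fun p hp => by
      refine (aeval_map_aeval p x).trans ?_
      have h0 : mk (ev p) = 0 := Ideal.Quotient.eq_zero_iff_mem.2 (Ideal.subset_span ⟨p, hp, rfl⟩)
      exact (hφ (ev p)).trans ((congrArg _ h0).trans (TrivSqZeroExt.inl_zero _))
    have h7 := (aeval_map_aeval p _).symm.trans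
      (isPoint_expAt_add hG hM hx (DualNumber.eps_mul_eps (R := Polynomial ℂ ⧸ J)) p hp)
    have h8 := (Polynomial.aeval_add_of_sq_eq_zero (ev p) x DualNumber.eps
      ((pow_two _).trans DualNumber.eps_mul_eps)).symm.trans h7
    rw [hφ, hφ] at h8
    have h9 := congrArg TrivSqZeroExt.snd h8
    rw [← Ideal.Quotient.eq_zero_iff_mem]
    simpa using h9
  refine eq_bot_of_derivative_mem (fun q hq => ?_) fun q hq => ?_
  · induction hq using Submodule.span_induction with
    | zero => simp
    | add x y _ _ hx hy => rw [Polynomial.eval_add, hx, hy, add_zero]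
    | smul a x _ hx => rw [smul_eq_mul, Polynomial.eval_mul, hx, mul_zero]
    | mem x hx =>
      obtain ⟨p, hp, rfl⟩ := hx
      have h := MvPolynomial.comp_aeval_apply (R := ℂ)
        (fun ij : Fin N × Fin N => expMat M ij.1 ij.2) (aeval (R := ℂ) (0 : ℂ)) p
      rw [Polynomial.coe_aeval_eq_eval] at h
      have h1 := G.one_mem p hp
      rw [← expMat_eval_zero hM] at h1
      exact h.trans h1
  · induction hq using Submodule.span_induction with
    | zero => simp
    | add x y _ _ hx hy => rw [map_add]; exact add_mem hx hy
    | smul a x hx hx' =>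
      rw [smul_eq_mul, Polynomial.derivative_mul]
      exact add_mem (Ideal.mul_mem_left _ _ hx) (Ideal.mul_mem_left _ _ hx')
    | mem x hx =>
      obtain ⟨p, hp, rfl⟩ := hx
      exact hder p hp

theorem isPoint_expAt {G : LinearAlgebraicGroup N} (hG : M ∈ G.lie) (hM : IsNilpotent M) {R : Type}
    [CommRing R] [Algebra ℂ R] (s : R) : G.IsPoint (expAt M s) :=
  (isPoint_expMat hG hM).map (aeval s)

end LinearAlgebraicGroup
end Isostokes

/-! ### Logarithmic derivatives and representatives of reflections -/

namespace Isostokes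

namespace Laurent

/-- Coefficients of the solution of `z s' = (z u) s` with `s(0) = 1`, for a power series `z u`
without constant term. -/
def odeCoeff (u : ℕ → ℂ) : ℕ → ℂ
  | 0 => 1
  | k + 1 => (∑ j : Fin (k + 1), u (k - j) * odeCoeff u j) / (k + 1)

/-- A Laurent series with at most a simple pole and an integral residue is a logarithmic
derivative. -/
theorem exists_logDeriv {u : Laurent} (hu : u ∈ ge (-1)) {m : ℤ} (hm : coeff (-1) u = m) :
    ∃ s : Laurent, s ≠ 0 ∧ deriv s = u * s := by
  let a := odeCoeff fun k => coeff k u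
  -- The solution is `z ^ m y`, where `m` is the residue and the power series `y` solves `y' = v y`,
  -- `y(0) = 1`, for the regular part `v` of `u`.
  let y : Laurent := ofCoeffs (fun k => if k < 0 then 0 else a k.toNat) 0 fun k hk => if_pos hk
  have hy : y ∈ ge 0 := fun k hk => if_pos hk
  have hyk : ∀ k : ℕ, coeff k y = a k := fun k => by
    change (if (k : ℤ) < 0 then 0 else a (k : ℤ).toNat) = a k
    rw [if_neg (by omega), Int.toNat_natCast]
  let v := u - (m : ℂ) • monomial (-1)
  have hv : v ∈ ge 0 := fun k hk => by
    rw [map_sub, map_smul, coeff_monomial]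
    split_ifs with h
    · rw [h, hm, smul_eq_mul, mul_one, sub_self]
    · rw [hu k (by omega), smul_zero, sub_zero]
  have hvk : ∀ k : ℕ, coeff k v = coeff k u := fun k => by
    rw [map_sub, map_smul, coeff_monomial, if_neg (by omega), smul_zero, sub_zero]
  have hdy : deriv y = v * y := by
    ext k
    rcases lt_or_ge k 0 with hk | hk
    · rw [mul_mem_ge hv hy k (by omega), coeff_deriv]
      rcases eq_or_ne k (-1) with rfl | hk1
      · simp
      · rw [hy (k + 1) (by omega), mul_zero]
    · obtain ⟨k, rfl⟩ := Int.eq_ofNat_of_zero_le hk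
      have h1 : coeff ((k : ℤ) + 1) y = a (k + 1) := hyk (k + 1)
      have h2 : a (k + 1) = (∑ j : Fin (k + 1), coeff ((k - j : ℕ) : ℤ) u * a j) / (k + 1) := by
        simp only [a]
        rw [odeCoeff]
      have h3 : ((k + 1 : ℤ) : ℂ) ≠ 0 := by exact_mod_cast k.succ_ne_zero
      have h4 : ((k : ℂ) + 1) ≠ 0 := by exact_mod_cast k.succ_ne_zero
      rw [coeff_deriv, h1, h2, mul_comm v, coeff_mul_Icc hy hv]
      push_cast
      rw [mul_div_cancel₀ _ h4, Fin.sum_univ_eq_sum_range (fun j => coeff ((k - j : ℕ) : ℤ) u * a j) (k + 1)]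
      refine Finset.sum_nbij' (fun j => (j : ℤ)) (fun j => j.toNat) ?_ ?_ ?_ ?_ ?_
      · intro j hj
        simp only [Finset.mem_range, Finset.mem_Icc] at hj ⊢
        omega
      · intro j hj
        simp only [Finset.mem_range, Finset.mem_Icc] at hj ⊢
        omega
      · intro j _
        simp
      · intro j hj
        simp only [Finset.mem_Icc] at hj
        omega
      · intro j hj
        rw [Finset.mem_range] at hj
        rw [hyk, mul_comm, ← hvk, Nat.cast_sub (by omega)]
  refine ⟨monomial m * y, mul_ne_zero (monomial_hasOrd m).ne_zero fun h0 => ?_, ?_⟩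
  · have := hyk 0
    rw [h0, map_zero] at this
    exact zero_ne_one (this.trans (by simp only [a]; rw [odeCoeff]))
  · have h1 : deriv (monomial m) = (m : ℂ) • (monomial (-1) * monomial m) := by
      ext k
      rw [coeff_deriv, map_smul, coeff_monomial_mul, coeff_monomial, coeff_monomial]
      by_cases h : k + 1 = m
      · rw [if_pos h, if_pos (by omega), h]
        simp
      · rw [if_neg h, if_neg (by omega)]
        simp
    rw [Derivation.leibniz, hdy, h1, smul_eq_mul, smul_eq_mul, Algebra.smul_def]
    simp only [v, Algebra.smul_def]
    ring

end Laurent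

namespace LinearAlgebraicGroup

attribute [local instance 100] LieRing.ofAssociativeRing

variable {N : ℕ}

/-- Nonzero powers `e ^ k` would be eigenvectors of `ad h` with infinitely many distinct eigenvalues
`k c`. -/
theorem isNilpotent_of_lie_eq {e h : Matrix (Fin N) (Fin N) ℂ} {c : ℂ} (hc : c ≠ 0)
    (he : h * e - e * h = c • e) : IsNilpotent e := by
  by_contra hne
  have hpow : ∀ k : ℕ, h * e ^ k - e ^ k * h = (k * c) • e ^ k := by
    intro k
    induction k with
    | zero => simp
    | succ k ih =>
      have h1 : h * e ^ (k + 1) - e ^ (k + 1) * h =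
          (h * e ^ k - e ^ k * h) * e + e ^ k * (h * e - e * h) := by
        rw [pow_succ]
        noncomm_ring
      rw [h1, ih, he, smul_mul_assoc, mul_smul_comm, ← pow_succ, ← add_smul]
      push_cast
      congr 1
      ring
  let f : Module.End ℂ (Matrix (Fin N) (Fin N) ℂ) := LinearMap.mulLeft ℂ h - LinearMap.mulRight ℂ h
  have hinj : Function.Injective fun k : ℕ => (k : ℂ) * c := fun k l hkl => by
    exact_mod_cast mul_right_cancel₀ hc hkl
  refine Set.infinite_range_of_injective hinj ((Module.End.finite_hasEigenvalue f).subset ?_)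
  rintro _ ⟨k, rfl⟩
  exact Module.End.hasEigenvalue_of_hasEigenvector (x := e ^ k)
    ⟨Module.End.mem_eigenspace_iff.2 (hpow k), fun h0 => hne ⟨k, h0⟩⟩

section Weyl

variable {R : Type} [CommRing R] [Algebra ℂ R] {e f h : Matrix (Fin N) (Fin N) ℂ}

/-- The element `exp (s e) exp (-s⁻¹ f) exp (s e)` (with `r = s⁻¹`), which represents a
reflection. -/
def weyl (e f : Matrix (Fin N) (Fin N) ℂ) (s r : R) : Matrix (Fin N) (Fin N) R :=
  expAt e s * expAt f (-r) * expAt e s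

variable (he : IsNilpotent e) (hf : IsNilpotent f) (h1 : h * e - e * h = (2 : ℂ) • e)
  (h2 : h * f - f * h = (-2 : ℂ) • f) (h3 : e * f - f * e = h)

theorem expAt_mul_e {f e h : Matrix (Fin N) (Fin N) ℂ} (hf : IsNilpotent f)
    (h2 : h * f - f * h = (-2 : ℂ) • f) (h3 : e * f - f * e = h) (r : R) :
    expAt f r * e.map (algebraMap ℂ R) = (e.map (algebraMap ℂ R) - r • h.map (algebraMap ℂ R) -
      (r ^ 2) • f.map (algebraMap ℂ R)) * expAt f r := by
  rw [expAt_conj hf r (Y₁ := -h) (Y₂ := -f), map_neg_algebraMap, map_neg_algebraMap, smul_neg, smul_neg,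
    sub_eq_add_neg, sub_eq_add_neg]
  · rw [← h3, neg_sub]
  · rw [mul_neg, neg_mul, smul_neg, ← neg_smul, ← h2]
    abel
  · rw [mul_neg, neg_mul, sub_self]

theorem expAt_mul_eigen {f t : Matrix (Fin N) (Fin N) ℂ} (hf : IsNilpotent f) {a : ℂ}
    (h : t * f - f * t = a • f) (r : R) :
    expAt f r * t.map (algebraMap ℂ R) = (t.map (algebraMap ℂ R) -
      (algebraMap ℂ R a * r) • f.map (algebraMap ℂ R)) * expAt f r := by
  rw [expAt_conj hf r (Y₁ := -(a • f)) (Y₂ := 0)]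
  · congr 1
    ext i j
    simp
    ring
  · rw [← h, neg_sub]
  · simp
  · simp

/-- The action on `𝔥` is the reflection `t ↦ t - α(t) h` and does not depend on the parameter `s`,
so in a product of two such elements the reflections cancel. -/
theorem weyl_mul (he : IsNilpotent e) (hf : IsNilpotent f) (h1 : h * e - e * h = (2 : ℂ) • e)
    (h2 : h * f - f * h = (-2 : ℂ) • f) (h3 : e * f - f * e = h) {s r : R} (hs : s * r = 1)
    {t : Matrix (Fin N) (Fin N) ℂ} {a : ℂ} (hte : t * e - e * t = a • e)
    (htf : t * f - f * t = (-a) • f) :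
    weyl e f s r * t.map (algebraMap ℂ R) = (t - a • h).map (algebraMap ℂ R) * weyl e f s r := by
  have e1 := expAt_mul_eigen he hte s
  have e2 := expAt_mul_eigen hf htf (-r)
  have e3 := expAt_mul_e hf h2 h3 (-r)
  have e4 := expAt_mul_eigen he h1 s
  have e5 := expAt_comm (M := e) s
  have e6 : (t - a • h).map (algebraMap ℂ R) =
      t.map (algebraMap ℂ R) - (algebraMap ℂ R a) • h.map (algebraMap ℂ R) := by
    ext i j
    simp only [Matrix.map_apply, Matrix.sub_apply, Matrix.smul_apply, map_sub, smul_eq_mul, map_mul]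
  rw [weyl, e6]
  simp only [map_neg, map_ofNat] at e2 e4
  generalize expAt e s = E at *
  generalize expAt f (-r) = F at *
  generalize e.map (algebraMap ℂ R) = e at *
  generalize f.map (algebraMap ℂ R) = f at *
  generalize h.map (algebraMap ℂ R) = h at *
  generalize t.map (algebraMap ℂ R) = t at *
  generalize algebraMap ℂ R a = a at *
  have k1 : E * F * E * t = E * (F * t - (a * s) • (F * e)) * E := by
    rw [mul_assoc (E * F), e1]
    simp only [mul_sub, sub_mul, mul_smul_comm, smul_mul_assoc, mul_assoc]
  have k2 : F * t - (a * s) • (F * e) = (t - (a * s) • e - a • h) * F := by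
    rw [e2, e3]
    simp only [sub_mul, smul_mul_assoc]
    linear_combination (norm := module) (-a) • hs • (h * F) + (a * r) • hs • (f * F)
  have k3 : E * (t - (a * s) • e - a • h) = (t - a • h) * E := by
    simp only [mul_sub, mul_smul_comm, e1, e4, e5, sub_mul, smul_mul_assoc]
    module
  rw [k1, k2, ← mul_assoc E, k3]
  simp only [mul_assoc]

/-- Differentiating the three factors and moving everything to the left, the contributions of `e`
and `f` cancel and only `(D s / s) h` remains. -/
theorem weyl_derivation (he : IsNilpotent e) (hf : IsNilpotent f) (h1 : h * e - e * h = (2 : ℂ) • e)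
    (h2 : h * f - f * h = (-2 : ℂ) • f) (h3 : e * f - f * e = h) {s r : R} (hs : s * r = 1)
    (D : Derivation ℂ R R) :
    (weyl e f s r).map D = (D s * r) • (h.map (algebraMap ℂ R) * weyl e f s r) := by
  have hr : D r = -(r ^ 2 * D s) := by
    have := congrArg D hs
    rw [Derivation.leibniz, Derivation.map_one_eq_zero, smul_eq_mul, smul_eq_mul] at this
    linear_combination r * this - D r * hs
  have e3 := expAt_mul_e hf h2 h3 (-r)
  have e4 := expAt_mul_eigen he h1 s
  have e5 := expAt_comm (M := e) s
  have d1 := expAt_derivation he D s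
  have d2 := expAt_derivation hf D (-r)
  rw [weyl, map_derivation_mul, map_derivation_mul, d1, d2, map_neg, hr, neg_neg]
  simp only [map_ofNat] at e4
  generalize expAt e s = E at *
  generalize expAt f (-r) = F at *
  generalize e.map (algebraMap ℂ R) = e at *
  generalize f.map (algebraMap ℂ R) = f at *
  generalize h.map (algebraMap ℂ R) = h at *
  generalize D s = d at *
  have k1 : (d • (e * E) * F + E * (r ^ 2 * d) • (f * F)) * E + E * F * d • (e * E) =
      d • ((e * E) * F * E + E * ((r ^ 2) • (f * F) + F * e) * E) := by
    simp only [mul_add, add_mul, mul_smul_comm, smul_mul_assoc, mul_assoc, smul_add, smul_smul,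
      mul_comm d]
    abel
  have k2 : (r ^ 2) • (f * F) + F * e = (e + r • h) * F := by
    rw [e3]
    simp only [sub_mul, add_mul, smul_mul_assoc]
    module
  have k3 : E * (e + r • h) = (r • h - e) * E := by
    simp only [mul_add, mul_smul_comm, e4, e5, sub_mul, smul_mul_assoc]
    linear_combination (norm := module) (-2 : R) • hs • (e * E)
  rw [k1, k2, ← mul_assoc E, k3]
  simp only [sub_mul, smul_mul_assoc, mul_assoc]
  module

end Weyl

end LinearAlgebraicGroup
end Isostokes

/-! ### Coroots evaluated at Laurent series -/

namespace Isostokes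

namespace LinearAlgebraicGroup

attribute [local instance 100] LieRing.ofAssociativeRing

open LieAlgebra IsKilling

variable {N : ℕ} {G : LinearAlgebraicGroup N}

theorem coe_lie (x y : G.lie) : ((⁅x, y⁆ : G.lie) : Matrix (Fin N) (Fin N) ℂ) =
    (x : Matrix (Fin N) (Fin N) ℂ) * y - y * x := by
  rw [LieSubalgebra.coe_bracket, Ring.lie_def]

theorem isPoint_one {R : Type} [CommRing R] [Algebra ℂ R] :
    G.IsPoint (1 : Matrix (Fin N) (Fin N) R) := by
  have h := IsPoint.map (G := G) (g := (1 : Matrix (Fin N) (Fin N) ℂ)) (Algebra.ofId ℂ R) G.one_mem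
  rwa [Matrix.map_one _ (map_zero _) (map_one _)] at h

theorem toMatrix_tmul (s : Laurent) (x : G.lie) :
    toMatrix (s ⊗ₜ[ℂ] x) = s • (x : Matrix (Fin N) (Fin N) ℂ).map (algebraMap ℂ Laurent) := by
  rw [toMatrix, TensorProduct.lift.tmul]
  rfl

variable [LieAlgebra.IsKilling ℂ G.lie] {H : LieSubalgebra ℂ G.lie} [H.IsCartanSubalgebra]

/-- Elements of the Lie algebra as matrices over `ℂ((z))`. -/
abbrev laurentMat (x : G.lie) : Matrix (Fin N) (Fin N) Laurent :=
  (x : Matrix (Fin N) (Fin N) ℂ).map (algebraMap ℂ Laurent)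

/-- The values of the coroots on invertible Laurent series. -/
theorem exists_gl_coroot {α : LieModule.Weight ℂ H G.lie} (hα : α.IsNonZero) {s r : Laurent}
    (hs : s * r = 1) : ∃ g : GL (Fin N) Laurent, G.IsPoint g.val ∧
      g.val.map Laurent.deriv = toMatrix ((Laurent.deriv s * r) ⊗ₜ[ℂ] ((coroot α : H) : G.lie)) * g.val ∧
      ∀ t : H, Commute g.val (laurentMat (t : G.lie)) := by
  obtain ⟨h, e, f, hsl, heα, hfα⟩ := exists_isSl2Triple_of_weight_isNonZero hα
  have hh : h = coroot α := hsl.h_eq_coroot hα heα hfα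
  have h1 : (h : Matrix (Fin N) (Fin N) ℂ) * e - e * h = (2 : ℂ) • (e : Matrix (Fin N) (Fin N) ℂ) := by
    rw [← coe_lie, hsl.lie_h_e_smul ℂ]; rfl
  have h2 : (h : Matrix (Fin N) (Fin N) ℂ) * f - f * h = (-2 : ℂ) • (f : Matrix (Fin N) (Fin N) ℂ) := by
    rw [← coe_lie, hsl.lie_lie_smul_f ℂ, ← neg_smul]; rfl
  have h3 : (e : Matrix (Fin N) (Fin N) ℂ) * f - f * e = (h : Matrix (Fin N) (Fin N) ℂ) := by
    rw [← coe_lie, hsl.lie_e_f]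
  have he := isNilpotent_of_lie_eq two_ne_zero h1
  have hf := isNilpotent_of_lie_eq (neg_ne_zero.2 two_ne_zero) h2
  have hte : ∀ t : H, ((t : G.lie) : Matrix (Fin N) (Fin N) ℂ) * e - e * (t : G.lie) =
      α t • (e : Matrix (Fin N) (Fin N) ℂ) := fun t => by
    rw [← coe_lie]
    exact congrArg Subtype.val (lie_eq_smul_of_mem_rootSpace heα t)
  have htf : ∀ t : H, ((t : G.lie) : Matrix (Fin N) (Fin N) ℂ) * f - f * (t : G.lie) =
      (-α t) • (f : Matrix (Fin N) (Fin N) ℂ) := fun t => by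
    rw [← coe_lie]
    exact congrArg Subtype.val (lie_eq_smul_of_mem_rootSpace hfα t)
  let E : Laurent → GL (Fin N) Laurent := fun s => expGL he s
  let F : Laurent → GL (Fin N) Laurent := fun s => expGL hf s
  have hE : ∀ s, G.IsPoint (E s).val := fun s => isPoint_expAt e.2 he s
  have hF : ∀ s, G.IsPoint (F s).val := fun s => isPoint_expAt f.2 hf s
  have hW : ∀ s r, (E s * F (-r) * E s).val = weyl (e : Matrix (Fin N) (Fin N) ℂ) f s r := fun s r => rfl
  have hmul : ∀ g g' : GL (Fin N) Laurent, G.IsPoint g.val → G.IsPoint g'.val →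
      G.IsPoint (g * g').val := fun g g' hg hg' => G.mul_mem g g' hg hg'
  -- The value of the coroot at `s` is `w(s) w(-1)`. The second factor is constant, so it does not
  -- affect the logarithmic derivative, and it undoes the reflection.
  refine ⟨(E s * F (-r) * E s) * (E (-1) * F (-(-1)) * E (-1)), ?_, ?_, ?_⟩
  · exact hmul _ _ (hmul _ _ (hmul _ _ (hE _) (hF _)) (hE _))
      (hmul _ _ (hmul _ _ (hE _) (hF _)) (hE _))
  · rw [Units.val_mul, hW, hW, map_derivation_mul, weyl_derivation he hf h1 h2 h3 hs,
      weyl_derivation he hf h1 h2 h3 (by norm_num : (-1 : Laurent) * -1 = 1), map_neg,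
      Derivation.map_one_eq_zero, neg_zero, zero_mul, zero_smul, mul_zero, add_zero, toMatrix_tmul,
      ← hh, smul_mul_assoc, smul_mul_assoc, mul_assoc]
  · intro t
    change (E s * F (-r) * E s).val * (E (-1) * F (-(-1)) * E (-1)).val * _ = _
    rw [hW, hW, mul_assoc, weyl_mul he hf h1 h2 h3 (by norm_num : (-1 : Laurent) * -1 = 1) (hte t)
      (htf t), ← mul_assoc, weyl_mul he hf h1 h2 h3 hs (a := -α t), mul_assoc]
    · congr 2
      rw [neg_smul, sub_neg_eq_add, sub_add_cancel]
    · rw [sub_mul, mul_sub, smul_mul_assoc, mul_smul_comm]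
      linear_combination (norm := module) hte t - α t • h1
    · rw [sub_mul, mul_sub, smul_mul_assoc, mul_smul_comm]
      linear_combination (norm := module) htf t - α t • h2

/-- A combination of coroots, whose coefficients are Laurent series with simple poles and integral
residues, is a logarithmic derivative. -/
theorem exists_gl_logDeriv {κ : Type*} (S : Finset κ) (h : κ → H)
    (hh : ∀ j, ∃ α : LieModule.Weight ℂ H G.lie, α.IsNonZero ∧ h j = coroot α) (u : κ → Laurent)
    (hu : ∀ j, u j ∈ Laurent.ge (-1)) (hm : ∀ j, ∃ m : ℤ, Laurent.coeff (-1) (u j) = m) :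
    ∃ g : GL (Fin N) Laurent, G.IsPoint g.val ∧
      g.val.map Laurent.deriv = toMatrix (∑ j ∈ S, u j ⊗ₜ[ℂ] ((h j : H) : G.lie)) * g.val ∧
      ∀ t : H, Commute g.val (laurentMat (t : G.lie)) := by
  classical
  induction S using Finset.induction_on with
  | empty =>
    refine ⟨1, isPoint_one, ?_, fun t => ?_⟩
    · rw [Finset.sum_empty, map_zero, zero_mul, Units.val_one]
      ext i j k
      simp [Matrix.one_apply, apply_ite]
    · rw [Units.val_one]
      exact Commute.one_left _
  | insert j S hj ih =>
    obtain ⟨g, hg, hg', hgt⟩ := ih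
    obtain ⟨m, hm⟩ := hm j
    obtain ⟨s, hs0, hs⟩ := Laurent.exists_logDeriv (hu j) hm
    obtain ⟨α, hα, hjα⟩ := hh j
    obtain ⟨g₁, hg₁, hg₁', hgt₁⟩ := exists_gl_coroot hα (mul_inv_cancel₀ hs0)
    rw [hs, mul_assoc, mul_inv_cancel₀ hs0, mul_one, ← hjα] at hg₁'
    refine ⟨g * g₁, G.mul_mem g g₁ hg hg₁, ?_, fun t => ?_⟩
    · have hc : g.val * toMatrix (u j ⊗ₜ[ℂ] ((h j : H) : G.lie)) =
          toMatrix (u j ⊗ₜ[ℂ] ((h j : H) : G.lie)) * g.val := by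
        rw [toMatrix_tmul, mul_smul_comm, smul_mul_assoc]
        exact congrArg _ (hgt (h j)).eq
      rw [Units.val_mul, map_derivation_mul, hg', hg₁', ← mul_assoc g.val, hc, Finset.sum_insert hj,
        map_add, add_mul, add_comm, mul_assoc, mul_assoc]
    · rw [Units.val_mul]
      exact (hgt t).mul_left (hgt₁ t)

end LinearAlgebraicGroup
end Isostokes

/-! ### Points of `𝒞onn_U` with prescribed normal forms -/

namespace Isostokes

open LieAlgebra IsKilling

section Cartan

variable {𝔤 : Type*} [LieRing 𝔤] [LieAlgebra ℂ 𝔤] [FiniteDimensional ℂ 𝔤] [LieAlgebra.IsKilling ℂ 𝔤]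
  {H : LieSubalgebra ℂ 𝔤} [H.IsCartanSubalgebra]

variable (H) in
/-- The coordinates of elements of `𝔥` with respect to the coroots can be chosen linearly. -/
theorem exists_coroot_coords : ∃ ρ : H →ₗ[ℂ] (H.root → ℂ), ∀ x : H,
    ∑ α : H.root, ρ x α • coroot (α : LieModule.Weight ℂ H 𝔤) = x := by
  have h1 : Function.Surjective (Fintype.linearCombination ℂ
      fun α : H.root => coroot (α : LieModule.Weight ℂ H 𝔤)) := by
    rw [← LinearMap.range_eq_top, Fintype.range_linearCombination]
    rw [← RootPairing.IsRootSystem.span_coroot_eq_top (P := rootSystem H)]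
    rfl
  obtain ⟨ρ, hρ⟩ := LinearMap.exists_rightInverse_of_surjective _ (LinearMap.range_eq_top.2 h1)
  exact ⟨ρ, fun x => LinearMap.congr_fun hρ x⟩

end Cartan

section Moduli

variable {N : ℕ} {G : LinearAlgebraicGroup N} [LieAlgebra.IsKilling ℂ G.lie]
  {H : LieSubalgebra ℂ G.lie} [H.IsCartanSubalgebra]

/-- An `𝔥`-valued loop with a simple pole, whose residue is in the coroot lattice, is a logarithmic
derivative. -/
theorem exists_gl_of_residue {v : Loop G.lie} (hv : ∀ k, coeff k v ∈ H)
    (hv1 : ∀ k < -1, coeff k v = 0) {m : H.root → ℤ}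
    (hm : coeff (-1) v = ((∑ α, m α • coroot (α : LieModule.Weight ℂ H G.lie) : H) : G.lie)) :
    ∃ g : GL (Fin N) Laurent, G.IsPoint g.val ∧ g.val.map Laurent.deriv = toMatrix v * g.val ∧
      ∀ t : H, Commute g.val (LinearAlgebraicGroup.laurentMat (t : G.lie)) := by
  obtain ⟨ρ, hρ⟩ := exists_coroot_coords H
  -- At order `-1` the given integers are used instead of the linear coordinates `ρ`: coroots are
  -- linearly dependent, and only integral residues come from Laurent series.
  let a : H.root → ℤ → ℂ := fun α k => if k < -1 then 0 else if k = -1 then m α else ρ ⟨coeff k v, hv k⟩ α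
  let u : H.root → Laurent := fun α => Laurent.ofCoeffs (a α) (-1) fun k hk => if_pos hk
  have hu : ∀ α k, Laurent.coeff k (u α) = a α k := fun α k => rfl
  have hv' : v = ∑ α, u α ⊗ₜ[ℂ] ((coroot (α : LieModule.Weight ℂ H G.lie) : H) : G.lie) := by
    refine loop_ext fun k => ?_
    simp only [map_sum, coeff_tmul, hu]
    rcases lt_trichotomy k (-1) with hk | rfl | hk
    · rw [hv1 k hk, Finset.sum_eq_zero]
      intro α _
      simp only [a, if_pos hk, zero_smul]
    · rw [hm]
      simp [a, Int.cast_smul_eq_zsmul]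
    · have h1 : ∀ α, a α k = ρ ⟨coeff k v, hv k⟩ α := fun α => by
        simp only [a, if_neg (not_lt.2 hk.le), if_neg hk.ne']
      simp only [h1]
      have h2 := congrArg (fun x : H => (x : G.lie)) (hρ ⟨coeff k v, hv k⟩)
      simp only at h2
      refine h2.symm.trans ?_
      simp
  clear_value u
  have h1 : ∀ α, u α ∈ Laurent.ge (-1) := fun α k hk => (hu α k).trans (if_pos hk)
  have h2 : ∀ α, ∃ m : ℤ, Laurent.coeff (-1) (u α) = m := fun α => ⟨m α, by
    rw [hu]
    simp [a]⟩
  have h3 : ∀ α : H.root, ∃ β : LieModule.Weight ℂ H G.lie, β.IsNonZero ∧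
      coroot (α : LieModule.Weight ℂ H G.lie) = coroot β := fun α => ⟨α, mem_root_iff.1 α.2, rfl⟩
  obtain ⟨g, hg⟩ := LinearAlgebraicGroup.exists_gl_logDeriv Finset.univ _ h3 u h1 h2
  rw [← hv'] at hg
  exact ⟨g, hg⟩

variable {A : Type} [CommRing A] [IsDedekindDomain A] [Algebra ℂ A] [Algebra.FiniteType ℂ A]
  {ι : Type} [Fintype ι] [Nonempty ι] (X : Completion A ι) {n : ι → ℕ}
  (b : (LieAlgebra.IsKilling.rootSystem H).Base)

/-- For given irregular types, the points of `𝒞onn_U` assume all values of the `β`-coordinates, and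
all residues in a translate of the coroot lattice. -/
theorem exists_connU (hn : ∀ i, 1 ≤ n i) (c₀ : TargetCoords n H) :
    ∃ a : {j : ι // 2 ≤ n j} → H, ∀ c : TargetCoords n H, InTarget c →
      (∀ j : {j : ι // 2 ≤ n j}, ∀ i : Fin (n j), 1 ≤ (i : ℕ) → (c j).1 i = (c₀ j).1 i) →
      (∀ j : {j : ι // 2 ≤ n j}, ∃ m : H.root → ℤ, ∀ i : Fin (n j), (i : ℕ) = 0 →
        (c j).1 i = a j + ∑ α, m α • coroot (α : LieModule.Weight ℂ H G.lie)) →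
      ∃ p : ConnU X n b, p.HasIT c := by
  classical
  obtain ⟨ρ, hρ⟩ := exists_coroot_coords H
  -- The prescribed coefficients of order below `-1`; simple poles cannot be prescribed and are left
  -- free.
  let q : ι → ℤ → H := fun i k => if h : 2 ≤ n i then
    if k < -1 then ⟨coeff k (normalForm (c₀ ⟨i, h⟩)), coeff_normalForm_mem _ k⟩ else 0 else 0
  have hq0 : ∀ i, ∀ k < -(n i : ℤ), q i k = 0 := by
    intro i k hk
    simp only [q]
    split_ifs with h1 h2
    · exact Subtype.ext (coeff_normalForm_lt _ hk)
    · rfl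
    · rfl
  let P : H.root → ι → Laurent := fun α i => Laurent.ofCoeffs (fun k => ρ (q i k) α) (-(n i : ℤ))
    fun k hk => by rw [hq0 i k hk, map_zero, Pi.zero_apply]
  have hP : ∀ α i k, Laurent.coeff k (P α i) = ρ (q i k) α := fun _ _ _ => rfl
  choose ω hω using fun α => X.exists_form (P α)
  let h : H.root → G.lie := fun α => ((coroot (α : LieModule.Weight ℂ H G.lie) : H) : G.lie)
  let θ : Ω[A⁄ℂ] ⊗[ℂ] G.lie := ∑ α, ω α ⊗ₜ[ℂ] h α
  have hθ : ∀ i, X.expandLieForm i θ = ∑ α, X.expandForm i (ω α) ⊗ₜ[ℂ] h α := fun i => by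
    simp only [θ, map_sum]
    rfl
  have hΘ : ∀ i k, coeff k (X.expandLieForm i θ) ∈ H := fun i k => by
    rw [hθ, map_sum]
    exact sum_mem fun α _ => H.smul_mem _ (SetLike.coe_mem _)
  have hlow : ∀ i, ∀ k < -1, coeff k (X.expandLieForm i θ) = q i k := fun i k hk => by
    rw [hθ, map_sum]
    refine Eq.trans ?_ (congrArg (fun x : H => (x : G.lie)) (hρ (q i k)))
    rw [AddSubmonoidClass.coe_finsetSum]
    refine Finset.sum_congr rfl fun α _ => ?_
    have h3 := hω α i k hk
    rw [map_sub, sub_eq_zero, hP] at h3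
    rw [coeff_tmul, h3]
    rfl
  -- The translate of the coroot lattice is determined by the residues of the form `θ` just
  -- constructed.
  refine ⟨fun j => ⟨_, hΘ j (-1)⟩, fun c hc hc1 hc0 => ?_⟩
  -- At the irregular points the desired normal form itself is taken as local connection. Its
  -- difference from the expansion of `θ` has at most a simple pole with residue in the coroot
  -- lattice, so a loop in the torus is available as transition function.
  let loc : ι → Loop G.lie := fun i => if hi : 2 ≤ n i then normalForm (c ⟨i, hi⟩) else
    X.expandLieForm i θ
  have hloc : ∀ i k, coeff k (loc i) ∈ H := by
    intro i k
    simp only [loc]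
    split_ifs
    · exact coeff_normalForm_mem _ _
    · exact hΘ i k
  have hlocn : ∀ i, ∀ k < -(n i : ℤ), coeff k (loc i) = 0 := by
    intro i k hk
    simp only [loc]
    split_ifs with hi
    · exact coeff_normalForm_lt _ hk
    · have := hn i
      rw [hlow i k (by omega), hq0 i k hk]
      rfl
  have hm : ∀ i, ∃ m : H.root → ℤ, coeff (-1) (X.expandLieForm i θ - loc i) =
      ((∑ α, m α • coroot (α : LieModule.Weight ℂ H G.lie) : H) : G.lie) := by
    intro i
    by_cases hi : 2 ≤ n i
    · obtain ⟨m, hm⟩ := hc0 ⟨i, hi⟩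
      refine ⟨-m, ?_⟩
      have h0 : 0 < n i := hn i
      have h1 := coeff_normalForm_neg (c ⟨i, hi⟩) ⟨0, h0⟩
      simp only [Nat.cast_zero, zero_add] at h1
      have h4 : loc i = normalForm (c ⟨i, hi⟩) := dif_pos hi
      rw [h4, map_sub, h1, hm ⟨0, h0⟩ rfl]
      have h5 : ∀ x y : H, ((x + y : H) : G.lie) = (x : G.lie) + (y : G.lie) := fun _ _ => rfl
      rw [h5, sub_add_cancel_left]
      simp only [Pi.neg_apply, neg_smul, Finset.sum_neg_distrib]
      rfl
    · refine ⟨0, ?_⟩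
      have h4 : loc i = X.expandLieForm i θ := dif_neg hi
      rw [h4, sub_self, map_zero]
      simp
  have hlow' : ∀ i, ∀ k < -1, coeff k (X.expandLieForm i θ - loc i) = 0 := by
    intro i k hk
    rw [map_sub, hlow i k hk]
    by_cases hi : 2 ≤ n i
    · have h4 : loc i = normalForm (c ⟨i, hi⟩) := dif_pos hi
      have h5 : (q i k : G.lie) = coeff k (normalForm (c₀ ⟨i, hi⟩)) := by
        simp only [q, dif_pos hi, if_pos hk]
      rw [h4, h5, sub_eq_zero]
      by_cases hk' : k < -(n i : ℤ)
      · rw [coeff_normalForm_lt _ hk', coeff_normalForm_lt _ hk']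
      · have h0 : (-k - 1).toNat < n i := by omega
        have h6 := fun c : TargetCoords n H => coeff_normalForm_neg (c ⟨i, hi⟩)
          ⟨(-k - 1).toNat, h0⟩
        have h7 : -((((-k - 1).toNat : ℕ) : ℤ) + 1) = k := by omega
        simp only [h7] at h6
        rw [h6, h6, hc1 ⟨i, hi⟩ _ (by dsimp only; omega)]
    · have h4 : loc i = X.expandLieForm i θ := dif_neg hi
      rw [h4, hlow i k hk, sub_self]
  choose m hm using hm
  choose g hg hg' hgt using fun i => exists_gl_of_residue (fun k => by
    rw [map_sub]
    exact sub_mem (hΘ i k) (hloc i k)) (hlow' i) (hm i)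
  refine ⟨⟨θ, g, hg, loc, fun i => ?_, fun i => (isHiggs_iff b).2
    (mem_higgs_of_cartan b (hloc i) (hlocn i)), fun i hi => ?_⟩, fun j => ?_⟩
  · have h1 : Commute (g i).val (toMatrix (X.expandLieForm i θ)) := by
      rw [hθ, map_sum]
      refine Commute.sum_right _ _ _ fun α _ => ?_
      rw [LinearAlgebraicGroup.toMatrix_tmul]
      exact (hgt i _).smul_right _
    rw [h1.eq, hg', mul_assoc, mul_assoc, Units.mul_inv, mul_one, mul_one, ← map_sub, sub_sub_cancel]
  · have h4 : loc i = normalForm (c ⟨i, hi⟩) := dif_pos hi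
    have h0 : n i - 1 < n i := by omega
    have h1 := coeff_normalForm_neg (c ⟨i, hi⟩) ⟨n i - 1, h0⟩
    have h7 : -(((n i - 1 : ℕ) : ℤ) + 1) = -(n i : ℤ) := by omega
    simp only [h7] at h1
    change IsRegularSemisimple H (coeff (-(n i : ℤ)) (loc i))
    rw [h4, h1]
    exact hc ⟨i, hi⟩
  · have h4 : loc j = normalForm (c j) := dif_pos j.2
    change HasCoords b (loc j) (c j)
    rw [hasCoords_iff (hn j)]
    exact ⟨0, zero_mem _, by rw [gauge_zero, h4]⟩

end Moduli
end Isostokes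

/-! ### Regular functions on the target and their derivatives -/

namespace Isostokes

open LieAlgebra IsKilling

section PolynomialFunctions

variable {E : Type*} [AddCommGroup E] [Module ℂ E]

/-- The polynomial function on a vector space given by a polynomial in linear forms. -/
def evalAt (P : MvPolynomial (Module.Dual ℂ E) ℂ) (c : E) : ℂ := MvPolynomial.eval (fun l => l c) P

theorem hasLineDerivAt_linear (l : Module.Dual ℂ E) (c w : E) :
    HasLineDerivAt ℂ (fun x => l x) (l w) c w := by
  unfold HasLineDerivAt
  have h : (fun t : ℂ => l (c + t • w)) = fun t => l c + t * l w := by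
    funext t
    rw [map_add, map_smul, smul_eq_mul]
  rw [h]
  simpa using ((hasDerivAt_id (0 : ℂ)).mul_const (l w)).const_add (l c)

theorem HasLineDerivAt.mul' {f g : E → ℂ} {f' g' : ℂ} {c w : E} (hf : HasLineDerivAt ℂ f f' c w)
    (hg : HasLineDerivAt ℂ g g' c w) :
    HasLineDerivAt ℂ (fun x => f x * g x) (f' * g c + f c * g') c w := by
  have h := HasDerivAt.mul hf hg
  simp only [zero_smul, add_zero] at h
  exact h

theorem exists_linear_lineDeriv (P : MvPolynomial (Module.Dual ℂ E) ℂ) (c : E) :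
    ∃ L : E →ₗ[ℂ] ℂ, ∀ w, HasLineDerivAt ℂ (evalAt P) (L w) c w := by
  induction P using MvPolynomial.induction_on with
  | C a =>
    refine ⟨0, fun w => ?_⟩
    have h : evalAt (E := E) (MvPolynomial.C a) = fun _ => a := funext fun c => MvPolynomial.eval_C _
    rw [h]
    exact hasDerivAt_const _ _
  | add P Q hP hQ =>
    obtain ⟨L, hL⟩ := hP
    obtain ⟨M, hM⟩ := hQ
    refine ⟨L + M, fun w => ?_⟩
    have h : evalAt (P + Q) = fun c => evalAt P c + evalAt Q c := funext fun c => map_add _ _ _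
    rw [h]
    exact HasDerivAt.add (hL w) (hM w)
  | mul_X P l hP =>
    obtain ⟨L, hL⟩ := hP
    refine ⟨l c • L + evalAt P c • l, fun w => ?_⟩
    have h : evalAt (P * MvPolynomial.X l) = fun c => evalAt P c * l c := funext fun c => by
      rw [evalAt, map_mul, MvPolynomial.eval_X, evalAt]
    rw [h]
    have h1 := HasLineDerivAt.mul' (hL w) (hasLineDerivAt_linear l c w)
    convert h1 using 1
    simp only [LinearMap.add_apply, LinearMap.smul_apply, smul_eq_mul]
    ring

/-- For a fixed direction the derivative is again polynomial in the point, whereas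
`exists_linear_lineDeriv` gives linearity in the direction at a fixed point; both are needed. -/
theorem exists_evalAt_lineDeriv (P : MvPolynomial (Module.Dual ℂ E) ℂ) (w : E) :
    ∃ Q : MvPolynomial (Module.Dual ℂ E) ℂ, ∀ c, HasLineDerivAt ℂ (evalAt P) (evalAt Q c) c w := by
  induction P using MvPolynomial.induction_on with
  | C a =>
    refine ⟨0, fun c => ?_⟩
    have h : evalAt (E := E) (MvPolynomial.C a) = fun _ => a := funext fun c => MvPolynomial.eval_C _
    have h0 : evalAt (0 : MvPolynomial (Module.Dual ℂ E) ℂ) c = 0 := map_zero _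
    rw [h, h0]
    exact hasDerivAt_const _ _
  | add P Q hP hQ =>
    obtain ⟨L, hL⟩ := hP
    obtain ⟨M, hM⟩ := hQ
    refine ⟨L + M, fun c => ?_⟩
    have h : ∀ P Q : MvPolynomial (Module.Dual ℂ E) ℂ,
      evalAt (P + Q) = fun c => evalAt P c + evalAt Q c := fun P Q => funext fun c => map_add _ _ _
    rw [h, h]
    exact HasDerivAt.add (hL c) (hM c)
  | mul_X P l hP =>
    obtain ⟨L, hL⟩ := hP
    refine ⟨L * MvPolynomial.X l + P * MvPolynomial.C (l w), fun c => ?_⟩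
    have h : evalAt (P * MvPolynomial.X l) = fun c => evalAt P c * l c := funext fun c => by
      rw [evalAt, map_mul, MvPolynomial.eval_X, evalAt]
    rw [h]
    have h1 := HasLineDerivAt.mul' (hL c) (hasLineDerivAt_linear l c w)
    convert h1 using 1
    simp only [evalAt, map_add, map_mul, MvPolynomial.eval_X, MvPolynomial.eval_C]

/-- A polynomial function whose derivative in the direction `w` vanishes along a line. -/
theorem evalAt_add_of_lineDeriv {P Q : MvPolynomial (Module.Dual ℂ E) ℂ} {w : E}
    (hQ : ∀ c, HasLineDerivAt ℂ (evalAt P) (evalAt Q c) c w) {c : E}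
    (h : ∀ t : ℂ, evalAt Q (c + t • w) = 0) : evalAt P (c + w) = evalAt P c := by
  have h1 : ∀ t : ℂ, HasDerivAt (fun t : ℂ => evalAt P (c + t • w)) 0 t := by
    intro t
    have h2 := hQ (c + t • w)
    rw [h t] at h2
    have h3 : HasDerivAt (fun s : ℂ => evalAt P (c + t • w + s • w)) 0 (t - t) := by
      rw [sub_self]
      exact h2
    have h4 := HasDerivAt.comp_sub_const t t h3
    refine h4.congr_of_eventuallyEq (Filter.Eventually.of_forall fun s => ?_)
    simp only
    rw [add_assoc, ← add_smul, add_sub_cancel]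
  have h2 := is_const_of_deriv_eq_zero (f := fun t : ℂ => evalAt P (c + t • w))
    (fun t => (h1 t).differentiableAt) (fun t => (h1 t).deriv) 1 0
  simpa using h2

/-- A polynomial function that vanishes on a translate of a lattice. -/
theorem evalAt_eq_zero_of_lattice {σ : Type*} [Fintype σ] (Q : MvPolynomial (Module.Dual ℂ E) ℂ)
    (c : E) (v : σ → E) (h : ∀ m : σ → ℤ, evalAt Q (c + ∑ i, m i • v i) = 0) (t : σ → ℂ) :
    evalAt Q (c + ∑ i, t i • v i) = 0 := by
  -- The restriction of `Q` to the parametrized translate, as a polynomial in the parameters. It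
  -- vanishes on a product of infinite sets.
  let R : MvPolynomial σ ℂ := MvPolynomial.aeval (fun l : Module.Dual ℂ E =>
    MvPolynomial.C (l c) + ∑ i, MvPolynomial.X i * MvPolynomial.C (l (v i))) Q
  have hR : ∀ t : σ → ℂ, MvPolynomial.eval t R = evalAt Q (c + ∑ i, t i • v i) := by
    intro t
    have h1 := MvPolynomial.comp_aeval_apply (R := ℂ) (fun l : Module.Dual ℂ E =>
      (MvPolynomial.C (l c) + ∑ i, MvPolynomial.X i * MvPolynomial.C (l (v i)) : MvPolynomial σ ℂ))
      (MvPolynomial.aeval t) Q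
    rw [← MvPolynomial.coe_aeval_eq_eval]
    refine h1.trans ?_
    rw [evalAt, ← MvPolynomial.coe_aeval_eq_eval]
    refine congrArg (fun g : Module.Dual ℂ E → ℂ => MvPolynomial.aeval g Q) (funext fun l => ?_)
    simp
  have h2 : R = 0 := by
    refine MvPolynomial.funext_set (fun _ : σ => Set.range ((↑) : ℤ → ℂ))
      (fun _ => Set.infinite_range_of_injective Int.cast_injective) fun x hx => ?_
    choose m hm using fun i => hx i trivial
    rw [map_zero, hR, ← h m]
    refine congrArg (fun y => evalAt Q (c + y)) (Finset.sum_congr rfl fun i _ => ?_)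
    rw [← hm, Int.cast_smul_eq_zsmul]
  rw [← hR, h2, map_zero]

end PolynomialFunctions

section Target

variable {𝔤 : Type*} [LieRing 𝔤] [LieAlgebra ℂ 𝔤] [FiniteDimensional ℂ 𝔤] [LieAlgebra.IsKilling ℂ 𝔤]
  {H : LieSubalgebra ℂ 𝔤} [H.IsCartanSubalgebra] {ι : Type} [Fintype ι] {n : ι → ℕ}

theorem inTarget_iff (b : (LieAlgebra.IsKilling.rootSystem H).Base) {c : TargetCoords n H} :
    InTarget c ↔ discriminant c ≠ 0 := by
  simp only [InTarget, discriminant, Finset.prod_ne_zero_iff, Finset.mem_univ, true_implies]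
  refine forall_congr' fun j => ⟨fun h χ hχ => ?_, fun h => ?_⟩
  · exact root_ne_zero_of_regular (SetLike.coe_mem (leading c j)) h b χ (mem_root_iff.1 hχ)
  · exact isRegularSemisimple_of_cartan (SetLike.coe_mem (leading c j)) fun χ hχ =>
      h χ (mem_root_iff.2 hχ)

theorem discriminant_congr {c c' : TargetCoords n H} (h : ∀ j, leading c j = leading c' j) :
    discriminant c = discriminant c' := by
  simp only [discriminant, h]

variable (n H) in
theorem exists_evalAt_discriminant : ∃ D : MvPolynomial (Module.Dual ℂ (TargetCoords n H)) ℂ,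
    ∀ c, evalAt D c = discriminant c := by
  let l : {j : ι // 2 ≤ n j} → LieModule.Weight ℂ H 𝔤 → Module.Dual ℂ (TargetCoords n H) := fun j χ =>
    { toFun := fun c => χ (leading c j)
      map_add' := fun c c' => χ.toLinear.map_add (leading c j) (leading c' j)
      map_smul' := fun r c => χ.toLinear.map_smul r (leading c j) }
  refine ⟨∏ j, ∏ χ ∈ H.root, MvPolynomial.X (l j χ), fun c => ?_⟩
  rw [evalAt, map_prod]
  refine Finset.prod_congr rfl fun j _ => ?_
  rw [map_prod]
  refine Finset.prod_congr rfl fun χ _ => ?_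
  rw [MvPolynomial.eval_X]
  rfl

/-- The differential of a regular function. -/
theorem IsRegularFunction.exists_differential (b : (LieAlgebra.IsKilling.rootSystem H).Base)
    {f : TargetCoords n H → ℂ} (hf : IsRegularFunction f) {c : TargetCoords n H} (hc : InTarget c) :
    ∃ L : TargetCoords n H →ₗ[ℂ] ℂ, ∀ w, HasLineDerivAt ℂ f (L w) c w := by
  obtain ⟨P, m, hP⟩ := hf
  obtain ⟨D, hD⟩ := exists_evalAt_discriminant H n
  obtain ⟨L, hL⟩ := exists_linear_lineDeriv P c
  obtain ⟨M, hM⟩ := exists_linear_lineDeriv (D ^ m) c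
  have hDm : ∀ c, evalAt (D ^ m) c = discriminant c ^ m := fun c => by
    rw [← hD, evalAt, map_pow, evalAt]
  rw [inTarget_iff b, ← hD] at hc
  have hc' : evalAt (D ^ m) c ≠ 0 := by
    rw [hDm, ← hD]
    exact pow_ne_zero _ hc
  refine ⟨(evalAt (D ^ m) c ^ 2)⁻¹ • (evalAt (D ^ m) c • L - evalAt P c • M), fun w => ?_⟩
  have h1 : HasDerivAt (fun t : ℂ => evalAt P (c + t • w) / evalAt (D ^ m) (c + t • w)) _ 0 :=
    HasDerivAt.div (hL w) (hM w) (by simpa using hc')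
  simp only [zero_smul, add_zero] at h1
  obtain ⟨M', hM'⟩ := exists_linear_lineDeriv D c
  -- Outside the target `f` is arbitrary, so the formula for `f` is used only near the point, where
  -- the discriminant stays nonzero.
  have h2 : ContinuousAt (fun t : ℂ => evalAt D (c + t • w)) 0 := HasDerivAt.continuousAt (hM' w)
  have h3 := h2.eventually_ne (y := 0) (by simpa using hc)
  have h4 := h1.congr_of_eventuallyEq (f₁ := fun t : ℂ => f (c + t • w)) (by
    filter_upwards [h3] with t ht
    rw [hD, ← inTarget_iff b] at ht
    rw [hP _ ht, hDm]
    rfl)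
  unfold HasLineDerivAt
  convert h4 using 1
  simp only [LinearMap.sub_apply, LinearMap.smul_apply, smul_eq_mul]
  rw [div_eq_inv_mul]
  ring

/-- A regular function is independent of the `β`-coordinates, if its derivatives in the directions
of these coordinates vanish on a set that meets each fibre of the irregular type in a translate of
the coroot lattice. -/
theorem IsRegularFunction.independentOfBeta (b : (LieAlgebra.IsKilling.rootSystem H).Base)
    {f : TargetCoords n H → ℂ} (hf : IsRegularFunction f) {S : Set (TargetCoords n H)}
    (hS : ∀ c₀ : TargetCoords n H, ∃ a : {j : ι // 2 ≤ n j} → H, ∀ c : TargetCoords n H, InTarget c →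
      (∀ j : {j : ι // 2 ≤ n j}, ∀ i : Fin (n j), 1 ≤ (i : ℕ) → (c j).1 i = (c₀ j).1 i) →
      (∀ j : {j : ι // 2 ≤ n j}, ∃ m : H.root → ℤ, ∀ i : Fin (n j), (i : ℕ) = 0 →
        (c j).1 i = a j + ∑ α, m α • coroot (α : LieModule.Weight ℂ H 𝔤)) → c ∈ S)
    (h : ∀ c ∈ S, InTarget c → ∀ w : TargetCoords n H, (∀ j, (w j).1 = 0) → lineDeriv ℂ f c w = 0) :
    IndependentOfBeta f := by
  classical
  obtain ⟨P, m, hP⟩ := hf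
  intro c c' hc hc' hcc
  set w : TargetCoords n H := c' - c with hw
  have hw0 : ∀ j, (w j).1 = 0 := fun j => sub_eq_zero.2 (hcc j).symm
  obtain ⟨Q, hQ⟩ := exists_evalAt_lineDeriv P w
  have hlead : ∀ (x : TargetCoords n H) (t : ℂ) j, leading (x + t • w) j = leading x j := by
    intro x t j
    have h1 : leading (x + t • w) j = leading x j + t • (w j).1 ⟨n j - 1, by have := j.2; omega⟩ := rfl
    rw [h1, hw0 j, Pi.zero_apply, smul_zero, add_zero]
  have hint : ∀ (x : TargetCoords n H) (t : ℂ), InTarget x → InTarget (x + t • w) := by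
    intro x t hx j
    rw [hlead]
    exact hx j
  -- Along `w` the leading coefficients, hence the denominator, are constant, so the derivative of
  -- `f` is that of the polynomial `P` up to a nonzero factor.
  have hQS : ∀ x ∈ S, InTarget x → evalAt Q x = 0 := by
    intro x hx hxt
    have h1 : HasDerivAt (fun t : ℂ => evalAt P (x + t • w)) (evalAt Q x) 0 := hQ x
    have h2 := h1.div_const (discriminant x ^ m)
    have h3 := h2.congr_of_eventuallyEq (f₁ := fun t : ℂ => f (x + t • w))
      (Filter.Eventually.of_forall fun t => by
        simp only
        rw [hP _ (hint x t hxt), discriminant_congr (hlead x t)]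
        rfl)
    have h4 := h x hx hxt w hw0
    rw [HasLineDerivAt.lineDeriv (f' := evalAt Q x / discriminant x ^ m) h3, div_eq_zero_iff] at h4
    exact h4.resolve_right (pow_ne_zero _ ((inTarget_iff b).1 hxt))
  have hQ0 : ∀ x, InTarget x → evalAt Q x = 0 := by
    intro x hx
    obtain ⟨a, ha⟩ := hS x
    obtain ⟨ρ, hρ⟩ := exists_coroot_coords H
    have hpos : ∀ j : {j : ι // 2 ≤ n j}, 0 < n j := fun j => by have := j.2; omega
    let e : ∀ j : {j : ι // 2 ≤ n j}, H →ₗ[ℂ] TargetCoords n H := fun j =>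
      LinearMap.single ℂ (fun j : {j : ι // 2 ≤ n j} => Coords H (n j)) j ∘ₗ
        LinearMap.inl ℂ _ _ ∘ₗ LinearMap.single ℂ (fun _ : Fin (n j) => H) ⟨0, hpos j⟩
    have he0 : ∀ (j j' : {j : ι // 2 ≤ n j}) y (i : Fin (n j')), (i : ℕ) = 0 →
        (e j y j').1 i = if j = j' then y else 0 := by
      intro j j' y i hi
      obtain rfl : i = ⟨0, hpos j'⟩ := Fin.ext hi
      split_ifs with hj
      · subst hj
        simp [e]
      · simp [e, Pi.single_eq_of_ne (Ne.symm hj)]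
    have he1 : ∀ (j j' : {j : ι // 2 ≤ n j}) y (i : Fin (n j')), 1 ≤ (i : ℕ) → (e j y j').1 i = 0 := by
      intro j j' y i hi
      by_cases hj : j' = j
      · subst hj
        have : i ≠ ⟨0, hpos j'⟩ := fun h => by rw [h] at hi; simp at hi
        simp [e, Pi.single_eq_of_ne this]
      · simp [e, Pi.single_eq_of_ne hj]
    let v : {j : ι // 2 ≤ n j} × H.root → TargetCoords n H := fun jα =>
      e jα.1 (coroot (jα.2 : LieModule.Weight ℂ H 𝔤))
    -- The point `x` with its residues replaced by the base point `a` of the lattice translate. `Q`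
    -- vanishes at all lattice translates of `x₀`, hence on their complex span, which contains `x`.
    let x₀ : TargetCoords n H := x + ∑ j, e j (a j - (x j).1 ⟨0, hpos j⟩)
    have hfst : ∀ (y : TargetCoords n H) j i, (y j).1 i =
      (LinearMap.proj i ∘ₗ LinearMap.fst ℂ _ _ ∘ₗ LinearMap.proj j : TargetCoords n H →ₗ[ℂ] H) y :=
      fun _ _ _ => rfl
    have hx₀1 : ∀ (j : {j : ι // 2 ≤ n j}) (i : Fin (n j)), 1 ≤ (i : ℕ) → (x₀ j).1 i = (x j).1 i := by
      intro j i hi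
      rw [hfst, hfst x, map_add, map_sum, Finset.sum_eq_zero, add_zero]
      intro j' _
      rw [← hfst, he1 _ _ _ _ hi]
    have hx₀0 : ∀ (j : {j : ι // 2 ≤ n j}) (i : Fin (n j)), (i : ℕ) = 0 → (x₀ j).1 i = a j := by
      intro j i hi
      have h1 : i = ⟨0, hpos j⟩ := Fin.ext hi
      rw [hfst, map_add, map_sum]
      simp only [← hfst, he0 _ _ _ _ hi, Finset.sum_ite_eq', Finset.mem_univ, if_true]
      rw [h1, add_sub_cancel]
    have h1 : ∀ m : {j : ι // 2 ≤ n j} × H.root → ℤ, evalAt Q (x₀ + ∑ i, m i • v i) = 0 := by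
      intro m
      have h11 : ∀ (j : {j : ι // 2 ≤ n j}) (i : Fin (n j)), 1 ≤ (i : ℕ) → ((x₀ + ∑ i, m i • v i) j).1 i = (x j).1 i := by
        intro j i hi
        rw [hfst, map_add, map_sum, Finset.sum_eq_zero, add_zero, ← hfst, hx₀1 j i hi]
        intro k _
        rw [map_zsmul, ← hfst, he1 _ _ _ _ hi, smul_zero]
      have h12 : InTarget (x₀ + ∑ i, m i • v i) := fun j => by
        rw [leading, h11 j _ (by have := j.2; dsimp only; omega)]
        exact hx j
      refine hQS _ (ha _ h12 h11 fun j => ⟨fun α => m (j, α), fun i hi => ?_⟩) h12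
      rw [hfst, map_add, map_sum, ← hfst, hx₀0 j i hi, Fintype.sum_prod_type]
      congr 1
      rw [Finset.sum_eq_single j]
      · refine Finset.sum_congr rfl fun α _ => ?_
        rw [map_zsmul, ← hfst, he0 _ _ _ _ hi, if_pos rfl]
      · intro j' _ hj'
        refine Finset.sum_eq_zero fun α _ => ?_
        rw [map_zsmul, ← hfst, he0 _ _ _ _ hi, if_neg hj', smul_zero]
      · simp
    have h2 := evalAt_eq_zero_of_lattice Q x₀ v h1
      fun jα => ρ ((x jα.1).1 ⟨0, hpos jα.1⟩ - a jα.1) jα.2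
    have h3 : ∑ jα, ρ ((x jα.1).1 ⟨0, hpos jα.1⟩ - a jα.1) jα.2 • v jα =
        ∑ j, e j ((x j).1 ⟨0, hpos j⟩ - a j) := by
      rw [Fintype.sum_prod_type]
      refine Finset.sum_congr rfl fun j _ => ?_
      simp only [v, ← map_smul, ← map_sum]
      exact congrArg (e j) (hρ ((x j).1 ⟨0, hpos j⟩ - a j))
    rw [h3] at h2
    have h4 : x₀ + ∑ j, e j ((x j).1 ⟨0, hpos j⟩ - a j) = x := by
      simp only [x₀]
      rw [add_assoc, ← Finset.sum_add_distrib, Finset.sum_eq_zero, add_zero]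
      intro j _
      rw [← map_add, sub_add_sub_cancel, sub_self, map_zero]
    rwa [h4] at h2
  have h1 := evalAt_add_of_lineDeriv hQ (c := c) fun t => hQ0 _ (hint c t hc)
  have h2 : c + w = c' := add_sub_cancel c c'
  rw [h2] at h1
  have h3 : discriminant c = discriminant c' := discriminant_congr fun j => by
    rw [leading, leading, hcc]
  rw [hP c hc, hP c' hc', h3]
  exact congrArg (· / _) h1.symm

end Target
end Isostokes

/-! ### Hamiltonian vectors on `𝒞onn_U` -/

namespace Isostokes

open LieAlgebra LieFiltration

section Local

variable {𝔤 : Type*} [LieRing 𝔤] [LieAlgebra ℂ 𝔤] [FiniteDimensional ℂ 𝔤] [LieAlgebra.IsKilling ℂ 𝔤]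
  {H : LieSubalgebra ℂ 𝔤} [H.IsCartanSubalgebra] {b : (LieAlgebra.IsKilling.rootSystem H).Base}
  {n : ℕ}

namespace IsNormalization

variable {A x : Loop 𝔤} {c : Coords H n}
local notation "E" => LieFiltration.expAd (loopFiltration b)

/-- The residue of the connection does not change in the directions `-∇χ`. -/
theorem residue_eq_zero (S : IsNormalization b n A x c) {χ : Loop 𝔤} (hχ : -nabla A χ ∈ higgs b n)
    {w : Coords H n} (h : HasTangentCoords b A (-nabla A χ) c w) (i : Fin n) (hi : (i : ℕ) = 0) :
    w.1 i = 0 := by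
  have h0 : E x (-nabla A χ) = -E x (nabla A χ) := map_neg (expAdₗ S.memF) _
  rw [(S.tangent_iff hχ).1 h, h0, S.expAd_nabla_eq, map_neg]
  refine Subtype.ext ?_
  change -hpart H (coeff (-((i : ℤ) + 1)) (nabla (normalForm c) (E x χ))) = 0
  rw [hpart_coeff_nabla (coeff_normalForm_mem c), hi]
  simp

theorem expAd_regular (S : IsNormalization b n A x c) {μ : Loop 𝔤} (hμ : ∀ k < 0, coeff k μ = 0) :
    ∀ k < 0, coeff k (E x μ) = 0 := by
  -- For pole order zero the condition says just that the loop is regular, so the stability already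
  -- proved for forms applies.
  have h0 : ∀ μ : Loop 𝔤, μ ∈ higgs b 0 ↔ ∀ k < 0, coeff k μ = 0 := fun μ => by
    rw [← isHiggs_iff, IsHiggs, Nat.cast_zero, neg_zero, and_iff_left_iff_imp]
    intro h k hk
    rw [h k hk]
    exact zero_mem _
  have hx : x ∈ lieGU b 0 := (isLieGU_iff b).1 ⟨((isLieGU_iff b).2 S.mem).1, fun k hk => by
    rw [((isLieGU_iff b).2 S.mem).1 k (by simpa using hk)]
    exact zero_mem _⟩
  rw [← h0] at hμ ⊢
  exact expAd_mem_of_stable (isClosed_coeffFil b _) S.memF (fun _ h => lie_mem_higgs b hx h) hμ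

/-- The lifts of covectors that are combinations of the `dα_i` are regular. -/
theorem lift_regular (S : IsNormalization b n A x c) {l : Coords H n → ℂ}
    (hl : ∀ w, w.1 = 0 → l w = 0) {ξ : Loop 𝔤} (h : IsLift b A c l ξ) :
    ∀ k < 0, coeff k ξ = 0 := by
  intro k hk
  refine killing_nondegenerate fun y => ?_
  have h1 : mono (-1 - k) y ∈ higgs b n := mono_mem_higgs (by omega) (by omega)
  have h2 := resPair_mono ξ (-1 - k) y
  rw [sub_sub_cancel] at h2
  rw [← h2, h _ _ ((isHiggs_iff b).2 h1) ((S.tangent_iff h1).2 rfl)]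
  refine hl _ (funext fun i => Subtype.ext ?_)
  change hpart H (coeff (-((i : ℤ) + 1)) (E x (mono (-1 - k) y))) = 0
  rw [S.expAd_regular (fun j hj => by rw [coeff_mono, if_neg (by omega)]) _ (by omega), map_zero]

end IsNormalization

end Local

section Moduli

attribute [local instance 100] LieRing.ofAssociativeRing

variable {N : ℕ} {G : LinearAlgebraicGroup N}

theorem coeff_toMatrix (k : ℤ) (L : Loop G.lie) (i j : Fin N) :
    Laurent.coeff k (toMatrix L i j) = ((coeff k L : G.lie) : Matrix (Fin N) (Fin N) ℂ) i j := by
  induction L using TensorProduct.induction_on with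
  | zero => simp
  | add x y hx hy =>
    rw [map_add, Matrix.add_apply, map_add, hx, hy, map_add]
    rfl
  | tmul s x =>
    rw [LinearAlgebraicGroup.toMatrix_tmul, coeff_tmul, Matrix.smul_apply, Matrix.map_apply, smul_eq_mul,
      mul_comm, ← Algebra.smul_def, map_smul, smul_eq_mul, mul_comm]
    rfl

theorem toMatrix_ddz (L : Loop G.lie) : toMatrix (ddz L) = (toMatrix L).map Laurent.deriv := by
  induction L using TensorProduct.induction_on with
  | zero =>
    rw [map_zero, map_zero]
    ext i j : 2
    simp
  | add x y hx hy =>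
    rw [map_add, map_add, hx, hy, map_add]
    ext i j : 2
    simp
  | tmul s x =>
    have h : ddz (s ⊗ₜ[ℂ] x : Loop G.lie) = Laurent.deriv s ⊗ₜ[ℂ] x := rfl
    rw [h, LinearAlgebraicGroup.toMatrix_tmul, LinearAlgebraicGroup.toMatrix_tmul]
    ext i j : 2
    simp [Derivation.leibniz, mul_comm]

theorem toMatrix_lie (L M : Loop G.lie) :
    toMatrix ⁅L, M⁆ = toMatrix L * toMatrix M - toMatrix M * toMatrix L := by
  induction L using TensorProduct.induction_on with
  | zero => simp
  | add x y hx hy => rw [add_lie, map_add, hx, hy, map_add, add_mul, mul_add, add_sub_add_comm]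
  | tmul s x =>
    induction M using TensorProduct.induction_on with
    | zero => simp
    | add x y hx hy => rw [lie_add, map_add, hx, hy, map_add, add_mul, mul_add, add_sub_add_comm]
    | tmul t y =>
      rw [LieAlgebra.ExtendScalars.bracket_tmul]
      simp only [LinearAlgebraicGroup.toMatrix_tmul]
      rw [smul_mul_smul_comm, smul_mul_smul_comm, mul_comm t s, ← smul_sub, ← Matrix.map_mul,
        ← Matrix.map_mul, LinearAlgebraicGroup.coe_lie, Matrix.map_sub _ (map_sub _)]

theorem toMatrix_nabla (L M : Loop G.lie) : toMatrix (nabla L M) =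
    (toMatrix M).map Laurent.deriv + (toMatrix L * toMatrix M - toMatrix M * toMatrix L) := by
  rw [nabla, map_add, toMatrix_ddz, toMatrix_lie]

/-- The covariant derivative in another trivialization. -/
theorem nabla_conj (g : GL (Fin N) Laurent) (T R : Matrix (Fin N) (Fin N) Laurent) :
    (g.val * R * g⁻¹.val).map Laurent.deriv +
      ((g.val * T * g⁻¹.val - g.val.map Laurent.deriv * g⁻¹.val) * (g.val * R * g⁻¹.val) -
        (g.val * R * g⁻¹.val) * (g.val * T * g⁻¹.val - g.val.map Laurent.deriv * g⁻¹.val)) =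
      g.val * (R.map Laurent.deriv + (T * R - R * T)) * g⁻¹.val := by
  have h1 : g⁻¹.val * g.val = 1 := Units.inv_mul g
  have h2 : g.val * g⁻¹.val = 1 := Units.mul_inv g
  have h3 : g⁻¹.val.map Laurent.deriv = -(g⁻¹.val * g.val.map Laurent.deriv * g⁻¹.val) := by
    have h := congrArg (fun M : Matrix (Fin N) (Fin N) Laurent => M.map Laurent.deriv) h1
    simp only [LinearAlgebraicGroup.map_derivation_mul] at h
    have h0 : (1 : Matrix (Fin N) (Fin N) Laurent).map Laurent.deriv = 0 := by
      ext i j : 2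
      by_cases hij : i = j <;> simp [hij]
    rw [h0] at h
    have h4 := congrArg (fun M => M * g⁻¹.val) h
    simp only [add_mul, zero_mul, mul_assoc, h2, mul_one] at h4
    rw [mul_assoc]
    exact eq_neg_of_add_eq_zero_left h4
  rw [LinearAlgebraicGroup.map_derivation_mul, LinearAlgebraicGroup.map_derivation_mul, h3]
  generalize g.val.map Laurent.deriv = g' at *
  generalize g⁻¹.val = i at *
  generalize g.val = g at *
  have e1 : ∀ Z, i * (g * Z) = Z := fun Z => by rw [← mul_assoc, h1, one_mul]
  simp only [sub_mul, mul_sub, add_mul, mul_add, mul_neg, mul_assoc, e1]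
  abel

variable [LieAlgebra.IsKilling ℂ G.lie] {H : LieSubalgebra ℂ G.lie} [H.IsCartanSubalgebra]

theorem toMatrix_injective : Function.Injective (toMatrix (G := G)) := by
  intro L M h
  refine loop_ext fun k => Subtype.ext (Matrix.ext fun i j => ?_)
  rw [← coeff_toMatrix, h, coeff_toMatrix]

variable {A : Type} [CommRing A] [IsDomain A] [Algebra ℂ A] {ι : Type} {X : Completion A ι}
  {n : ι → ℕ} {b : (LieAlgebra.IsKilling.rootSystem H).Base}

namespace ConnU

theorem isConnB (p : ConnU X n b) (j : {j : ι // 2 ≤ n j}) : IsConnB b (n j) (p.loc j) :=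
  ⟨p.higgs j, p.nonresonant j j.2⟩

theorem inTarget {p : ConnU X n b} {c : TargetCoords n H} (h : p.HasIT c) : InTarget c := fun j =>
  regular_leading_coords j.2 (p.isConnB j) (h j) _

theorem exists_tangent_hasIT {p : ConnU X n b} {c : TargetCoords n H} (h : p.HasIT c)
    (v : p.Tangent) : ∃ w, v.HasIT c w := by
  choose w hw using fun j : {j : ι // 2 ≤ n j} =>
    (((local_poisson b (n j) j.2 _ (p.isConnB j)).2 _ (h j)).1 _ (v.higgs j)).exists
  exact ⟨w, hw⟩

/-- The deformation that changes the trivializations at the points `x_i` only. -/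
def gaugeTangent (p : ConnU X n b) (ψ : ι → Loop G.lie)
    (hψ : ∀ i, IsHiggs b (n i) (-nabla (p.loc i) (ψ i))) : p.Tangent where
  dθ := 0
  ψ := ψ
  ν i := -nabla (p.loc i) (ψ i)
  ν_eq i := by rw [map_zero, map_zero, mul_zero, zero_mul, zero_sub, map_neg]
  higgs := hψ

/-- The terms with `ψ'` cancel because `∇` is skew, so only the change of the local connections
matters; this is what makes pullbacks from the target of `IT_U` hamiltonian. -/
theorem symplecticForm_gaugeTangent_left [Fintype ι] (p : ConnU X n b) {ψ : ι → Loop G.lie}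
    (hψ : ∀ i, IsHiggs b (n i) (-nabla (p.loc i) (ψ i))) (v : p.Tangent) :
    symplecticForm (p.gaugeTangent ψ hψ) v = ∑ i, resPair (ψ i) (v.ν i) := by
  refine Finset.sum_congr rfl fun i _ => ?_
  change resPair (ψ i) (v.ν i + nabla (p.loc i) (v.ψ i)) -
    resPair (v.ψ i) (-nabla (p.loc i) (ψ i)) = _
  rw [resPair_add_right, resPair_neg_right, resPair_nabla, resPair_comm _ (v.ψ i)]
  ring

theorem symplecticForm_gaugeTangent_right [Fintype ι] (p : ConnU X n b) {ψ : ι → Loop G.lie}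
    (hψ : ∀ i, IsHiggs b (n i) (-nabla (p.loc i) (ψ i))) (v : p.Tangent) :
    symplecticForm v (p.gaugeTangent ψ hψ) = -∑ i, resPair (ψ i) (v.ν i) := by
  rw [← Finset.sum_neg_distrib]
  refine Finset.sum_congr rfl fun i _ => ?_
  change resPair (v.ψ i) (-nabla (p.loc i) (ψ i) + nabla (p.loc i) (ψ i)) - resPair (ψ i) (v.ν i) = _
  rw [neg_add_cancel, show resPair (v.ψ i) 0 = 0 by simp [resPair], zero_sub]

/-- If a deformation of `(E, ∇)` is trivial, the connections at the points `x_i` change by gauge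
transformations. -/
theorem Tangent.ν_eq_neg_nabla {p : ConnU X n b} {v : p.Tangent} {R : A ⊗[ℂ] G.lie}
    {χ : ι → Loop G.lie}
    (h1 : ∀ i, X.expandLieForm i v.dθ = -nabla (X.expandLieForm i p.θ) (X.expandLieFun i R))
    (h2 : ∀ i, toMatrix (v.ψ i) =
      toMatrix (χ i) - (p.g i).val * toMatrix (X.expandLieFun i R) * (p.g i)⁻¹.val) (i : ι) :
    v.ν i = -nabla (p.loc i) (χ i) := by
  refine toMatrix_injective ?_
  have h3 := nabla_conj (p.g i) (toMatrix (X.expandLieForm i p.θ)) (toMatrix (X.expandLieFun i R))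
  rw [← p.loc_eq] at h3
  rw [v.ν_eq, h1, map_neg, map_neg, toMatrix_nabla, toMatrix_nabla (p.loc i), toMatrix_nabla (p.loc i),
    h2, mul_neg, neg_mul, ← h3]
  have h4 : ∀ L M : Matrix (Fin N) (Fin N) Laurent,
      (L - M).map Laurent.deriv = L.map Laurent.deriv - M.map Laurent.deriv := fun L M =>
    Matrix.map_sub _ (map_sub _) _ _
  rw [h4]
  simp only [mul_sub, sub_mul]
  abel

variable [Fintype ι]

/-- Covectors at the points of the target lift to deformations. -/
theorem exists_gaugeTangent {p : ConnU X n b} {c : TargetCoords n H} (h : p.HasIT c)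
    (l : ∀ j : {j : ι // 2 ≤ n j}, Coords H (n j) →ₗ[ℂ] ℂ) :
    ∃ (ψ : ι → Loop G.lie) (_ : ∀ i, IsHiggs b (n i) (-nabla (p.loc i) (ψ i))),
      (∀ j : {j : ι // 2 ≤ n j}, IsLift b (p.loc j) (c j) (l j) (ψ j)) ∧
      (∀ i, ¬2 ≤ n i → ψ i = 0) ∧ ∀ (v : p.Tangent) (w : TargetCoords n H), v.HasIT c w →
        ∑ i, resPair (ψ i) (v.ν i) = ∑ j, l j (w j) := by
  classical
  choose x S using fun j : {j : ι // 2 ≤ n j} => exists_normalization j.2 (p.isConnB j) (h j)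
  choose ξ hξ using fun j => (S j).exists_lift (l j)
  let ψ : ι → Loop G.lie := fun i => if hi : 2 ≤ n i then ξ ⟨i, hi⟩ else 0
  have h1 : ∀ j : {j : ι // 2 ≤ n j}, ψ j = ξ j := fun j => dif_pos j.2
  have h0 : ∀ i, ¬2 ≤ n i → ψ i = 0 := fun i hi => dif_neg hi
  have hlift : ∀ j : {j : ι // 2 ≤ n j}, IsLift b (p.loc j) (c j) (l j) (ψ j) := fun j => by
    rw [h1]
    exact hξ j
  have hz : ∀ L : Loop G.lie, nabla L 0 = 0 := fun L => by rw [nabla, map_zero, lie_zero, add_zero]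
  refine ⟨ψ, fun i => ?_, hlift, h0, fun v w hw => ?_⟩
  · rw [isHiggs_iff]
    by_cases hi : 2 ≤ n i
    · exact (S ⟨i, hi⟩).neg_nabla_mem (hlift ⟨i, hi⟩)
    · rw [h0 i hi, hz, neg_zero]
      exact zero_mem _
  · have h2 : ∑ i, resPair (ψ i) (v.ν i) =
        ∑ i ∈ Finset.univ.filter fun i => 2 ≤ n i, resPair (ψ i) (v.ν i) :=
      (Finset.sum_filter_of_ne fun i _ hi => by
        by_contra hn
        rw [h0 i hn] at hi
        simp [resPair] at hi).symm
    rw [h2, Finset.sum_subtype (p := fun i => 2 ≤ n i) _ (by simp)]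
    exact Finset.sum_congr rfl fun j _ => hlift j _ _ (v.higgs j) (hw j)

/-- Functions on the target of `IT_U` with a differential at `IT_U(p)` have hamiltonian vectors
at `p`. -/
theorem exists_isHamiltonian [DecidableEq ι] {p : ConnU X n b} {c : TargetCoords n H} (h : p.HasIT c)
    {f : TargetCoords n H → ℂ} {L : TargetCoords n H →ₗ[ℂ] ℂ}
    (hL : ∀ w, HasLineDerivAt ℂ f (L w) c w) :
    ∃ (ψ : ι → Loop G.lie) (hψ : ∀ i, IsHiggs b (n i) (-nabla (p.loc i) (ψ i))),
      (p.gaugeTangent ψ hψ).IsHamiltonian f c ∧ (∀ i, ¬2 ≤ n i → ψ i = 0) ∧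
      ∀ j : {j : ι // 2 ≤ n j}, IsLift b (p.loc j) (c j)
        (L ∘ₗ LinearMap.single ℂ (fun j : {j : ι // 2 ≤ n j} => Coords H (n j)) j) (ψ j) := by
  obtain ⟨ψ, hψ, h1, h0, h2⟩ := exists_gaugeTangent h fun j =>
    L ∘ₗ LinearMap.single ℂ (fun j : {j : ι // 2 ≤ n j} => Coords H (n j)) j
  refine ⟨ψ, hψ, fun v w hw => ?_, h0, h1⟩
  rw [symplecticForm_gaugeTangent_left, h2 v w hw, (hL w).lineDeriv]
  conv_rhs => rw [← Finset.univ_sum_single w, map_sum]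
  rfl

/-- Functions of the `α`-coordinates are stupid hamiltonians. -/
theorem isStupid_of_independentOfBeta {f : TargetCoords n H → ℂ} (hf : IsRegularFunction f)
    (hβ : IndependentOfBeta f) : IsStupid X n b f := by
  classical
  intro p c hc
  have hct := inTarget hc
  obtain ⟨L, hL⟩ := hf.exists_differential b hct
  obtain ⟨ψ, hψ, hv, h0, hlift⟩ := exists_isHamiltonian hc hL
  choose x S using fun j : {j : ι // 2 ≤ n j} => exists_normalization j.2 (p.isConnB j) (hc j)
  have hL0 : ∀ w : TargetCoords n H, (∀ j, (w j).1 = 0) → L w = 0 := by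
    intro w hw
    have h1 : (fun t : ℂ => f (c + t • w)) = fun _ => f c := by
      funext t
      have h2 : ∀ j, ((c + t • w) j).1 = (c j).1 := by
        intro j
        have h3 : ((c + t • w) j).1 = (c j).1 + t • (w j).1 := rfl
        rw [h3, hw, smul_zero, add_zero]
      refine hβ _ _ (fun j => ?_) hct h2
      rw [leading, h2]
      exact hct j
    have h2 : HasDerivAt (fun t : ℂ => f (c + t • w)) (L w) 0 := hL w
    rw [h1] at h2
    exact h2.unique (hasDerivAt_const _ _)
  have hl0 : ∀ (j : {j : ι // 2 ≤ n j}) (w : Coords H (n j)), w.1 = 0 →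
      (L ∘ₗ LinearMap.single ℂ (fun j : {j : ι // 2 ≤ n j} => Coords H (n j)) j) w = 0 := by
    intro j w hw
    refine hL0 _ fun k => ?_
    rw [LinearMap.single_apply]
    by_cases hk : k = j
    · subst hk
      rw [Pi.single_eq_same, hw]
    · rw [Pi.single_eq_of_ne hk]
      rfl
  -- The trivialization over `Ẋ` is kept, and `ψ` itself is the change of the trivializations at the
  -- `x_i`; it is admissible because lifts of combinations of the `dα_i` are regular.
  refine ⟨p.gaugeTangent ψ hψ, hv, ⟨0, ψ, fun i => ?_, fun i => ?_, fun i => ?_⟩, fun w hw j i _ => ?_⟩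
  · by_cases hi : 2 ≤ n i
    · exact (S ⟨i, hi⟩).lift_regular (hl0 ⟨i, hi⟩) (hlift ⟨i, hi⟩)
    · intro k _
      rw [h0 i hi, map_zero]
  · change X.expandLieForm i 0 = _
    rw [map_zero, map_zero, nabla, map_zero, lie_zero, add_zero, neg_zero]
  · rw [map_zero, map_zero, mul_zero, zero_mul, sub_zero]
    rfl
  · rw [(S j).ham_fst_eq_zero (hl0 j) ⟨ψ j, hlift j, hψ j, hw j⟩]
    rfl

/-- The derivatives of a stupid hamiltonian in the directions of the `β`-coordinates. -/
theorem lineDeriv_eq_zero_of_isStupid {f : TargetCoords n H → ℂ} (hf : IsStupid X n b f)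
    {p : ConnU X n b} {c : TargetCoords n H} (hc : p.HasIT c) {w : TargetCoords n H}
    (hw : ∀ j, (w j).1 = 0) : lineDeriv ℂ f c w = 0 := by
  choose x S using fun j : {j : ι // 2 ≤ n j} => exists_normalization j.2 (p.isConnB j) (hc j)
  -- A direction that moves only the `β`-coordinates is the hamiltonian vector of a covector in the
  -- `dα_i`, so it is realized by a change of trivializations.
  choose l hl hlw using fun j => (S j).exists_ham (w := w j) fun i _ => congrFun (hw j) i
  obtain ⟨v, hv, ⟨R, χ, -, h1, h2⟩, hfix⟩ := hf p c hc
  obtain ⟨u, hu⟩ := exists_tangent_hasIT hc v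
  have hν := Tangent.ν_eq_neg_nabla h1 h2
  -- Irregular types are fixed by assumption; residues are fixed because the local connections
  -- change by gauge transformations `-∇χ`.
  have hu0 : ∀ j, (u j).1 = 0 := by
    intro j
    funext i
    by_cases hi : 1 ≤ (i : ℕ)
    · exact hfix u hu j i hi
    · have h3 := hu j
      have h4 := v.higgs j
      rw [hν, isHiggs_iff] at h4
      rw [hν] at h3
      exact (S j).residue_eq_zero h4 h3 i (by omega)
  obtain ⟨ψ, hψ, hlift, -, hs⟩ := exists_gaugeTangent hc l
  have h3 : (p.gaugeTangent ψ hψ).HasIT c w := fun j => by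
    have h4 : IsHamVector b (p.loc j) (c j) (l j) (w j) := hlw j
    obtain ⟨w', hw'⟩ := exists_tangent_hasIT hc (p.gaugeTangent ψ hψ)
    have h5 : IsHamVector b (p.loc j) (c j) (l j) (w' j) := ⟨ψ j, hlift j, hψ j, hw' j⟩
    rw [((S j).existsUnique_ham (l j)).unique h4 h5]
    exact hw' j
  -- The derivative of `f` is the symplectic form of the two vectors, which can also be evaluated
  -- with the covector `l`: it is `-l` of the image of `v`, and that image has no `α`-component.
  rw [← hv _ _ h3, symplecticForm_gaugeTangent_right, hs v u hu, neg_eq_zero]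
  exact Finset.sum_eq_zero fun j _ => hl j (hw j) _ (hu0 j)

end ConnU

end Moduli
end Isostokes

/-! ### The proposition -/

theorem mainTheorem9
    -- a connected semisimple group, a Cartan subalgebra and a system of positive roots
    {N : ℕ} (G : Isostokes.LinearAlgebraicGroup N) (hG : G.IsConnected)
    [LieAlgebra.IsKilling ℂ G.lie]
    (H : LieSubalgebra ℂ G.lie) [H.IsCartanSubalgebra]
    (b : (LieAlgebra.IsKilling.rootSystem H).Base)
    -- a smooth complete curve with the divisor `∑ n_i x_i` and coordinates at the points `x_i`
    {A : Type} [CommRing A] [IsDedekindDomain A] [Algebra ℂ A] [Algebra.FiniteType ℂ A]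
    (hA : ¬ IsField A) {ι : Type} [Fintype ι] (X : Isostokes.Completion A ι)
    (n : ι → ℕ) (hn : ∀ i, 1 ≤ n i) (hirr : ∃ i, 2 ≤ n i) :
    -- `α`, `β` are coordinates on `𝐂𝐨𝐧𝐧ₘᴮ / Gₘᵁ`, and its tangent vectors and hamiltonian
    -- vectors are well defined
    (∀ m : ℕ, 2 ≤ m → ∀ L : Isostokes.Loop G.lie, Isostokes.IsConnB b m L →
      (∃! c : Isostokes.Coords H m, Isostokes.HasCoords b L c) ∧
      ∀ c : Isostokes.Coords H m, Isostokes.HasCoords b L c →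
        (∀ ν, Isostokes.IsHiggs b m ν → ∃! w, Isostokes.HasTangentCoords b L ν c w) ∧
        (∀ l : Isostokes.Coords H m →ₗ[ℂ] ℂ, ∃! w, Isostokes.IsHamVector b L c l w) ∧
        -- the `α`-coordinates Poisson commute
        (∀ l l' : Isostokes.Coords H m →ₗ[ℂ] ℂ,
          (∀ w, w.1 = 0 → l w = 0) → (∀ w, w.1 = 0 → l' w = 0) →
          ∀ r, Isostokes.IsBracket b L c l l' r ↔ r = 0) ∧
        -- the symplectic leaves are given by `α₁ = const`
        (∀ w, (∃ l : Isostokes.Coords H m →ₗ[ℂ] ℂ, Isostokes.IsHamVector b L c l w) ↔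
          ∀ i : Fin m, (i : ℕ) = 0 → w.1 i = 0) ∧
        -- the fibers of `φ` in the symplectic leaves are lagrangian
        (∀ w, (∃ l : Isostokes.Coords H m →ₗ[ℂ] ℂ, (∀ w', w'.1 = 0 → l w' = 0) ∧
          Isostokes.IsHamVector b L c l w) ↔ w.1 = 0)) ∧
    -- the image of `IT_U` is in the target
    (∀ (p : Isostokes.ConnU X n b) (c : Isostokes.TargetCoords n H),
      p.HasIT c → Isostokes.InTarget c) ∧
    -- stupid hamiltonians
    ∀ f : Isostokes.TargetCoords n H → ℂ, Isostokes.IsRegularFunction f →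
      (∀ (p : Isostokes.ConnU X n b) (c : Isostokes.TargetCoords n H), p.HasIT c →
        ∃ v : p.Tangent, v.IsHamiltonian f c) ∧
      (Isostokes.IsStupid X n b f ↔ Isostokes.IndependentOfBeta f) := by
  classical
  have : Nonempty ι := ⟨hirr.choose⟩
  refine ⟨fun m hm L hL => Isostokes.local_poisson b m hm L hL,
    fun p c h => Isostokes.ConnU.inTarget h, fun f hf => ⟨fun p c h => ?_, fun hs => ?_,
      Isostokes.ConnU.isStupid_of_independentOfBeta hf⟩⟩
  · obtain ⟨L, hL⟩ := hf.exists_differential b (Isostokes.ConnU.inTarget h)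
    obtain ⟨ψ, hψ, hv, -⟩ := Isostokes.ConnU.exists_isHamiltonian h hL
    exact ⟨_, hv⟩
  -- The derivatives are known to vanish only on the image of `IT_U`, which is taken for `S`.
  · refine hf.independentOfBeta b (S := {c | ∃ p : Isostokes.ConnU X n b, p.HasIT c}) (fun c₀ => ?_)
      fun c ⟨p, hp⟩ _ w hw => Isostokes.ConnU.lineDeriv_eq_zero_of_isStupid hs hp hw
    exact Isostokes.exists_connU X b hn c₀
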